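/- Work over $\mathbb{C}$. Genus 13. Let $S_6\subset\mathbb{P}^6_{[x_0:\dots:x_6]}$ be the sextic del Pezzo surface given as the closure of the image of $\mathbb{P}^2\dashrightarrow\mathbb{P}^6$, $[u_0:u_1:u_2]\mapsto[u_1^2u_2:u_1u_2^2:u_0^2u_2:u_0u_2^2:u_0^2u_1:u_0u_1^2:u_0u_1u_2]$. Let $V\subset\mathbb{P}^7_{[x_0:\dots:x_6:y]}$ be the cone over $S_6$ with vertex $[0:\dots:0:1]$, and let $\tau$ be the involution of $V$ induced by $[x_0:\dots:x_6:y]\mapsto[x_2:x_4:x_0:x_5:x_1:x_3:x_6:-y]$. Let $\pi:V\to\mathbb{P}^{13}$ be given by the quadratic forms $x_6^2$, $x_0^2+x_2^2$, $x_1^2+x_4^2$, $x_3^2+x_5^2$, $(x_0+x_2)x_6$, $(x_1+x_4)x_6$, $(x_3+x_5)x_6$, $x_0x_1+x_2x_4$, $x_2x_3+x_0x_5$, $x_1x_3+x_4x_5$, $(x_0-x_2)y$, $(x_1-x_4)y$, $(x_3-x_5)y$, $y^2$. Genus 17. Let $P\subset\mathbb{P}^8$ be the octic del Pezzo surface given as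 the image of $\mathbb{P}^1\times\mathbb{P}^1$ under $y_{i,j}=u_0^iu_1^{2-i}v_0^jv_1^{2-j}$ $(0\le i,j\le 2)$. Let $V\subset\mathbb{P}^9_{[y_{0,0}:\dots:y_{2,2}:x]}$ be the cone over $P$ with vertex $[0:\dots:0:1]$, and let $\tau$ be the involution of $V$ induced by $y_{i,j}\mapsto(-1)^{i+j}y_{i,j}$, $x\mapsto -x$. Let $\pi:V\to\mathbb{P}^{17}$ be given by the quadratic forms $y_{1,1}^2$, $y_{0,0}^2$, $y_{0,2}^2$, $y_{2,0}^2$, $y_{2,2}^2$, $x^2$, $y_{0,1}^2$, $y_{1,0}^2$, $y_{1,2}^2$, $y_{2,1}^2$, $y_{0,1}x$, $y_{1,0}x$, $y_{1,2}x$, $y_{2,1}x$, $y_{0,0}y_{1,1}$, $y_{0,2}y_{1,1}$, $y_{2,0}y_{1,1}$, $y_{2,2}y_{1,1}$. For $p\in\{13,17\}$ let $W_P^p:=V/\tau$ be the corresponding quotient (Prokhorov's Enriques--Fano threefold of genus $p$). Two distinct singular points of a variety in projective space are called associated if the line joining them lies in the variety. The singular points are called similar if they all have the same multiplicity and the same tangent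 cone (up to a linear change of coordinates), and there is an $m$ such that each of them is associated with exactly $m$ others. Theorem. Let $p\in\{13,17\}$. (1) The forms above have no common zero on $V$, and $\pi$ induces an isomorphism of the quotient variety $V/\tau$ with the closed irreducible threefold $\pi(V)\subset\mathbb{P}^p$. Hence $W_P^p$ is embedded in $\mathbb{P}^p$. The homogeneous ideal of $W_P^p\subset\mathbb{P}^p$ is generated by quadrics. (2) $W_P^p$ has exactly five singular points $P_1,\dots,P_5$. They are not similar. The point $P_5$ is associated with each of $P_1,P_2,P_3,P_4$, and no two of $P_1,P_2,P_3,P_4$ are associated. (3) For $i=1,2,3,4$, the point $P_i$ has multiplicity $4$, and the tangent cone to $W_P^p$ at $P_i$ is the cone over a Veronese surface in a $\mathbb{P}^5$. (4) If $p=13$, then $P_5$ has multiplicity $5$, and the tangent cone at $P_5$ is the cone over a surface $M_5$ contained in a $\mathbb{P}^6$. This surface is the union of five planes $\pi_0,\dots,\pi_4$ such that $\pi_1,\pi_2,\pi_3,\pi_4$ meet $\pi_0$ along the four edges of a quadrilateral, that is, along four lines no three of which have a common point. (5) If $p=17$, then $P_5$ has multiplicity $6$, and the tangent cone at $P_5$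 is the cone over a surface $M_6$ contained in a $\mathbb{P}^7$. This surface is the union of four planes $\pi_1,\pi_2,\pi_1',\pi_2'$ and a smooth quadric surface $Q\subset\mathbb{P}^3\subset\mathbb{P}^7$. The planes meet $Q$ along lines $l_1,l_2,l_1',l_2'$ respectively. Here $l_i\cap l_i'=\emptyset$ for $i=1,2$, and each of $l_1\cap l_2$, $l_1\cap l_2'$, $l_1'\cap l_2$, $l_1'\cap l_2'$ is a single point. In (3)--(5) the tangent cones are described as schemes: the ideal generated by the lowest-degree homogeneous parts of the local equations is the full ideal of the stated cone. -/

import Mathlib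

open scoped LinearAlgebra.Projectivization

noncomputable section

namespace EnriquesFano

open MvPolynomial Projectivization Filter Topology

/-! ### Projective varieties over the complex numbers -/

/-- Complex projective `n`-space, with homogeneous coordinates indexed by `0, …, n`. -/
abbrev PSp (n : ℕ) : Type := ℙ ℂ (Fin (n + 1) → ℂ)

/-- The polynomial ring in `n` variables; for `n + 1` variables, the homogeneous coordinate ring
of `PSp n`. -/
abbrev Poly (n : ℕ) : Type := MvPolynomial (Fin n) ℂ

/-- The (homogeneous) ideal of a subset of projective space: all polynomials that vanish on
every homogeneous coordinate vector of every point of the subset. -/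
def projIdeal {n : ℕ} (X : Set (PSp n)) : Ideal (Poly (n + 1)) :=
  MvPolynomial.vanishingIdeal ℂ
    {v : Fin (n + 1) → ℂ | ∃ hv : v ≠ 0, Projectivization.mk ℂ v hv ∈ X}

/-- Zariski closed subsets of projective space: common zero loci of homogeneous polynomials. -/
def IsZariskiClosed {n : ℕ} (X : Set (PSp n)) : Prop :=
  ∃ S : Set (Poly (n + 1)), (∀ F ∈ S, ∃ d : ℕ, F.IsHomogeneous d) ∧
    X = {P | ∀ F ∈ S, eval P.rep F = 0}

/-- The Zariski closure of a subset of projective space. -/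
def zariskiClosure {n : ℕ} (X : Set (PSp n)) : Set (PSp n) :=
  {P | ∀ (d : ℕ) (F : Poly (n + 1)), F.IsHomogeneous d →
    (∀ Q ∈ X, eval Q.rep F = 0) → eval P.rep F = 0}

/-- `U` is a relatively open subset of `X` in the Zariski topology. -/
def IsOpenIn {n : ℕ} (X U : Set (PSp n)) : Prop :=
  ∃ C : Set (PSp n), IsZariskiClosed C ∧ U = X \ C

/-- The values of `f` on `U` form a regular function: locally on `U` they are given by a quotient
of two homogeneous polynomials of the same degree. -/
def IsRegularOn {n : ℕ} (U : Set (PSp n)) (f : PSp n → ℂ) : Prop :=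
  ∀ P ∈ U, ∃ (d : ℕ) (F G : Poly (n + 1)), F.IsHomogeneous d ∧ G.IsHomogeneous d ∧
    eval P.rep G ≠ 0 ∧
    ∀ Q ∈ U, eval Q.rep G ≠ 0 → f Q = eval Q.rep F / eval Q.rep G

/-- The image of `X` under the rational map `[v] ↦ [z_0(v) : … : z_m(v)]` given by forms `z_i` of
equal degree; points of `X` at which all `z_i` vanish are left out. -/
def imageUnder {m n : ℕ} (z : Fin (m + 1) → Poly (n + 1)) (X : Set (PSp n)) : Set (PSp m) :=
  {Q | ∃ (v : Fin (n + 1) → ℂ) (hv : v ≠ 0) (hz : (fun i => eval v (z i)) ≠ 0),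
    Projectivization.mk ℂ v hv ∈ X ∧ Q = Projectivization.mk ℂ (fun i => eval v (z i)) hz}

/-- The cone in `PSp (n + 1)`, with vertex `[0 : … : 0 : 1]`, over a subset `X` of the hyperplane
`PSp n` on which the last coordinate vanishes. -/
def coneOver {n : ℕ} (X : Set (PSp n)) : Set (PSp (n + 1)) :=
  {Q | ∃ (a : Fin (n + 1) → ℂ) (ha : a ≠ 0) (c x : ℂ)
      (h : (Fin.snoc (c • a) x : Fin (n + 2) → ℂ) ≠ 0),
    Projectivization.mk ℂ a ha ∈ X ∧
      Q = Projectivization.mk ℂ (Fin.snoc (c • a) x : Fin (n + 2) → ℂ) h}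

/-- `π` is given on `V` by the forms `z`, which have no common zero on `V`. -/
def IsGivenBy {m n : ℕ} (V : Set (PSp n)) (z : Fin (m + 1) → Poly (n + 1))
    (π : PSp n → PSp m) : Prop :=
  ∀ (v : Fin (n + 1) → ℂ) (hv : v ≠ 0), Projectivization.mk ℂ v hv ∈ V →
    ∃ hz : (fun i => eval v (z i)) ≠ 0,
      π (Projectivization.mk ℂ v hv) = Projectivization.mk ℂ (fun i => eval v (z i)) hz

/-- The restriction of `π` to `V` identifies the quotient variety `V / t` of `V` by the involution
`t` with the closed subvariety `W` of projective space. The quotient `V / t` is the orbit set with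
the quotient topology and with the invariant regular functions as its regular functions; the
structure says that `π` induces a bijection from it to `W`, which is a homeomorphism and under
which the regular functions on open subsets correspond. -/
structure IsQuotientOnto {m n : ℕ} (V : Set (PSp n)) (t : PSp n → PSp n) (W : Set (PSp m))
    (π : PSp n → PSp m) : Prop where
  isClosed_source : IsZariskiClosed V
  isClosed_target : IsZariskiClosed W
  mapsTo : ∀ P ∈ V, t P ∈ V
  involutive : ∀ P ∈ V, t (t P) = P
  image_eq : π '' V = W
  fiber : ∀ P ∈ V, ∀ Q ∈ V, π P = π Q ↔ Q = P ∨ Q = t P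
  isOpen_iff : ∀ U ⊆ W, IsOpenIn W U ↔ IsOpenIn V (V ∩ π ⁻¹' U)
  regular_iff : ∀ U, IsOpenIn W U → ∀ f : PSp m → ℂ,
    IsRegularOn U f ↔ IsRegularOn (V ∩ π ⁻¹' U) (f ∘ π)

/-- The ideal of `X` is generated by quadrics. -/
def IdealGeneratedByQuadrics {n : ℕ} (X : Set (PSp n)) : Prop :=
  ∃ S : Set (Poly (n + 1)), (∀ F ∈ S, F.IsHomogeneous 2) ∧ projIdeal X = Ideal.span S

/-- `X` is a (closed, irreducible) projective variety of dimension `d`: the Krull dimension of its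
homogeneous coordinate ring is `d + 1`. -/
def IsProjectiveVarietyOfDim {n : ℕ} (X : Set (PSp n)) (d : ℕ) : Prop :=
  IsZariskiClosed X ∧ X.Nonempty ∧ (projIdeal X).IsPrime ∧
    ringKrullDim (Poly (n + 1) ⧸ projIdeal X) = ((d + 1 : ℕ) : WithBot ℕ∞)

/-! ### Singular points, multiplicities and tangent cones -/

/-- The linear subspace whose projectivization is the embedded projective tangent space of `X`
at `P`: the common kernel of the differentials at `P` of the polynomials in the ideal of `X`. Its
dimension is one more than the dimension of the Zariski tangent space of `X` at `P`. -/
def embeddedTangentSpace {n : ℕ} (X : Set (PSp n)) (P : PSp n) :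
    Submodule ℂ (Fin (n + 1) → ℂ) :=
  ⨅ F ∈ projIdeal X, LinearMap.ker
    (∑ j, eval P.rep (pderiv j F) • (LinearMap.proj j : (Fin (n + 1) → ℂ) →ₗ[ℂ] ℂ))

/-- The singular points of an irreducible projective variety `X`: the points at which the tangent
space has larger dimension than `X` (both dimensions are shifted by one here). -/
def singularLocus {n : ℕ} (X : Set (PSp n)) : Set (PSp n) :=
  {P | P ∈ X ∧ ringKrullDim (Poly (n + 1) ⧸ projIdeal X) <
    ((Module.finrank ℂ (embeddedTangentSpace X P) : ℕ) : WithBot ℕ∞)}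

theorem exists_coord_ne_zero {n : ℕ} (P : PSp n) :
    (Finset.univ.filter fun i : Fin (n + 1) => P.rep i ≠ 0).Nonempty := by
  obtain ⟨i, hi⟩ := Function.ne_iff.mp P.rep_nonzero
  exact ⟨i, by simpa using hi⟩

/-- The index of the first nonzero homogeneous coordinate of `P`. -/
def chartIndex {n : ℕ} (P : PSp n) : Fin (n + 1) :=
  (Finset.univ.filter fun i : Fin (n + 1) => P.rep i ≠ 0).min' (exists_coord_ne_zero P)

/-- Restriction of polynomials to the affine chart `{z_i = 1}` around `P`, where `i` is the index
of the first nonzero coordinate of `P`, with affine coordinates centred at `P`. -/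
def toChart {n : ℕ} (P : PSp n) : Poly (n + 1) →ₐ[ℂ] Poly n :=
  aeval (Fin.insertNth (α := fun _ => Poly n) (chartIndex P) 1
    fun j => X j + C (P.rep ((chartIndex P).succAbove j) / P.rep (chartIndex P)))

/-- The ideal of `X` in the affine chart around `P`, with `P` as origin. -/
def localIdeal {n : ℕ} (X : Set (PSp n)) (P : PSp n) : Ideal (Poly n) :=
  (projIdeal X).map (toChart P)

/-- The ideal generated by the homogeneous parts of minimal degree of the elements of `J`. -/
def initialIdeal {n : ℕ} (J : Ideal (Poly n)) : Ideal (Poly n) :=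
  Ideal.span {g | ∃ f ∈ J, ∃ d : ℕ, (∀ e < d, homogeneousComponent e f = 0) ∧
    g = homogeneousComponent d f}

/-- The ideal of the tangent cone of `X` at `P`. -/
def tangentConeIdeal {n : ℕ} (X : Set (PSp n)) (P : PSp n) : Ideal (Poly n) :=
  initialIdeal (localIdeal X P)

/-- The tangent cone of `X` at `P` is (as a scheme) the cone, with vertex `P`, over the subset `Y`
of the projective space `PSp n` of lines through `P` in `PSp (n + 1)`. -/
def TangentConeIsConeOver {n : ℕ} (X : Set (PSp (n + 1))) (P : PSp (n + 1))
    (Y : Set (PSp n)) : Prop :=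
  tangentConeIdeal X P = projIdeal Y

/-- The Hilbert–Samuel function of the local ring `𝒪` of `X` at `P`: `k ↦ dim_ℂ 𝒪 / 𝔪 ^ (k+1)`. -/
def hilbertSamuel {n : ℕ} (X : Set (PSp n)) (P : PSp n) (k : ℕ) : ℕ :=
  Module.finrank ℂ
    (Poly n ⧸ (localIdeal X P ⊔
      (Ideal.span (Set.range (MvPolynomial.X : Fin n → Poly n))) ^ (k + 1)))

/-- The `d`-dimensional variety `X` has multiplicity `e` at `P`: the Hilbert–Samuel function
grows like `e * k ^ d / d!`. -/
def HasMultiplicity {n : ℕ} (X : Set (PSp n)) (P : PSp n) (d e : ℕ) : Prop :=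
  Tendsto (fun k : ℕ => (d.factorial : ℝ) * (hilbertSamuel X P k : ℝ) / (k : ℝ) ^ d)
    atTop (𝓝 (e : ℝ))

/-- Substitution of the linear map `g` into a polynomial: `f ↦ f ∘ g`. -/
def linSubst {n : ℕ} (g : (Fin n → ℂ) →ₗ[ℂ] (Fin n → ℂ)) : Poly n →ₐ[ℂ] Poly n :=
  aeval fun j => ∑ k, C (LinearMap.toMatrix' g j k) * X k

/-- The tangent cones of `X` at `P` and `Q` are the same up to a linear change of coordinates. -/
def SameTangentCone {n : ℕ} (X : Set (PSp n)) (P Q : PSp n) : Prop :=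
  ∃ g : (Fin n → ℂ) ≃ₗ[ℂ] (Fin n → ℂ),
    tangentConeIdeal X Q = (tangentConeIdeal X P).comap (linSubst g.toLinearMap)

/-- The projective subspace with underlying vector space `E`. -/
def projSubspace {n : ℕ} (E : Submodule ℂ (Fin (n + 1) → ℂ)) : Set (PSp n) :=
  {P | P.submodule ≤ E}

/-- Two distinct points are associated if the line joining them is contained in `X`. -/
def Associated {n : ℕ} (X : Set (PSp n)) (P Q : PSp n) : Prop :=
  P ≠ Q ∧ projSubspace (P.submodule ⊔ Q.submodule) ⊆ X

/-- The singular points of the `d`-dimensional variety `X` are similar: they have the same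
multiplicity and the same tangent cone, and each of them is associated with the same number of
others. -/
def HasSimilarSingularPoints {n : ℕ} (X : Set (PSp n)) (d : ℕ) : Prop :=
  (∃ e : ℕ, ∀ P ∈ singularLocus X, HasMultiplicity X P d e) ∧
  (∀ P ∈ singularLocus X, ∀ Q ∈ singularLocus X, SameTangentCone X P Q) ∧
  ∃ m : ℕ, ∀ P ∈ singularLocus X,
    {Q | Q ∈ singularLocus X ∧ Associated X P Q}.Finite ∧
    {Q | Q ∈ singularLocus X ∧ Associated X P Q}.ncard = m

/-! ### Surfaces occurring as bases of tangent cones -/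

/-- The Veronese surface in `PSp 5`. -/
def standardVeronese : Set (PSp 5) :=
  imageUnder (n := 2)
    ![X 0 ^ 2, X 1 ^ 2, X 2 ^ 2, X 0 * X 1, X 0 * X 2, X 1 * X 2] Set.univ

/-- `Y` is a Veronese surface in some 5-dimensional projective subspace. -/
def IsVeroneseSurface {n : ℕ} (Y : Set (PSp n)) : Prop :=
  ∃ (L : (Fin 6 → ℂ) →ₗ[ℂ] (Fin (n + 1) → ℂ)) (hL : Function.Injective L),
    Y = Projectivization.map L hL '' standardVeronese

/-- `Y` is a smooth quadric surface in the 3-dimensional projective subspace with underlying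
vector space `H`: up to coordinates on `H`, it is `{x₀ x₃ = x₁ x₂}`. -/
def IsQuadricSurfaceIn {n : ℕ} (H : Submodule ℂ (Fin (n + 1) → ℂ)) (Y : Set (PSp n)) : Prop :=
  ∃ (L : (Fin 4 → ℂ) →ₗ[ℂ] (Fin (n + 1) → ℂ)) (hL : Function.Injective L),
    LinearMap.range L = H ∧
    Y = Projectivization.map L hL ''
      {P : PSp 3 | P.rep 0 * P.rep 3 = P.rep 1 * P.rep 2}

/-- A union of five planes `π₀, …, π₄` contained in a 6-dimensional projective subspace, such that
`π₁, …, π₄` meet `π₀` along the four edges of a quadrilateral (four lines of `π₀`, no three of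
which have a common point). -/
def IsUnionOfFivePlanes {n : ℕ} (M : Set (PSp n)) : Prop :=
  ∃ (H : Submodule ℂ (Fin (n + 1) → ℂ)) (E : Fin 5 → Submodule ℂ (Fin (n + 1) → ℂ)),
    Module.finrank ℂ H = 7 ∧ (∀ i, E i ≤ H) ∧ (∀ i, Module.finrank ℂ (E i) = 3) ∧
    M = ⋃ i, projSubspace (E i) ∧
    (∀ i, i ≠ 0 → Module.finrank ℂ ↥(E 0 ⊓ E i) = 2) ∧
    ∀ i j k, i ≠ 0 → j ≠ 0 → k ≠ 0 → i ≠ j → i ≠ k → j ≠ k →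
      E 0 ⊓ E i ⊓ E j ⊓ E k = ⊥

/-- A union, contained in a 7-dimensional projective subspace, of four planes `π₁, π₂, π₁', π₂'`
and a smooth quadric surface `Q`, such that the planes meet `Q` along lines `l₁, l₂, l₁', l₂'`,
where `l₁` and `l₁'` are disjoint, `l₂` and `l₂'` are disjoint, and any other two of the lines meet
in exactly one point. -/
def IsUnionOfFourPlanesAndQuadric {n : ℕ} (M : Set (PSp n)) : Prop :=
  ∃ (H H₃ : Submodule ℂ (Fin (n + 1) → ℂ)) (Q : Set (PSp n))
    (E E' l l' : Fin 2 → Submodule ℂ (Fin (n + 1) → ℂ)),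
    Module.finrank ℂ H = 8 ∧ H₃ ≤ H ∧ IsQuadricSurfaceIn H₃ Q ∧
    (∀ i, E i ≤ H ∧ Module.finrank ℂ (E i) = 3) ∧
    (∀ i, E' i ≤ H ∧ Module.finrank ℂ (E' i) = 3) ∧
    M = (⋃ i, projSubspace (E i)) ∪ (⋃ i, projSubspace (E' i)) ∪ Q ∧
    (∀ i, Module.finrank ℂ (l i) = 2 ∧ projSubspace (E i) ∩ Q = projSubspace (l i)) ∧
    (∀ i, Module.finrank ℂ (l' i) = 2 ∧ projSubspace (E' i) ∩ Q = projSubspace (l' i)) ∧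
    (∀ i, l i ⊓ l' i = ⊥) ∧
    Module.finrank ℂ ↥(l 0 ⊓ l 1) = 1 ∧ Module.finrank ℂ ↥(l 0 ⊓ l' 1) = 1 ∧
    Module.finrank ℂ ↥(l' 0 ⊓ l 1) = 1 ∧ Module.finrank ℂ ↥(l' 0 ⊓ l' 1) = 1

/-! ### The threefold of genus 13 -/

/-- The sextic del Pezzo surface in `PSp 6`: the closure of the image of the plane under the
rational map given by the cubics through the three coordinate points. -/
def delPezzoSix : Set (PSp 6) :=
  zariskiClosure (imageUnder (n := 2)
    ![X 1 ^ 2 * X 2, X 1 * X 2 ^ 2, X 0 ^ 2 * X 2, X 0 * X 2 ^ 2, X 0 ^ 2 * X 1,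
      X 0 * X 1 ^ 2, X 0 * X 1 * X 2] Set.univ)

/-- The cone over the sextic del Pezzo surface, in `PSp 7` with coordinates
`x₀, …, x₆, y`. -/
def V13 : Set (PSp 7) := coneOver delPezzoSix

/-- The linear map `(x₀, …, x₆, y) ↦ (x₂, x₄, x₀, x₅, x₁, x₃, x₆, -y)`. -/
def t13Lin : (Fin 8 → ℂ) →ₗ[ℂ] (Fin 8 → ℂ) where
  toFun w := ![w 2, w 4, w 0, w 5, w 1, w 3, w 6, -w 7]
  map_add' v w := by
    ext i
    fin_cases i <;> simp [add_comm]
  map_smul' c w := by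
    ext i
    fin_cases i <;> simp

theorem t13Lin_involutive : Function.Involutive t13Lin := by
  intro w
  ext i
  fin_cases i <;> simp [t13Lin]

/-- The involution of `PSp 7` that restricts to the involution `τ` of `V13`. -/
def t13 : PSp 7 → PSp 7 := Projectivization.map t13Lin t13Lin_involutive.injective

/-- The quadratic forms `z₀, …, z₁₃` defining the quotient map (variables `x₀, …, x₆, y`). -/
def z13 : Fin 14 → Poly 8 :=
  ![X 6 ^ 2, X 0 ^ 2 + X 2 ^ 2, X 1 ^ 2 + X 4 ^ 2, X 3 ^ 2 + X 5 ^ 2,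
    (X 0 + X 2) * X 6, (X 1 + X 4) * X 6, (X 3 + X 5) * X 6,
    X 0 * X 1 + X 2 * X 4, X 2 * X 3 + X 0 * X 5, X 1 * X 3 + X 4 * X 5,
    (X 0 - X 2) * X 7, (X 1 - X 4) * X 7, (X 3 - X 5) * X 7, X 7 ^ 2]

/-- The Enriques–Fano threefold of genus 13, embedded in `PSp 13`. -/
def W13 : Set (PSp 13) := imageUnder z13 V13

/-! ### The threefold of genus 17 -/

/-- The octic del Pezzo surface in `PSp 8`: the image of `ℙ¹ × ℙ¹` under the forms of bidegree
`(2, 2)`, with coordinates `y_{i,j} = u₀ ^ i u₁ ^ (2-i) v₀ ^ j v₁ ^ (2-j)` in the order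
`y₀₀, y₀₁, y₀₂, y₁₀, y₁₁, y₁₂, y₂₀, y₂₁, y₂₂`. -/
def delPezzoEight : Set (PSp 8) :=
  {Q | ∃ u v : Fin 2 → ℂ, u ≠ 0 ∧ v ≠ 0 ∧
    ∃ h : (![u 1 ^ 2 * v 1 ^ 2, u 1 ^ 2 * (v 0 * v 1), u 1 ^ 2 * v 0 ^ 2,
        u 0 * u 1 * v 1 ^ 2, u 0 * u 1 * (v 0 * v 1), u 0 * u 1 * v 0 ^ 2,
        u 0 ^ 2 * v 1 ^ 2, u 0 ^ 2 * (v 0 * v 1), u 0 ^ 2 * v 0 ^ 2] : Fin 9 → ℂ) ≠ 0,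
      Q = Projectivization.mk ℂ _ h}

/-- The cone over the octic del Pezzo surface, in `PSp 9` with coordinates
`y₀₀, y₀₁, y₀₂, y₁₀, y₁₁, y₁₂, y₂₀, y₂₁, y₂₂, x`. -/
def V17 : Set (PSp 9) := coneOver delPezzoEight

/-- The linear map `y_{i,j} ↦ (-1) ^ (i+j) y_{i,j}`, `x ↦ -x`. -/
def t17Lin : (Fin 10 → ℂ) →ₗ[ℂ] (Fin 10 → ℂ) where
  toFun w := ![w 0, -w 1, w 2, -w 3, w 4, -w 5, w 6, -w 7, w 8, -w 9]
  map_add' v w := by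
    ext i
    fin_cases i <;> simp [add_comm]
  map_smul' c w := by
    ext i
    fin_cases i <;> simp

theorem t17Lin_involutive : Function.Involutive t17Lin := by
  intro w
  ext i
  fin_cases i <;> simp [t17Lin]

/-- The involution of `PSp 9` that restricts to the involution `τ` of `V17`. -/
def t17 : PSp 9 → PSp 9 := Projectivization.map t17Lin t17Lin_involutive.injective

/-- The quadratic forms `z₀, …, z₁₇` defining the quotient map. In terms of the `y_{i,j}` and `x`
they are `y₁₁², y₀₀², y₀₂², y₂₀², y₂₂², x², y₀₁², y₁₀², y₁₂², y₂₁², y₀₁x, y₁₀x, y₁₂x, y₂₁x,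
y₀₀y₁₁, y₀₂y₁₁, y₂₀y₁₁, y₂₂y₁₁`. -/
def z17 : Fin 18 → Poly 10 :=
  ![X 4 ^ 2, X 0 ^ 2, X 2 ^ 2, X 6 ^ 2, X 8 ^ 2, X 9 ^ 2,
    X 1 ^ 2, X 3 ^ 2, X 5 ^ 2, X 7 ^ 2,
    X 1 * X 9, X 3 * X 9, X 5 * X 9, X 7 * X 9,
    X 0 * X 4, X 2 * X 4, X 6 * X 4, X 8 * X 4]

/-- The Enriques–Fano threefold of genus 17, embedded in `PSp 17`. -/
def W17 : Set (PSp 17) := imageUnder z17 V17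

end EnriquesFano

end

noncomputable section

namespace EnriquesFano

open MvPolynomial Projectivization Filter Topology

theorem exists_sq (a : ℂ) : ∃ r, r ^ 2 = a := IsAlgClosed.exists_pow_nat_eq a two_pos

theorem eval_aeval {σ τ : Type} (v : τ → ℂ) (z : σ → MvPolynomial τ ℂ) (F : MvPolynomial σ ℂ) :
    eval v (aeval z F) = eval (fun k => eval v (z k)) F := by
  simp only [← MvPolynomial.aeval_eq_eval, ← AlgHom.comp_apply]
  congr 1
  ext j
  simp

/-! ### Homogeneous polynomials -/

theorem homogeneousComponent_mul_of_le {n a e : ℕ} {F : Poly n} (hF : F.IsHomogeneous a)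
    (h : a ≤ e) (G : Poly n) :
    homogeneousComponent e (F * G) = F * homogeneousComponent (e - a) G := by
  let _ := MvPolynomial.gradedAlgebra (σ := Fin n) (R := ℂ)
  have := DirectSum.coe_decompose_mul_of_left_mem_of_le (homogeneousSubmodule (Fin n) ℂ)
    (b := G) (show F ∈ homogeneousSubmodule (Fin n) ℂ a from hF) h
  simpa only [decomposition.decompose'_apply, DirectSum.decompose,
    Equiv.coe_fn_mk, DirectSum.Decomposition.decompose'] using this

theorem homogeneousComponent_mul_of_lt {n a e : ℕ} {F : Poly n} (hF : F.IsHomogeneous a)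
    (h : e < a) (G : Poly n) : homogeneousComponent e (F * G) = 0 := by
  let _ := MvPolynomial.gradedAlgebra (σ := Fin n) (R := ℂ)
  have := DirectSum.coe_decompose_mul_of_left_mem_of_not_le (homogeneousSubmodule (Fin n) ℂ)
    (b := G) (show F ∈ homogeneousSubmodule (Fin n) ℂ a from hF) (not_le.mpr h)
  simpa only [decomposition.decompose'_apply, DirectSum.decompose,
    Equiv.coe_fn_mk, DirectSum.Decomposition.decompose'] using this

theorem homogeneousComponent_same {n d : ℕ} {F : Poly n} (hF : F.IsHomogeneous d) :
    homogeneousComponent d F = F := by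
  simpa using homogeneousComponent_of_mem (m := d) (n := d) hF

theorem homogeneousComponent_ne {n d e : ℕ} {F : Poly n} (hF : F.IsHomogeneous d) (h : e ≠ d) :
    homogeneousComponent e F = 0 := by
  have := homogeneousComponent_of_mem (m := e) (n := d) hF
  rwa [if_neg h] at this

theorem eval_smul_of_isHomogeneous {n d : ℕ} {F : Poly n} (hF : F.IsHomogeneous d) (a : ℂ)
    (v : Fin n → ℂ) : eval (a • v) F = a ^ d * eval v F := by
  rw [eval_eq, eval_eq, Finset.mul_sum]
  refine Finset.sum_congr rfl fun x hx => ?_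
  have hd : ∑ i ∈ x.support, x i = d := by
    rw [hF.degree_eq_sum_deg_support hx]
  simp only [Pi.smul_apply, smul_eq_mul, mul_pow, Finset.prod_mul_distrib,
    Finset.prod_pow_eq_pow_sum, hd]
  ring

theorem eval_eq_sum_homogeneousComponent {n : ℕ} (F : Poly n) (v : Fin n → ℂ) :
    eval v F = ∑ e ∈ Finset.range (F.totalDegree + 1), eval v (homogeneousComponent e F) := by
  conv_lhs => rw [← sum_homogeneousComponent F]
  rw [map_sum]

theorem aeval_isHomogeneous {n k d : ℕ} {h : Poly k} (hh : h.IsHomogeneous d)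
    {x : Fin k → Poly n} (hx : ∀ i, (x i).IsHomogeneous 1) : (aeval x h).IsHomogeneous d := by
  simpa using hh.aeval x hx

theorem homogeneousComponent_aeval {n k : ℕ} {x : Fin k → Poly n}
    (hx : ∀ i, (x i).IsHomogeneous 1) (h : Poly k) (d : ℕ) :
    homogeneousComponent d (aeval x h) = aeval x (homogeneousComponent d h) := by
  conv_lhs => rw [← sum_homogeneousComponent h]
  rw [map_sum, map_sum, Finset.sum_eq_single d]
  · exact homogeneousComponent_same
      (aeval_isHomogeneous (homogeneousComponent_isHomogeneous d h) hx)
  · intro b _ hb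
    exact homogeneousComponent_ne
      (aeval_isHomogeneous (homogeneousComponent_isHomogeneous b h) hx) hb.symm
  · intro hd
    have h0 : homogeneousComponent d h = 0 :=
      homogeneousComponent_eq_zero _ _ (by simpa [Nat.lt_succ_iff] using hd)
    simp [h0]

theorem mem_maxIdeal_pow_iff {n k : ℕ} (F : Poly n) :
    F ∈ (Ideal.span (Set.range (X : Fin n → Poly n))) ^ k ↔
      ∀ e < k, homogeneousComponent e F = 0 := by
  rw [show Ideal.span (Set.range (X : Fin n → Poly n)) = idealOfVars (Fin n) ℂ from rfl,
    mem_pow_idealOfVars_iff']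
  constructor
  · intro h e he
    ext x
    rw [coeff_homogeneousComponent, coeff_zero]
    split_ifs with hx
    · exact h x (hx ▸ he)
    · rfl
  · intro h x hx
    have := congrArg (coeff x) (h _ hx)
    simpa [coeff_homogeneousComponent] using this

/-- A polynomial that vanishes wherever a nonzero polynomial does not vanish is zero. -/
theorem eq_zero_of_eval_ne_zero {n : ℕ} {F D : Poly n} (hD : D ≠ 0)
    (h : ∀ v, eval v D ≠ 0 → eval v F = 0) : F = 0 := by
  have : F * D = 0 := by
    refine MvPolynomial.funext fun v => ?_
    by_cases hv : eval v D = 0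
    · simp [hv]
    · simp [h v hv]
  exact (mul_eq_zero.mp this).resolve_right hD

/-! ### Points of projective space and cones -/

theorem exists_rep_eq_smul {n : ℕ} (v : Fin (n + 1) → ℂ) (hv : v ≠ 0) :
    ∃ a : ℂ, a ≠ 0 ∧ (mk ℂ v hv).rep = a • v := by
  obtain ⟨a, ha⟩ := exists_smul_eq_mk_rep ℂ v hv
  exact ⟨a, a.ne_zero, ha.symm⟩

theorem mk_eq_mk_iff_smul {n : ℕ} {v w : Fin (n + 1) → ℂ} (hv : v ≠ 0) (hw : w ≠ 0) :
    mk ℂ v hv = mk ℂ w hw ↔ ∃ a : ℂ, a ≠ 0 ∧ v = a • w := by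
  rw [mk_eq_mk_iff]
  constructor
  · rintro ⟨a, ha⟩
    exact ⟨a, a.ne_zero, ha.symm⟩
  · rintro ⟨a, ha, h⟩
    exact ⟨Units.mk0 a ha, h.symm⟩

theorem mk_smul {n : ℕ} {v : Fin (n + 1) → ℂ} (hv : v ≠ 0) {a : ℂ} (h : a • v ≠ 0) :
    mk ℂ (a • v) h = mk ℂ v hv := by
  rw [mk_eq_mk_iff_smul]
  exact ⟨a, fun h0 => h (by simp [h0]), rfl⟩

theorem eval_rep_eq_zero_iff {n d : ℕ} {F : Poly (n + 1)} (hF : F.IsHomogeneous d)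
    (v : Fin (n + 1) → ℂ) (hv : v ≠ 0) : eval (mk ℂ v hv).rep F = 0 ↔ eval v F = 0 := by
  obtain ⟨a, ha, h⟩ := exists_rep_eq_smul v hv
  rw [h, eval_smul_of_isHomogeneous hF]
  simp [ha]

/-- The nonzero vectors that represent the points of `X`. -/
def affineCone {n : ℕ} (X : Set (PSp n)) : Set (Fin (n + 1) → ℂ) :=
  {v | ∃ hv : v ≠ 0, mk ℂ v hv ∈ X}

theorem mem_projIdeal {n : ℕ} {X : Set (PSp n)} {F : Poly (n + 1)} :
    F ∈ projIdeal X ↔ ∀ v ∈ affineCone X, eval v F = 0 := by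
  unfold projIdeal
  rw [mem_vanishingIdeal_iff]
  rfl

theorem smul_mem_affineCone {n : ℕ} {X : Set (PSp n)} {v : Fin (n + 1) → ℂ}
    (hv : v ∈ affineCone X) {a : ℂ} (ha : a ≠ 0) : a • v ∈ affineCone X := by
  obtain ⟨h0, h⟩ := hv
  exact ⟨smul_ne_zero ha h0, by rwa [mk_smul h0]⟩

theorem rep_mem_affineCone {n : ℕ} {X : Set (PSp n)} {P : PSp n} (hP : P ∈ X) :
    P.rep ∈ affineCone X :=
  ⟨P.rep_nonzero, by rwa [mk_rep]⟩

/-- If a polynomial vanishes at all nonzero multiples of a vector, then so do its homogeneous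
components. -/
theorem eval_homogeneousComponent_eq_zero {n : ℕ} {F : Poly n} {v : Fin n → ℂ}
    (h : ∀ a : ℂ, a ≠ 0 → eval (a • v) F = 0) (d : ℕ) :
    eval v (homogeneousComponent d F) = 0 := by
  set p : Polynomial ℂ := ∑ e ∈ Finset.range (F.totalDegree + 1),
    Polynomial.C (eval v (homogeneousComponent e F)) * Polynomial.X ^ e with hp
  have hev : ∀ a, p.eval a = eval (a • v) F := by
    intro a
    rw [eval_eq_sum_homogeneousComponent, hp, Polynomial.eval_finsetSum]
    refine Finset.sum_congr rfl fun e _ => ?_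
    rw [eval_smul_of_isHomogeneous (homogeneousComponent_isHomogeneous e F)]
    simp only [Polynomial.eval_mul, Polynomial.eval_C, Polynomial.eval_pow, Polynomial.eval_X]
    ring
  have hp0 : p = 0 := by
    have : p * Polynomial.X = 0 := by
      refine Polynomial.funext fun a => ?_
      by_cases ha : a = 0
      · simp [ha]
      · simp [hev, h a ha]
    simpa using this
  by_cases hd : F.totalDegree < d
  · rw [homogeneousComponent_eq_zero _ _ hd, map_zero]
  · have := congrArg (fun q => Polynomial.coeff q d) hp0
    simp only [hp, Polynomial.finsetSum_coeff, Polynomial.coeff_C_mul, Polynomial.coeff_X_pow,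
      Polynomial.coeff_zero] at this
    simpa [Nat.lt_succ_iff, not_lt.mp hd] using this

theorem homogeneousComponent_mem_projIdeal {n : ℕ} {X : Set (PSp n)} {F : Poly (n + 1)}
    (hF : F ∈ projIdeal X) (d : ℕ) : homogeneousComponent d F ∈ projIdeal X := by
  rw [mem_projIdeal] at hF ⊢
  exact fun v hv => eval_homogeneousComponent_eq_zero
    (fun a ha => hF _ (smul_mem_affineCone hv ha)) d

/-! ### Affine charts and tangent cones -/

theorem chartIndex_mk {n : ℕ} {q : Fin (n + 1) → ℂ} (hq : q ≠ 0) {i : Fin (n + 1)}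
    (hi : q i ≠ 0) (hlt : ∀ j < i, q j = 0) : chartIndex (mk ℂ q hq) = i := by
  obtain ⟨a, ha, h⟩ := exists_rep_eq_smul q hq
  unfold chartIndex
  apply le_antisymm
  · apply Finset.min'_le
    simp [h, ha, hi]
  · apply Finset.le_min'
    intro j hj
    by_contra hji
    simp [h, hlt j (not_le.mp hji)] at hj

/-- Restriction of polynomials to the chart `{z_i = 1}`, centred at the vector `q`. -/
def chartMap {n : ℕ} (i : Fin (n + 1)) (q : Fin (n + 1) → ℂ) : Poly (n + 1) →ₐ[ℂ] Poly n :=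
  aeval (Fin.insertNth (α := fun _ => Poly n) i 1 fun j => X j + C (q (i.succAbove j)))

theorem toChart_mk {n : ℕ} {q : Fin (n + 1) → ℂ} (hq : q ≠ 0) {i : Fin (n + 1)}
    (hi : q i = 1) (hlt : ∀ j < i, q j = 0) : toChart (mk ℂ q hq) = chartMap i q := by
  have hc := chartIndex_mk hq (by simp [hi]) hlt
  obtain ⟨a, ha, h⟩ := exists_rep_eq_smul q hq
  unfold toChart chartMap
  rw [hc]
  congr
  funext j
  simp [h, hi, ha]

theorem eval_chartMap {n : ℕ} {i : Fin (n + 1)} {q : Fin (n + 1) → ℂ} (hi : q i = 1)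
    (w : Fin n → ℂ) (F : Poly (n + 1)) :
    eval w (chartMap i q F) = eval (q + Fin.insertNth (α := fun _ => ℂ) i 0 w) F := by
  unfold chartMap
  rw [← MvPolynomial.aeval_eq_eval, ← MvPolynomial.aeval_eq_eval]
  rw [← AlgHom.comp_apply]
  congr 1
  ext j
  rcases Fin.eq_self_or_eq_succAbove i j with rfl | ⟨k, rfl⟩
  · simp [hi]
  · simp [add_comm]

theorem chartMap_X_self {n : ℕ} (i : Fin (n + 1)) (q : Fin (n + 1) → ℂ) :
    chartMap i q (X i) = 1 := by
  simp [chartMap]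

theorem chartMap_X_succAbove {n : ℕ} (i : Fin (n + 1)) (q : Fin (n + 1) → ℂ) (j : Fin n) :
    chartMap i q (X (i.succAbove j)) = X j + C (q (i.succAbove j)) := by
  simp [chartMap]

theorem eval_localIdeal {n : ℕ} {X : Set (PSp n)} {q : Fin (n + 1) → ℂ} (hq : q ≠ 0)
    {i : Fin (n + 1)} (hi : q i = 1) (hlt : ∀ j < i, q j = 0) {w : Fin n → ℂ}
    (hw : q + Fin.insertNth (α := fun _ => ℂ) i 0 w ∈ affineCone X) {f : Poly n}
    (hf : f ∈ localIdeal X (mk ℂ q hq)) : eval w f = 0 := by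
  have : localIdeal X (mk ℂ q hq) ≤ RingHom.ker (eval w) := by
    unfold localIdeal
    rw [Ideal.map_le_iff_le_comap]
    intro F hF
    rw [Ideal.mem_comap, RingHom.mem_ker, toChart_mk hq hi hlt]
    exact (eval_chartMap hi w F).trans (mem_projIdeal.mp hF _ hw)
  exact this hf

/-- Initial forms vanish on the limit directions of curves. -/
theorem eval_initialIdeal {n : ℕ} {J : Ideal (Poly n)} {w : ℂ → Fin n → ℂ}
    (hw : ContinuousAt w 0)
    (hJ : ∀ᶠ t in 𝓝[≠] (0 : ℂ), ∀ f ∈ J, eval (t ^ 2 • w t) f = 0) {g : Poly n}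
    (hg : g ∈ initialIdeal J) : eval (w 0) g = 0 := by
  have : initialIdeal J ≤ RingHom.ker (eval (w 0)) := by
    unfold initialIdeal
    rw [Ideal.span_le]
    rintro g ⟨f, hf, d, hd, rfl⟩
    rw [SetLike.mem_coe, RingHom.mem_ker]
    set N := f.totalDegree + 1
    let φ : ℂ → ℂ := fun t => eval (w t) (homogeneousComponent d f) +
      ∑ e ∈ Finset.range N, if d < e then
        (t ^ 2) ^ (e - d) * eval (w t) (homogeneousComponent e f) else 0
    have hcont : ∀ p : Poly n, ContinuousAt (fun t => eval (w t) p) 0 := fun p =>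
      (MvPolynomial.continuous_eval p).continuousAt.comp hw
    have hφ : ContinuousAt φ 0 := by
      refine (hcont _).add ?_
      refine tendsto_finsetSum _ fun e _ => ?_
      split_ifs
      · exact ((continuous_pow 2).pow _).continuousAt.mul (hcont _)
      · exact tendsto_const_nhds
    have h0 : φ 0 = eval (w 0) (homogeneousComponent d f) := by
      simp only [φ, add_eq_left]
      refine Finset.sum_eq_zero fun e _ => ?_
      split_ifs with he
      · have : e - d ≠ 0 := by omega
        simp [this]
      · rfl
    have hz : ∀ᶠ t in 𝓝[≠] (0 : ℂ), φ t = 0 := by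
      filter_upwards [hJ, self_mem_nhdsWithin] with t ht ht0
      have ht0' : (t ^ 2) ^ d ≠ 0 := pow_ne_zero _ (pow_ne_zero _ ht0)
      have h1 := ht f hf
      rw [eval_eq_sum_homogeneousComponent] at h1
      refine (mul_eq_zero.mp ?_).resolve_left ht0'
      rw [← h1]
      simp only [φ, mul_add, Finset.mul_sum]
      by_cases hdN : d < N
      · rw [← Finset.add_sum_erase _ _ (Finset.mem_range.mpr hdN),
          ← Finset.add_sum_erase (Finset.range N) (fun e => eval (t ^ 2 • w t) _)
            (Finset.mem_range.mpr hdN)]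
        simp only [lt_irrefl, if_false, mul_zero, zero_add]
        rw [eval_smul_of_isHomogeneous (homogeneousComponent_isHomogeneous d f)]
        congr 1
        refine Finset.sum_congr rfl fun e he => ?_
        rw [eval_smul_of_isHomogeneous (homogeneousComponent_isHomogeneous e f)]
        split_ifs with hde
        · rw [← mul_assoc, ← pow_add]
          congr 2
          omega
        · rw [hd e (lt_of_le_of_ne (not_lt.mp hde) (Finset.ne_of_mem_erase he))]
          simp
      · rw [homogeneousComponent_eq_zero d f (by omega)]
        simp only [map_zero, mul_zero, zero_add]
        refine Finset.sum_congr rfl fun e he => ?_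
        rw [Finset.mem_range] at he
        rw [if_neg (by omega), hd e (by omega)]
        simp
    have hlim : Tendsto φ (𝓝[≠] 0) (𝓝 (φ 0)) := hφ.tendsto.mono_left nhdsWithin_le_nhds
    rw [← h0]
    exact tendsto_nhds_unique hlim ((tendsto_congr' hz).mpr tendsto_const_nhds)
  exact this hg

/-! ### Embedded tangent spaces -/

/-- The differential of `F` at `q`, applied to `u`. -/
def dEval {n : ℕ} (q u : Fin n → ℂ) : Poly n →ₗ[ℂ] ℂ where
  toFun F := ∑ j, eval q (pderiv j F) * u j
  map_add' F G := by simp [add_mul, Finset.sum_add_distrib]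
  map_smul' c F := by simp [Finset.mul_sum, mul_assoc]

theorem dEval_mul {n : ℕ} (q u : Fin n → ℂ) (F G : Poly n) :
    dEval q u (F * G) = eval q F * dEval q u G + eval q G * dEval q u F := by
  simp only [dEval, LinearMap.coe_mk, AddHom.coe_mk, Finset.mul_sum, ← Finset.sum_add_distrib]
  refine Finset.sum_congr rfl fun j _ => ?_
  simp only [Derivation.leibniz, smul_eq_mul, map_add, map_mul]
  ring

theorem dEval_C {n : ℕ} (q u : Fin n → ℂ) (a : ℂ) : dEval q u (C a) = 0 := by
  simp [dEval]

theorem dEval_X {n : ℕ} (q u : Fin n → ℂ) (i : Fin n) : dEval q u (X i) = u i := by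
  simp [dEval, pderiv_X, Pi.single_apply, apply_ite]

theorem dEval_linear {n : ℕ} (q u : Fin n → ℂ) {F : Poly n} (hF : F.IsHomogeneous 1) :
    dEval q u F = eval u F := by
  have : F ∈ Submodule.span ℂ (Set.range (X : Fin n → Poly n)) := by
    rw [← homogeneousSubmodule_one_eq_span_X]
    exact hF
  refine LinearMap.eqOn_span (f := dEval q u) (g := (aeval u).toLinearMap) ?_ this
  rintro _ ⟨i, rfl⟩
  simp [dEval_X]

theorem dEval_smul_left_of_isHomogeneous {n d : ℕ} {F : Poly n} (hF : F.IsHomogeneous d)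
    {q u : Fin n → ℂ} (h : dEval q u F = 0) (a : ℂ) : dEval (a • q) u F = 0 := by
  have h1 : dEval (a • q) u F = a ^ (d - 1) * dEval q u F := by
    simp only [dEval, LinearMap.coe_mk, AddHom.coe_mk, Finset.mul_sum]
    refine Finset.sum_congr rfl fun j _ => ?_
    rw [eval_smul_of_isHomogeneous hF.pderiv]
    ring
  rw [h1, h, mul_zero]

theorem mem_embeddedTangentSpace {n : ℕ} {X : Set (PSp n)} {P : PSp n} {u : Fin (n + 1) → ℂ} :
    u ∈ embeddedTangentSpace X P ↔ ∀ F ∈ projIdeal X, dEval P.rep u F = 0 := by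
  unfold embeddedTangentSpace dEval
  simp [Submodule.mem_iInf]

theorem dEval_eq_zero_of_mem {n d : ℕ} {X : Set (PSp n)} {q u : Fin (n + 1) → ℂ} (hq : q ≠ 0)
    (hu : u ∈ embeddedTangentSpace X (mk ℂ q hq)) {F : Poly (n + 1)} (hF : F ∈ projIdeal X)
    (hd : F.IsHomogeneous d) : dEval q u F = 0 := by
  obtain ⟨a, ha, h⟩ := exists_rep_eq_smul q hq
  have := mem_embeddedTangentSpace.mp hu F hF
  rw [h] at this
  have h2 := dEval_smul_left_of_isHomogeneous hd this a⁻¹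
  rwa [inv_smul_smul₀ ha] at h2

/-- First-order Taylor expansion of a polynomial. -/
theorem exists_taylor {n : ℕ} (F : Poly n) (q : Fin n → ℂ) :
    ∃ R : ℂ → (Fin n → ℂ) → ℂ, Continuous (Function.uncurry R) ∧
      ∀ r u, eval (q + r • u) F = eval q F + r * dEval q u F + r ^ 2 * R r u := by
  have hcd : ∀ G : Poly n, Continuous fun x : ℂ × (Fin n → ℂ) => dEval q x.2 G := by
    intro G
    simp only [dEval, LinearMap.coe_mk, AddHom.coe_mk]
    fun_prop
  induction F using MvPolynomial.induction_on with
  | C a => exact ⟨fun _ _ => 0, continuous_const, fun r u => by simp [dEval_C]⟩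
  | add F G hF hG =>
    obtain ⟨R, hR, h⟩ := hF
    obtain ⟨S, hS, h'⟩ := hG
    refine ⟨fun r u => R r u + S r u, hR.add hS, fun r u => ?_⟩
    rw [map_add, map_add, map_add, h, h']
    ring
  | mul_X F i hF =>
    obtain ⟨R, hR, h⟩ := hF
    refine ⟨fun r u => R r u * (q i + r * u i) + dEval q u F * u i, ?_, fun r u => ?_⟩
    · refine (hR.mul ?_).add ((hcd F).mul ?_) <;> fun_prop
    · rw [map_mul, map_mul, h, dEval_mul, dEval_X]
      simp only [eval_X, Pi.add_apply, Pi.smul_apply, smul_eq_mul]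
      ring

/-- Limits of secant directions are tangent. -/
theorem mem_embeddedTangentSpace_of_curve {n : ℕ} {X : Set (PSp n)} {q : Fin (n + 1) → ℂ}
    (hq : q ≠ 0) (hX : mk ℂ q hq ∈ X) {w : ℂ → Fin (n + 1) → ℂ} (hw : ContinuousAt w 0)
    (hc : ∀ᶠ t in 𝓝[≠] (0 : ℂ), q + t ^ 2 • w t ∈ affineCone X) :
    w 0 ∈ embeddedTangentSpace X (mk ℂ q hq) := by
  obtain ⟨a, ha, h⟩ := exists_rep_eq_smul q hq
  rw [mem_embeddedTangentSpace]
  intro F hF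
  suffices hs : dEval (mk ℂ q hq).rep (a • w 0) F = 0 by
    have : dEval (mk ℂ q hq).rep (a • w 0) F = a * dEval (mk ℂ q hq).rep (w 0) F := by
      simp only [dEval, LinearMap.coe_mk, AddHom.coe_mk, Finset.mul_sum, Pi.smul_apply,
        smul_eq_mul]
      exact Finset.sum_congr rfl fun j _ => by ring
    rw [this] at hs
    exact (mul_eq_zero.mp hs).resolve_left ha
  obtain ⟨R, hR, hT⟩ := exists_taylor F (mk ℂ q hq).rep
  let φ : ℂ → ℂ := fun t => dEval (mk ℂ q hq).rep (a • w t) F + t ^ 2 * R (t ^ 2) (a • w t)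
  have hφ : ContinuousAt φ 0 := by
    have h1 : ContinuousAt (fun t => a • w t) 0 := hw.const_smul a
    refine ContinuousAt.add ?_ (ContinuousAt.mul (by fun_prop) ?_)
    · simp only [dEval, LinearMap.coe_mk, AddHom.coe_mk]
      refine tendsto_finsetSum _ fun j _ => ?_
      exact tendsto_const_nhds.mul ((continuous_apply j).continuousAt.comp h1)
    · exact hR.continuousAt.comp (f := fun t : ℂ => (t ^ 2, a • w t))
        ((continuous_pow 2).continuousAt.prodMk h1)
  have hz : ∀ᶠ t in 𝓝[≠] (0 : ℂ), φ t = 0 := by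
    filter_upwards [hc, self_mem_nhdsWithin] with t ht ht0
    have h2 := mem_projIdeal.mp hF _ (smul_mem_affineCone ht ha)
    rw [smul_add, ← h, smul_comm, hT, mem_projIdeal.mp hF _ (rep_mem_affineCone hX)] at h2
    refine (mul_eq_zero.mp ?_).resolve_left (pow_ne_zero 2 ht0 : t ^ 2 ≠ 0)
    rw [← h2]
    simp only [φ]
    ring
  have hlim : Tendsto φ (𝓝[≠] 0) (𝓝 (φ 0)) := hφ.tendsto.mono_left nhdsWithin_le_nhds
  have h0 := tendsto_nhds_unique hlim ((tendsto_congr' hz).mpr tendsto_const_nhds)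
  simpa [φ] using h0

theorem self_mem_embeddedTangentSpace {n : ℕ} {X : Set (PSp n)} {q : Fin (n + 1) → ℂ}
    (hq : q ≠ 0) (hX : mk ℂ q hq ∈ X) : q ∈ embeddedTangentSpace X (mk ℂ q hq) := by
  refine mem_embeddedTangentSpace_of_curve hq hX (w := fun _ => q) continuousAt_const ?_
  have : ∀ᶠ t in 𝓝[≠] (0 : ℂ), 1 + t ^ 2 ≠ 0 := by
    refine nhdsWithin_le_nhds (ContinuousAt.eventually_ne ?_ ?_)
    · fun_prop
    · simp
  filter_upwards [this] with t ht
  have h1 : q + t ^ 2 • q = (1 + t ^ 2) • q := by rw [add_smul, one_smul]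
  rw [h1]
  exact smul_mem_affineCone ⟨hq, hX⟩ ht

/-- Vectors that are separated by coordinates bound the dimension from below. -/
theorem le_finrank_of_coordinates {n k : ℕ} {E : Submodule ℂ (Fin n → ℂ)}
    (b : Fin k → Fin n → ℂ) (hb : ∀ i, b i ∈ E) (hli : LinearIndependent ℂ b) :
    k ≤ Module.finrank ℂ E := by
  have h : Submodule.span ℂ (Set.range b) ≤ E := by
    rw [Submodule.span_le]
    rintro _ ⟨i, rfl⟩
    exact hb i
  have := Submodule.finrank_mono h
  rwa [finrank_span_eq_card hli, Fintype.card_fin] at this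

/-! ### Hilbert–Samuel functions and tangent cones -/

theorem exists_mem_of_mem_initialIdeal {n : ℕ} {J : Ideal (Poly n)} {i : Poly n}
    (hi : i ∈ initialIdeal J) (k : ℕ) :
    ∃ j ∈ J, (∀ e < k, homogeneousComponent e j = 0) ∧
      homogeneousComponent k j = homogeneousComponent k i := by
  induction hi using Submodule.span_induction generalizing k with
  | mem g hg =>
    obtain ⟨f, hf, d, hd, rfl⟩ := hg
    by_cases hk : k = d
    · subst hk
      exact ⟨f, hf, hd,
        (homogeneousComponent_same (homogeneousComponent_isHomogeneous k f)).symm⟩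
    · refine ⟨0, J.zero_mem, by simp, ?_⟩
      rw [homogeneousComponent_ne (homogeneousComponent_isHomogeneous d f) hk, map_zero]
  | zero => exact ⟨0, J.zero_mem, by simp, by simp⟩
  | add x y _ _ hx hy =>
    obtain ⟨a, ha, ha1, ha2⟩ := hx k
    obtain ⟨b, hb, hb1, hb2⟩ := hy k
    exact ⟨a + b, J.add_mem ha hb, fun e he => by rw [map_add, ha1 e he, hb1 e he, add_zero],
      by rw [map_add, map_add, ha2, hb2]⟩
  | smul p g _ hg =>
    choose f hf hf1 hf2 using hg
    refine ⟨∑ a ∈ Finset.range (k + 1), homogeneousComponent a p * f (k - a),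
      J.sum_mem fun a _ => J.mul_mem_left _ (hf _), fun e he => ?_, ?_⟩
    · rw [map_sum]
      refine Finset.sum_eq_zero fun a ha => ?_
      rw [Finset.mem_range] at ha
      by_cases hae : a ≤ e
      · rw [homogeneousComponent_mul_of_le (homogeneousComponent_isHomogeneous a p) hae,
          hf1 _ _ (by omega), mul_zero]
      · exact homogeneousComponent_mul_of_lt (homogeneousComponent_isHomogeneous a p)
          (not_le.mp hae) _
    · have hp : homogeneousComponent k (p • g) =
          ∑ a ∈ Finset.range (k + 1), homogeneousComponent a p * homogeneousComponent (k - a) g := by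
        conv_lhs => rw [← sum_homogeneousComponent p, smul_eq_mul, Finset.sum_mul, map_sum]
        have key : ∀ a, homogeneousComponent k (homogeneousComponent a p * g) =
            if a ≤ k then homogeneousComponent a p * homogeneousComponent (k - a) g else 0 := by
          intro a
          split_ifs with h
          · exact homogeneousComponent_mul_of_le (homogeneousComponent_isHomogeneous a p) h g
          · exact homogeneousComponent_mul_of_lt (homogeneousComponent_isHomogeneous a p)
              (not_le.mp h) g
        simp only [key]
        rw [← Finset.sum_filter]
        have hsub : Finset.filter (fun a => a ≤ k) (Finset.range (p.totalDegree + 1)) ⊆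
            Finset.range (k + 1) := by
          intro a
          simp only [Finset.mem_filter, Finset.mem_range]
          omega
        refine Finset.sum_subset hsub fun a ha ha' => ?_
        simp only [Finset.mem_filter, Finset.mem_range] at ha ha'
        rw [homogeneousComponent_eq_zero a p (by omega), zero_mul]
      rw [hp, map_sum]
      refine Finset.sum_congr rfl fun a ha => ?_
      rw [Finset.mem_range] at ha
      rw [homogeneousComponent_mul_of_le (homogeneousComponent_isHomogeneous a p) (by omega), hf2]

theorem finrank_homogeneousSubmodule (j : ℕ) :
    Module.finrank ℂ (homogeneousSubmodule (Fin 3) ℂ j) = (j + 2).choose 2 := by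
  classical
  rw [homogeneousSubmodule_eq_finsupp_supported]
  have e := AddMonoidAlgebra.supportedEquivFinsupp (R := ℂ) (S := ℂ) {d : Fin 3 →₀ ℕ | d.degree = j}
  have hs : {d : Fin 3 →₀ ℕ | d.degree = j} =
      ((Finset.univ : Finset (Fin 3)).finsuppAntidiag j : Set (Fin 3 →₀ ℕ)) := by
    ext d
    simp [Finset.mem_finsuppAntidiag, Finsupp.degree_eq_sum]
  rw [hs] at e ⊢
  refine (LinearEquiv.finrank_eq e).trans ?_
  rw [Module.finrank_finsupp_self]
  simp only [Finset.coe_sort_coe, Fintype.card_coe]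
  rw [Finset.card_finsuppAntidiag_nat_eq_choose]
  simp only [Finset.card_univ, Fintype.card_fin]
  rw [show 3 + j - 1 = j + 2 by omega]
  exact (Nat.choose_symm_add (a := j) (b := 2))

instance finite_homogeneousSubmodule (n j : ℕ) :
    Module.Finite ℂ (homogeneousSubmodule (Fin n) ℂ j) :=
  Module.Finite.iff_fg.mpr (homogeneousSubmodule_fg ℂ (σ := Fin n) j)

/-- The sum of the `m a * h a (ψ a)`, where `h a` is a polynomial in three variables. -/
def normalForm {n r : ℕ} (m : Fin r → Poly n) (ψ : Fin r → Fin 3 → Poly n) :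
    (Fin r → Poly 3) →ₗ[ℂ] Poly n where
  toFun h := ∑ a, m a * aeval (ψ a) (h a)
  map_add' h h' := by simp [mul_add, Finset.sum_add_distrib]
  map_smul' c h := by simp [Finset.smul_sum]

/-- The `ℂ`-dimension of the local ring modulo the `k`-th power of its maximal ideal. -/
abbrev jetQuotient {n : ℕ} (J : Ideal (Poly n)) (k : ℕ) : Type :=
  Poly n ⧸ (J ⊔ (Ideal.span (Set.range (X : Fin n → Poly n))) ^ k)

theorem jetQuotient_step {n r : ℕ} {J : Ideal (Poly n)} {m : Fin r → Poly n}
    {ψ : Fin r → Fin 3 → Poly n} {s : Fin r → ℕ} (hm : ∀ a, (m a).IsHomogeneous (s a))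
    (hψ : ∀ a i, (ψ a i).IsHomogeneous 1)
    (hind : ∀ h, normalForm m ψ h ∈ initialIdeal J → h = 0)
    (hspan : ∀ F, ∃ h, F - normalForm m ψ h ∈ initialIdeal J)
    (hI : ∀ F ∈ initialIdeal J, ∀ d, homogeneousComponent d F ∈ initialIdeal J)
    {k : ℕ} (hk : ∀ a, s a ≤ k) (hfin : Module.Finite ℂ (jetQuotient J k)) :
    Module.Finite ℂ (jetQuotient J (k + 1)) ∧
      Module.finrank ℂ (jetQuotient J (k + 1)) =
        Module.finrank ℂ (jetQuotient J k) + ∑ a, (k - s a + 2).choose 2 := by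
  set M := Ideal.span (Set.range (X : Fin n → Poly n)) with hM
  have hle : J ⊔ M ^ (k + 1) ≤ J ⊔ M ^ k := sup_le_sup le_rfl (Ideal.pow_le_pow_right (by omega))
  let pr : jetQuotient J (k + 1) →ₗ[ℂ] jetQuotient J k :=
    (Ideal.Quotient.factorₐ ℂ hle).toLinearMap
  have hpr : Function.Surjective pr := Ideal.Quotient.factor_surjective hle
  let Θ : (∀ a, homogeneousSubmodule (Fin 3) ℂ (k - s a)) →ₗ[ℂ] jetQuotient J (k + 1) :=
    (Ideal.Quotient.mkₐ ℂ (J ⊔ M ^ (k + 1))).toLinearMap ∘ₗ normalForm m ψ ∘ₗ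
      LinearMap.pi fun a => (homogeneousSubmodule (Fin 3) ℂ (k - s a)).subtype ∘ₗ LinearMap.proj a
  have hΘ : ∀ h, Θ h = Ideal.Quotient.mk _ (normalForm m ψ fun a => (h a : Poly 3)) := fun h => rfl
  have hhom : ∀ h : (∀ a, homogeneousSubmodule (Fin 3) ℂ (k - s a)),
      (normalForm m ψ fun a => (h a : Poly 3)).IsHomogeneous k := by
    intro h
    refine IsHomogeneous.sum _ _ _ fun a _ => ?_
    have h1 := (hm a).mul (aeval_isHomogeneous (h a).2 (hψ a))
    rwa [Nat.add_sub_cancel' (hk a)] at h1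
  have hinj : Function.Injective Θ := by
    rw [← LinearMap.ker_eq_bot, LinearMap.ker_eq_bot']
    intro h h0
    rw [hΘ, Ideal.Quotient.eq_zero_iff_mem, Submodule.mem_sup] at h0
    obtain ⟨j, hj, g, hg, hjg⟩ := h0
    rw [mem_maxIdeal_pow_iff] at hg
    have hc : ∀ e ≤ k, homogeneousComponent e j =
        homogeneousComponent e (normalForm m ψ fun a => (h a : Poly 3)) := by
      intro e he
      rw [← hjg, map_add, hg e (by omega), add_zero]
    have h1 := hind (fun a => (h a : Poly 3)) (Ideal.subset_span ⟨j, hj, k, fun e he => by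
      rw [hc e he.le, homogeneousComponent_ne (hhom h) he.ne], by
      rw [hc k le_rfl, homogeneousComponent_same (hhom h)]⟩)
    funext a
    exact Subtype.ext (congrFun h1 a)
  have hrange : LinearMap.range Θ = LinearMap.ker pr := by
    apply le_antisymm
    · rintro _ ⟨h, rfl⟩
      rw [LinearMap.mem_ker, hΘ]
      refine Ideal.Quotient.eq_zero_iff_mem.mpr (Ideal.mem_sup_right ?_)
      rw [mem_maxIdeal_pow_iff]
      exact fun e he => homogeneousComponent_ne (hhom h) he.ne
    · intro x hx
      obtain ⟨f, rfl⟩ := Ideal.Quotient.mk_surjective x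
      have hf : f ∈ J ⊔ M ^ k := Ideal.Quotient.eq_zero_iff_mem.mp hx
      obtain ⟨j, hj, g, hg, rfl⟩ := Submodule.mem_sup.mp hf
      rw [mem_maxIdeal_pow_iff] at hg
      obtain ⟨h, hh⟩ := hspan g
      have hh' := hI _ hh k
      have hnf : homogeneousComponent k (normalForm m ψ h) =
          normalForm m ψ fun a => homogeneousComponent (k - s a) (h a) := by
        change homogeneousComponent k (∑ a, m a * aeval (ψ a) (h a)) =
          ∑ a, m a * aeval (ψ a) (homogeneousComponent (k - s a) (h a))
        rw [map_sum]
        refine Finset.sum_congr rfl fun a _ => ?_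
        rw [homogeneousComponent_mul_of_le (hm a) (hk a), homogeneousComponent_aeval (hψ a)]
      rw [map_sub, hnf] at hh'
      obtain ⟨j', hj', hj1, hj2⟩ := exists_mem_of_mem_initialIdeal hh' k
      let h' : ∀ a, homogeneousSubmodule (Fin 3) ℂ (k - s a) := fun a =>
        ⟨homogeneousComponent (k - s a) (h a), homogeneousComponent_isHomogeneous _ _⟩
      refine ⟨h', ?_⟩
      rw [hΘ, Ideal.Quotient.eq]
      have h3 : (normalForm m ψ fun a => (h' a : Poly 3)) - (j + g) =
          -(j + j') + (((normalForm m ψ fun a => (h' a : Poly 3)) - g) + j') := by ring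
      rw [h3]
      refine Ideal.add_mem _ (Ideal.mem_sup_left (J.neg_mem (J.add_mem hj hj')))
        (Ideal.mem_sup_right ?_)
      rw [mem_maxIdeal_pow_iff]
      intro e he
      rcases lt_or_eq_of_le (Nat.lt_succ_iff.mp he) with he | rfl
      · rw [map_add, map_sub, hj1 e he, hg e he, homogeneousComponent_ne (hhom h') he.ne]
        simp
      · rw [map_add, map_sub, hj2, map_sub,
          homogeneousComponent_same (homogeneousComponent_isHomogeneous _ g),
          homogeneousComponent_same (hhom h')]
        ring
  have hker : Module.Finite ℂ (LinearMap.ker pr) := by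
    rw [← hrange]
    infer_instance
  have hfin' : Module.Finite ℂ (jetQuotient J (k + 1)) := by
    have : Module.Finite ℂ (jetQuotient J (k + 1) ⧸ LinearMap.ker pr) :=
      Module.Finite.equiv (pr.quotKerEquivOfSurjective hpr).symm
    exact Module.Finite.of_submodule_quotient (LinearMap.ker pr)
  refine ⟨hfin', ?_⟩
  rw [← LinearMap.finrank_range_add_finrank_ker pr, LinearMap.range_eq_top.mpr hpr, finrank_top,
    ← hrange, LinearMap.finrank_range_of_inj hinj, Module.finrank_pi_fintype]
  simp only [finrank_homogeneousSubmodule]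

theorem finite_jetQuotient_one {n : ℕ} (J : Ideal (Poly n)) :
    Module.Finite ℂ (jetQuotient J 1) := by
  refine Module.Finite.of_surjective (Algebra.linearMap ℂ (jetQuotient J 1)) fun x => ?_
  obtain ⟨f, rfl⟩ := Ideal.Quotient.mk_surjective x
  refine ⟨coeff 0 f, ?_⟩
  change Ideal.Quotient.mk _ (C (coeff 0 f)) = _
  rw [Ideal.Quotient.eq]
  refine Ideal.mem_sup_right ?_
  rw [mem_maxIdeal_pow_iff]
  intro e he
  obtain rfl : e = 0 := by omega
  simp [homogeneousComponent_zero]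

theorem sum_choose_two (s k : ℕ) (hs : s ≤ 1) :
    (k + 3 - s).choose 3 = (if s = 0 then 1 else 0) +
      ∑ j ∈ Finset.range k, (j + 1 - s + 2).choose 2 := by
  induction k with
  | zero => interval_cases s <;> simp [Nat.choose]
  | succ k ih =>
    rw [Finset.sum_range_succ, ← add_assoc, ← ih]
    interval_cases s
    · rw [show k + 1 + 3 - 0 = (k + 3) + 1 by omega, Nat.choose_succ_succ]
      simp [add_comm]
    · rw [show k + 1 + 3 - 1 = (k + 2) + 1 by omega, Nat.choose_succ_succ]
      simp [add_comm]

theorem tendsto_choose_three (s : ℕ) (hs : s ≤ 1) :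
    Tendsto (fun k : ℕ => (6 : ℝ) * ((k + 3 - s).choose 3 : ℕ) / (k : ℝ) ^ 3) atTop (𝓝 1) := by
  have hinv : Tendsto (fun k : ℕ => (k : ℝ)⁻¹) atTop (𝓝 0) := tendsto_inv_atTop_nhds_zero_nat
  have hc : ∀ c : ℝ, Tendsto (fun k : ℕ => 1 + c * (k : ℝ)⁻¹) atTop (𝓝 1) := fun c => by
    simpa using (hinv.const_mul c).const_add 1
  have key : Tendsto (fun k : ℕ => (1 + (3 - (s : ℝ)) * (k : ℝ)⁻¹) *
      (1 + (2 - (s : ℝ)) * (k : ℝ)⁻¹) * (1 + (1 - (s : ℝ)) * (k : ℝ)⁻¹)) atTop (𝓝 1) := by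
    simpa using ((hc (3 - s)).mul (hc (2 - s))).mul (hc (1 - s))
  refine key.congr' ?_
  filter_upwards [eventually_gt_atTop 0] with k hk
  have hk' : (k : ℝ) ≠ 0 := by positivity
  have h6 : (6 : ℝ) * ((k + 3 - s).choose 3 : ℕ) =
      ((k : ℝ) + (3 - s)) * ((k : ℝ) + (2 - s)) * ((k : ℝ) + (1 - s)) := by
    have h1 := Nat.descFactorial_eq_factorial_mul_choose (k + 3 - s) 3
    have h2 : (k + 3 - s).descFactorial 3 = (k + 3 - s) * (k + 2 - s) * (k + 1 - s) := by
      simp only [Nat.descFactorial]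
      rw [show k + 3 - s - 2 = k + 1 - s by omega, show k + 3 - s - 1 = k + 2 - s by omega]
      simp only [Nat.sub_zero]
      ring
    have h3 : 6 * (k + 3 - s).choose 3 = (k + 3 - s) * (k + 2 - s) * (k + 1 - s) := by
      rw [← h2, h1]
      rfl
    have h4 := congrArg (Nat.cast : ℕ → ℝ) h3
    rw [Nat.cast_mul, Nat.cast_mul, Nat.cast_mul, Nat.cast_sub (by omega), Nat.cast_sub (by omega),
      Nat.cast_sub (by omega)] at h4
    push_cast at h4
    rw [h4]
    ring
  rw [h6]
  field_simp

/-- A point whose tangent cone has a normal form with `r` pieces in three variables has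
multiplicity `r`. -/
theorem hasMultiplicity_of_normalForm {n r : ℕ} {X : Set (PSp n)} {P : PSp n} {m : Fin r → Poly n}
    {ψ : Fin r → Fin 3 → Poly n} {s : Fin r → ℕ} (hs : ∀ a, s a ≤ 1)
    (hm : ∀ a, (m a).IsHomogeneous (s a)) (hψ : ∀ a i, (ψ a i).IsHomogeneous 1)
    (hind : ∀ h, normalForm m ψ h ∈ tangentConeIdeal X P → h = 0)
    (hspan : ∀ F, ∃ h, F - normalForm m ψ h ∈ tangentConeIdeal X P)
    (hI : ∀ F ∈ tangentConeIdeal X P, ∀ d, homogeneousComponent d F ∈ tangentConeIdeal X P) :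
    HasMultiplicity X P 3 r := by
  set J := localIdeal X P with hJ
  have hstep : ∀ k, Module.Finite ℂ (jetQuotient J (k + 1)) ∧
      Module.finrank ℂ (jetQuotient J (k + 1)) = Module.finrank ℂ (jetQuotient J 1) +
        ∑ j ∈ Finset.range k, ∑ a, (j + 1 - s a + 2).choose 2 := by
    intro k
    induction k with
    | zero => exact ⟨finite_jetQuotient_one J, by simp⟩
    | succ k ih =>
      obtain ⟨h1, h2⟩ := jetQuotient_step hm hψ hind hspan hI
        (fun a => (hs a).trans (Nat.le_add_left 1 k)) ih.1
      refine ⟨h1, ?_⟩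
      rw [h2, ih.2, Finset.sum_range_succ, add_assoc]
  have hHS : ∀ k, (hilbertSamuel X P k : ℝ) = ((Module.finrank ℂ (jetQuotient J 1) : ℝ) -
      ∑ a, if s a = 0 then 1 else 0) + ∑ a, ((k + 3 - s a).choose 3 : ℕ) := by
    intro k
    have h1 : hilbertSamuel X P k = Module.finrank ℂ (jetQuotient J (k + 1)) := rfl
    rw [h1, (hstep k).2, Finset.sum_comm]
    simp only [fun a => sum_choose_two (s a) k (hs a)]
    push_cast
    rw [Finset.sum_add_distrib]
    ring
  unfold HasMultiplicity
  simp only [hHS]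
  set c : ℝ := (Module.finrank ℂ (jetQuotient J 1) : ℝ) - ∑ a, if s a = 0 then 1 else 0
  have hc : Tendsto (fun k : ℕ => 6 * c / (k : ℝ) ^ 3) atTop (𝓝 0) :=
    ((tendsto_pow_atTop (by norm_num)).comp tendsto_natCast_atTop_atTop).const_div_atTop (6 * c)
  have hsum : Tendsto (fun k : ℕ => ∑ a, (6 : ℝ) * ((k + 3 - s a).choose 3 : ℕ) / (k : ℝ) ^ 3)
      atTop (𝓝 (∑ _a : Fin r, 1)) :=
    tendsto_finsetSum _ fun a _ => tendsto_choose_three (s a) (hs a)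
  have htot := hc.add hsum
  simp only [Finset.sum_const, Finset.card_univ, Fintype.card_fin, nsmul_eq_mul, mul_one,
    zero_add] at htot
  refine htot.congr fun k => ?_
  rw [← Finset.sum_div, ← Finset.mul_sum]
  simp only [Nat.factorial]
  push_cast
  ring

/-! ### Toric ideals -/

/-- The monomial with a given multiset of variables. -/
def multisetMonomial {σ : Type} (s : Multiset σ) : MvPolynomial σ ℂ := (s.map X).prod

@[simp] theorem multisetMonomial_zero {σ : Type} :
    multisetMonomial (0 : Multiset σ) = 1 := by simp [multisetMonomial]

@[simp] theorem multisetMonomial_cons {σ : Type} (a : σ) (s : Multiset σ) :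
    multisetMonomial (a ::ₘ s) = X a * multisetMonomial s := by simp [multisetMonomial]

theorem multisetMonomial_add {σ : Type} (s t : Multiset σ) :
    multisetMonomial (s + t) = multisetMonomial s * multisetMonomial t := by
  simp [multisetMonomial]

theorem mem_span_multisetMonomial {σ : Type} (p : MvPolynomial σ ℂ) :
    p ∈ Submodule.span ℂ (Set.range (multisetMonomial (σ := σ))) := by
  induction p using MvPolynomial.induction_on with
  | C a =>
    have : (C a : MvPolynomial σ ℂ) = a • multisetMonomial 0 := by simp [smul_eq_C_mul]
    rw [this]
    exact Submodule.smul_mem _ _ (Submodule.subset_span ⟨0, rfl⟩)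
  | add p q hp hq => exact Submodule.add_mem _ hp hq
  | mul_X p i hp =>
    induction hp using Submodule.span_induction with
    | mem x hx =>
      obtain ⟨s, rfl⟩ := hx
      exact Submodule.subset_span ⟨i ::ₘ s, by rw [multisetMonomial_cons, mul_comm]⟩
    | zero => simp
    | add x y _ _ hx hy => rw [add_mul]; exact Submodule.add_mem _ hx hy
    | smul a x _ hx => rw [smul_mul_assoc]; exact Submodule.smul_mem _ _ hx

/-- The kernel of a monomial map lies in every ideal that contains the differences of monomials
with equal image. -/
theorem mem_of_monomialMap_eq_zero {σ τ : Type} (A : σ → τ →₀ ℕ) (I : Ideal (MvPolynomial σ ℂ))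
    (h : ∀ s t : Multiset σ, (s.map A).sum = (t.map A).sum →
      multisetMonomial s - multisetMonomial t ∈ I)
    {p : MvPolynomial σ ℂ}
    (hp : aeval (fun i => (monomial (A i) 1 : MvPolynomial τ ℂ)) p = 0) : p ∈ I := by
  classical
  let T : MvPolynomial τ ℂ →ₗ[ℂ] MvPolynomial σ ℂ ⧸ I :=
    (basisMonomials τ ℂ).constr ℂ fun w =>
      if hw : ∃ s : Multiset σ, (s.map A).sum = w then
        Ideal.Quotient.mk I (multisetMonomial hw.choose) else 0
  have hT : ∀ w, T (monomial w 1) = if hw : ∃ s : Multiset σ, (s.map A).sum = w then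
        Ideal.Quotient.mk I (multisetMonomial hw.choose) else 0 := by
    intro w
    have := (basisMonomials τ ℂ).constr_basis ℂ (fun w =>
      if hw : ∃ s : Multiset σ, (s.map A).sum = w then
        Ideal.Quotient.mk I (multisetMonomial hw.choose) else 0) w
    rwa [coe_basisMonomials] at this
  have hφ : ∀ s : Multiset σ, aeval (fun i => (monomial (A i) 1 : MvPolynomial τ ℂ))
      (multisetMonomial s) = monomial ((s.map A).sum) 1 := by
    intro s
    induction s using Multiset.induction_on with
    | empty => simp
    | cons a s ih =>
      rw [multisetMonomial_cons, map_mul, ih, aeval_X, monomial_mul, one_mul, Multiset.map_cons,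
        Multiset.sum_cons]
  have key : ∀ p : MvPolynomial σ ℂ,
      T (aeval (fun i => (monomial (A i) 1 : MvPolynomial τ ℂ)) p) = Ideal.Quotient.mk I p := by
    intro p
    refine LinearMap.eqOn_span (f := T ∘ₗ (aeval fun i => (monomial (A i) 1 :
      MvPolynomial τ ℂ)).toLinearMap) (g := (Ideal.Quotient.mkₐ ℂ I).toLinearMap) ?_
      (mem_span_multisetMonomial p)
    rintro _ ⟨s, rfl⟩
    simp only [LinearMap.comp_apply, AlgHom.toLinearMap_apply, hφ, hT]
    have hw : ∃ t : Multiset σ, (t.map A).sum = (s.map A).sum := ⟨s, rfl⟩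
    rw [dif_pos hw]
    exact Ideal.Quotient.eq.mpr (h _ _ hw.choose_spec)
  have := key p
  rw [hp, map_zero] at this
  exact Ideal.Quotient.eq_zero_iff_mem.mp this.symm

/-- Two monomials of the same degree and multidegree that are congruent modulo `I`. -/
structure Congruent {σ : Type} {M : Type} [AddCommMonoid M] (A : σ → M)
    (I : Ideal (MvPolynomial σ ℂ)) (s t : Multiset σ) : Prop where
  sub_mem : multisetMonomial s - multisetMonomial t ∈ I
  sum_eq : (s.map A).sum = (t.map A).sum
  card_eq : Multiset.card s = Multiset.card t

namespace Congruent

variable {σ M : Type} [AddCommMonoid M] {A : σ → M} {I : Ideal (MvPolynomial σ ℂ)}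
  {s t u : Multiset σ}

theorem refl (s : Multiset σ) : Congruent A I s s := ⟨by simp, rfl, rfl⟩

theorem symm (h : Congruent A I s t) : Congruent A I t s :=
  ⟨by simpa using I.neg_mem h.sub_mem, h.sum_eq.symm, h.card_eq.symm⟩

theorem trans (h : Congruent A I s t) (h' : Congruent A I t u) : Congruent A I s u :=
  ⟨by simpa using I.add_mem h.sub_mem h'.sub_mem, h.sum_eq.trans h'.sum_eq,
    h.card_eq.trans h'.card_eq⟩

theorem cons (a : σ) (h : Congruent A I s t) : Congruent A I (a ::ₘ s) (a ::ₘ t) :=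
  ⟨by
    rw [multisetMonomial_cons, multisetMonomial_cons, ← mul_sub]
    exact I.mul_mem_left _ h.sub_mem, by simp [h.sum_eq], by simp [h.card_eq]⟩

theorem pair {a b c d : σ} (h : A a + A b = A c + A d) (hI : X a * X b - X c * X d ∈ I)
    (s : Multiset σ) : Congruent A I (a ::ₘ b ::ₘ s) (c ::ₘ d ::ₘ s) :=
  ⟨by
    simp only [multisetMonomial_cons, ← mul_assoc, ← sub_mul]
    exact I.mul_mem_right _ hI, by simp [← add_assoc, h], by simp⟩

theorem single {a b : σ} (h : A a = A b) (hI : X a - X b ∈ I)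
    (s : Multiset σ) : Congruent A I (a ::ₘ s) (b ::ₘ s) :=
  ⟨by
    simp only [multisetMonomial_cons, ← sub_mul]
    exact I.mul_mem_right _ hI, by simp [h], by simp⟩

end Congruent

/-- Monomials of equal multidegree are congruent if they always have, up to congruence, a common
variable. -/
theorem congruent_of_common {σ M : Type} [AddCancelCommMonoid M] (A : σ → M)
    (I : Ideal (MvPolynomial σ ℂ)) (h0 : ∀ s : Multiset σ, (s.map A).sum = 0 → s = 0)
    (h : ∀ s t : Multiset σ, s ≠ 0 → (s.map A).sum = (t.map A).sum →
      ∃ k s' t', Congruent A I s (k ::ₘ s') ∧ Congruent A I t (k ::ₘ t')) :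
    ∀ s t : Multiset σ, (s.map A).sum = (t.map A).sum → Congruent A I s t := by
  intro s
  induction hn : Multiset.card s generalizing s with
  | zero =>
    intro t hst
    rw [Multiset.card_eq_zero] at hn
    subst hn
    rw [h0 t (by simpa using hst.symm)]
    exact Congruent.refl _
  | succ n ih =>
    intro t hst
    obtain ⟨k, s', t', hs, ht⟩ := h s t (by rintro rfl; simp at hn) hst
    refine hs.trans (Congruent.trans ?_ ht.symm)
    refine Congruent.cons k (ih s' ?_ t' ?_)
    · have := hs.card_eq
      rw [Multiset.card_cons] at this
      omega
    · have := hs.sum_eq.symm.trans (hst.trans ht.sum_eq)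
      simpa using this

/-- Pairs of elements of equal parity. -/
abbrev ParityPair {K : Type} (odd : K → Bool) : Type := {p : K × K // odd p.1 = odd p.2}

/-- The ideal of the products of two variables of equal parity is generated by minors. -/
theorem mem_of_pairMap_eq_zero {K : Type} (odd : K → Bool)
    (I : Ideal (MvPolynomial (ParityPair odd) ℂ))
    (hsymm : ∀ a b (h : odd a = odd b), X ⟨(a, b), h⟩ - X ⟨(b, a), h.symm⟩ ∈ I)
    (hminor : ∀ a b c d (h1 : odd a = odd b) (h2 : odd c = odd d) (h3 : odd a = odd c),
      X ⟨(a, b), h1⟩ * X ⟨(c, d), h2⟩ -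
        X ⟨(a, c), h3⟩ * X ⟨(b, d), h1.symm.trans (h3.trans h2)⟩ ∈ I)
    {p : MvPolynomial (ParityPair odd) ℂ}
    (hp : aeval (fun q : ParityPair odd => (X q.1.1 * X q.1.2 : MvPolynomial K ℂ)) p = 0) :
    p ∈ I := by
  classical
  let A : ParityPair odd → Multiset K := fun q => {q.1.1, q.1.2}
  have hA : ∀ q, A q = q.1.1 ::ₘ q.1.2 ::ₘ 0 := fun q => rfl
  have hcong : ∀ s t : Multiset (ParityPair odd), (s.map A).sum = (t.map A).sum →
      Congruent A I s t := by
    have swap : ∀ a b (h : odd a = odd b) s,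
        Congruent A I (⟨(a, b), h⟩ ::ₘ s) (⟨(b, a), h.symm⟩ ::ₘ s) := fun a b h s =>
      Congruent.single (by simp only [hA]; exact Multiset.cons_swap a b 0) (hsymm a b h) s
    have extract : ∀ (t : Multiset (ParityPair odd)) (a : K), a ∈ (t.map A).sum →
        ∃ b, ∃ h : odd a = odd b, ∃ t', Congruent A I t (⟨(a, b), h⟩ ::ₘ t') := by
      intro t a ha
      obtain ⟨x, hx, hax⟩ := Multiset.mem_join.mp ha
      obtain ⟨⟨⟨c, d⟩, hcd⟩, hq, rfl⟩ := Multiset.mem_map.mp hx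
      obtain ⟨t', rfl⟩ := Multiset.exists_cons_of_mem hq
      simp only [hA, Multiset.mem_cons, Multiset.notMem_zero, or_false] at hax
      rcases hax with rfl | rfl
      · exact ⟨d, hcd, t', Congruent.refl _⟩
      · exact ⟨c, hcd.symm, t', swap _ _ _ _⟩
    refine congruent_of_common A I ?_ ?_
    · intro s hs
      by_contra hne
      obtain ⟨q, hq⟩ := Multiset.exists_mem_of_ne_zero hne
      have : q.1.1 ∈ (s.map A).sum :=
        Multiset.mem_join.mpr ⟨A q, Multiset.mem_map_of_mem A hq, by simp [hA]⟩
      simp [hs] at this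
    · intro s t hs hst
      obtain ⟨⟨⟨a, c⟩, hac⟩, hq⟩ := Multiset.exists_mem_of_ne_zero hs
      obtain ⟨s', rfl⟩ := Multiset.exists_cons_of_mem hq
      rw [Multiset.map_cons, Multiset.sum_cons, hA] at hst
      obtain ⟨b, hab, t1, ht1⟩ := extract t a (by rw [← hst]; simp)
      have h1 := hst.trans ht1.sum_eq
      rw [Multiset.map_cons, Multiset.sum_cons, hA] at h1
      simp only [Multiset.cons_add, Multiset.zero_add, Multiset.cons_inj_right] at h1
      have hc : c ∈ b ::ₘ (t1.map A).sum := by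
        rw [← h1]
        exact Multiset.mem_cons_self _ _
      rcases Multiset.mem_cons.mp hc with rfl | hc
      · exact ⟨_, s', t1, Congruent.refl _, ht1⟩
      · obtain ⟨d, hcd, t2, ht2⟩ := extract t1 c hc
        refine ⟨⟨(a, c), hac⟩, s', _, Congruent.refl _, ht1.trans ((ht2.cons _).trans
          (Congruent.pair ?_ (hminor a b c d hab hcd hac) t2))⟩
        simp only [hA]
        rw [Multiset.cons_add, Multiset.cons_add, Multiset.cons_add, Multiset.cons_add]
        simp only [Multiset.zero_add]
        rw [Multiset.cons_swap b c]
  refine mem_of_monomialMap_eq_zero (fun q => Multiset.toFinsupp (A q)) I (fun s t hst => ?_) ?_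
  · refine (hcong s t ?_).sub_mem
    apply Multiset.toFinsupp.injective
    rw [map_multiset_sum, map_multiset_sum, Multiset.map_map, Multiset.map_map]
    exact hst
  · rw [← hp]
    congr 2
    funext q
    simp only [hA]
    rw [← Multiset.singleton_add, ← Multiset.singleton_add, map_add, map_add, map_zero, add_zero,
      Multiset.toFinsupp_singleton, Multiset.toFinsupp_singleton, X, X, monomial_mul, one_mul]

/-! ### Quadratic forms as matrices -/

/-- The contraction of an array with a matrix. -/
def contract {N : ℕ} {A : Type} [AddCommMonoid A] [Module ℂ A] (β : Matrix (Fin N) (Fin N) ℂ)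
    (f : Fin N → Fin N → A) : A := ∑ i, ∑ j, β i j • f i j

section contract

variable {N : ℕ} {A B : Type} [AddCommGroup A] [Module ℂ A] [AddCommGroup B] [Module ℂ B]

theorem contract_add (β γ : Matrix (Fin N) (Fin N) ℂ) (f : Fin N → Fin N → A) :
    contract (β + γ) f = contract β f + contract γ f := by
  simp [contract, add_smul, Finset.sum_add_distrib]

theorem contract_sub (β γ : Matrix (Fin N) (Fin N) ℂ) (f : Fin N → Fin N → A) :
    contract (β - γ) f = contract β f - contract γ f := by
  simp [contract, sub_smul, Finset.sum_sub_distrib]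

theorem contract_smul (a : ℂ) (β : Matrix (Fin N) (Fin N) ℂ) (f : Fin N → Fin N → A) :
    contract (a • β) f = a • contract β f := by
  simp [contract, mul_smul, Finset.smul_sum]

theorem contract_single (i j : Fin N) (a : ℂ) (f : Fin N → Fin N → A) :
    contract (Matrix.single i j a) f = a • f i j := by
  unfold contract
  rw [Finset.sum_eq_single i, Finset.sum_eq_single j]
  · simp
  · intro b _ hb
    simp [hb.symm]
  · simp
  · intro b _ hb
    simp [hb.symm]
  · simp

theorem map_contract {F : Type} [FunLike F A B] [LinearMapClass F ℂ A B] (φ : F)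
    (β : Matrix (Fin N) (Fin N) ℂ)
    (f : Fin N → Fin N → A) : φ (contract β f) = contract β fun i j => φ (f i j) := by
  simp [contract, map_sum]

theorem contract_congr {β : Matrix (Fin N) (Fin N) ℂ} {f g : Fin N → Fin N → A}
    (h : ∀ i j, β i j ≠ 0 → f i j = g i j) : contract β f = contract β g := by
  refine Finset.sum_congr rfl fun i _ => Finset.sum_congr rfl fun j _ => ?_
  by_cases hb : β i j = 0
  · simp [hb]
  · rw [h i j hb]

theorem contract_const_smul (a : ℂ) (β : Matrix (Fin N) (Fin N) ℂ) (f : Fin N → Fin N → A) :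
    contract β (fun i j => a • f i j) = a • contract β f := by
  simp only [contract, Finset.smul_sum]
  exact Finset.sum_congr rfl fun i _ => Finset.sum_congr rfl fun j _ => smul_comm _ _ _

theorem contract_fun_add (β : Matrix (Fin N) (Fin N) ℂ) (f g : Fin N → Fin N → A) :
    contract β (fun i j => f i j + g i j) = contract β f + contract β g := by
  simp [contract, Finset.sum_add_distrib]

theorem contract_mul_right {R : Type} [CommRing R] [Algebra ℂ R] (β : Matrix (Fin N) (Fin N) ℂ)
    (f : Fin N → Fin N → R) (r : R) :
    contract β (fun i j => f i j * r) = contract β f * r := by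
  simp [contract, Finset.sum_mul]

theorem contract_isHomogeneous {k d : ℕ} (β : Matrix (Fin N) (Fin N) ℂ)
    {f : Fin N → Fin N → Poly k} (hf : ∀ i j, (f i j).IsHomogeneous d) :
    (contract β f).IsHomogeneous d := by
  refine IsHomogeneous.sum _ _ _ fun i _ => IsHomogeneous.sum _ _ _ fun j _ => ?_
  rw [smul_eq_C_mul]
  exact (hf i j).C_mul _

end contract

/-- The quadratic form with matrix `β`. -/
def quadric {N : ℕ} (β : Matrix (Fin N) (Fin N) ℂ) : Poly N := contract β fun i j => X i * X j

theorem eval_contract {N k : ℕ} (q : Fin k → ℂ) (β : Matrix (Fin N) (Fin N) ℂ)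
    (f : Fin N → Fin N → Poly k) : eval q (contract β f) = contract β fun i j => eval q (f i j) := by
  simp only [← MvPolynomial.aeval_eq_eval]
  exact map_contract (aeval q) β f

theorem eval_quadric {N : ℕ} (β : Matrix (Fin N) (Fin N) ℂ) (c : Fin N → ℂ) :
    eval c (quadric β) = contract β fun i j => c i * c j := by
  simp [quadric, eval_contract]

theorem quadric_isHomogeneous {N : ℕ} (β : Matrix (Fin N) (Fin N) ℂ) :
    (quadric β).IsHomogeneous 2 :=
  contract_isHomogeneous β fun i j => (isHomogeneous_X ℂ i).mul (isHomogeneous_X ℂ j)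

/-! ### Quotients of cones by diagonal involutions -/

/-- A cone cut out by quadrics, each of them even or odd for an involution that is diagonal in the
coordinates `g`, and even quadratic forms `Z` that separate the products of coordinates of equal
parity. -/
structure QuotientData (n m : ℕ) where
  ofMatrices ::
  g : (Fin (n + 1) → ℂ) ≃ₗ[ℂ] (Fin (n + 1) → ℂ)
  odd : Fin (n + 1) → Bool
  eqs : Set (Matrix (Fin (n + 1)) (Fin (n + 1)) ℂ)
  eqs_parity : ∀ β ∈ eqs, (∀ i j, odd i ≠ odd j → β i j = 0) ∨ (∀ i j, odd i = odd j → β i j = 0)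
  Z : Fin (m + 1) → Matrix (Fin (n + 1)) (Fin (n + 1)) ℂ
  Z_even : ∀ k i j, odd i ≠ odd j → Z k i j = 0
  L : Fin (n + 1) → Fin (n + 1) → Poly (m + 1)
  L_hom : ∀ i j, (L i j).IsHomogeneous 1
  L_spec : ∀ c : Fin (n + 1) → ℂ, (∀ β ∈ eqs, contract β (fun i j => c i * c j) = 0) →
    ∀ i j, odd i = odd j →
      eval (fun k => contract (Z k) fun i j => c i * c j) (L i j) = c i * c j
  Z_L : ∀ k, contract (Z k) L = X k

namespace QuotientData

variable {n m : ℕ} (D : QuotientData n m)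

/-- The cone, in diagonal coordinates. -/
def cone : Set (Fin (n + 1) → ℂ) := {c | ∀ β ∈ D.eqs, contract β (fun i j => c i * c j) = 0}

/-- The quadratic map, in diagonal coordinates. -/
def zmap (c : Fin (n + 1) → ℂ) : Fin (m + 1) → ℂ := fun k => contract (D.Z k) fun i j => c i * c j

/-- The eigenvalues of the involution. -/
def sgn (i : Fin (n + 1)) : ℂ := if D.odd i then -1 else 1

/-- The involution, in diagonal coordinates. -/
def flip (c : Fin (n + 1) → ℂ) : Fin (n + 1) → ℂ := fun i => D.sgn i * c i

theorem sgn_mul_self (i : Fin (n + 1)) : D.sgn i * D.sgn i = 1 := by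
  unfold sgn
  split_ifs <;> simp

theorem sgn_mul_of_eq {i j : Fin (n + 1)} (h : D.odd i = D.odd j) : D.sgn i * D.sgn j = 1 := by
  unfold sgn
  rw [h]
  split_ifs <;> simp

theorem sgn_mul_of_ne {i j : Fin (n + 1)} (h : D.odd i ≠ D.odd j) : D.sgn i * D.sgn j = -1 := by
  unfold sgn
  cases hi : D.odd i <;> cases hj : D.odd j <;> simp_all

theorem flip_flip (c : Fin (n + 1) → ℂ) : D.flip (D.flip c) = c := by
  funext i
  simp only [flip, ← mul_assoc, sgn_mul_self, one_mul]

theorem flip_smul (a : ℂ) (c : Fin (n + 1) → ℂ) : D.flip (a • c) = a • D.flip c := by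
  funext i
  simp only [flip, Pi.smul_apply, smul_eq_mul]
  ring

theorem eval_L {c : Fin (n + 1) → ℂ} (hc : c ∈ D.cone) {i j : Fin (n + 1)}
    (h : D.odd i = D.odd j) : eval (D.zmap c) (D.L i j) = c i * c j := D.L_spec c hc i j h

theorem smul_mem_cone {c : Fin (n + 1) → ℂ} (hc : c ∈ D.cone) (a : ℂ) : a • c ∈ D.cone := by
  intro β hβ
  have : contract β (fun i j => (a • c) i * (a • c) j) =
      a ^ 2 • contract β fun i j => c i * c j := by
    rw [← contract_const_smul]
    congr
    funext i j
    simp only [Pi.smul_apply, smul_eq_mul]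
    ring
  rw [this, hc β hβ, smul_zero]

theorem contract_flip_of_even {β : Matrix (Fin (n + 1)) (Fin (n + 1)) ℂ}
    (h : ∀ i j, D.odd i ≠ D.odd j → β i j = 0) (c : Fin (n + 1) → ℂ) :
    contract β (fun i j => D.flip c i * D.flip c j) = contract β fun i j => c i * c j := by
  refine contract_congr fun i j hb => ?_
  have hij : D.odd i = D.odd j := by
    by_contra hne
    exact hb (h i j hne)
  simp only [flip]
  linear_combination (c i * c j) * D.sgn_mul_of_eq hij

theorem contract_flip_of_odd {β : Matrix (Fin (n + 1)) (Fin (n + 1)) ℂ}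
    (h : ∀ i j, D.odd i = D.odd j → β i j = 0) (c : Fin (n + 1) → ℂ) :
    contract β (fun i j => D.flip c i * D.flip c j) = -contract β fun i j => c i * c j := by
  rw [← neg_one_smul ℂ (contract β _), ← contract_const_smul]
  refine contract_congr fun i j hb => ?_
  have hij : D.odd i ≠ D.odd j := fun he => hb (h i j he)
  simp only [flip, smul_eq_mul]
  linear_combination (c i * c j) * D.sgn_mul_of_ne hij

theorem flip_mem_cone {c : Fin (n + 1) → ℂ} (hc : c ∈ D.cone) : D.flip c ∈ D.cone := by
  intro β hβ
  rcases D.eqs_parity β hβ with h | h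
  · rw [D.contract_flip_of_even h, hc β hβ]
  · rw [D.contract_flip_of_odd h, hc β hβ, neg_zero]

theorem zmap_smul (a : ℂ) (c : Fin (n + 1) → ℂ) : D.zmap (a • c) = a ^ 2 • D.zmap c := by
  funext k
  simp only [zmap, Pi.smul_apply, ← contract_const_smul]
  congr
  funext i j
  simp only [smul_eq_mul]
  ring

theorem zmap_flip (c : Fin (n + 1) → ℂ) : D.zmap (D.flip c) = D.zmap c := by
  funext k
  exact D.contract_flip_of_even (D.Z_even k) c

theorem zmap_ne_zero {c : Fin (n + 1) → ℂ} (hc : c ∈ D.cone) (h0 : c ≠ 0) : D.zmap c ≠ 0 := by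
  intro h
  apply h0
  funext i
  have := D.eval_L hc (rfl : D.odd i = D.odd i)
  rw [h] at this
  have h2 : eval (0 : Fin (m + 1) → ℂ) (D.L i i) = 0 := by
    have := eval_smul_of_isHomogeneous (D.L_hom i i) 0 0
    simpa using this
  rw [h2] at this
  simpa using this.symm

theorem zmap_eq_iff {c d : Fin (n + 1) → ℂ} (hc : c ∈ D.cone) (hd : d ∈ D.cone) :
    D.zmap c = D.zmap d ↔ c = d ∨ c = -d ∨ c = D.flip d ∨ c = -D.flip d := by
  constructor
  · intro h
    have hprod : ∀ i j, D.odd i = D.odd j → c i * c j = d i * d j := by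
      intro i j hij
      rw [← D.eval_L hc hij, h, D.eval_L hd hij]
    have hblock : ∀ b : Bool, ∃ s : ℂ, (s = 1 ∨ s = -1) ∧ ∀ i, D.odd i = b → c i = s * d i := by
      intro b
      by_cases hz : ∃ i, D.odd i = b ∧ d i ≠ 0
      · obtain ⟨i, hi, hdi⟩ := hz
        have h1 := hprod i i rfl
        have h2 : c i = d i ∨ c i = -d i := mul_self_eq_mul_self_iff.mp h1
        rcases h2 with h2 | h2
        · refine ⟨1, Or.inl rfl, fun j hj => ?_⟩
          have h3 := hprod i j (hi.trans hj.symm)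
          rw [h2] at h3
          rw [one_mul]
          exact mul_left_cancel₀ hdi h3
        · refine ⟨-1, Or.inr rfl, fun j hj => ?_⟩
          have h3 := hprod i j (hi.trans hj.symm)
          rw [h2] at h3
          refine mul_left_cancel₀ hdi ?_
          linear_combination -h3
      · push Not at hz
        refine ⟨1, Or.inl rfl, fun i hi => ?_⟩
        have := hprod i i rfl
        rw [hz i hi] at this ⊢
        simpa using this
    obtain ⟨s, hs, hs'⟩ := hblock false
    obtain ⟨t, ht, ht'⟩ := hblock true
    have hall : ∀ i, c i = (if D.odd i then t else s) * d i := by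
      intro i
      cases hi : D.odd i
      · simpa using hs' i hi
      · simpa using ht' i hi
    rcases hs with rfl | rfl <;> rcases ht with rfl | rfl
    · left; funext i; simp [hall i]
    · right; right; left; funext i; simp [hall i, flip, sgn]
    · right; right; right; funext i; rw [hall i]; simp only [flip, sgn, Pi.neg_apply]
      split_ifs <;> simp
    · right; left; funext i; simp [hall i]
  · have hneg : ∀ e, D.zmap (-e) = D.zmap e := fun e => by
      have := D.zmap_smul (-1) e
      simpa using this
    rintro (rfl | rfl | rfl | rfl)
    · rfl
    · rw [hneg]
    · rw [zmap_flip]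
    · rw [hneg, zmap_flip]

/-! #### Invariant forms -/

/-- The variables for products of coordinates of equal parity. -/
abbrev PairPoly : Type := MvPolynomial (ParityPair D.odd) ℂ

/-- Pairs of coordinates as products. -/
def toSource : D.PairPoly →ₐ[ℂ] Poly (n + 1) := aeval fun q => X q.1.1 * X q.1.2

/-- Pairs of coordinates as linear forms on the target. -/
def toTarget : D.PairPoly →ₐ[ℂ] Poly (m + 1) := aeval fun q => D.L q.1.1 q.1.2

theorem eval_toTarget {c : Fin (n + 1) → ℂ} (hc : c ∈ D.cone) (G : D.PairPoly) :
    eval (D.zmap c) (D.toTarget G) = eval c (D.toSource G) := by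
  simp only [toSource, toTarget, ← MvPolynomial.aeval_eq_eval, ← AlgHom.comp_apply]
  congr 1
  ext q
  simpa using D.eval_L hc q.2

theorem toTarget_isHomogeneous {G : D.PairPoly} {k : ℕ} (hG : G.IsHomogeneous k) :
    (D.toTarget G).IsHomogeneous k := by
  simpa [toTarget] using hG.aeval _ fun q : ParityPair D.odd => D.L_hom q.1.1 q.1.2

theorem exists_pairs_of_parity (b : Bool) (k : ℕ) :
    ∀ s : Multiset (Fin (n + 1)), (∀ i ∈ s, D.odd i = b) → Multiset.card s = 2 * k →
      ∃ G : D.PairPoly, G.IsHomogeneous k ∧ D.toSource G = multisetMonomial s := by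
  induction k with
  | zero =>
    intro s _ hs
    rw [mul_zero, Multiset.card_eq_zero] at hs
    subst hs
    exact ⟨1, isHomogeneous_one _ _, by simp⟩
  | succ k ih =>
    intro s hb hs
    obtain ⟨i, s1, rfl⟩ := Multiset.card_pos_iff_exists_mem.mp (by omega : 0 < Multiset.card s) |>.imp
      fun i hi => Multiset.exists_cons_of_mem hi
    rw [Multiset.card_cons] at hs
    obtain ⟨j, s2, rfl⟩ :=
      Multiset.card_pos_iff_exists_mem.mp (by omega : 0 < Multiset.card s1) |>.imp
        fun i hi => Multiset.exists_cons_of_mem hi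
    rw [Multiset.card_cons] at hs
    obtain ⟨G, hG, hG'⟩ := ih s2 (fun l hl => hb l (by simp [hl])) (by omega)
    have hij : D.odd i = D.odd j := (hb i (by simp)).trans (hb j (by simp)).symm
    refine ⟨X ⟨(i, j), hij⟩ * G, ?_, ?_⟩
    · rw [add_comm k 1]
      exact (isHomogeneous_X _ _).mul hG
    · rw [map_mul, hG', multisetMonomial_cons, multisetMonomial_cons, ← mul_assoc]
      simp [toSource]

/-- The number of variables of a given parity. -/
def parityCount (b : Bool) (s : Multiset (Fin (n + 1))) : ℕ :=
  Multiset.card (s.filter fun i => D.odd i = b)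

theorem parityCount_add (s : Multiset (Fin (n + 1))) :
    D.parityCount false s + D.parityCount true s = Multiset.card s := by
  unfold parityCount
  have h := congrArg Multiset.card (Multiset.filter_add_not (fun i => D.odd i = false) s)
  simpa using h

theorem exists_pairs {s : Multiset (Fin (n + 1))} (h0 : Even (D.parityCount false s))
    (h1 : Even (D.parityCount true s)) {k : ℕ} (hk : Multiset.card s = 2 * k) :
    ∃ G : D.PairPoly, G.IsHomogeneous k ∧ D.toSource G = multisetMonomial s := by
  obtain ⟨a, ha⟩ := h0
  obtain ⟨b, hb⟩ := h1
  obtain ⟨G, hG, hG'⟩ := D.exists_pairs_of_parity false a (s.filter fun i => D.odd i = false)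
    (fun i hi => (Multiset.mem_filter.mp hi).2) (by unfold parityCount at ha; omega)
  obtain ⟨H, hH, hH'⟩ := D.exists_pairs_of_parity true b (s.filter fun i => D.odd i = true)
    (fun i hi => (Multiset.mem_filter.mp hi).2) (by unfold parityCount at hb; omega)
  refine ⟨G * H, ?_, ?_⟩
  · have : k = a + b := by
      have := D.parityCount_add s
      omega
    rw [this]
    exact hG.mul hH
  · rw [map_mul, hG', hH', ← multisetMonomial_add]
    congr 1
    have h := Multiset.filter_add_not (fun i => D.odd i = false) s
    simpa using h

theorem eval_flip_multisetMonomial (s : Multiset (Fin (n + 1))) (c : Fin (n + 1) → ℂ) :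
    eval (D.flip c) (multisetMonomial s) =
      (-1) ^ D.parityCount true s * eval c (multisetMonomial s) := by
  induction s using Multiset.induction_on with
  | empty => simp [parityCount]
  | cons a s ih =>
    simp only [multisetMonomial_cons, map_mul, ih, eval_X]
    cases h : D.odd a
    · simp only [parityCount, Multiset.filter_cons, h, flip, sgn]
      simp
      ring
    · simp only [parityCount, Multiset.filter_cons, h, flip, sgn]
      simp [pow_add]
      ring

theorem multisetMonomial_isHomogeneous {N : ℕ} (s : Multiset (Fin N)) :
    (multisetMonomial s).IsHomogeneous (Multiset.card s) := by
  induction s using Multiset.induction_on with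
  | empty => simpa using isHomogeneous_one _ _
  | cons a s ih =>
    rw [multisetMonomial_cons, Multiset.card_cons, add_comm]
    exact (isHomogeneous_X _ _).mul ih

/-- The symmetrization of a form of even degree comes from the target. -/
theorem exists_form {F : Poly (n + 1)} {k : ℕ} (hF : F.IsHomogeneous (2 * k)) :
    ∃ G : Poly (m + 1), G.IsHomogeneous k ∧
      ∀ c ∈ D.cone, eval (D.zmap c) G = eval c F + eval (D.flip c) F := by
  suffices h : ∀ p : Poly (n + 1), ∃ G : Poly (m + 1), G.IsHomogeneous k ∧
      ∀ c ∈ D.cone, eval (D.zmap c) G = eval c (homogeneousComponent (2 * k) p) +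
        eval (D.flip c) (homogeneousComponent (2 * k) p) by
    obtain ⟨G, h1, h2⟩ := h F
    rw [homogeneousComponent_same hF] at h2
    exact ⟨G, h1, h2⟩
  intro p
  induction mem_span_multisetMonomial p using Submodule.span_induction with
  | mem x hx =>
    obtain ⟨s, rfl⟩ := hx
    by_cases hs : Multiset.card s = 2 * k
    · rw [← hs, homogeneousComponent_same (multisetMonomial_isHomogeneous s)]
      have hadd := D.parityCount_add s
      by_cases h1 : Even (D.parityCount true s)
      · have h0 : Even (D.parityCount false s) := by
          rw [Nat.even_iff] at h1 ⊢
          omega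
        obtain ⟨G, hG, hG'⟩ := D.exists_pairs h0 h1 hs
        refine ⟨D.toTarget ((2 : ℂ) • G), D.toTarget_isHomogeneous ?_, fun c hc => ?_⟩
        · rw [smul_eq_C_mul]
          exact hG.C_mul 2
        · rw [D.eval_toTarget hc, map_smul, hG', D.eval_flip_multisetMonomial, h1.neg_one_pow,
            smul_eval]
          ring
      · refine ⟨0, isHomogeneous_zero _ _ _, fun c hc => ?_⟩
        rw [D.eval_flip_multisetMonomial, (Nat.not_even_iff_odd.mp h1).neg_one_pow]
        simp
    · refine ⟨0, isHomogeneous_zero _ _ _, fun c hc => ?_⟩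
      rw [homogeneousComponent_ne (multisetMonomial_isHomogeneous s) (Ne.symm hs)]
      simp
  | zero => exact ⟨0, isHomogeneous_zero _ _ _, by simp⟩
  | add x y _ _ hx hy =>
    obtain ⟨G, hG, hG'⟩ := hx
    obtain ⟨H, hH, hH'⟩ := hy
    refine ⟨G + H, hG.add hH, fun c hc => ?_⟩
    rw [map_add, hG' c hc, hH' c hc, map_add, map_add, map_add]
    ring
  | smul a x _ hx =>
    obtain ⟨G, hG, hG'⟩ := hx
    refine ⟨C a * G, hG.C_mul a, fun c hc => ?_⟩
    rw [map_mul, hG' c hc, map_smul, smul_eval, smul_eval]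
    simp
    ring

end QuotientData

/-! ### The quotient map -/

theorem eval_linSubst {n : ℕ} (g : (Fin n → ℂ) →ₗ[ℂ] (Fin n → ℂ)) (v : Fin n → ℂ) (F : Poly n) :
    eval v (linSubst g F) = eval (g v) F := by
  simp only [linSubst, ← MvPolynomial.aeval_eq_eval, ← AlgHom.comp_apply]
  congr 1
  ext j
  simp only [AlgHom.comp_apply, aeval_X, map_sum, map_mul, algHom_C, Algebra.algebraMap_self,
    RingHom.id_apply]
  conv_rhs => rw [← LinearMap.toMatrix'_mulVec g v]
  simp [Matrix.mulVec, dotProduct]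

theorem linSubst_isHomogeneous {n d : ℕ} (g : (Fin n → ℂ) →ₗ[ℂ] (Fin n → ℂ)) {F : Poly n}
    (hF : F.IsHomogeneous d) : (linSubst g F).IsHomogeneous d :=
  aeval_isHomogeneous hF fun _ => IsHomogeneous.sum _ _ _ fun k _ => (isHomogeneous_X _ k).C_mul _

/-- The projective variety `V`, the involution `t` and the forms `z` are described by `D`. -/
structure QuotientData.Describes {n m : ℕ} (D : QuotientData n m) (V : Set (PSp n))
    (t : PSp n → PSp n) (z : Fin (m + 1) → Poly (n + 1)) : Prop where
  intro ::
  mem : ∀ v (hv : v ≠ 0), mk ℂ v hv ∈ V ↔ D.g v ∈ D.cone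
  t_mk : ∀ v (hv : v ≠ 0), ∃ h, t (mk ℂ v hv) = mk ℂ (D.g.symm (D.flip (D.g v))) h
  z_eval : ∀ v k, eval v (z k) = D.zmap (D.g v) k
  z_hom : ∀ k, (z k).IsHomogeneous 2

namespace QuotientData.Describes

variable {n m : ℕ} {D : QuotientData n m} {V : Set (PSp n)} {t : PSp n → PSp n}
  {z : Fin (m + 1) → Poly (n + 1)} (h : D.Describes V t z)
include h

theorem z_eval' (v : Fin (n + 1) → ℂ) : (fun k => eval v (z k)) = D.zmap (D.g v) :=
  funext (h.z_eval v)

theorem mem_rep {P : PSp n} : P ∈ V ↔ D.g P.rep ∈ D.cone := by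
  conv_lhs => rw [← mk_rep P]
  exact h.mem _ _

theorem z_ne_zero {v : Fin (n + 1) → ℂ} (hv : v ≠ 0) (hV : mk ℂ v hv ∈ V) :
    (fun k => eval v (z k)) ≠ 0 := by
  rw [h.z_eval']
  exact D.zmap_ne_zero ((h.mem v hv).mp hV) (by simpa using hv)

theorem mk_mem_image {q : Fin (m + 1) → ℂ} (hq : q ≠ 0) :
    mk ℂ q hq ∈ imageUnder z V ↔ ∃ c ∈ D.cone, D.zmap c = q := by
  constructor
  · rintro ⟨v, hv, hz, hV, hQ⟩
    rw [mk_eq_mk_iff_smul] at hQ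
    obtain ⟨a, -, rfl⟩ := hQ
    obtain ⟨b, hb⟩ := exists_sq a
    refine ⟨b • D.g v, D.smul_mem_cone ((h.mem v hv).mp hV) b, ?_⟩
    rw [D.zmap_smul, hb, h.z_eval']
  · rintro ⟨c, hc, rfl⟩
    have hc0 : c ≠ 0 := by
      rintro rfl
      apply hq
      have := D.zmap_smul 0 0
      simpa using this
    have hv : D.g.symm c ≠ 0 := by simpa using hc0
    have hz := h.z_eval' (D.g.symm c)
    rw [LinearEquiv.apply_symm_apply] at hz
    refine ⟨D.g.symm c, hv, by rw [hz]; exact hq, ?_, ?_⟩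
    · rw [h.mem]
      simpa using hc
    · congr 1
      exact hz.symm

theorem mem_affineCone_image {q : Fin (m + 1) → ℂ} :
    q ∈ affineCone (imageUnder z V) ↔ q ≠ 0 ∧ ∃ c ∈ D.cone, D.zmap c = q := by
  constructor
  · rintro ⟨hq, hmem⟩
    exact ⟨hq, (h.mk_mem_image hq).mp hmem⟩
  · rintro ⟨hq, hc⟩
    exact ⟨hq, (h.mk_mem_image hq).mpr hc⟩

theorem zmap_mem_affineCone {c : Fin (n + 1) → ℂ} (hc : c ∈ D.cone) (h0 : c ≠ 0) :
    D.zmap c ∈ affineCone (imageUnder z V) :=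
  h.mem_affineCone_image.mpr ⟨D.zmap_ne_zero hc h0, c, hc, rfl⟩

theorem isZariskiClosed_source : IsZariskiClosed V := by
  refine ⟨(fun β => linSubst D.g.toLinearMap (quadric β)) '' D.eqs, ?_, ?_⟩
  · rintro _ ⟨β, _, rfl⟩
    exact ⟨2, linSubst_isHomogeneous _ (quadric_isHomogeneous β)⟩
  · ext P
    rw [h.mem_rep]
    simp only [Set.mem_ofPred_eq, Set.forall_mem_image, eval_linSubst, eval_quadric]
    rfl

omit h in
theorem eval_toMap {P : PSp n} (hP : (fun k => eval P.rep (z k)) ≠ 0) {v : Fin (n + 1) → ℂ}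
    (hz : ∀ k, (z k).IsHomogeneous 2) (hv : v ≠ 0) (hPv : P = mk ℂ v hv) :
    ∃ hzv : (fun k => eval v (z k)) ≠ 0, mk ℂ _ hP = mk ℂ (fun k => eval v (z k)) hzv := by
  obtain ⟨a, ha, hr⟩ := exists_rep_eq_smul v hv
  have h1 : (fun k => eval P.rep (z k)) = a ^ 2 • fun k => eval v (z k) := by
    funext k
    rw [hPv, hr, eval_smul_of_isHomogeneous (hz k)]
    rfl
  have h2 : (fun k => eval v (z k)) ≠ 0 := by
    intro h0
    apply hP
    rw [h1, h0, smul_zero]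
  refine ⟨h2, ?_⟩
  rw [mk_eq_mk_iff_smul]
  exact ⟨a ^ 2, pow_ne_zero 2 ha, h1⟩

omit h in
/-- The map given by the forms `z`, with an arbitrary value where they all vanish. -/
theorem exists_map (z : Fin (m + 1) → Poly (n + 1)) (hz : ∀ k, (z k).IsHomogeneous 2) :
    ∃ π : PSp n → PSp m, ∀ v (hv : v ≠ 0) (hzv : (fun k => eval v (z k)) ≠ 0),
      π (mk ℂ v hv) = mk ℂ (fun k => eval v (z k)) hzv := by
  classical
  have h1 : (fun _ => 1 : Fin (m + 1) → ℂ) ≠ 0 := fun h0 => one_ne_zero (congrFun h0 0)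
  refine ⟨fun P => if hP : (fun k => eval P.rep (z k)) ≠ 0 then mk ℂ _ hP else mk ℂ _ h1,
    fun v hv hzv => ?_⟩
  have hP : (fun k => eval (mk ℂ v hv).rep (z k)) ≠ 0 := by
    obtain ⟨k, hk⟩ := Function.ne_iff.mp hzv
    refine Function.ne_iff.mpr ⟨k, ?_⟩
    simpa using (eval_rep_eq_zero_iff (hz k) v hv).not.mpr hk
  simp only [dif_pos hP]
  exact (eval_toMap hP hz hv rfl).2

theorem exists_form {F : Poly (n + 1)} {k : ℕ} (hF : F.IsHomogeneous (2 * k)) :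
    ∃ G : Poly (m + 1), G.IsHomogeneous k ∧ ∀ v (hv : v ≠ 0), mk ℂ v hv ∈ V →
      eval (fun k => eval v (z k)) G = eval v F + eval (D.g.symm (D.flip (D.g v))) F := by
  obtain ⟨G, hG, hG'⟩ := D.exists_form (linSubst_isHomogeneous D.g.symm.toLinearMap hF)
  refine ⟨G, hG, fun v hv hV => ?_⟩
  rw [h.z_eval', hG' _ ((h.mem v hv).mp hV), eval_linSubst, eval_linSubst]
  simp

omit h in
/-- A form that does not vanish at `v` can be multiplied by a quadratic form so that the
symmetrization of the product with its square does not vanish at `v`. -/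
theorem exists_multiplier {F : Poly (n + 1)} {d : ℕ} (hF : F.IsHomogeneous d)
    {v : Fin (n + 1) → ℂ} (hv : v ≠ 0) (hFv : eval v F ≠ 0) :
    ∃ H : Poly (n + 1), H.IsHomogeneous 2 ∧
      eval v (H * F ^ 2) + eval (D.g.symm (D.flip (D.g v))) (H * F ^ 2) ≠ 0 := by
  set w := D.g.symm (D.flip (D.g v)) with hw
  by_cases hvw : ∃ a : ℂ, w = a • v
  · obtain ⟨a, ha⟩ := hvw
    have hww : D.g.symm (D.flip (D.g w)) = v := by
      rw [hw, LinearEquiv.apply_symm_apply, D.flip_flip, LinearEquiv.symm_apply_apply]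
    have ha2 : a ^ 2 = 1 := by
      have h1 : D.g.symm (D.flip (D.g w)) = a • w := by
        conv_lhs => rw [ha, map_smul, D.flip_smul, map_smul, ← hw]
      rw [hww, ha, smul_smul] at h1
      obtain ⟨i, hi⟩ := Function.ne_iff.mp hv
      have h2 := congrFun h1 i
      simp only [Pi.smul_apply, smul_eq_mul] at h2
      have h3 : (a * a - 1) * v i = 0 := by linear_combination -h2
      rcases mul_eq_zero.mp h3 with h4 | h4
      · linear_combination h4
      · exact absurd h4 hi
    obtain ⟨i, hi⟩ := Function.ne_iff.mp hv
    refine ⟨X i ^ 2, by simpa using (isHomogeneous_X ℂ i).pow 2, ?_⟩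
    rw [ha]
    have hFa : eval (a • v) F ^ 2 = eval v F ^ 2 := by
      rw [eval_smul_of_isHomogeneous hF, mul_pow, ← pow_mul, mul_comm d 2, pow_mul, ha2, one_pow,
        one_mul]
    simp only [map_mul, map_pow, eval_X, hFa, Pi.smul_apply, smul_eq_mul, mul_pow, ha2, one_mul]
    rw [← two_mul]
    exact mul_ne_zero two_ne_zero (mul_ne_zero (pow_ne_zero 2 hi) (pow_ne_zero 2 hFv))
  · push Not at hvw
    have : ∃ i j, w i * v j - w j * v i ≠ 0 := by
      by_contra hall
      push Not at hall
      obtain ⟨i, hi⟩ := Function.ne_iff.mp hv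
      apply hvw (w i / v i)
      funext j
      have := hall i j
      simp only [Pi.smul_apply, smul_eq_mul]
      have hi' : v i ≠ 0 := hi
      field_simp
      linear_combination -this
    obtain ⟨i, j, hij⟩ := this
    refine ⟨(C (w i) * X j - C (w j) * X i) ^ 2, ?_, ?_⟩
    · simpa using (((isHomogeneous_X ℂ j).C_mul (w i)).sub ((isHomogeneous_X ℂ i).C_mul (w j))).pow 2
    · simp only [map_mul, map_pow, map_sub, eval_X, eval_C]
      have h0 : w i * w j - w j * w i = 0 := by ring
      rw [h0]
      simp only [ne_eq, OfNat.ofNat_ne_zero, not_false_eq_true, zero_pow, zero_mul, add_zero]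
      exact mul_ne_zero (pow_ne_zero 2 hij) (pow_ne_zero 2 hFv)

theorem flip_mem {v : Fin (n + 1) → ℂ} (hv : v ≠ 0) (hV : mk ℂ v hv ∈ V) :
    ∃ h0 : D.g.symm (D.flip (D.g v)) ≠ 0, mk ℂ _ h0 ∈ V ∧
      (fun k => eval (D.g.symm (D.flip (D.g v))) (z k)) = fun k => eval v (z k) := by
  obtain ⟨h0, -⟩ := h.t_mk v hv
  refine ⟨h0, ?_, ?_⟩
  · rw [h.mem, LinearEquiv.apply_symm_apply]
    exact D.flip_mem_cone ((h.mem v hv).mp hV)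
  · rw [h.z_eval', h.z_eval', LinearEquiv.apply_symm_apply, D.zmap_flip]

theorem isOpen_iff {π : PSp n → PSp m}
    (hπ : ∀ v (hv : v ≠ 0) (hzv : (fun k => eval v (z k)) ≠ 0),
      π (mk ℂ v hv) = mk ℂ (fun k => eval v (z k)) hzv)
    {U : Set (PSp m)} (hU : U ⊆ imageUnder z V) :
    IsOpenIn (imageUnder z V) U ↔ IsOpenIn V (V ∩ π ⁻¹' U) := by
  have hπmem : ∀ P ∈ V, π P ∈ imageUnder z V := by
    intro P hP
    induction P using Projectivization.ind with
    | h v hv =>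
      have hz := h.z_ne_zero hv hP
      exact ⟨v, hv, hz, hP, hπ v hv hz⟩
  constructor
  · rintro ⟨C, ⟨S, hS, rfl⟩, rfl⟩
    refine ⟨{P | ∀ F ∈ (fun F => aeval z F) '' S, eval P.rep F = 0},
      ⟨_, ?_, rfl⟩, ?_⟩
    · rintro _ ⟨F, hF, rfl⟩
      obtain ⟨d, hd⟩ := hS F hF
      exact ⟨2 * d, hd.aeval z h.z_hom⟩
    · ext P
      simp only [Set.mem_inter_iff, Set.mem_preimage, Set.mem_sdiff, Set.mem_ofPred_eq,
        Set.forall_mem_image]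
      refine and_congr_right fun hP => ?_
      have hP' := hP
      rw [← mk_rep P] at hP'
      have hz := h.z_ne_zero P.rep_nonzero hP'
      have h1 := hπ P.rep P.rep_nonzero hz
      rw [mk_rep] at h1
      rw [and_iff_right (hπmem P hP), h1, not_iff_not]
      refine forall₂_congr fun F hF => ?_
      obtain ⟨d, hd⟩ := hS F hF
      rw [eval_rep_eq_zero_iff hd]
      rw [eval_aeval]
  · rintro ⟨C, ⟨S, hS, rfl⟩, hopen⟩
    refine ⟨{Q | ∀ G ∈ {G : Poly (m + 1) | (∃ d, G.IsHomogeneous d) ∧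
      ∀ Q ∈ imageUnder z V \ U, eval Q.rep G = 0}, eval Q.rep G = 0}, ⟨_, fun G hG => hG.1, rfl⟩, ?_⟩
    ext Q
    constructor
    · intro hQ
      refine ⟨hU hQ, fun hall => ?_⟩
      obtain ⟨v, hv, hz, hV, rfl⟩ := hU hQ
      have hmem : mk ℂ v hv ∈ V ∩ π ⁻¹' U := ⟨hV, by rw [Set.mem_preimage, hπ v hv hz]; exact hQ⟩
      rw [hopen] at hmem
      have hnot := hmem.2
      simp only [Set.mem_ofPred_eq, not_forall] at hnot
      obtain ⟨F, hF, hFv⟩ := hnot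
      obtain ⟨d, hd⟩ := hS F hF
      rw [eval_rep_eq_zero_iff hd] at hFv
      obtain ⟨H, hH, hne⟩ := exists_multiplier (D := D) hd hv hFv
      have hdeg : (H * F ^ 2).IsHomogeneous (2 * (d + 1)) := by
        have := hH.mul (hd.pow 2)
        rwa [show 2 + d * 2 = 2 * (d + 1) by ring] at this
      obtain ⟨G, hG, hG'⟩ := h.exists_form hdeg
      have hGz := hall G ⟨⟨_, hG⟩, ?_⟩
      · rw [eval_rep_eq_zero_iff hG, hG' v hv hV] at hGz
        exact hne hGz
      · rintro _ ⟨⟨w, hw, hzw, hwV, rfl⟩, hwU⟩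
        have hvan : ∀ u (hu : u ≠ 0), mk ℂ u hu ∈ V →
            (fun k => eval u (z k)) = (fun k => eval w (z k)) → eval u F = 0 := by
          intro u hu huV huz
          by_contra hne'
          have : mk ℂ u hu ∈ V ∩ π ⁻¹' U := by
            rw [hopen]
            refine ⟨huV, fun hall' => hne' ?_⟩
            rw [← eval_rep_eq_zero_iff hd u hu]
            exact hall' F hF
          have h2 := this.2
          rw [Set.mem_preimage, hπ u hu (by rw [huz]; exact hzw)] at h2
          apply hwU
          convert h2 using 2
          exact huz.symm
        obtain ⟨h0, h1, h2⟩ := h.flip_mem hw hwV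
        rw [eval_rep_eq_zero_iff hG, hG' w hw hwV, map_mul, map_mul, map_pow, map_pow,
          hvan w hw hwV rfl, hvan _ h0 h1 h2]
        simp
    · rintro ⟨hQ, hnot⟩
      by_contra hQU
      exact hnot fun G hG => hG.2 Q ⟨hQ, hQU⟩

omit h in
theorem eval_div_rep {k d : ℕ} {F G : Poly (k + 1)} (hF : F.IsHomogeneous d)
    (hG : G.IsHomogeneous d) (v : Fin (k + 1) → ℂ) (hv : v ≠ 0) :
    eval (mk ℂ v hv).rep F / eval (mk ℂ v hv).rep G = eval v F / eval v G := by
  obtain ⟨a, ha, hr⟩ := exists_rep_eq_smul v hv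
  rw [hr, eval_smul_of_isHomogeneous hF, eval_smul_of_isHomogeneous hG]
  exact mul_div_mul_left _ _ (pow_ne_zero d ha)

theorem regular_iff {π : PSp n → PSp m}
    (hπ : ∀ v (hv : v ≠ 0) (hzv : (fun k => eval v (z k)) ≠ 0),
      π (mk ℂ v hv) = mk ℂ (fun k => eval v (z k)) hzv)
    {U : Set (PSp m)} (hU : U ⊆ imageUnder z V) (f : PSp m → ℂ) :
    IsRegularOn U f ↔ IsRegularOn (V ∩ π ⁻¹' U) (f ∘ π) := by
  constructor
  · intro hreg P hP
    obtain ⟨d, F, G, hF, hG, hGP, hFG⟩ := hreg (π P) hP.2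
    have key : ∀ Q ∈ V, ∃ hz, π Q = mk ℂ (fun k => eval Q.rep (z k)) hz := by
      intro Q hQ
      have hQ' := hQ
      rw [← mk_rep Q] at hQ'
      have hz := h.z_ne_zero Q.rep_nonzero hQ'
      have h1 := hπ Q.rep Q.rep_nonzero hz
      rw [mk_rep] at h1
      exact ⟨hz, h1⟩
    refine ⟨2 * d, aeval z F, aeval z G, hF.aeval z h.z_hom, hG.aeval z h.z_hom, ?_, ?_⟩
    · obtain ⟨hz, h1⟩ := key P hP.1
      rw [h1, ne_eq, eval_rep_eq_zero_iff hG] at hGP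
      rwa [eval_aeval]
    · intro Q hQ hGQ
      obtain ⟨hz, h1⟩ := key Q hQ.1
      rw [eval_aeval] at hGQ
      have h2 := hFG (π Q) hQ.2 (by rwa [h1, ne_eq, eval_rep_eq_zero_iff hG])
      rw [Function.comp_apply, h2, eval_aeval, eval_aeval, h1, eval_div_rep hF hG]
  · intro hreg Q hQ
    obtain ⟨v, hv, hz, hV, rfl⟩ := hU hQ
    have hπv := hπ v hv hz
    obtain ⟨d, F, G, hF, hG, hGP, hFG⟩ := hreg (mk ℂ v hv) ⟨hV, by
      rw [Set.mem_preimage, hπv]; exact hQ⟩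
    rw [ne_eq, eval_rep_eq_zero_iff hG] at hGP
    obtain ⟨H, hH, hne⟩ := exists_multiplier (D := D) hG hv hGP
    have hdegG : (H * G ^ 2).IsHomogeneous (2 * (d + 1)) := by
      have := hH.mul (hG.pow 2)
      rwa [show 2 + d * 2 = 2 * (d + 1) by ring] at this
    have hdegF : (H * (F * G)).IsHomogeneous (2 * (d + 1)) := by
      have := hH.mul (hF.mul hG)
      rwa [show 2 + (d + d) = 2 * (d + 1) by ring] at this
    obtain ⟨G', hG', hGv⟩ := h.exists_form hdegG
    obtain ⟨F', hF', hFv⟩ := h.exists_form hdegF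
    refine ⟨d + 1, F', G', hF', hG', ?_, ?_⟩
    · rw [ne_eq, eval_rep_eq_zero_iff hG', hGv v hv hV]
      exact hne
    · intro Q' hQ' hne'
      obtain ⟨w, hw, hzw, hwV, rfl⟩ := hU hQ'
      rw [eval_div_rep hF' hG']
      rw [ne_eq, eval_rep_eq_zero_iff hG'] at hne'
      rw [eq_div_iff hne', hGv w hw hwV, hFv w hw hwV]
      have key : ∀ u (hu : u ≠ 0), mk ℂ u hu ∈ V →
          (fun k => eval u (z k)) = (fun k => eval w (z k)) →
          f (mk ℂ _ hzw) * eval u (H * G ^ 2) = eval u (H * (F * G)) := by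
        intro u hu huV huz
        have hzu : (fun k => eval u (z k)) ≠ 0 := by rw [huz]; exact hzw
        have hπu : π (mk ℂ u hu) = mk ℂ _ hzw := by
          rw [hπ u hu hzu]
          congr 1
        simp only [map_mul, map_pow]
        by_cases hGu : eval u G = 0
        · simp [hGu]
        · have := hFG (mk ℂ u hu) ⟨huV, by rw [Set.mem_preimage, hπu]; exact hQ'⟩
            (by rwa [ne_eq, eval_rep_eq_zero_iff hG])
          rw [Function.comp_apply, hπu, eval_div_rep hF hG] at this
          rw [this]
          field_simp
      obtain ⟨h0, h1, h2⟩ := h.flip_mem hw hwV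
      rw [mul_add, key w hw hwV rfl, key _ h0 h1 h2]

theorem exists_quotient (hclosed : IsZariskiClosed (imageUnder z V)) :
    ∃ π : PSp n → PSp m, IsGivenBy V z π ∧ IsQuotientOnto V t (imageUnder z V) π := by
  obtain ⟨π, hπ⟩ := exists_map z h.z_hom
  refine ⟨π, fun v hv hV => ⟨h.z_ne_zero hv hV, hπ v hv _⟩, ?_⟩
  have ht : ∀ v (hv : v ≠ 0), mk ℂ v hv ∈ V → t (mk ℂ v hv) ∈ V := by
    intro v hv hV
    obtain ⟨h0, h1⟩ := h.t_mk v hv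
    rw [h1]
    exact (h.flip_mem hv hV).2.1
  refine ⟨h.isZariskiClosed_source, hclosed, ?_, ?_, ?_, ?_, ?_, ?_⟩
  · intro P
    induction P using Projectivization.ind with
    | h v hv => exact ht v hv
  · intro P
    induction P using Projectivization.ind with
    | h v hv =>
      intro hV
      obtain ⟨h0, h1⟩ := h.t_mk v hv
      obtain ⟨h0', h1'⟩ := h.t_mk _ h0
      rw [h1, h1']
      congr 1
      rw [LinearEquiv.apply_symm_apply, D.flip_flip, LinearEquiv.symm_apply_apply]
  · ext Q
    constructor
    · rintro ⟨P, hP, rfl⟩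
      induction P using Projectivization.ind with
      | h v hv => exact ⟨v, hv, h.z_ne_zero hv hP, hP, hπ v hv _⟩
    · rintro ⟨v, hv, hz, hV, rfl⟩
      exact ⟨mk ℂ v hv, hV, hπ v hv hz⟩
  · intro P hP Q hQ
    induction P using Projectivization.ind with
    | h v hv =>
    induction Q using Projectivization.ind with
    | h w hw =>
      obtain ⟨h0, h1⟩ := h.t_mk v hv
      rw [h1, hπ v hv (h.z_ne_zero hv hP), hπ w hw (h.z_ne_zero hw hQ), mk_eq_mk_iff_smul,
        mk_eq_mk_iff_smul, mk_eq_mk_iff_smul, h.z_eval', h.z_eval']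
      have hcv := (h.mem v hv).mp hP
      have hcw := (h.mem w hw).mp hQ
      constructor
      · rintro ⟨a, ha, hza⟩
        obtain ⟨b, hb⟩ := exists_sq a
        have hb0 : b ≠ 0 := by
          rintro rfl
          exact ha (by rw [← hb]; simp)
        rw [← hb, ← D.zmap_smul, D.zmap_eq_iff hcv (D.smul_mem_cone hcw b)] at hza
        have hback : ∀ c d : Fin (n + 1) → ℂ, D.g v = c → c = D.g d → v = d := by
          rintro c d h1 h2
          exact D.g.injective (h1.trans h2)
        rcases hza with h2 | h2 | h2 | h2
        · left
          refine ⟨b⁻¹, inv_ne_zero hb0, ?_⟩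
          rw [← map_smul] at h2
          rw [D.g.injective h2, inv_smul_smul₀ hb0]
        · left
          refine ⟨-b⁻¹, neg_ne_zero.mpr (inv_ne_zero hb0), ?_⟩
          rw [← map_smul, ← map_neg] at h2
          rw [D.g.injective h2, neg_smul, smul_neg, inv_smul_smul₀ hb0, neg_neg]
        · right
          refine ⟨b⁻¹, inv_ne_zero hb0, ?_⟩
          rw [h2, D.flip_flip, map_smul, LinearEquiv.symm_apply_apply, inv_smul_smul₀ hb0]
        · right
          refine ⟨-b⁻¹, neg_ne_zero.mpr (inv_ne_zero hb0), ?_⟩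
          have h3 : -D.flip (b • D.g w) = (-b) • D.flip (D.g w) := by
            rw [D.flip_smul, neg_smul]
          rw [h2, h3, D.flip_smul, D.flip_flip, map_smul, LinearEquiv.symm_apply_apply, smul_smul]
          have : -b⁻¹ * -b = 1 := by field_simp
          rw [this, one_smul]
      · rintro (⟨a, ha, rfl⟩ | ⟨a, ha, rfl⟩)
        · refine ⟨(a ^ 2)⁻¹, inv_ne_zero (pow_ne_zero 2 ha), ?_⟩
          rw [map_smul, D.zmap_smul, inv_smul_smul₀ (pow_ne_zero 2 ha)]
        · refine ⟨(a ^ 2)⁻¹, inv_ne_zero (pow_ne_zero 2 ha), ?_⟩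
          rw [map_smul, D.zmap_smul, LinearEquiv.apply_symm_apply, D.zmap_flip,
            inv_smul_smul₀ (pow_ne_zero 2 ha)]
  · exact fun U hU => h.isOpen_iff hπ hU
  · rintro U ⟨C, _, rfl⟩ f
    exact h.regular_iff hπ Set.sdiff_subset f

end QuotientData.Describes

namespace QuotientData

variable {n m : ℕ} (D : QuotientData n m)

/-! ### Equations of the quotient -/

/-- The polynomials that vanish on the image of the cone. -/
def Vanishes (F : Poly (m + 1)) : Prop := ∀ c ∈ D.cone, eval (D.zmap c) F = 0

theorem vanishes_minor {a b c d : Fin (n + 1)} (h1 : D.odd a = D.odd b) (h2 : D.odd c = D.odd d)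
    (h3 : D.odd a = D.odd c) : D.Vanishes (D.L a b * D.L c d - D.L a c * D.L b d) := by
  intro v hv
  rw [map_sub, map_mul, map_mul, D.eval_L hv h1, D.eval_L hv h2, D.eval_L hv h3,
    D.eval_L hv (h1.symm.trans (h3.trans h2))]
  ring

theorem minor_isHomogeneous (a b c d : Fin (n + 1)) :
    (D.L a b * D.L c d - D.L a c * D.L b d).IsHomogeneous 2 :=
  ((D.L_hom a b).mul (D.L_hom c d)).sub ((D.L_hom a c).mul (D.L_hom b d))

theorem contract_congr_even {A : Type} [AddCommGroup A] [Module ℂ A]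
    {β : Matrix (Fin (n + 1)) (Fin (n + 1)) ℂ}
    (he : ∀ i j, D.odd i ≠ D.odd j → β i j = 0) {f g : Fin (n + 1) → Fin (n + 1) → A}
    (h : ∀ i j, D.odd i = D.odd j → f i j = g i j) : contract β f = contract β g := by
  refine contract_congr fun i j hb => h i j ?_
  by_contra hne
  exact hb (he i j hne)

theorem contract_congr_odd {A : Type} [AddCommGroup A] [Module ℂ A]
    {β : Matrix (Fin (n + 1)) (Fin (n + 1)) ℂ}
    (ho : ∀ i j, D.odd i = D.odd j → β i j = 0) {f g : Fin (n + 1) → Fin (n + 1) → A}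
    (h1 : ∀ i j, D.odd i = true → D.odd j = false → f i j = g i j)
    (h2 : ∀ i j, D.odd i = false → D.odd j = true → f i j = g i j) :
    contract β f = contract β g := by
  refine contract_congr fun i j hb => ?_
  have hne : D.odd i ≠ D.odd j := fun h => hb (ho i j h)
  cases hi : D.odd i
  · exact h2 i j hi (by simpa [hi] using hne)
  · exact h1 i j hi (by simpa [hi] using hne)

theorem vanishes_even {β : Matrix (Fin (n + 1)) (Fin (n + 1)) ℂ} (hβ : β ∈ D.eqs)
    (he : ∀ i j, D.odd i ≠ D.odd j → β i j = 0) : D.Vanishes (contract β D.L) := by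
  intro c hc
  rw [eval_contract, ← hc β hβ]
  exact D.contract_congr_even he fun i j => D.eval_L hc

section oddProduct

variable {R S : Type} [CommRing R] [CommRing S]

/-- The entry of an odd matrix at an odd and an even index, multiplied by an even and by an odd
coordinate. -/
def oddProduct (f : Fin (n + 1) → Fin (n + 1) → R) (k l i j : Fin (n + 1)) : R :=
  if D.odd i then f i l * f j k else f i k * f j l

theorem map_contract_oddProduct [Algebra ℂ R] [Algebra ℂ S] (φ : R →ₐ[ℂ] S)
    (β : Matrix (Fin (n + 1)) (Fin (n + 1)) ℂ) (f : Fin (n + 1) → Fin (n + 1) → R)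
    (k l : Fin (n + 1)) : φ (contract β (D.oddProduct f k l)) =
      contract β (D.oddProduct (fun i j => φ (f i j)) k l) := by
  rw [map_contract]
  congr 1
  funext i j
  unfold oddProduct
  split_ifs <;> simp

theorem contract_oddProduct_mul [Algebra ℂ R] (β : Matrix (Fin (n + 1)) (Fin (n + 1)) ℂ) (x : Fin (n + 1) → R) (k l : Fin (n + 1)) :
    contract β (D.oddProduct (fun i j => x i * x j) k l) =
      contract β (fun i j => x i * x j) * (x k * x l) := by
  rw [← contract_mul_right]
  congr 1
  funext i j
  unfold oddProduct
  split_ifs <;> ring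

theorem contract_oddProduct_congr [Algebra ℂ R] {β : Matrix (Fin (n + 1)) (Fin (n + 1)) ℂ}
    (ho : ∀ i j, D.odd i = D.odd j → β i j = 0) {k l : Fin (n + 1)} (hk : D.odd k = false)
    (hl : D.odd l = true) {f g : Fin (n + 1) → Fin (n + 1) → R}
    (h : ∀ i j, D.odd i = D.odd j → f i j = g i j) :
    contract β (D.oddProduct f k l) = contract β (D.oddProduct g k l) := by
  refine D.contract_congr_odd ho (fun i j hi hj => ?_) fun i j hi hj => ?_
  · rw [oddProduct, oddProduct, h i l (hi.trans hl.symm), h j k (hj.trans hk.symm)]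
    simp [hi]
  · rw [oddProduct, oddProduct, h i k (hi.trans hk.symm), h j l (hj.trans hl.symm)]
    simp [hi]

end oddProduct

theorem oddProduct_isHomogeneous (k l i j : Fin (n + 1)) :
    (D.oddProduct D.L k l i j).IsHomogeneous 2 := by
  unfold oddProduct
  split_ifs <;> exact (D.L_hom _ _).mul (D.L_hom _ _)

theorem eval_contract_oddProduct {β : Matrix (Fin (n + 1)) (Fin (n + 1)) ℂ} (ho : ∀ i j, D.odd i = D.odd j → β i j = 0)
    {k l : Fin (n + 1)} (hk : D.odd k = false) (hl : D.odd l = true) {q : Fin (m + 1) → ℂ}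
    {c : Fin (n + 1) → ℂ} (hc : ∀ i j, D.odd i = D.odd j → eval q (D.L i j) = c i * c j) :
    eval q (contract β (D.oddProduct D.L k l)) =
      contract β (fun i j => c i * c j) * (c k * c l) := by
  rw [← contract_oddProduct_mul, ← D.contract_oddProduct_congr ho hk hl hc,
    ← MvPolynomial.aeval_eq_eval]
  exact D.map_contract_oddProduct (aeval q) β D.L k l

theorem vanishes_odd {β : Matrix (Fin (n + 1)) (Fin (n + 1)) ℂ} (hβ : β ∈ D.eqs)
    (ho : ∀ i j, D.odd i = D.odd j → β i j = 0) {k l : Fin (n + 1)} (hk : D.odd k = false)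
    (hl : D.odd l = true) : D.Vanishes (contract β (D.oddProduct D.L k l)) := by
  intro c hc
  rw [D.eval_contract_oddProduct ho hk hl fun i j => D.eval_L hc, hc β hβ, zero_mul]

/-- A point at which all forms that vanish on the image of the cone vanish is in that image. -/
theorem exists_preimage {q : Fin (m + 1) → ℂ}
    (hq : ∀ (d : ℕ) (F : Poly (m + 1)), F.IsHomogeneous d → D.Vanishes F → eval q F = 0) :
    ∃ c ∈ D.cone, D.zmap c = q := by
  have hminor : ∀ a b c d, D.odd a = D.odd b → D.odd c = D.odd d → D.odd a = D.odd c →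
      eval q (D.L a b) * eval q (D.L c d) = eval q (D.L a c) * eval q (D.L b d) := by
    intro a b c d h1 h2 h3
    have := hq 2 _ (D.minor_isHomogeneous a b c d) (D.vanishes_minor h1 h2 h3)
    rw [map_sub, map_mul, map_mul] at this
    exact sub_eq_zero.mp this
  have hblock : ∀ b : Bool, ∃ d : Fin (n + 1) → ℂ, ∀ i j, D.odd i = b → D.odd j = b →
      eval q (D.L i j) = d i * d j := by
    intro b
    by_cases hz : ∃ i, D.odd i = b ∧ eval q (D.L i i) ≠ 0
    · obtain ⟨i, hi, hne⟩ := hz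
      obtain ⟨r, hr⟩ := exists_sq (eval q (D.L i i))
      have hr0 : r ≠ 0 := by
        rintro rfl
        exact hne (by rw [← hr]; simp)
      refine ⟨fun j => eval q (D.L i j) / r, fun j k hj hk => ?_⟩
      have := hminor i i j k rfl (hj.trans hk.symm) (hi.trans hj.symm)
      rw [← hr] at this
      field_simp
      linear_combination this
    · push Not at hz
      refine ⟨0, fun i j hi hj => ?_⟩
      have := hminor i j i j (hi.trans hj.symm) (hi.trans hj.symm) rfl
      rw [hz i hi, zero_mul] at this
      simpa using this
  obtain ⟨d0, hd0⟩ := hblock false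
  obtain ⟨d1, hd1⟩ := hblock true
  let c : Fin (n + 1) → ℂ := fun i => if D.odd i then d1 i else d0 i
  have hc : ∀ i j, D.odd i = D.odd j → eval q (D.L i j) = c i * c j := by
    intro i j hij
    simp only [c]
    cases hi : D.odd i
    · rw [← hij, hi]
      simpa using hd0 i j hi (hij.symm.trans hi)
    · rw [← hij, hi]
      simpa using hd1 i j hi (hij.symm.trans hi)
  refine ⟨c, fun β hβ => ?_, ?_⟩
  · rcases D.eqs_parity β hβ with he | ho
    · have := hq 1 _ (contract_isHomogeneous β D.L_hom) (D.vanishes_even hβ he)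
      rw [eval_contract] at this
      rw [← this]
      exact D.contract_congr_even he fun i j hij => (hc i j hij).symm
    · by_cases hkl : ∃ k l, D.odd k = false ∧ D.odd l = true ∧ c k * c l ≠ 0
      · obtain ⟨k, l, hk, hl, hne⟩ := hkl
        have := hq 2 _ (contract_isHomogeneous β (D.oddProduct_isHomogeneous k l))
          (D.vanishes_odd hβ ho hk hl)
        rw [D.eval_contract_oddProduct ho hk hl hc] at this
        exact (mul_eq_zero.mp this).resolve_right hne
      · push Not at hkl
        exact (D.contract_congr_odd ho (g := fun _ _ => 0)
          (fun i j hi hj => (mul_comm _ _).trans (hkl j i hj hi)) fun i j => hkl i j).trans (by simp [contract])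
  · funext k
    have h1 := congrArg (eval q) (D.Z_L k)
    rw [eval_contract, eval_X] at h1
    rw [← h1]
    exact D.contract_congr_even (D.Z_even k) fun i j hij => (hc i j hij).symm

/-! ### The ideal of the quotient -/

/-- The sign change of the coordinates of a given parity. -/
def signHom (b : Bool) : Poly (n + 1) →ₐ[ℂ] Poly (n + 1) :=
  aeval fun i => if D.odd i = b then -X i else X i

theorem signHom_multisetMonomial (b : Bool) (s : Multiset (Fin (n + 1))) :
    D.signHom b (multisetMonomial s) = (-1 : ℂ) ^ D.parityCount b s • multisetMonomial s := by
  induction s using Multiset.induction_on with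
  | empty => simp [parityCount]
  | cons a s ih =>
    rw [multisetMonomial_cons, map_mul, ih]
    have hX : D.signHom b (X a) = if D.odd a = b then -X a else X a := by simp [signHom]
    rw [hX]
    by_cases h : D.odd a = b
    · rw [if_pos h, parityCount, parityCount,
        Multiset.filter_cons_of_pos (p := fun i => D.odd i = b) s h, Multiset.card_cons,
        pow_succ]
      simp
    · rw [if_neg h, parityCount, parityCount,
        Multiset.filter_cons_of_neg (p := fun i => D.odd i = b) s h]
      simp

theorem signHom_quadric_even {β : Matrix (Fin (n + 1)) (Fin (n + 1)) ℂ}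
    (he : ∀ i j, D.odd i ≠ D.odd j → β i j = 0) (b : Bool) :
    D.signHom b (quadric β) = quadric β := by
  unfold quadric
  rw [map_contract]
  refine D.contract_congr_even he fun i j hij => ?_
  rw [map_mul]
  simp only [signHom, aeval_X, hij]
  split_ifs <;> simp

theorem signHom_quadric_odd {β : Matrix (Fin (n + 1)) (Fin (n + 1)) ℂ}
    (ho : ∀ i j, D.odd i = D.odd j → β i j = 0) (b : Bool) :
    D.signHom b (quadric β) = -quadric β := by
  unfold quadric
  rw [← neg_one_smul ℂ (contract β _), ← contract_const_smul, map_contract]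
  refine D.contract_congr_odd ho ?_ ?_ <;> intro i j hi hj <;>
    rw [map_mul, signHom, aeval_X, aeval_X, hi, hj] <;> cases b <;> simp

/-- The projection to the polynomials that are even in the coordinates of each parity. -/
def evenPart : Poly (n + 1) →ₗ[ℂ] Poly (n + 1) :=
  (4⁻¹ : ℂ) • (LinearMap.id + (D.signHom false).toLinearMap + (D.signHom true).toLinearMap +
    (D.signHom false).toLinearMap ∘ₗ (D.signHom true).toLinearMap)

theorem evenPart_apply (x : Poly (n + 1)) : D.evenPart x = (4⁻¹ : ℂ) •
    (x + D.signHom false x + D.signHom true x + D.signHom false (D.signHom true x)) := rfl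

theorem evenPart_eq {x : Poly (n + 1)} {a b : ℂ} (ha : D.signHom false x = a • x)
    (hb : D.signHom true x = b • x) : D.evenPart x = (4⁻¹ * (1 + a) * (1 + b)) • x := by
  rw [evenPart_apply, hb, map_smul, ha]
  module

theorem evenPart_toSource (H : D.PairPoly) : D.evenPart (D.toSource H) = D.toSource H := by
  have h1 : ∀ b, D.signHom b (D.toSource H) = D.toSource H := by
    intro b
    rw [← AlgHom.comp_apply]
    congr 1
    refine MvPolynomial.algHom_ext fun q => ?_
    simp only [AlgHom.comp_apply, toSource, aeval_X, map_mul, signHom, q.2]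
    split_ifs <;> simp
  rw [D.evenPart_eq (a := 1) (b := 1) (by rw [h1, one_smul]) (by rw [h1, one_smul])]
  norm_num

theorem span_quadrics_le (E : Set (Matrix (Fin (n + 1)) (Fin (n + 1)) ℂ)) {x : Poly (n + 1)}
    (hx : x ∈ Ideal.span (quadric '' E)) :
    x ∈ Submodule.span ℂ {y | ∃ s, ∃ β ∈ E, y = multisetMonomial s * quadric β} := by
  set G := Submodule.span ℂ {y | ∃ s, ∃ β ∈ E, y = multisetMonomial s * quadric β} with hG
  induction hx using Submodule.span_induction with
  | mem x hx =>
    obtain ⟨β, hβ, rfl⟩ := hx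
    exact Submodule.subset_span ⟨0, β, hβ, by simp⟩
  | zero => exact Submodule.zero_mem _
  | add x y _ _ hx hy => exact Submodule.add_mem _ hx hy
  | smul p x hx₀ hx =>
    rw [smul_eq_mul]
    clear hx₀
    induction mem_span_multisetMonomial p using Submodule.span_induction with
    | mem y hy =>
      obtain ⟨s, rfl⟩ := hy
      induction hx using Submodule.span_induction with
      | mem z hz =>
        obtain ⟨t, β, hβ, rfl⟩ := hz
        exact Submodule.subset_span ⟨s + t, β, hβ, by rw [multisetMonomial_add, mul_assoc]⟩
      | zero => simp
      | add z w _ _ hz hw => rw [mul_add]; exact Submodule.add_mem _ hz hw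
      | smul a z _ hz => rw [mul_smul_comm]; exact Submodule.smul_mem _ _ hz
    | zero => simp
    | add y z _ _ hy hz => rw [add_mul]; exact Submodule.add_mem _ hy hz
    | smul a y _ hy => rw [smul_mul_assoc]; exact Submodule.smul_mem _ _ hy

/-- The variable of an even pair of indices. -/
def pairVar (i j : Fin (n + 1)) : D.PairPoly :=
  if h : D.odd i = D.odd j then X ⟨(i, j), h⟩ else 0

theorem toSource_pairVar {i j : Fin (n + 1)} (h : D.odd i = D.odd j) :
    D.toSource (D.pairVar i j) = X i * X j := by
  simp [pairVar, h, toSource]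

theorem toTarget_pairVar {i j : Fin (n + 1)} (h : D.odd i = D.odd j) :
    D.toTarget (D.pairVar i j) = D.L i j := by
  simp [pairVar, h, toTarget]

/-- The ideal generated by the quadrics that vanish on the image of the cone. -/
def quadricIdeal : Ideal (Poly (m + 1)) := Ideal.span {G | G.IsHomogeneous 2 ∧ D.Vanishes G}

section ideal

variable (hfree : ∀ F : Poly (m + 1), F.IsHomogeneous 1 → D.Vanishes F → F = 0)
include hfree

theorem evenPart_lift {s : Multiset (Fin (n + 1))} {β : Matrix (Fin (n + 1)) (Fin (n + 1)) ℂ}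
    (hβ : β ∈ D.eqs) : ∃ K : D.PairPoly, D.toTarget K ∈ D.quadricIdeal ∧
      D.toSource K = D.evenPart (multisetMonomial s * quadric β) := by
  have hs : ∀ b, D.signHom b (multisetMonomial s) =
      (-1 : ℂ) ^ D.parityCount b s • multisetMonomial s := fun b => D.signHom_multisetMonomial b s
  rcases D.eqs_parity β hβ with he | ho
  · have hq := D.signHom_quadric_even he
    have hpart := D.evenPart_eq (x := multisetMonomial s * quadric β)
      (a := (-1 : ℂ) ^ D.parityCount false s) (b := (-1 : ℂ) ^ D.parityCount true s)
      (by rw [map_mul, hq, hs, smul_mul_assoc]) (by rw [map_mul, hq, hs, smul_mul_assoc])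
    rw [hpart]
    by_cases h0 : Even (D.parityCount false s)
    · by_cases h1 : Even (D.parityCount true s)
      · obtain ⟨k, hk⟩ : Even (Multiset.card s) := by
          rw [← D.parityCount_add s]
          exact h0.add h1
        obtain ⟨G, -, hG⟩ := D.exists_pairs h0 h1 (k := k) (by omega)
        refine ⟨G * contract β D.pairVar, ?_, ?_⟩
        · rw [map_mul, map_contract, D.contract_congr_even he fun i j => D.toTarget_pairVar,
            hfree _ (contract_isHomogeneous β D.L_hom) (D.vanishes_even hβ he), mul_zero]
          exact Ideal.zero_mem _
        · rw [map_mul, hG, map_contract, D.contract_congr_even he fun i j => D.toSource_pairVar,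
            h0.neg_one_pow, h1.neg_one_pow, quadric]
          norm_num
      · exact ⟨0, by simp, by simp [(Nat.not_even_iff_odd.mp h1).neg_one_pow]⟩
    · exact ⟨0, by simp, by simp [(Nat.not_even_iff_odd.mp h0).neg_one_pow]⟩
  · have hq := D.signHom_quadric_odd ho
    have hpart := D.evenPart_eq (x := multisetMonomial s * quadric β)
      (a := -(-1 : ℂ) ^ D.parityCount false s) (b := -(-1 : ℂ) ^ D.parityCount true s)
      (by rw [map_mul, hq, hs, mul_neg, smul_mul_assoc, neg_smul])
      (by rw [map_mul, hq, hs, mul_neg, smul_mul_assoc, neg_smul])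
    rw [hpart]
    by_cases h0 : Even (D.parityCount false s)
    · exact ⟨0, by simp, by simp [h0.neg_one_pow]⟩
    · by_cases h1 : Even (D.parityCount true s)
      · exact ⟨0, by simp, by simp [h1.neg_one_pow]⟩
      · rw [Nat.not_even_iff_odd] at h0 h1
        have hex : ∀ b, Odd (D.parityCount b s) → ∃ i ∈ s, D.odd i = b := by
          intro b hb
          have hpos : 0 < Multiset.card (s.filter fun i => D.odd i = b) := hb.pos
          obtain ⟨i, hi⟩ := Multiset.card_pos_iff_exists_mem.mp hpos
          exact ⟨i, Multiset.mem_filter.mp hi⟩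
        obtain ⟨k, hks, hk⟩ := hex false h0
        obtain ⟨s1, rfl⟩ := Multiset.exists_cons_of_mem hks
        obtain ⟨l, hls, hl⟩ := hex true h1
        rcases Multiset.mem_cons.mp hls with rfl | hls
        · rw [hk] at hl
          exact absurd hl (by simp)
        obtain ⟨t, rfl⟩ := Multiset.exists_cons_of_mem hls
        have hc0 : D.parityCount false (k ::ₘ l ::ₘ t) = D.parityCount false t + 1 := by
          simp [parityCount, hk, hl, add_comm]
        have hc1 : D.parityCount true (k ::ₘ l ::ₘ t) = D.parityCount true t + 1 := by
          simp [parityCount, hk, hl, add_comm]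
        have h0' : Even (D.parityCount false t) := by
          rw [hc0] at h0
          simpa [Nat.odd_add_one] using h0
        have h1' : Even (D.parityCount true t) := by
          rw [hc1] at h1
          simpa [Nat.odd_add_one] using h1
        obtain ⟨r, hr⟩ : Even (Multiset.card t) := by
          rw [← D.parityCount_add t]
          exact h0'.add h1'
        obtain ⟨G, -, hG⟩ := D.exists_pairs h0' h1' (k := r) (by omega)
        refine ⟨G * contract β (D.oddProduct D.pairVar k l), ?_, ?_⟩
        · rw [map_mul, map_contract_oddProduct,
            D.contract_oddProduct_congr ho hk hl fun i j => D.toTarget_pairVar]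
          exact Ideal.mul_mem_left _ _ (Ideal.subset_span
            ⟨contract_isHomogeneous β (D.oddProduct_isHomogeneous k l), D.vanishes_odd hβ ho hk hl⟩)
        · rw [map_mul, hG, map_contract_oddProduct,
            D.contract_oddProduct_congr ho hk hl fun i j => D.toSource_pairVar,
            contract_oddProduct_mul, h0.neg_one_pow, h1.neg_one_pow, multisetMonomial_cons,
            multisetMonomial_cons, quadric]
          norm_num
          ring

theorem mem_quadricIdeal
    (hideal : ∀ F : Poly (n + 1), (∀ c ∈ D.cone, eval c F = 0) →
      F ∈ Ideal.span (quadric '' D.eqs))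
    {F : Poly (m + 1)} (hF : D.Vanishes F) : F ∈ D.quadricIdeal := by
  classical
  let H : D.PairPoly := aeval (fun k => contract (D.Z k) D.pairVar) F
  have hH : D.toTarget H = F := by
    have : (D.toTarget.comp (aeval fun k => contract (D.Z k) D.pairVar)) = AlgHom.id ℂ _ := by
      refine MvPolynomial.algHom_ext fun k => ?_
      rw [AlgHom.comp_apply, aeval_X, AlgHom.id_apply, ← D.Z_L k]
      exact (map_contract D.toTarget (D.Z k) D.pairVar).trans
        (D.contract_congr_even (D.Z_even k) fun i j => D.toTarget_pairVar)
    exact congrArg (fun φ => φ F) this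
  have hI : D.toSource H ∈ Ideal.span (quadric '' D.eqs) := by
    refine hideal _ fun c hc => ?_
    rw [← D.eval_toTarget hc, hH]
    exact hF c hc
  have hlift : ∀ x ∈ Submodule.span ℂ {y | ∃ s, ∃ β ∈ D.eqs, y = multisetMonomial s * quadric β},
      ∃ K : D.PairPoly, D.toTarget K ∈ D.quadricIdeal ∧ D.toSource K = D.evenPart x := by
    intro x hx
    induction hx using Submodule.span_induction with
    | mem x hx =>
      obtain ⟨s, β, hβ, rfl⟩ := hx
      exact D.evenPart_lift hfree hβ
    | zero => exact ⟨0, by simp, by simp⟩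
    | add x y _ _ hx hy =>
      obtain ⟨K, hK, hK'⟩ := hx
      obtain ⟨K₂, hK₂, hK₂'⟩ := hy
      exact ⟨K + K₂, by rw [map_add]; exact Ideal.add_mem _ hK hK₂, by
        rw [map_add, map_add, hK', hK₂']⟩
    | smul a x _ hx =>
      obtain ⟨K, hK, hK'⟩ := hx
      exact ⟨a • K, by rw [map_smul, smul_eq_C_mul]; exact Ideal.mul_mem_left _ _ hK, by
        rw [map_smul, map_smul, hK']⟩
  obtain ⟨K, hK, hK'⟩ := hlift _ (span_quadrics_le D.eqs hI)
  rw [D.evenPart_toSource] at hK'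
  have hsub : H - K ∈ D.quadricIdeal.comap D.toTarget := by
    have hLX : ∀ q : ParityPair D.odd, D.toTarget (X q) = D.L q.1.1 q.1.2 := fun q => by
      simp [toTarget]
    refine mem_of_pairMap_eq_zero D.odd _ ?_ ?_ (p := H - K) ?_
    · intro a b hab
      rw [Ideal.mem_comap, map_sub, hLX, hLX]
      have : D.L a b - D.L b a = 0 := by
        refine hfree _ ((D.L_hom a b).sub (D.L_hom b a)) fun c hc => ?_
        rw [map_sub, D.eval_L hc hab, D.eval_L hc hab.symm]
        ring
      rw [this]
      exact Ideal.zero_mem _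
    · intro a b c d h1 h2 h3
      rw [Ideal.mem_comap, map_sub, map_mul, map_mul, hLX, hLX, hLX, hLX]
      exact Ideal.subset_span ⟨D.minor_isHomogeneous a b c d, D.vanishes_minor h1 h2 h3⟩
    · change D.toSource (H - K) = 0
      rw [map_sub, hK', sub_self]
  rw [Ideal.mem_comap, map_sub, hH] at hsub
  have := Ideal.add_mem _ hsub hK
  rwa [sub_add_cancel] at this

end ideal

/-! ### Tangent spaces of the quotient -/

theorem tangent_lift {c : Fin (n + 1) → ℂ} (hc : c ∈ D.cone) {k l : Fin (n + 1)}
    (hk : D.odd k = false) (hl : D.odd l = true) (hck : c k ≠ 0) (hcl : c l ≠ 0)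
    {u : Fin (m + 1) → ℂ}
    (hu : ∀ (d : ℕ) (F : Poly (m + 1)), F.IsHomogeneous d → D.Vanishes F →
      dEval (D.zmap c) u F = 0) :
    ∃ e : Fin (n + 1) → ℂ,
      (∀ β ∈ D.eqs, contract β (fun i j => e i * c j + c i * e j) = 0) ∧
      ∀ r, u r = contract (D.Z r) fun i j => e i * c j + c i * e j := by
  have hdL : ∀ i j, dEval (D.zmap c) u (D.L i j) = eval u (D.L i j) := fun i j =>
    dEval_linear _ _ (D.L_hom i j)
  have hminor : ∀ a i j, D.odd i = D.odd a → D.odd j = D.odd a →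
      c a * c a * eval u (D.L i j) + c i * c j * eval u (D.L a a) =
        c a * c i * eval u (D.L a j) + c a * c j * eval u (D.L a i) := by
    intro a i j hi hj
    have := hu 2 _ (D.minor_isHomogeneous a a i j) (D.vanishes_minor rfl (hi.trans hj.symm) hi.symm)
    rw [map_sub, dEval_mul, dEval_mul, D.eval_L hc rfl, D.eval_L hc (hi.trans hj.symm),
      D.eval_L hc hi.symm, D.eval_L hc hj.symm, hdL, hdL, hdL, hdL] at this
    linear_combination this
  let E : Fin (n + 1) → Fin (n + 1) → ℂ := fun a i =>
    eval u (D.L a i) / c a - eval u (D.L a a) * c i / (2 * c a ^ 2)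
  have hE : ∀ a i j, c a ≠ 0 → D.odd i = D.odd a → D.odd j = D.odd a →
      eval u (D.L i j) = E a i * c j + c i * E a j := by
    intro a i j ha hi hj
    have := hminor a i j hi hj
    simp only [E]
    field_simp
    linear_combination 2 * this
  let e : Fin (n + 1) → ℂ := fun i => if D.odd i then E l i else E k i
  have he : ∀ i j, D.odd i = D.odd j → eval u (D.L i j) = e i * c j + c i * e j := by
    intro i j hij
    simp only [e]
    cases hi : D.odd i
    · rw [← hij, hi]
      simpa using hE k i j hck (hi.trans hk.symm) ((hij.symm.trans hi).trans hk.symm)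
    · rw [← hij, hi]
      simpa using hE l i j hcl (hi.trans hl.symm) ((hij.symm.trans hi).trans hl.symm)
  have hdc : ∀ (β : Matrix (Fin (n + 1)) (Fin (n + 1)) ℂ) (f : Fin (n + 1) → Fin (n + 1) → Poly (m + 1)),
      dEval (D.zmap c) u (contract β f) = contract β fun i j => dEval (D.zmap c) u (f i j) :=
    fun β f => map_contract _ β f
  refine ⟨e, fun β hβ => ?_, fun r => ?_⟩
  · rcases D.eqs_parity β hβ with hev | ho
    · have := hu 1 _ (contract_isHomogeneous β D.L_hom) (D.vanishes_even hβ hev)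
      rw [hdc] at this
      rw [← this]
      exact D.contract_congr_even hev fun i j hij => by rw [hdL, he _ _ hij]
    · have := hu 2 _ (contract_isHomogeneous β (D.oddProduct_isHomogeneous k l))
        (D.vanishes_odd hβ ho hk hl)
      rw [hdc] at this
      have h2 : contract β (fun i j => dEval (D.zmap c) u (D.oddProduct D.L k l i j)) =
          contract β fun i j => (e i * c j + c i * e j) * (c k * c l) +
            c i * c j * (c l * e k + c k * e l) := by
        refine D.contract_congr_odd ho (fun i j hi hj => ?_) fun i j hi hj => ?_
        · rw [oddProduct, if_pos hi, dEval_mul, D.eval_L hc (hi.trans hl.symm),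
            D.eval_L hc (hj.trans hk.symm), hdL, hdL, he _ _ (hi.trans hl.symm),
            he _ _ (hj.trans hk.symm)]
          ring
        · rw [oddProduct, hi, if_neg (by simp), dEval_mul, D.eval_L hc (hi.trans hk.symm),
            D.eval_L hc (hj.trans hl.symm), hdL, hdL, he _ _ (hi.trans hk.symm),
            he _ _ (hj.trans hl.symm)]
          ring
      rw [h2, contract_fun_add, contract_mul_right, contract_mul_right, hc β hβ, zero_mul,
        add_zero] at this
      exact (mul_eq_zero.mp this).resolve_right (mul_ne_zero hck hcl)
  · have h1 := congrArg (eval u) (D.Z_L r)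
    rw [eval_contract, eval_X] at h1
    rw [← h1]
    exact D.contract_congr_even (D.Z_even r) he

end QuotientData

/-- The polarization of the quadratic form with matrix `β` at `c`. -/
def polar {n : ℕ} (c : Fin (n + 1) → ℂ) (β : Matrix (Fin (n + 1)) (Fin (n + 1)) ℂ) : (Fin (n + 1) → ℂ) →ₗ[ℂ] ℂ where
  toFun e := contract β fun i j => e i * c j + c i * e j
  map_add' a b := by
    rw [← contract_fun_add]
    congr
    funext i j
    simp only [Pi.add_apply]
    ring
  map_smul' a e := by
    rw [RingHom.id_apply, ← contract_const_smul]
    congr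
    funext i j
    simp only [Pi.smul_apply, smul_eq_mul]
    ring

namespace QuotientData.Describes

variable {n m : ℕ} {D : QuotientData n m} {V : Set (PSp n)} {t : PSp n → PSp n}
  {z : Fin (m + 1) → Poly (n + 1)} (h : D.Describes V t z)
include h

theorem mem_projIdeal_of_vanishes {F : Poly (m + 1)} (hF : D.Vanishes F) :
    F ∈ projIdeal (imageUnder z V) := by
  rw [mem_projIdeal]
  intro q hq
  obtain ⟨-, c, hc, rfl⟩ := h.mem_affineCone_image.mp hq
  exact hF c hc

theorem mem_projIdeal_iff (hne : ∃ c ∈ D.cone, c ≠ 0) {F : Poly (m + 1)} :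
    F ∈ projIdeal (imageUnder z V) ↔ D.Vanishes F := by
  refine ⟨fun hF c hc => ?_, h.mem_projIdeal_of_vanishes⟩
  by_cases h0 : c = 0
  · obtain ⟨d, hd, hd0⟩ := hne
    have := mem_projIdeal.mp (homogeneousComponent_mem_projIdeal hF 0) _
      (h.zmap_mem_affineCone hd hd0)
    rw [homogeneousComponent_zero, eval_C] at this
    have hz : D.zmap c = 0 := by
      rw [h0]
      have := D.zmap_smul 0 0
      simpa using this
    rw [hz, ← constantCoeff_eq] at *
    simpa using this
  · exact mem_projIdeal.mp hF _ (h.zmap_mem_affineCone hc h0)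

theorem isZariskiClosed_image : IsZariskiClosed (imageUnder z V) := by
  refine ⟨{F | (∃ d, F.IsHomogeneous d) ∧ D.Vanishes F}, fun F hF => hF.1, ?_⟩
  ext Q
  induction Q using Projectivization.ind with
  | h q hq =>
    rw [h.mk_mem_image]
    constructor
    · rintro ⟨c, hc, rfl⟩ F ⟨⟨d, hd⟩, hF⟩
      rw [eval_rep_eq_zero_iff hd]
      exact hF c hc
    · intro hall
      refine D.exists_preimage fun d F hd hF => ?_
      rw [← eval_rep_eq_zero_iff hd q hq]
      exact hall F ⟨⟨d, hd⟩, hF⟩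

theorem idealGeneratedByQuadrics (hne : ∃ c ∈ D.cone, c ≠ 0)
    (hfree : ∀ F : Poly (m + 1), F.IsHomogeneous 1 → D.Vanishes F → F = 0)
    (hideal : ∀ F : Poly (n + 1), (∀ c ∈ D.cone, eval c F = 0) →
      F ∈ Ideal.span (quadric '' D.eqs)) :
    IdealGeneratedByQuadrics (imageUnder z V) := by
  refine ⟨{G | G.IsHomogeneous 2 ∧ D.Vanishes G}, fun F hF => hF.1, le_antisymm ?_ ?_⟩
  · intro F hF
    exact D.mem_quadricIdeal hfree hideal ((h.mem_projIdeal_iff hne).mp hF)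
  · rw [Ideal.span_le]
    exact fun F hF => h.mem_projIdeal_of_vanishes hF.2

/-- The tangent space of the quotient at a point outside the fixed locus is at most as large as
that of the cone. -/
theorem finrank_tangent_le {c : Fin (n + 1) → ℂ} (hc : c ∈ D.cone) {k l : Fin (n + 1)}
    (hk : D.odd k = false) (hl : D.odd l = true) (hck : c k ≠ 0) (hcl : c l ≠ 0) {r : ℕ}
    (φ : (Fin (n + 1) → ℂ) →ₗ[ℂ] (Fin r → ℂ))
    (hφ : ∀ e, (∀ β ∈ D.eqs, contract β (fun i j => e i * c j + c i * e j) = 0) → φ e = 0 → e = 0)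
    (hq : D.zmap c ≠ 0) :
    Module.finrank ℂ (embeddedTangentSpace (imageUnder z V) (mk ℂ (D.zmap c) hq)) ≤ r := by
  let T : Submodule ℂ (Fin (n + 1) → ℂ) := ⨅ β ∈ D.eqs, LinearMap.ker (polar c β)
  let ψ : (Fin (n + 1) → ℂ) →ₗ[ℂ] (Fin (m + 1) → ℂ) := LinearMap.pi fun s => polar c (D.Z s)
  have hle : embeddedTangentSpace (imageUnder z V) (mk ℂ (D.zmap c) hq) ≤ T.map ψ := by
    intro u hu
    obtain ⟨e, he, hue⟩ := D.tangent_lift hc hk hl hck hcl fun d F hd hF =>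
      dEval_eq_zero_of_mem hq hu (h.mem_projIdeal_of_vanishes hF) hd
    exact ⟨e, by simpa [T, polar] using he, funext fun s => (hue s).symm⟩
  have h1 := Submodule.finrank_mono hle
  have h2 := Submodule.finrank_map_le ψ T
  have h3 : Module.finrank ℂ T ≤ r := by
    have hinj : Function.Injective (φ ∘ₗ T.subtype) := by
      rw [← LinearMap.ker_eq_bot, LinearMap.ker_eq_bot']
      rintro ⟨e, he⟩ h0
      exact Subtype.ext (hφ e (by simpa [T, polar] using he) h0)
    simpa using LinearMap.finrank_le_finrank_of_injective hinj
  omega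

end QuotientData.Describes

/-! ### Dimension -/

theorem ringKrullDim_eq_of_isIntegral {R S : Type} [CommRing R] [CommRing S] [IsDomain S]
    [Algebra R S] [Algebra.IsIntegral R S] (hinj : Function.Injective (algebraMap R S)) :
    ringKrullDim S = ringKrullDim R := by
  refine le_antisymm ?_ ?_
  · refine Order.krullDim_le_of_strictMono (PrimeSpectrum.comap (algebraMap R S)) ?_
    intro I J hIJ
    exact Ideal.IsIntegral.comap_lt_comap hIJ
  · refine iSup_le fun l => ?_
    obtain ⟨Q, hQ, hQ'⟩ := Ideal.exists_ideal_over_prime_of_isIntegral_of_isDomain (S := S)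
      (RelSeries.head l).asIdeal (by
        rw [(RingHom.injective_iff_ker_eq_bot _).mp hinj]
        exact bot_le)
    have : Q.LiesOver (RelSeries.head l).asIdeal := ⟨hQ'.symm⟩
    obtain ⟨L, hL, -⟩ := Ideal.exists_ltSeries_of_hasGoingUp l Q
    rw [← hL]
    exact le_iSup (fun p : LTSeries (PrimeSpectrum S) => (p.length : WithBot ℕ∞)) L

theorem isIntegral_of_cubic {R B : Type} [CommRing R] [CommRing B] [Algebra R B] {a b c x : B}
    (ha : IsIntegral R a) (hb : IsIntegral R b) (hc : IsIntegral R c)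
    (h : x ^ 3 = a * x ^ 2 + b * x + c) : IsIntegral R x := by
  let C := integralClosure R B
  have : IsIntegral C x := by
    refine ⟨Polynomial.X ^ 3 - (Polynomial.C (⟨a, ha⟩ : C) * Polynomial.X ^ 2 +
      Polynomial.C (⟨b, hb⟩ : C) * Polynomial.X + Polynomial.C (⟨c, hc⟩ : C)), ?_, ?_⟩
    · refine Polynomial.monic_X_pow_sub (n := 3) (Polynomial.degree_quadratic_le.trans_lt ?_)
      norm_num
    · simp only [Polynomial.eval₂_sub, Polynomial.eval₂_pow, Polynomial.eval₂_X,
        Polynomial.eval₂_add, Polynomial.eval₂_mul, Polynomial.eval₂_C]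
      rw [h]
      exact sub_self _
  exact isIntegral_trans x this

namespace QuotientData

variable {n m : ℕ} (D : QuotientData n m)

/-- The ideal generated by the equations of the cone. -/
def coneIdeal : Ideal (Poly (n + 1)) := Ideal.span (quadric '' D.eqs)

/-- The quadratic map, on polynomials. -/
def pullback : Poly (m + 1) →ₐ[ℂ] Poly (n + 1) := aeval fun k => quadric (D.Z k)

theorem eval_pullback (F : Poly (m + 1)) (c : Fin (n + 1) → ℂ) :
    eval c (D.pullback F) = eval (D.zmap c) F := by
  simp only [pullback, ← MvPolynomial.aeval_eq_eval, ← AlgHom.comp_apply]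
  congr 1
  ext k
  rw [AlgHom.comp_apply, aeval_X, aeval_X, MvPolynomial.aeval_eq_eval]
  exact eval_quadric _ _

theorem zeroLocus_coneIdeal : zeroLocus ℂ D.coneIdeal = D.cone := by
  rw [coneIdeal, zeroLocus_span]
  ext c
  simp only [Set.mem_ofPred_eq, Set.forall_mem_image, cone, MvPolynomial.aeval_eq_eval,
    eval_quadric]

theorem mem_coneIdeal (hp : D.coneIdeal.IsPrime) {F : Poly (n + 1)} :
    F ∈ D.coneIdeal ↔ ∀ c ∈ D.cone, eval c F = 0 := by
  rw [← MvPolynomial.IsPrime.vanishingIdeal_zeroLocus (K := ℂ) D.coneIdeal, zeroLocus_coneIdeal,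
    mem_vanishingIdeal_iff]
  rfl

theorem vanishes_iff (hp : D.coneIdeal.IsPrime) {F : Poly (m + 1)} :
    D.Vanishes F ↔ D.pullback F ∈ D.coneIdeal := by
  rw [D.mem_coneIdeal hp]
  simp only [eval_pullback]
  rfl

theorem pullback_L (hp : D.coneIdeal.IsPrime) {i j : Fin (n + 1)} (h : D.odd i = D.odd j) :
    D.pullback (D.L i j) - X i * X j ∈ D.coneIdeal := by
  rw [D.mem_coneIdeal hp]
  intro c hc
  rw [map_sub, eval_pullback, D.eval_L hc h]
  simp

end QuotientData

namespace QuotientData.Describes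

variable {n m : ℕ} {D : QuotientData n m} {V : Set (PSp n)} {t : PSp n → PSp n}
  {z : Fin (m + 1) → Poly (n + 1)} (h : D.Describes V t z)
include h

theorem projIdeal_eq_comap (hne : ∃ c ∈ D.cone, c ≠ 0) (hp : D.coneIdeal.IsPrime) :
    projIdeal (imageUnder z V) = D.coneIdeal.comap D.pullback := by
  ext F
  rw [h.mem_projIdeal_iff hne, D.vanishes_iff hp, Ideal.mem_comap]

theorem isProjectiveVarietyOfDim {d : ℕ} (hne : ∃ c ∈ D.cone, c ≠ 0) (hp : D.coneIdeal.IsPrime)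
    (T : Fin (d + 1) → Poly (m + 1)) {E : Poly (d + 1)} (hE : E ≠ 0)
    (hsurj : ∀ w, eval w E ≠ 0 → ∃ c ∈ D.cone, ∀ i, eval (D.zmap c) (T i) = w i)
    (hint : ∀ [Algebra (Poly (d + 1)) (Poly (n + 1) ⧸ D.coneIdeal)],
      (∀ i, IsIntegral (Poly (d + 1)) (Ideal.Quotient.mk D.coneIdeal (D.pullback (T i)))) →
      (∀ a, IsIntegral (Poly (d + 1)) (Ideal.Quotient.mk D.coneIdeal (C a))) →
      ∀ i, IsIntegral (Poly (d + 1)) (Ideal.Quotient.mk D.coneIdeal (X i))) :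
    IsProjectiveVarietyOfDim (imageUnder z V) d := by
  have hI := h.projIdeal_eq_comap hne hp
  have hprime : (projIdeal (imageUnder z V)).IsPrime := by
    rw [hI]
    exact Ideal.comap_isPrime _ _
  refine ⟨h.isZariskiClosed_image, ?_, hprime, ?_⟩
  · obtain ⟨c, hc, h0⟩ := hne
    obtain ⟨h1, h2⟩ := h.zmap_mem_affineCone hc h0
    exact ⟨_, h2⟩
  · set I := projIdeal (imageUnder z V) with hIdef
    let θ : Poly (d + 1) →ₐ[ℂ] Poly (m + 1) ⧸ I := (Ideal.Quotient.mkₐ ℂ I).comp (aeval T)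
    let ι : Poly (m + 1) ⧸ I →ₐ[ℂ] Poly (n + 1) ⧸ D.coneIdeal :=
      Ideal.quotientMapₐ D.coneIdeal D.pullback hI.le
    have hι : Function.Injective ι := by
      refine Ideal.quotientMap_injective' (H := hI.le) hI.ge
    have hιmk : ∀ F, ι (Ideal.Quotient.mk I F) = Ideal.Quotient.mk _ (D.pullback F) := fun F => rfl
    let _ : Algebra (Poly (d + 1)) (Poly (m + 1) ⧸ I) := θ.toRingHom.toAlgebra
    let _ : Algebra (Poly (d + 1)) (Poly (n + 1) ⧸ D.coneIdeal) :=
      ((Ideal.Quotient.mkₐ ℂ D.coneIdeal).comp (D.pullback.comp (aeval T))).toRingHom.toAlgebra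
    have hmap : ∀ F, IsIntegral (Poly (d + 1))
        (Ideal.Quotient.mk D.coneIdeal (D.pullback (aeval T F))) := fun _ => isIntegral_algebraMap
    have hconst : ∀ a : ℂ, IsIntegral (Poly (d + 1)) (Ideal.Quotient.mk D.coneIdeal (C a)) := by
      intro a
      have := hmap (C a)
      rwa [aeval_C, AlgHom.commutes, MvPolynomial.algebraMap_eq] at this
    have hX := hint (fun i => by simpa only [aeval_X] using hmap (X i)) hconst
    have hB : ∀ x : Poly (n + 1), IsIntegral (Poly (d + 1)) (Ideal.Quotient.mk D.coneIdeal x) := by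
      intro x
      induction x using MvPolynomial.induction_on with
      | C a => exact hconst a
      | add p q hp hq => rw [map_add]; exact hp.add hq
      | mul_X p i hp => rw [map_mul]; exact hp.mul (hX i)
    let ι' : Poly (m + 1) ⧸ I →ₐ[Poly (d + 1)] Poly (n + 1) ⧸ D.coneIdeal :=
      { ι.toRingHom with commutes' := fun r => rfl }
    have : IsDomain (Poly (m + 1) ⧸ I) := (Ideal.Quotient.isDomain_iff_prime I).mpr hprime
    have hA : Algebra.IsIntegral (Poly (d + 1)) (Poly (m + 1) ⧸ I) := by
      refine ⟨fun x => ?_⟩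
      obtain ⟨F, rfl⟩ := Ideal.Quotient.mk_surjective x
      rw [← isIntegral_algHom_iff ι' hι]
      exact hB _
    have hinj : Function.Injective (algebraMap (Poly (d + 1)) (Poly (m + 1) ⧸ I)) := by
      rw [injective_iff_map_eq_zero]
      intro F hF
      have hmem : aeval T F ∈ I := Ideal.Quotient.eq_zero_iff_mem.mp hF
      rw [hIdef, h.mem_projIdeal_iff hne] at hmem
      refine eq_zero_of_eval_ne_zero hE fun w hw => ?_
      obtain ⟨c, hc, hcw⟩ := hsurj w hw
      have := hmem c hc
      rwa [eval_aeval, funext hcw] at this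
    rw [ringKrullDim_eq_of_isIntegral hinj, MvPolynomial.ringKrullDim_of_isNoetherianRing,
      ringKrullDim_eq_zero_of_field]
    simp

end QuotientData.Describes

/-! ### Cones over toric varieties -/

/-- The monomial map with exponents `A`. -/
def toricMap {σ : Type} {l : ℕ} (A : σ → Fin l → ℕ) : MvPolynomial σ ℂ →ₐ[ℂ] Poly l :=
  aeval fun i => monomial (Finsupp.equivFunOnFinite.symm (A i)) 1

theorem toricMap_X {σ : Type} {l : ℕ} (A : σ → Fin l → ℕ) (i : σ) :
    toricMap A (X i) = monomial (Finsupp.equivFunOnFinite.symm (A i)) 1 := by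
  rw [toricMap, aeval_X]

theorem equivFunOnFinite_symm_add {l : ℕ} (a b : Fin l → ℕ) :
    (Finsupp.equivFunOnFinite.symm (a + b) : Fin l →₀ ℕ) =
      Finsupp.equivFunOnFinite.symm a + Finsupp.equivFunOnFinite.symm b := by
  ext i
  simp

theorem toricMap_X_mul_X {σ : Type} {l : ℕ} (A : σ → Fin l → ℕ) (i j : σ) :
    toricMap A (X i * X j) = monomial (Finsupp.equivFunOnFinite.symm (A i + A j)) 1 := by
  rw [map_mul, toricMap_X, toricMap_X, monomial_mul, one_mul, equivFunOnFinite_symm_add]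

theorem eval_toricMap {σ : Type} {l : ℕ} (A : σ → Fin l → ℕ) (w : Fin l → ℂ)
    (F : MvPolynomial σ ℂ) :
    eval w (toricMap A F) = eval (fun i => ∏ k, w k ^ A i k) F := by
  simp only [toricMap, ← MvPolynomial.aeval_eq_eval, ← AlgHom.comp_apply]
  congr 1
  ext i
  rw [AlgHom.comp_apply, aeval_X, aeval_X, MvPolynomial.aeval_eq_eval]
  rw [eval_monomial, one_mul, Finsupp.prod_fintype _ _ (by simp)]
  rfl

theorem mem_of_toricMap_eq_zero {σ : Type} {l : ℕ} (A : σ → Fin l → ℕ)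
    (I : Ideal (MvPolynomial σ ℂ)) (hA : ∀ i, A i ≠ 0)
    (h : ∀ s t : Multiset σ, s ≠ 0 → (s.map A).sum = (t.map A).sum →
      ∃ k s' t', Congruent A I s (k ::ₘ s') ∧ Congruent A I t (k ::ₘ t'))
    {p : MvPolynomial σ ℂ} (hp : toricMap A p = 0) : p ∈ I := by
  refine mem_of_monomialMap_eq_zero (fun i => Finsupp.equivFunOnFinite.symm (A i)) I ?_ hp
  intro s t hst
  have hsum : ∀ s : Multiset σ,
      ((s.map fun i => (Finsupp.equivFunOnFinite.symm (A i) : Fin l →₀ ℕ)).sum : Fin l → ℕ) =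
        (s.map A).sum := by
    intro s
    induction s using Multiset.induction_on with
    | empty => simp
    | cons a s ih =>
      rw [Multiset.map_cons, Multiset.sum_cons, Multiset.map_cons, Multiset.sum_cons,
        Finsupp.coe_add, ih]
      rfl
  refine (congruent_of_common A I ?_ h s t ?_).sub_mem
  · intro s hs
    rw [Multiset.sum_eq_zero_iff] at hs
    rw [Multiset.eq_zero_iff_forall_notMem]
    intro i hi
    exact hA i (hs _ (Multiset.mem_map_of_mem A hi))
  · rw [← hsum, ← hsum, hst]

theorem QuotientData.coneIdeal_eq_ker {n m l : ℕ} (D : QuotientData n m) (A : Fin (n + 1) → Fin l → ℕ)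
    (σ : Poly (n + 1) ≃ₐ[ℂ] Poly (n + 1)) (hA : ∀ i, A i ≠ 0)
    (h : ∀ I : Ideal (Poly (n + 1)), I = D.coneIdeal.comap σ.symm.toAlgHom →
      ∀ s t : Multiset (Fin (n + 1)), s ≠ 0 → (s.map A).sum = (t.map A).sum →
      ∃ k s' t', Congruent A I s (k ::ₘ s') ∧ Congruent A I t (k ::ₘ t'))
    (hβ : ∀ β ∈ D.eqs, toricMap A (σ (quadric β)) = 0) :
    D.coneIdeal = RingHom.ker ((toricMap A).comp σ.toAlgHom) := by
  refine le_antisymm ?_ ?_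
  · rw [QuotientData.coneIdeal, Ideal.span_le]
    rintro _ ⟨β, hb, rfl⟩
    exact hβ β hb
  · intro F hF
    have := mem_of_toricMap_eq_zero A _ hA (h _ rfl) (p := σ F) hF
    rw [Ideal.mem_comap] at this
    simpa using this

theorem linear_eq_zero {n l : ℕ} (Φ : Poly n →ₐ[ℂ] Poly l) (e : Fin n → Fin l →₀ ℕ)
    (he : ∀ i, coeff (e i) (Φ (X i)) ≠ 0) (hne : ∀ i j, i ≠ j → coeff (e i) (Φ (X j)) = 0)
    {F : Poly n} (hF : F.IsHomogeneous 1) (h0 : Φ F = 0) : F = 0 := by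
  have hmem : F ∈ Submodule.span ℂ (Set.range (X : Fin n → Poly n)) := by
    rw [← homogeneousSubmodule_one_eq_span_X]
    exact hF
  obtain ⟨a, rfl⟩ := (Submodule.mem_span_range_iff_exists_fun ℂ).mp hmem
  refine Finset.sum_eq_zero fun i _ => ?_
  have h1 := congrArg (coeff (e i)) h0
  simp only [map_sum, map_smul, coeff_sum, coeff_smul, coeff_zero, smul_eq_mul] at h1
  rw [Finset.sum_eq_single i (fun j _ hj => by rw [hne i j hj.symm, mul_zero]) (by simp)] at h1
  rw [(mul_eq_zero.mp h1).resolve_right (he i), zero_smul]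

/-! ### The cone over the octic del Pezzo surface -/

/-- The exponents of the coordinates of the cone over the octic del Pezzo surface. -/
def exponents17 : Fin 10 → Fin 4 → ℕ :=
  ![![0, 0, 1, 0], ![0, 1, 1, 0], ![0, 2, 1, 0], ![1, 0, 1, 0], ![1, 1, 1, 0], ![1, 2, 1, 0],
    ![2, 0, 1, 0], ![2, 1, 1, 0], ![2, 2, 1, 0], ![0, 0, 0, 1]]

/-- The coordinate `y_{i,j}`. -/
def cell (i j : Fin 3) : Fin 10 := Fin.castSucc (finProdFinEquiv (i, j))

theorem exists_balanced {σ : Type} (f : σ → ℕ) {s : Multiset σ} (hs : s ≠ 0)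
    (h2 : ∀ a ∈ s, f a ≤ 2) :
    ((s.map f).sum < Multiset.card s → ∃ a ∈ s, f a = 0) ∧
    (Multiset.card s < (s.map f).sum → ∃ a ∈ s, f a = 2) ∧
    ((s.map f).sum = Multiset.card s →
      (∃ a ∈ s, f a = 1) ∨ ((∃ a ∈ s, f a = 0) ∧ ∃ a ∈ s, f a = 2)) := by
  have hlow : (∀ a ∈ s, 1 ≤ f a) → Multiset.card s ≤ (s.map f).sum := by
    intro h
    have := Multiset.card_nsmul_le_sum (s := s.map f) (a := 1) (by
      intro x hx
      obtain ⟨a, ha, rfl⟩ := Multiset.mem_map.mp hx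
      exact h a ha)
    simpa using this
  have hlow2 : (∀ a ∈ s, 2 ≤ f a) → 2 * Multiset.card s ≤ (s.map f).sum := by
    intro h
    have := Multiset.card_nsmul_le_sum (s := s.map f) (a := 2) (by
      intro x hx
      obtain ⟨a, ha, rfl⟩ := Multiset.mem_map.mp hx
      exact h a ha)
    simpa [mul_comm] using this
  have hup : (∀ a ∈ s, f a ≤ 1) → (s.map f).sum ≤ Multiset.card s := by
    intro h
    have := Multiset.sum_le_card_nsmul (s.map f) 1 (by
      intro x hx
      obtain ⟨a, ha, rfl⟩ := Multiset.mem_map.mp hx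
      exact h a ha)
    simpa using this
  have hup0 : (∀ a ∈ s, f a = 0) → (s.map f).sum = 0 := by
    intro h
    rw [Multiset.sum_eq_zero_iff]
    intro x hx
    obtain ⟨a, ha, rfl⟩ := Multiset.mem_map.mp hx
    exact h a ha
  have hpos : 0 < Multiset.card s := Multiset.card_pos.mpr hs
  refine ⟨fun h => ?_, fun h => ?_, fun h => ?_⟩
  · by_contra! hc
    have := hlow fun a ha => Nat.one_le_iff_ne_zero.mpr (hc a ha)
    omega
  · by_contra! hc
    have := hup fun a ha => by have := hc a ha; have := h2 a ha; omega
    omega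
  · by_contra! hc
    obtain ⟨h1, hc⟩ := hc
    by_cases h0 : ∃ a ∈ s, f a = 0
    · have := hup0 fun a ha => by have := hc h0 a ha; have := h1 a ha; have := h2 a ha; omega
      omega
    · push Not at h0
      have := hlow2 fun a ha => by have := h0 a ha; have := h1 a ha; omega
      omega

section toric17

variable {I : Ideal (Poly 10)}
  (hI : ∀ a b c d, exponents17 a + exponents17 b = exponents17 c + exponents17 d →
    (X a * X b - X c * X d : Poly 10) ∈ I)
include hI

theorem congruent_swap17 {i j i' j' k l k' l' : Fin 3} {s : Multiset (Fin 10)}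
    (h1 : cell i j ∈ s) (h2 : cell i' j' ∈ s) (hne : cell i j ≠ cell i' j')
    (he : exponents17 (cell i j) + exponents17 (cell i' j') =
      exponents17 (cell k l) + exponents17 (cell k' l')) :
    ∃ s', Congruent exponents17 I s s' ∧ cell k l ∈ s' ∧ cell k' l' ∈ s' := by
  obtain ⟨s1, rfl⟩ := Multiset.exists_cons_of_mem h1
  obtain ⟨s2, rfl⟩ := Multiset.exists_cons_of_mem
    ((Multiset.mem_cons.mp h2).resolve_left hne.symm)
  exact ⟨_, Congruent.pair he (hI _ _ _ _ he) s2, by simp, by simp⟩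

/-- The row or column through which a multiset of cells can be moved. -/
def balance (M d : ℕ) : Fin 3 := if M < d then 0 else if M = d then 1 else 2

omit hI in
theorem exists_cell {a : Fin 10} (h : a ≠ 9) : ∃ i j, a = cell i j := by
  revert a
  decide

omit hI in
theorem exponents17_cell (i j : Fin 3) : exponents17 (cell i j) = ![(i : ℕ), (j : ℕ), 1, 0] := by
  revert i j
  decide

omit hI in
theorem exponents17_le_two (a : Fin 10) (k : Fin 4) : exponents17 a k ≤ 2 := by
  revert a k
  decide

omit hI in
theorem cell_inj {i j i' j' : Fin 3} : cell i j = cell i' j' ↔ i = i' ∧ j = j' := by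
  revert i j i' j'
  decide

theorem exists_row {s : Multiset (Fin 10)} (hs : s ≠ 0) (h9 : ∀ a ∈ s, a ≠ 9) :
    ∃ s', Congruent exponents17 I s s' ∧
      ∃ j, cell (balance (s.map fun a => exponents17 a 0).sum (Multiset.card s)) j ∈ s' := by
  have h2 : ∀ a ∈ s, exponents17 a 0 ≤ 2 := fun a _ => exponents17_le_two a _
  obtain ⟨hlt, hgt, heq⟩ := exists_balanced (fun a => exponents17 a 0) hs h2
  have hcell : ∀ r : Fin 3, (∃ a ∈ s, exponents17 a 0 = r) → ∃ j, cell r j ∈ s := by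
    rintro r ⟨a, ha, har⟩
    obtain ⟨i, j, rfl⟩ := exists_cell (h9 a ha)
    rw [exponents17_cell] at har
    have : i = r := Fin.ext har
    exact ⟨j, this ▸ ha⟩
  unfold balance
  split_ifs with h1 h3
  · exact ⟨s, Congruent.refl s, hcell 0 (hlt h1)⟩
  · rcases heq h3 with h | ⟨h, h'⟩
    · exact ⟨s, Congruent.refl s, hcell 1 h⟩
    · obtain ⟨j, hj⟩ := hcell 0 h
      obtain ⟨j', hj'⟩ := hcell 2 h'
      obtain ⟨s', hs', h1, -⟩ := congruent_swap17 hI (k := 1) (l := j) (k' := 1) (l' := j') hj hj'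
        (by rw [ne_eq, cell_inj]; simp) (by
          clear hj hj'
          revert j j'
          decide)
      exact ⟨s', hs', j, h1⟩
  · exact ⟨s, Congruent.refl s, hcell 2 (hgt (by omega))⟩

theorem exists_column {s : Multiset (Fin 10)} (hs : s ≠ 0) (h9 : ∀ a ∈ s, a ≠ 9) {r : Fin 3}
    (hr : ∃ j, cell r j ∈ s) :
    ∃ s', Congruent exponents17 I s s' ∧ (∃ j, cell r j ∈ s') ∧
      ∃ i, cell i (balance (s.map fun a => exponents17 a 1).sum (Multiset.card s)) ∈ s' := by
  have h2 : ∀ a ∈ s, exponents17 a 1 ≤ 2 := fun a _ => exponents17_le_two a _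
  obtain ⟨hlt, hgt, heq⟩ := exists_balanced (fun a => exponents17 a 1) hs h2
  have hcell : ∀ c : Fin 3, (∃ a ∈ s, exponents17 a 1 = c) → ∃ i, cell i c ∈ s := by
    rintro r ⟨a, ha, har⟩
    obtain ⟨i, j, rfl⟩ := exists_cell (h9 a ha)
    rw [exponents17_cell] at har
    have : j = r := Fin.ext har
    exact ⟨i, this ▸ ha⟩
  unfold balance
  split_ifs with h1 h3
  · exact ⟨s, Congruent.refl s, hr, hcell 0 (hlt h1)⟩
  · rcases heq h3 with h | ⟨h, h'⟩
    · exact ⟨s, Congruent.refl s, hr, hcell 1 h⟩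
    · obtain ⟨i, hi⟩ := hcell 0 h
      obtain ⟨i', hi'⟩ := hcell 2 h'
      have he : exponents17 (cell i 0) + exponents17 (cell i' 2) =
          exponents17 (cell i 1) + exponents17 (cell i' 1) := by
        clear hi hi'
        revert i i'
        decide
      obtain ⟨s1, rfl⟩ := Multiset.exists_cons_of_mem hi
      obtain ⟨s2, rfl⟩ := Multiset.exists_cons_of_mem
        ((Multiset.mem_cons.mp hi').resolve_left (by rw [cell_inj]; simp))
      refine ⟨_, Congruent.pair he (hI _ _ _ _ he) s2, ?_, i, by simp⟩
      obtain ⟨j, hj⟩ := hr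
      simp only [Multiset.mem_cons, cell_inj] at hj
      rcases hj with ⟨rfl, -⟩ | ⟨rfl, -⟩ | hj
      · exact ⟨1, by simp⟩
      · exact ⟨1, by simp⟩
      · exact ⟨j, by simp [hj]⟩
  · exact ⟨s, Congruent.refl s, hr, hcell 2 (hgt (by omega))⟩

omit hI in
theorem sum_exponents17 {s : Multiset (Fin 10)} (k : Fin 4) :
    (s.map exponents17).sum k = (s.map fun a => exponents17 a k).sum := by
  induction s using Multiset.induction_on with
  | empty => simp
  | cons a s ih => simp [ih]

omit hI in
theorem sum_vertex_eq_zero_iff {s : Multiset (Fin 10)} :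
    (s.map exponents17).sum 3 = 0 ↔ ∀ a ∈ s, a ≠ 9 := by
  rw [sum_exponents17, Multiset.sum_eq_zero_iff]
  simp only [Multiset.mem_map, forall_exists_index, and_imp, forall_apply_eq_imp_iff₂]
  refine forall₂_congr fun a ha => ?_
  clear ha
  revert a
  decide

omit hI in
theorem card_eq_sum17 {s : Multiset (Fin 10)} :
    Multiset.card s = (s.map exponents17).sum 2 + (s.map exponents17).sum 3 := by
  induction s using Multiset.induction_on with
  | empty => simp
  | cons a s ih =>
    have : exponents17 a 2 + exponents17 a 3 = 1 := by revert a; decide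
    simp only [Multiset.card_cons, ih, Multiset.map_cons, Multiset.sum_cons, Pi.add_apply]
    omega

theorem exists_common_cell {s : Multiset (Fin 10)} (hs : s ≠ 0)
    (h9 : (s.map exponents17).sum 3 = 0) :
    ∃ s', Congruent exponents17 I s
      (cell (balance ((s.map exponents17).sum 0) ((s.map exponents17).sum 2))
        (balance ((s.map exponents17).sum 1) ((s.map exponents17).sum 2)) ::ₘ s') := by
  have hcard := card_eq_sum17 (s := s)
  rw [h9, add_zero] at hcard
  have key : ∃ s', Congruent exponents17 I s s' ∧
      cell (balance ((s.map exponents17).sum 0) ((s.map exponents17).sum 2))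
        (balance ((s.map exponents17).sum 1) ((s.map exponents17).sum 2)) ∈ s' := by
    obtain ⟨s1, h1, hr⟩ := exists_row hI hs (sum_vertex_eq_zero_iff.mp h9)
    rw [← sum_exponents17] at hr
    have hs1 : s1 ≠ 0 := by
      rintro rfl
      exact hs (by simpa using h1.card_eq)
    obtain ⟨s2, h2, ⟨j, hj⟩, i, hi⟩ := exists_column hI hs1
      (sum_vertex_eq_zero_iff.mp (by rw [← h1.sum_eq, h9])) hr
    rw [← sum_exponents17, ← h1.sum_eq, ← h1.card_eq] at hi
    rw [hcard] at hi hj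
    by_cases hne : cell (balance ((s.map exponents17).sum 0) ((s.map exponents17).sum 2)) j =
        cell i (balance ((s.map exponents17).sum 1) ((s.map exponents17).sum 2))
    · rw [cell_inj] at hne
      refine ⟨s2, h1.trans h2, ?_⟩
      rwa [← hne.2]
    · obtain ⟨s3, h3, h4, -⟩ := congruent_swap17 hI hj hi hne
        (k := balance ((s.map exponents17).sum 0) ((s.map exponents17).sum 2))
        (l := balance ((s.map exponents17).sum 1) ((s.map exponents17).sum 2))
        (k' := i) (l' := j) (by
          simp only [exponents17_cell]
          ext k
          fin_cases k <;> simp [add_comm])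
      exact ⟨s3, (h1.trans h2).trans h3, h4⟩
  obtain ⟨s', h1, h2⟩ := key
  obtain ⟨s'', rfl⟩ := Multiset.exists_cons_of_mem h2
  exact ⟨s'', h1⟩

theorem exists_common17 (s t : Multiset (Fin 10)) (hs : s ≠ 0)
    (hst : (s.map exponents17).sum = (t.map exponents17).sum) :
    ∃ k s' t', Congruent exponents17 I s (k ::ₘ s') ∧ Congruent exponents17 I t (k ::ₘ t') := by
  by_cases h9 : (s.map exponents17).sum 3 = 0
  · have ht : t ≠ 0 := by
      rintro rfl
      apply hs
      rw [← Multiset.card_eq_zero, card_eq_sum17, hst]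
      rfl
    obtain ⟨s', hs'⟩ := exists_common_cell hI hs h9
    obtain ⟨t', ht'⟩ := exists_common_cell hI ht (hst ▸ h9)
    rw [← hst] at ht'
    exact ⟨_, s', t', hs', ht'⟩
  · have hmem : ∀ u : Multiset (Fin 10), (u.map exponents17).sum 3 ≠ 0 → ∃ u', u = 9 ::ₘ u' := by
      intro u hu
      rw [ne_eq, sum_vertex_eq_zero_iff] at hu
      push Not at hu
      obtain ⟨a, ha, rfl⟩ := hu
      exact Multiset.exists_cons_of_mem ha
    obtain ⟨s', rfl⟩ := hmem s h9
    obtain ⟨t', rfl⟩ := hmem t (hst ▸ h9)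
    exact ⟨9, s', t', Congruent.refl _, Congruent.refl _⟩

end toric17

theorem toricMap_multisetMonomial {σ : Type} {l : ℕ} (A : σ → Fin l → ℕ) (s : Multiset σ) :
    toricMap A (multisetMonomial s) =
      monomial (Finsupp.equivFunOnFinite.symm (s.map A).sum) 1 := by
  induction s using Multiset.induction_on with
  | empty =>
    have : (Finsupp.equivFunOnFinite.symm (0 : Fin l → ℕ) : Fin l →₀ ℕ) = 0 := by
      ext
      rfl
    simp [this]
  | cons a s ih =>
    rw [multisetMonomial_cons, map_mul, ih, toricMap_X, monomial_mul, one_mul, Multiset.map_cons,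
      Multiset.sum_cons, equivFunOnFinite_symm_add]

theorem eval_multisetMonomial {σ : Type} (c : σ → ℂ) (s : Multiset σ) :
    eval c (multisetMonomial s) = (s.map c).prod := by
  induction s using Multiset.induction_on with
  | empty => simp
  | cons a s ih => simp [ih]

/-- The points of a toric variety satisfy the binomial equations. -/
theorem QuotientData.prod_eq_of_mem_cone {n m l : ℕ} {D : QuotientData n m}
    {A : Fin (n + 1) → Fin l → ℕ} (hD : D.coneIdeal = RingHom.ker (toricMap A))
    {c : Fin (n + 1) → ℂ} (hc : c ∈ D.cone) (s t : List (Fin (n + 1)))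
    (h : (s.map A).sum = (t.map A).sum) : (s.map c).prod = (t.map c).prod := by
  have hmem : multisetMonomial (s : Multiset (Fin (n + 1))) -
      multisetMonomial (t : Multiset (Fin (n + 1))) ∈ D.coneIdeal := by
    rw [hD, RingHom.mem_ker]
    rw [map_sub, toricMap_multisetMonomial, toricMap_multisetMonomial, Multiset.map_coe,
      Multiset.map_coe, Multiset.sum_coe, Multiset.sum_coe, h, sub_self]
  rw [← D.zeroLocus_coneIdeal] at hc
  have := hc _ hmem
  rw [MvPolynomial.aeval_eq_eval] at this
  change eval c _ = 0 at this
  rw [map_sub, eval_multisetMonomial, eval_multisetMonomial, sub_eq_zero] at this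
  simpa using this

theorem prod_pow_mul_prod_pow {σ : Type} {l : ℕ} {A : σ → Fin l → ℕ} (w : Fin l → ℂ) {a b c d : σ}
    (h : A a + A b = A c + A d) :
    (∏ k, w k ^ A a k) * ∏ k, w k ^ A b k = (∏ k, w k ^ A c k) * ∏ k, w k ^ A d k := by
  rw [← Finset.prod_mul_distrib, ← Finset.prod_mul_distrib]
  refine Finset.prod_congr rfl fun k _ => ?_
  rw [← pow_add, ← pow_add]
  congr 1
  exact congrFun h k

/-! ### The quotient of genus 17 -/

/-- The pairs of coordinates of which the forms of genus 17 are the products. -/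
def pair17 : Fin 18 → Fin 10 × Fin 10 :=
  ![(4, 4), (0, 0), (2, 2), (6, 6), (8, 8), (9, 9), (1, 1), (3, 3), (5, 5), (7, 7),
    (1, 9), (3, 9), (5, 9), (7, 9), (0, 4), (2, 4), (6, 4), (8, 4)]

/-- The form that agrees on the cone with the product of two coordinates of equal parity. -/
def index17 : Fin 10 → Fin 10 → Fin 18 :=
  ![![1, 0, 6, 0, 14, 0, 7, 0, 0, 0],
    ![0, 6, 0, 14, 0, 15, 0, 0, 0, 10],
    ![6, 0, 2, 0, 15, 0, 0, 0, 8, 0],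
    ![0, 14, 0, 7, 0, 0, 0, 16, 0, 11],
    ![14, 0, 15, 0, 0, 0, 16, 0, 17, 0],
    ![0, 15, 0, 0, 0, 8, 0, 17, 0, 12],
    ![7, 0, 0, 0, 16, 0, 3, 0, 9, 0],
    ![0, 0, 0, 16, 0, 17, 0, 9, 0, 13],
    ![0, 0, 8, 0, 17, 0, 9, 0, 4, 0],
    ![0, 10, 0, 11, 0, 12, 0, 13, 0, 5]]

/-- The parity of the coordinates of the cone of genus 17. -/
def odd17 : Fin 10 → Bool :=
  ![false, true, false, true, false, true, false, true, false, true]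

theorem index17_spec : ∀ i j, odd17 i = odd17 j →
    exponents17 (pair17 (index17 i j)).1 + exponents17 (pair17 (index17 i j)).2 =
      exponents17 i + exponents17 j := by decide

theorem odd17_pair17 : ∀ k, odd17 (pair17 k).1 = odd17 (pair17 k).2 := by decide

theorem index17_pair17 : ∀ k, index17 (pair17 k).1 (pair17 k).2 = k := by decide

theorem exponents17_parity (a : Fin 10) :
    odd17 a = decide ((exponents17 a 0 + exponents17 a 1 + exponents17 a 3) % 2 = 1) := by
  revert a
  decide

theorem odd17_eq_iff {a b c d : Fin 10}
    (h : exponents17 a + exponents17 b = exponents17 c + exponents17 d) :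
    odd17 a = odd17 b ↔ odd17 c = odd17 d := by
  have h0 := congrFun h 0
  have h1 := congrFun h 1
  have h3 := congrFun h 3
  simp only [Pi.add_apply] at h0 h1 h3
  rw [exponents17_parity, exponents17_parity, exponents17_parity, exponents17_parity,
    decide_eq_decide, decide_eq_decide]
  omega

/-- The binomial equations of the cone over the octic del Pezzo surface. -/
def binomials17 : Set (Matrix (Fin 10) (Fin 10) ℂ) :=
  {β | ∃ a b c d, exponents17 a + exponents17 b = exponents17 c + exponents17 d ∧
    β = Matrix.single a b 1 - Matrix.single c d 1}

theorem contract_binomial {N : ℕ} {A : Type} [AddCommGroup A] [Module ℂ A] (a b c d : Fin N)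
    (f : Fin N → Fin N → A) :
    contract (Matrix.single a b 1 - Matrix.single c d 1) f = f a b - f c d := by
  rw [contract_sub, contract_single, contract_single, one_smul, one_smul]

theorem single_apply_eq_zero_of {N : ℕ} {P : Fin N → Fin N → Prop} {a b i j : Fin N}
    (h : ¬P a b) (hij : P i j) : (Matrix.single a b 1 : Matrix (Fin N) (Fin N) ℂ) i j = 0 := by
  rw [Matrix.single_apply, if_neg]
  rintro ⟨rfl, rfl⟩
  exact h hij

/-- The quotient of genus 17. -/
def D17 : QuotientData 9 17 where
  g := LinearEquiv.refl ℂ _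
  odd := odd17
  eqs := binomials17
  eqs_parity := by
    rintro _ ⟨a, b, c, d, h, rfl⟩
    have hpar := odd17_eq_iff h
    by_cases hab : odd17 a = odd17 b
    · left
      intro i j hij
      rw [Matrix.sub_apply,
        single_apply_eq_zero_of (P := fun i j => odd17 i ≠ odd17 j) (not_not.mpr hab) hij,
        single_apply_eq_zero_of (P := fun i j => odd17 i ≠ odd17 j) (not_not.mpr (hpar.mp hab)) hij,
        sub_zero]
    · right
      intro i j hij
      rw [Matrix.sub_apply,
        single_apply_eq_zero_of (P := fun i j => odd17 i = odd17 j) hab hij,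
        single_apply_eq_zero_of (P := fun i j => odd17 i = odd17 j) (mt hpar.mpr hab) hij, sub_zero]
  Z k := Matrix.single (pair17 k).1 (pair17 k).2 1
  Z_even k i j hij := single_apply_eq_zero_of (P := fun i j => odd17 i ≠ odd17 j)
    (not_not.mpr (odd17_pair17 k)) hij
  L i j := X (index17 i j)
  L_hom _ _ := isHomogeneous_X _ _
  L_spec := by
    intro c hc i j hij
    rw [eval_X, contract_single, one_smul]
    have := hc _ ⟨_, _, _, _, index17_spec i j hij, rfl⟩
    rwa [contract_binomial, sub_eq_zero] at this
  Z_L k := by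
    rw [contract_single, one_smul, index17_pair17]

theorem mem_cone17 {c : Fin 10 → ℂ} : c ∈ D17.cone ↔
    ∀ i j k l, exponents17 i + exponents17 j = exponents17 k + exponents17 l →
      c i * c j = c k * c l := by
  constructor
  · intro hc i j k l h
    have := hc _ ⟨i, j, k, l, h, rfl⟩
    rwa [contract_binomial, sub_eq_zero] at this
  · rintro hc _ ⟨i, j, k, l, h, rfl⟩
    rw [contract_binomial, sub_eq_zero]
    exact hc i j k l h

theorem zmap17 (c : Fin 10 → ℂ) (k : Fin 18) :
    D17.zmap c k = c (pair17 k).1 * c (pair17 k).2 := by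
  change contract (Matrix.single (pair17 k).1 (pair17 k).2 1) _ = _
  rw [contract_single, one_smul]

theorem quadric_single {N : ℕ} (a b : Fin N) : quadric (Matrix.single a b 1) = X a * X b := by
  rw [quadric, contract_single, one_smul]

theorem quadric_binomial {N : ℕ} (a b c d : Fin N) :
    quadric (Matrix.single a b 1 - Matrix.single c d 1) = X a * X b - X c * X d :=
  contract_binomial _ _ _ _ _

theorem coneIdeal17 : D17.coneIdeal = RingHom.ker (toricMap exponents17) := by
  have := D17.coneIdeal_eq_ker exponents17 AlgEquiv.refl (by decide) (by
    rintro I rfl s t hs hst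
    refine exists_common17 (fun a b c d h => ?_) s t hs hst
    have : (X a * X b - X c * X d : Poly 10) ∈ D17.coneIdeal :=
      Ideal.subset_span ⟨_, ⟨a, b, c, d, h, rfl⟩, quadric_binomial _ _ _ _⟩
    exact this) (by
    rintro _ ⟨a, b, c, d, h, rfl⟩
    change toricMap _ (quadric _) = 0
    rw [quadric_binomial, map_sub, toricMap_X_mul_X, toricMap_X_mul_X, h, sub_self])
  exact this

theorem coneIdeal17_isPrime : D17.coneIdeal.IsPrime := by
  rw [coneIdeal17]
  exact RingHom.ker_isPrime _

theorem linear17 {F : Poly 18} (hF : F.IsHomogeneous 1) (h : D17.Vanishes F) : F = 0 := by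
  rw [D17.vanishes_iff coneIdeal17_isPrime, coneIdeal17, RingHom.mem_ker] at h
  have hX : ∀ k, ((toricMap exponents17).comp D17.pullback) (X k) =
      monomial (Finsupp.equivFunOnFinite.symm
        (exponents17 (pair17 k).1 + exponents17 (pair17 k).2)) 1 := by
    intro k
    rw [AlgHom.comp_apply, QuotientData.pullback, aeval_X, ← toricMap_X_mul_X, ← quadric_single]
    rfl
  have hinj : ∀ k l, exponents17 (pair17 k).1 + exponents17 (pair17 k).2 =
      exponents17 (pair17 l).1 + exponents17 (pair17 l).2 → k = l := by decide
  refine linear_eq_zero ((toricMap exponents17).comp D17.pullback) (fun k =>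
    Finsupp.equivFunOnFinite.symm (exponents17 (pair17 k).1 + exponents17 (pair17 k).2))
    (fun k => ?_) (fun k l hkl => ?_) hF h
  · rw [hX, coeff_monomial, if_pos rfl]
    exact one_ne_zero
  · rw [hX, coeff_monomial, if_neg]
    intro he
    exact hkl (hinj l k (Finsupp.equivFunOnFinite.symm.injective he)).symm

/-- The exponents of the homogeneous parametrization. -/
def bihomogeneous17 : Fin 10 → Fin 6 → ℕ :=
  ![![0, 2, 0, 2, 1, 0], ![0, 2, 1, 1, 1, 0], ![0, 2, 2, 0, 1, 0], ![1, 1, 0, 2, 1, 0],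
    ![1, 1, 1, 1, 1, 0], ![1, 1, 2, 0, 1, 0], ![2, 0, 0, 2, 1, 0], ![2, 0, 1, 1, 1, 0],
    ![2, 0, 2, 0, 1, 0], ![0, 0, 0, 0, 0, 1]]

theorem bihomogeneous17_spec (a : Fin 10) :
    bihomogeneous17 a 0 = exponents17 a 0 ∧
    bihomogeneous17 a 1 + exponents17 a 0 = 2 * exponents17 a 2 ∧
    bihomogeneous17 a 2 = exponents17 a 1 ∧
    bihomogeneous17 a 3 + exponents17 a 1 = 2 * exponents17 a 2 ∧
    bihomogeneous17 a 4 = exponents17 a 2 ∧ bihomogeneous17 a 5 = exponents17 a 3 := by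
  revert a
  decide

theorem bihomogeneous17_add {a b c d : Fin 10}
    (h : exponents17 a + exponents17 b = exponents17 c + exponents17 d) :
    bihomogeneous17 a + bihomogeneous17 b = bihomogeneous17 c + bihomogeneous17 d := by
  have h0 := congrFun h 0
  have h1 := congrFun h 1
  have h2 := congrFun h 2
  have h3 := congrFun h 3
  simp only [Pi.add_apply] at h0 h1 h2 h3
  obtain ⟨a0, a1, a2, a3, a4, a5⟩ := bihomogeneous17_spec a
  obtain ⟨b0, b1, b2, b3, b4, b5⟩ := bihomogeneous17_spec b
  obtain ⟨c0, c1, c2, c3, c4, c5⟩ := bihomogeneous17_spec c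
  obtain ⟨d0, d1, d2, d3, d4, d5⟩ := bihomogeneous17_spec d
  have key : ∀ k : Fin 6, bihomogeneous17 a k + bihomogeneous17 b k =
      bihomogeneous17 c k + bihomogeneous17 d k := by
    intro k
    fin_cases k <;> simp only [Fin.reduceFinMk, Fin.zero_eta, Fin.mk_one] <;> omega
  exact funext key

theorem param_mem_cone17 (w : Fin 6 → ℂ) : (fun k => ∏ l, w l ^ bihomogeneous17 k l) ∈ D17.cone :=
  mem_cone17.mpr fun _ _ _ _ h => prod_pow_mul_prod_pow w (bihomogeneous17_add h)

/-- The point of the octic del Pezzo surface with given parameters. -/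
abbrev octicPoint (u v : Fin 2 → ℂ) : Fin 9 → ℂ :=
  ![u 1 ^ 2 * v 1 ^ 2, u 1 ^ 2 * (v 0 * v 1), u 1 ^ 2 * v 0 ^ 2,
    u 0 * u 1 * v 1 ^ 2, u 0 * u 1 * (v 0 * v 1), u 0 * u 1 * v 0 ^ 2,
    u 0 ^ 2 * v 1 ^ 2, u 0 ^ 2 * (v 0 * v 1), u 0 ^ 2 * v 0 ^ 2]

theorem cone_of_octicPoint (u v : Fin 2 → ℂ) (a x : ℂ) :
    (Fin.snoc (a • octicPoint u v) x : Fin 10 → ℂ) ∈ D17.cone := by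
  convert param_mem_cone17 ![u 0, u 1, v 0, v 1, a, x] using 1
  funext k
  rw [Fin.prod_univ_six]
  refine Fin.lastCases ?_ (fun k => ?_) k
  · rw [Fin.snoc_last]
    simp [bihomogeneous17, Fin.last]
  · rw [Fin.snoc_castSucc]
    fin_cases k <;> simp [bihomogeneous17] <;> ring

theorem mem_V17_of_octicPoint {c : Fin 10 → ℂ} (hc : c ≠ 0) {u v : Fin 2 → ℂ} (hu : u ≠ 0)
    (hv : v ≠ 0) (h0 : octicPoint u v ≠ 0) (a : ℂ)
    (h : ∀ k : Fin 9, c k.castSucc = a * octicPoint u v k) : mk ℂ c hc ∈ V17 := by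
  have hs : (Fin.snoc (a • octicPoint u v) (c 9) : Fin 10 → ℂ) = c := by
    funext k
    refine Fin.lastCases ?_ (fun k => ?_) k
    · rw [Fin.snoc_last]
      rfl
    · rw [Fin.snoc_castSucc, h]
      rfl
  refine ⟨octicPoint u v, h0, a, c 9, ?_, ⟨u, v, hu, hv, h0, rfl⟩, ?_⟩
  · rw [hs]
    exact hc
  · congr 1
    exact hs.symm

/-- The factors of the coordinates of a point of the octic del Pezzo surface. -/
def octicWord {α : Type} (u v : Fin 2 → α) : Fin 9 → List α :=
  ![[u 1, u 1, v 1, v 1], [u 1, u 1, v 0, v 1], [u 1, u 1, v 0, v 0],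
    [u 0, u 1, v 1, v 1], [u 0, u 1, v 0, v 1], [u 0, u 1, v 0, v 0],
    [u 0, u 0, v 1, v 1], [u 0, u 0, v 0, v 1], [u 0, u 0, v 0, v 0]]

theorem mem_V17 {c : Fin 10 → ℂ} (hc : c ≠ 0) : mk ℂ c hc ∈ V17 ↔ c ∈ D17.cone := by
  constructor
  · rintro ⟨a, ha, s, x, h, ⟨u, v, -, -, h0, hQ⟩, hc'⟩
    rw [mk_eq_mk_iff_smul] at hQ hc'
    obtain ⟨p, -, hp⟩ := hQ
    obtain ⟨q, -, rfl⟩ := hc'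
    refine D17.smul_mem_cone ?_ q
    rw [hp, smul_smul]
    exact cone_of_octicPoint u v (s * p) x
  · intro hmem
    have hprod := fun s t h => QuotientData.prod_eq_of_mem_cone coneIdeal17 hmem s t h
    have hfin : ∀ (p : Fin 9) (A B : Fin 2 → Fin 10) (i j : Fin 2), A i = p.castSucc →
        B j = p.castSucc → (∀ k, ((octicWord A B k).map exponents17).sum =
          ([k.castSucc, p.castSucc, p.castSucc, p.castSucc].map exponents17).sum) →
        c p.castSucc ≠ 0 → mk ℂ c hc ∈ V17 := by
      intro p A B i j hA hB hs hp
      have hk : ∀ k, octicPoint (c ∘ A) (c ∘ B) k = c k.castSucc * c p.castSucc ^ 3 := by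
        intro k
        have hL : octicPoint (c ∘ A) (c ∘ B) k = ((octicWord A B k).map c).prod := by
          fin_cases k <;> simp [octicWord] <;> ring
        rw [hL, hprod _ _ (hs k)]
        simp only [List.map_cons, List.map_nil, List.prod_cons, List.prod_nil]
        ring
      refine mem_V17_of_octicPoint hc (u := c ∘ A) (v := c ∘ B) (fun h => hp (hA ▸ congrFun h i))
        (fun h => hp (hB ▸ congrFun h j)) (fun h0 => ?_) ((c p.castSucc ^ 3)⁻¹) fun k => ?_
      · have := hk p
        rw [h0] at this
        exact mul_ne_zero hp (pow_ne_zero 3 hp) this.symm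
      · rw [hk]
        field_simp
    by_cases h0 : c 0 ≠ 0
    · exact hfin 0 ![3, 0] ![1, 0] 1 1 rfl rfl (by decide) h0
    by_cases h2 : c 2 ≠ 0
    · exact hfin 2 ![5, 2] ![2, 1] 1 0 rfl rfl (by decide) h2
    by_cases h6 : c 6 ≠ 0
    · exact hfin 6 ![6, 3] ![7, 6] 0 1 rfl rfl (by decide) h6
    by_cases h8 : c 8 ≠ 0
    · exact hfin 8 ![8, 5] ![8, 7] 0 0 rfl rfl (by decide) h8
    · push Not at h0 h2 h6 h8
      have hz : ∀ k : Fin 9, c k.castSucc = 0 := by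
        have hsq : ∀ (k p q : Fin 10), exponents17 k + exponents17 k =
            exponents17 p + exponents17 q → c p = 0 → c k = 0 := by
          intro k p q h hp
          have := mem_cone17.mp hmem k k p q h
          rw [hp, zero_mul] at this
          exact mul_self_eq_zero.mp this
        intro k
        match k with
        | 0 => exact h0
        | 1 => exact hsq 1 0 2 (by decide) h0
        | 2 => exact h2
        | 3 => exact hsq 3 0 6 (by decide) h0
        | 4 => exact hsq 4 0 8 (by decide) h0
        | 5 => exact hsq 5 2 8 (by decide) h2
        | 6 => exact h6
        | 7 => exact hsq 7 6 8 (by decide) h6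
        | 8 => exact h8
      refine mem_V17_of_octicPoint hc (u := ![1, 1]) (v := ![1, 1])
        (fun h => one_ne_zero (congrFun h 0)) (fun h => one_ne_zero (congrFun h 0)) (fun h => ?_) 0
        (fun k => by rw [hz, zero_mul])
      have := congrFun h 0
      simp at this

theorem flip17 (v : Fin 10 → ℂ) : D17.flip v = t17Lin v := by
  funext k
  change (if odd17 k then -1 else 1) * v k = _
  fin_cases k <;> simp [odd17, t17Lin]

theorem z17_eq (k : Fin 18) : z17 k = X (pair17 k).1 * X (pair17 k).2 := by
  fin_cases k <;> simp [z17, pair17, sq]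

theorem describes17 : D17.Describes V17 t17 z17 where
  mem v hv := mem_V17 hv
  t_mk v hv := by
    have h0 : D17.flip v ≠ 0 := by
      rw [flip17]
      exact fun h => hv (t17Lin_involutive.injective (h.trans (map_zero _).symm))
    refine ⟨h0, ?_⟩
    rw [t17, Projectivization.map_mk]
    congr 1
    exact (flip17 v).symm
  z_eval v k := by
    change _ = D17.zmap v k
    rw [zmap17, z17_eq, map_mul, eval_X, eval_X]
  z_hom k := by
    rw [z17_eq]
    exact (isHomogeneous_X ℂ _).mul (isHomogeneous_X ℂ _)

theorem cone17_nontrivial : ∃ c ∈ D17.cone, c ≠ 0 :=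
  ⟨_, param_mem_cone17 1, fun h => one_ne_zero (α := ℂ) (by simpa using congrFun h 0)⟩

theorem idealGeneratedByQuadrics17 : IdealGeneratedByQuadrics W17 :=
  describes17.idealGeneratedByQuadrics cone17_nontrivial (fun _ => linear17)
    fun _ => (D17.mem_coneIdeal coneIdeal17_isPrime).mpr

theorem exists_quotient17 : ∃ π : PSp 9 → PSp 17, IsGivenBy V17 z17 π ∧
    IsQuotientOnto V17 t17 W17 π :=
  describes17.exists_quotient describes17.isZariskiClosed_image

theorem exists_roots_quadratic (b c : ℂ) : ∃ r s : ℂ, r + s = b ∧ r * s = c := by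
  obtain ⟨d, hd⟩ := exists_sq (b ^ 2 - 4 * c)
  exact ⟨(b + d) / 2, (b - d) / 2, by ring, by linear_combination (-1 / 4 : ℂ) * hd⟩

theorem isProjectiveVarietyOfDim17 : IsProjectiveVarietyOfDim W17 3 := by
  refine describes17.isProjectiveVarietyOfDim cone17_nontrivial coneIdeal17_isPrime
    ![X 1, X 4, X 2 + X 3, X 5] (E := X 0) (X_ne_zero 0) ?_ ?_
  · intro w hw
    rw [eval_X] at hw
    obtain ⟨a, ha⟩ := exists_sq (w 0)
    obtain ⟨x, hx⟩ := exists_sq (w 3)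
    obtain ⟨r, s, hrs, hrs'⟩ := exists_roots_quadratic (w 2 / w 0) (w 1 / w 0)
    obtain ⟨p, hp⟩ := IsAlgClosed.exists_pow_nat_eq r (n := 4) (by norm_num)
    obtain ⟨q, hq⟩ := IsAlgClosed.exists_pow_nat_eq s (n := 4) (by norm_num)
    refine ⟨_, param_mem_cone17 ![p, 1, q, 1, a, x], fun i => ?_⟩
    rw [← hp, ← hq] at hrs hrs'
    rw [eq_div_iff hw] at hrs hrs'
    fin_cases i <;> simp [zmap17, pair17, bihomogeneous17, Fin.prod_univ_six]
    · linear_combination ha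
    · linear_combination hrs' + p ^ 4 * q ^ 4 * ha
    · linear_combination hrs + (p ^ 4 + q ^ 4) * ha
    · linear_combination hx
  · intro _ hT _
    let y : Fin 10 → Poly 10 ⧸ D17.coneIdeal := fun i => Ideal.Quotient.mk _ (X i)
    change ∀ i, IsIntegral (Poly 4) (y i)
    have hpull : ∀ k, D17.pullback (X k) = X (pair17 k).1 * X (pair17 k).2 := fun k => by
      rw [QuotientData.pullback, aeval_X]
      exact quadric_single _ _
    have hmul : ∀ a b c d, exponents17 a + exponents17 b = exponents17 c + exponents17 d →
        y a * y b = y c * y d := by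
      intro a b c d h
      simp only [y, ← map_mul]
      exact Ideal.Quotient.eq.mpr
        (Ideal.subset_span ⟨_, ⟨a, b, c, d, h, rfl⟩, quadric_binomial _ _ _ _⟩)
    have hsq : ∀ a b c, exponents17 a + exponents17 a = exponents17 b + exponents17 c →
        IsIntegral (Poly 4) (y b) → IsIntegral (Poly 4) (y c) → IsIntegral (Poly 4) (y a) := by
      intro a b c h hb hc
      refine IsIntegral.of_pow two_pos ?_
      rw [sq, hmul a a b c h]
      exact hb.mul hc
    have hroot : ∀ (i : Fin 4) k a, (![X 1, X 4, X 2 + X 3, X 5] i : Poly 18) = X k →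
        pair17 k = (a, a) → IsIntegral (Poly 4) (y a) := by
      intro i k a hi hk
      have := hT i
      rw [hi, hpull, hk, map_mul, ← sq] at this
      exact IsIntegral.of_pow two_pos this
    have h0 := hroot 0 1 0 rfl rfl
    have h8 := hroot 1 4 8 rfl rfl
    have h9 := hroot 3 5 9 rfl rfl
    have hsum : IsIntegral (Poly 4) (y 2 * y 2 + y 6 * y 6) := by
      have := hT 2
      change IsIntegral _ (Ideal.Quotient.mk _ (D17.pullback (X 2 + X 3))) at this
      rwa [map_add, hpull, hpull, map_add, map_mul, map_mul] at this
    have hprod : IsIntegral (Poly 4) (y 2 * y 6) := by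
      rw [hmul 2 6 0 8 (by decide)]
      exact h0.mul h8
    have hquad : ∀ a b, y a * y b = y 2 * y 6 → y a * y a + y b * y b = y 2 * y 2 + y 6 * y 6 →
        IsIntegral (Poly 4) (y a) := by
      intro a b hab hs
      refine IsIntegral.of_pow two_pos ?_
      refine isIntegral_of_cubic hsum (((hprod.pow 2).neg)) isIntegral_zero ?_
      linear_combination y a ^ 4 * hs - y a ^ 2 * (y a * y b + y 2 * y 6) * hab
    have h2 := hquad 2 6 rfl rfl
    have h6 := hquad 6 2 (mul_comm _ _) (add_comm _ _)
    intro i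
    match i with
    | 0 => exact h0
    | 1 => exact hsq 1 0 2 (by decide) h0 h2
    | 2 => exact h2
    | 3 => exact hsq 3 0 6 (by decide) h0 h6
    | 4 => exact hsq 4 0 8 (by decide) h0 h8
    | 5 => exact hsq 5 2 8 (by decide) h2 h8
    | 6 => exact h6
    | 7 => exact hsq 7 6 8 (by decide) h6 h8
    | 8 => exact h8
    | 9 => exact h9

/-! ### The cone over the sextic del Pezzo surface -/

/-- The exponents of the coordinates of the cone over the sextic del Pezzo surface. -/
def exponents13 : Fin 8 → Fin 4 → ℕ :=
  ![![0, 2, 1, 0], ![0, 1, 2, 0], ![2, 0, 1, 0], ![1, 0, 2, 0], ![2, 1, 0, 0], ![1, 2, 0, 0],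
    ![1, 1, 1, 0], ![0, 0, 0, 1]]

/-- The binomials `x_a x_b - x_c x_6` that generate the ideal of the sextic del Pezzo surface. -/
def moves13 : Fin 9 → Fin 8 × Fin 8 × Fin 8 :=
  ![(0, 2, 6), (1, 4, 6), (3, 5, 6), (0, 3, 1), (2, 5, 4), (1, 2, 3), (4, 0, 5), (3, 4, 2),
    (5, 1, 0)]

theorem moves13_spec : ∀ k, exponents13 (moves13 k).1 + exponents13 (moves13 k).2.1 =
    exponents13 6 + exponents13 (moves13 k).2.2 := by decide

/-- A set of vertices of the hexagon without a pair of non-adjacent vertices lies on an edge. -/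
theorem exists_extreme_of_no_move (S : Fin 8 → Bool) (h6 : S 6 = false) (h7 : S 7 = false)
    (h : ∀ k, S (moves13 k).1 = false ∨ S (moves13 k).2.1 = false) :
    ∃ k : Fin 3, (∀ a, S a = true → exponents13 a k.castSucc = 0) ∨
      ∀ a, S a = true → exponents13 a k.castSucc = 2 := by
  have key : ∀ s0 s1 s2 s3 s4 s5 : Bool,
      (∀ k, ![s0, s1, s2, s3, s4, s5, false, false] (moves13 k).1 = false ∨
        ![s0, s1, s2, s3, s4, s5, false, false] (moves13 k).2.1 = false) →
      ∃ k : Fin 3,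
        (∀ a, ![s0, s1, s2, s3, s4, s5, false, false] a = true → exponents13 a k.castSucc = 0) ∨
        ∀ a, ![s0, s1, s2, s3, s4, s5, false, false] a = true → exponents13 a k.castSucc = 2 := by
    decide
  have hS : S = ![S 0, S 1, S 2, S 3, S 4, S 5, false, false] := by
    funext a
    fin_cases a <;> first | rfl | exact h6 | exact h7
  have := key (S 0) (S 1) (S 2) (S 3) (S 4) (S 5)
  rw [← hS] at this
  exact this h

theorem sum_exponents13 {s : Multiset (Fin 8)} (k : Fin 4) :
    (s.map exponents13).sum k = (s.map fun a => exponents13 a k).sum := by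
  induction s using Multiset.induction_on with
  | empty => simp
  | cons a s ih => simp [ih]

theorem card_eq_sum13 {s : Multiset (Fin 8)} :
    3 * Multiset.card s = (s.map exponents13).sum 0 + (s.map exponents13).sum 1 +
      (s.map exponents13).sum 2 + 3 * (s.map exponents13).sum 3 := by
  induction s using Multiset.induction_on with
  | empty => simp
  | cons a s ih =>
    have : exponents13 a 0 + exponents13 a 1 + exponents13 a 2 + 3 * exponents13 a 3 = 3 := by
      revert a
      decide
    simp only [Multiset.card_cons, Multiset.map_cons, Multiset.sum_cons, Pi.add_apply]
    omega

theorem sum_vertex13_eq_zero_iff {s : Multiset (Fin 8)} :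
    (s.map exponents13).sum 3 = 0 ↔ ∀ a ∈ s, a ≠ 7 := by
  rw [sum_exponents13, Multiset.sum_eq_zero_iff]
  simp only [Multiset.mem_map, forall_exists_index, and_imp, forall_apply_eq_imp_iff₂]
  refine forall₂_congr fun a ha => ?_
  clear ha
  revert a
  decide

section toric13

variable {I : Ideal (Poly 8)}
  (hI : ∀ k, (X (moves13 k).1 * X (moves13 k).2.1 - X 6 * X (moves13 k).2.2 : Poly 8) ∈ I)
include hI

theorem exists_center {s : Multiset (Fin 8)} (h7 : ∀ a ∈ s, a ≠ 7)
    (hlow : ∀ k : Fin 3, (s.map exponents13).sum k.castSucc ≠ 0)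
    (hup : ∀ k : Fin 3, (s.map exponents13).sum k.castSucc ≠ 2 * Multiset.card s) :
    ∃ s', Congruent exponents13 I s (6 ::ₘ s') := by
  by_cases h6 : 6 ∈ s
  · obtain ⟨s', rfl⟩ := Multiset.exists_cons_of_mem h6
    exact ⟨s', Congruent.refl _⟩
  by_cases hmove : ∃ k, (moves13 k).1 ∈ s ∧ (moves13 k).2.1 ∈ s
  · obtain ⟨k, h1, h2⟩ := hmove
    obtain ⟨s1, rfl⟩ := Multiset.exists_cons_of_mem h1
    have hne : ∀ k, (moves13 k).2.1 ≠ (moves13 k).1 := by decide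
    obtain ⟨s2, rfl⟩ := Multiset.exists_cons_of_mem ((Multiset.mem_cons.mp h2).resolve_left (hne k))
    exact ⟨_, Congruent.pair (moves13_spec k) (hI k) s2⟩
  · exfalso
    obtain ⟨k, hk | hk⟩ := exists_extreme_of_no_move (fun a => decide (a ∈ s)) (by simpa using h6)
      (by simpa using fun h => h7 7 h rfl) (fun k => by
        by_contra hc
        push Not at hc
        exact hmove ⟨k, by simpa using hc.1, by simpa using hc.2⟩)
    · apply hlow k
      rw [sum_exponents13, Multiset.sum_eq_zero_iff]
      intro x hx
      obtain ⟨a, ha, rfl⟩ := Multiset.mem_map.mp hx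
      exact hk a (by simpa using ha)
    · apply hup k
      rw [sum_exponents13, Multiset.map_congr rfl (fun a ha => hk a (by simpa using ha))]
      simp [mul_comm]

omit hI in
theorem mem_of_edge {s t : Multiset (Fin 8)} (hst : (s.map exponents13).sum = (t.map exponents13).sum)
    {a b : Fin 8} {k : Fin 4} (hab : exponents13 a k < exponents13 b k)
    (hs : ∀ c ∈ s, c = a ∨ c = b) (ht : ∀ c ∈ t, c = a ∨ c = b) (hb : b ∈ s) :
    b ∈ t ∨ Multiset.card s ≠ Multiset.card t := by
  by_contra! hc
  obtain ⟨hb', hcard⟩ := hc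
  have hta : t = Multiset.replicate (Multiset.card t) a := by
    rw [Multiset.eq_replicate]
    exact ⟨rfl, fun c hc => (ht c hc).resolve_right fun h => hb' (h ▸ hc)⟩
  have h1 := congrFun hst k
  rw [sum_exponents13, sum_exponents13, hta, Multiset.map_replicate, Multiset.sum_replicate,
    ← hcard] at h1
  obtain ⟨s', rfl⟩ := Multiset.exists_cons_of_mem hb
  have h2 := Multiset.card_nsmul_le_sum (s := s'.map fun c => exponents13 c k)
    (a := exponents13 a k) (by
      intro x hx
      obtain ⟨c, hc, rfl⟩ := Multiset.mem_map.mp hx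
      rcases hs c (by simp [hc]) with rfl | rfl
      · exact le_rfl
      · exact hab.le)
  simp only [Multiset.map_cons, Multiset.sum_cons, Multiset.card_cons, Multiset.card_map,
    smul_eq_mul, add_mul] at h1 h2
  omega

omit hI in
theorem exists_common_edge {s t : Multiset (Fin 8)} (hs0 : s ≠ 0)
    (hst : (s.map exponents13).sum = (t.map exponents13).sum)
    (hcard : Multiset.card s = Multiset.card t)
    {a b : Fin 8} {k : Fin 4} (hab : exponents13 a k < exponents13 b k)
    (hs : ∀ c ∈ s, c = a ∨ c = b) (ht : ∀ c ∈ t, c = a ∨ c = b) : ∃ c, c ∈ s ∧ c ∈ t := by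
  by_cases hb : b ∈ s
  · exact ⟨b, hb, (mem_of_edge hst hab hs ht hb).resolve_right (not_not.mpr hcard)⟩
  · have hb' : b ∉ t := fun h =>
      hb ((mem_of_edge hst.symm hab ht hs h).resolve_right (not_not.mpr hcard.symm))
    obtain ⟨c, hc⟩ := Multiset.exists_mem_of_ne_zero hs0
    obtain ⟨d, hd⟩ := Multiset.exists_mem_of_ne_zero (s := t) (by
      rintro rfl
      exact hs0 (by simpa using hcard))
    have hca := (hs c hc).resolve_right fun h => hb (h ▸ hc)
    have hda := (ht d hd).resolve_right fun h => hb' (h ▸ hd)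
    exact ⟨a, hca ▸ hc, hda ▸ hd⟩

theorem exists_common13 (s t : Multiset (Fin 8)) (hs : s ≠ 0)
    (hst : (s.map exponents13).sum = (t.map exponents13).sum) :
    ∃ k s' t', Congruent exponents13 I s (k ::ₘ s') ∧ Congruent exponents13 I t (k ::ₘ t') := by
  have hcard : Multiset.card s = Multiset.card t := by
    have h1 := card_eq_sum13 (s := s)
    have h2 := card_eq_sum13 (s := t)
    rw [hst] at h1
    omega
  have hfin : (∃ c, c ∈ s ∧ c ∈ t) → ∃ k s' t', Congruent exponents13 I s (k ::ₘ s') ∧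
      Congruent exponents13 I t (k ::ₘ t') := by
    rintro ⟨c, hc, hc'⟩
    obtain ⟨s', rfl⟩ := Multiset.exists_cons_of_mem hc
    obtain ⟨t', rfl⟩ := Multiset.exists_cons_of_mem hc'
    exact ⟨c, s', t', Congruent.refl _, Congruent.refl _⟩
  by_cases h7 : (s.map exponents13).sum 3 = 0
  · have h7s := sum_vertex13_eq_zero_iff.mp h7
    have h7t := sum_vertex13_eq_zero_iff.mp (hst ▸ h7)
    have hzero : ∀ u : Multiset (Fin 8), ∀ k : Fin 3, (u.map exponents13).sum k.castSucc = 0 →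
        ∀ c ∈ u, exponents13 c k.castSucc = 0 := by
      intro u k h c hc
      rw [sum_exponents13, Multiset.sum_eq_zero_iff] at h
      exact h _ (Multiset.mem_map_of_mem _ hc)
    have htwo : ∀ u : Multiset (Fin 8), ∀ k : Fin 3,
        (u.map exponents13).sum k.castSucc = 2 * Multiset.card u →
        ∀ c ∈ u, exponents13 c k.castSucc = 2 := by
      intro u k h c hc
      have hle : ∀ (a : Fin 8) (k : Fin 4), exponents13 a k ≤ 2 := by decide
      by_contra hne
      obtain ⟨u', rfl⟩ := Multiset.exists_cons_of_mem hc
      have h2 := Multiset.sum_le_card_nsmul (u'.map fun c => exponents13 c k.castSucc) 2 (by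
        intro x hx
        obtain ⟨c, hc, rfl⟩ := Multiset.mem_map.mp hx
        exact hle _ _)
      have h3 := hle c k.castSucc
      rw [sum_exponents13] at h
      simp only [Multiset.map_cons, Multiset.sum_cons, Multiset.card_cons, Multiset.card_map,
        smul_eq_mul] at h h2
      omega
    have edge0 : ∀ k : Fin 3, ∃ (a b : Fin 8) (l : Fin 4), exponents13 a l < exponents13 b l ∧
        ∀ c, c ≠ 7 → exponents13 c k.castSucc = 0 → c = a ∨ c = b := by decide
    have edge2 : ∀ k : Fin 3, ∃ (a b : Fin 8) (l : Fin 4), exponents13 a l < exponents13 b l ∧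
        ∀ c, c ≠ 7 → exponents13 c k.castSucc = 2 → c = a ∨ c = b := by decide
    by_cases hlow : ∃ k : Fin 3, (s.map exponents13).sum k.castSucc = 0
    · obtain ⟨k, hk⟩ := hlow
      obtain ⟨a, b, l, hab, hc⟩ := edge0 k
      exact hfin (exists_common_edge hs hst hcard hab
        (fun c hcs => hc c (h7s c hcs) (hzero s k hk c hcs))
        (fun c hct => hc c (h7t c hct) (hzero t k (hst ▸ hk) c hct)))
    by_cases hup : ∃ k : Fin 3, (s.map exponents13).sum k.castSucc = 2 * Multiset.card s
    · obtain ⟨k, hk⟩ := hup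
      obtain ⟨a, b, l, hab, hc⟩ := edge2 k
      exact hfin (exists_common_edge hs hst hcard hab
        (fun c hcs => hc c (h7s c hcs) (htwo s k hk c hcs))
        (fun c hct => hc c (h7t c hct) (htwo t k (by rw [← hst, ← hcard, hk]) c hct)))
    push Not at hlow hup
    obtain ⟨s', hs'⟩ := exists_center hI h7s hlow hup
    obtain ⟨t', ht'⟩ := exists_center hI h7t (by rwa [← hst]) (by rwa [← hst, ← hcard])
    exact ⟨6, s', t', hs', ht'⟩
  · have hmem : ∀ u : Multiset (Fin 8), (u.map exponents13).sum 3 ≠ 0 → 7 ∈ u := by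
      intro u hu
      rw [ne_eq, sum_vertex13_eq_zero_iff] at hu
      push Not at hu
      obtain ⟨a, ha, rfl⟩ := hu
      exact ha
    exact hfin ⟨7, hmem s h7, hmem t (hst ▸ h7)⟩

end toric13

/-! ### The quotient of genus 13 -/

/-- The matrix with the listed entries. -/
def listMatrix {N : ℕ} (l : List (ℂ × Fin N × Fin N)) : Matrix (Fin N) (Fin N) ℂ :=
  (l.map fun p => p.1 • Matrix.single p.2.1 p.2.2 (1 : ℂ)).sum

theorem contract_listMatrix {N : ℕ} {A : Type} [AddCommGroup A] [Module ℂ A]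
    (l : List (ℂ × Fin N × Fin N)) (f : Fin N → Fin N → A) :
    contract (listMatrix l) f = (l.map fun p => p.1 • f p.2.1 p.2.2).sum := by
  unfold listMatrix
  induction l with
  | nil => simp [contract]
  | cons p l ih =>
    rw [List.map_cons, List.sum_cons, contract_add, ih, contract_smul, contract_single, one_smul,
      List.map_cons, List.sum_cons]

theorem listMatrix_apply_eq_zero {N : ℕ} {l : List (ℂ × Fin N × Fin N)} {P : Fin N → Fin N → Prop}
    (h : ∀ p ∈ l, ¬P p.2.1 p.2.2) {i j : Fin N} (hij : P i j) : listMatrix l i j = 0 := by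
  unfold listMatrix
  induction l with
  | nil => simp
  | cons p l ih =>
    rw [List.map_cons, List.sum_cons, Matrix.add_apply, ih fun q hq => h q (by simp [hq]),
      Matrix.smul_apply, single_apply_eq_zero_of (h p (by simp)) hij, smul_zero, add_zero]

/-- The change of coordinates that diagonalizes the involution of genus 13. -/
def diagonalize13 : (Fin 8 → ℂ) ≃ₗ[ℂ] (Fin 8 → ℂ) where
  toFun w := ![w 6, w 0 + w 2, w 1 + w 4, w 3 + w 5, w 0 - w 2, w 1 - w 4, w 3 - w 5, w 7]
  invFun c := ![(c 1 + c 4) / 2, (c 2 + c 5) / 2, (c 1 - c 4) / 2, (c 3 + c 6) / 2,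
    (c 2 - c 5) / 2, (c 3 - c 6) / 2, c 0, c 7]
  map_add' v w := by
    ext i
    fin_cases i <;> simp <;> ring
  map_smul' a w := by
    ext i
    fin_cases i <;> simp <;> ring
  left_inv w := by
    ext i
    fin_cases i <;> simp
  right_inv w := by
    ext i
    fin_cases i <;> simp <;> ring

/-- The parity of the coordinates of the cone of genus 13. -/
def odd13 : Fin 8 → Bool := ![false, false, false, false, true, true, true, true]

/-- The equations of the cone over the sextic del Pezzo surface, in diagonal coordinates. -/
def equations13 : Fin 9 → List (ℂ × Fin 8 × Fin 8) :=
  ![[(1, 1, 1), (-1, 4, 4), (-4, 0, 0)], [(1, 2, 2), (-1, 5, 5), (-4, 0, 0)],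
    [(1, 3, 3), (-1, 6, 6), (-4, 0, 0)], [(1, 1, 3), (1, 4, 6), (-2, 0, 2)],
    [(1, 1, 2), (-1, 4, 5), (-2, 0, 3)], [(1, 2, 3), (-1, 5, 6), (-2, 0, 1)],
    [(1, 1, 6), (1, 4, 3), (-2, 0, 5)], [(1, 5, 1), (-1, 2, 4), (-2, 0, 6)],
    [(1, 5, 3), (-1, 2, 6), (-2, 0, 4)]]

/-- The forms of genus 13, in diagonal coordinates. -/
def forms13 : Fin 14 → List (ℂ × Fin 8 × Fin 8) :=
  ![[(1, 0, 0)], [(1 / 2, 1, 1), (1 / 2, 4, 4)], [(1 / 2, 2, 2), (1 / 2, 5, 5)],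
    [(1 / 2, 3, 3), (1 / 2, 6, 6)], [(1, 0, 1)], [(1, 0, 2)], [(1, 0, 3)],
    [(1 / 2, 1, 2), (1 / 2, 4, 5)], [(1 / 2, 1, 3), (-1 / 2, 4, 6)],
    [(1 / 2, 2, 3), (1 / 2, 5, 6)], [(1, 4, 7)], [(1, 5, 7)], [(1, 6, 7)], [(1, 7, 7)]]

/-- The linear form that agrees on the cone with the product of two coordinates of equal parity. -/
def linear13 : Fin 8 → Fin 8 → Poly 14 :=
  ![![X 0, X 4, X 5, X 6, 0, 0, 0, 0],
    ![X 4, X 1 + C 2 * X 0, X 7 + X 6, X 8 + X 5, 0, 0, 0, 0],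
    ![X 5, X 7 + X 6, X 2 + C 2 * X 0, X 9 + X 4, 0, 0, 0, 0],
    ![X 6, X 8 + X 5, X 9 + X 4, X 3 + C 2 * X 0, 0, 0, 0, 0],
    ![0, 0, 0, 0, X 1 - C 2 * X 0, X 7 - X 6, X 5 - X 8, X 10],
    ![0, 0, 0, 0, X 7 - X 6, X 2 - C 2 * X 0, X 9 - X 4, X 11],
    ![0, 0, 0, 0, X 5 - X 8, X 9 - X 4, X 3 - C 2 * X 0, X 12],
    ![0, 0, 0, 0, X 10, X 11, X 12, X 13]]

/-- The equations of the cone of genus 13, evaluated. -/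
structure OnCone13 {R : Type} [CommRing R] (c : Fin 8 → R) : Prop where
  e0 : c 1 * c 1 - c 4 * c 4 - 4 * (c 0 * c 0) = 0
  e1 : c 2 * c 2 - c 5 * c 5 - 4 * (c 0 * c 0) = 0
  e2 : c 3 * c 3 - c 6 * c 6 - 4 * (c 0 * c 0) = 0
  e3 : c 1 * c 3 + c 4 * c 6 - 2 * (c 0 * c 2) = 0
  e4 : c 1 * c 2 - c 4 * c 5 - 2 * (c 0 * c 3) = 0
  e5 : c 2 * c 3 - c 5 * c 6 - 2 * (c 0 * c 1) = 0
  e6 : c 1 * c 6 + c 4 * c 3 - 2 * (c 0 * c 5) = 0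
  e7 : c 5 * c 1 - c 2 * c 4 - 2 * (c 0 * c 6) = 0
  e8 : c 5 * c 3 - c 2 * c 6 - 2 * (c 0 * c 4) = 0

theorem forall_equations13_iff {R : Type} [CommRing R] [Algebra ℂ R] (c : Fin 8 → R) :
    (∀ k, contract (listMatrix (equations13 k)) (fun i j => c i * c j) = 0) ↔ OnCone13 c := by
  have hs : ∀ (m : ℕ) [m.AtLeastTwo] (x : R), (OfNat.ofNat m : ℂ) • x = (OfNat.ofNat m : R) * x :=
    fun m _ x => by
      rw [Algebra.smul_def, map_ofNat]
  have key : ∀ k, contract (listMatrix (equations13 k)) (fun i j => c i * c j) =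
      ![c 1 * c 1 - c 4 * c 4 - 4 * (c 0 * c 0), c 2 * c 2 - c 5 * c 5 - 4 * (c 0 * c 0),
        c 3 * c 3 - c 6 * c 6 - 4 * (c 0 * c 0), c 1 * c 3 + c 4 * c 6 - 2 * (c 0 * c 2),
        c 1 * c 2 - c 4 * c 5 - 2 * (c 0 * c 3), c 2 * c 3 - c 5 * c 6 - 2 * (c 0 * c 1),
        c 1 * c 6 + c 4 * c 3 - 2 * (c 0 * c 5), c 5 * c 1 - c 2 * c 4 - 2 * (c 0 * c 6),
        c 5 * c 3 - c 2 * c 6 - 2 * (c 0 * c 4)] k := by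
    intro k
    rw [contract_listMatrix]
    fin_cases k <;> simp [equations13, hs] <;> ring
  simp only [key]
  constructor
  · intro h
    exact ⟨h 0, h 1, h 2, h 3, h 4, h 5, h 6, h 7, h 8⟩
  · rintro ⟨h0, h1, h2, h3, h4, h5, h6, h7, h8⟩ k
    fin_cases k <;> assumption

theorem contract_forms13 {R : Type} [CommRing R] [Algebra ℂ R] (f : Fin 8 → Fin 8 → R) (k : Fin 14) :
    contract (listMatrix (forms13 k)) f =
      ![f 0 0, (1 / 2 : ℂ) • (f 1 1 + f 4 4), (1 / 2 : ℂ) • (f 2 2 + f 5 5),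
        (1 / 2 : ℂ) • (f 3 3 + f 6 6), f 0 1, f 0 2, f 0 3, (1 / 2 : ℂ) • (f 1 2 + f 4 5),
        (1 / 2 : ℂ) • (f 1 3 - f 4 6), (1 / 2 : ℂ) • (f 2 3 + f 5 6), f 4 7, f 5 7, f 6 7,
        f 7 7] k := by
  rw [contract_listMatrix]
  fin_cases k <;> simp [forms13, smul_add, neg_div, sub_eq_add_neg]

/-- The values of the forms of genus 13 in diagonal coordinates. -/
abbrev zvec13 (c : Fin 8 → ℂ) : Fin 14 → ℂ :=
  ![c 0 * c 0, (c 1 * c 1 + c 4 * c 4) / 2, (c 2 * c 2 + c 5 * c 5) / 2,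
    (c 3 * c 3 + c 6 * c 6) / 2, c 0 * c 1, c 0 * c 2, c 0 * c 3, (c 1 * c 2 + c 4 * c 5) / 2,
    (c 1 * c 3 - c 4 * c 6) / 2, (c 2 * c 3 + c 5 * c 6) / 2, c 4 * c 7, c 5 * c 7, c 6 * c 7,
    c 7 * c 7]

theorem contract_forms13_eq (c : Fin 8 → ℂ) :
    (fun k => contract (listMatrix (forms13 k)) fun i j => c i * c j) = zvec13 c := by
  funext k
  rw [contract_forms13]
  fin_cases k <;> simp <;> ring

theorem eval_linear13 {c : Fin 8 → ℂ} (hc : OnCone13 c) (i j : Fin 8) (h : odd13 i = odd13 j) :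
    eval (zvec13 c) (linear13 i j) = c i * c j := by
  obtain ⟨e0, e1, e2, e3, e4, e5, -, -, -⟩ := hc
  fin_cases i <;> fin_cases j <;> first
    | (exfalso; revert h; decide)
    | (simp [linear13]; done)
    | (simp [linear13]; first
        | ring1
        | linear_combination e0 / 2
        | linear_combination -e0 / 2
        | linear_combination e1 / 2
        | linear_combination -e1 / 2
        | linear_combination e2 / 2
        | linear_combination -e2 / 2
        | linear_combination e3 / 2
        | linear_combination -e3 / 2
        | linear_combination e4 / 2
        | linear_combination -e4 / 2
        | linear_combination e5 / 2
        | linear_combination -e5 / 2)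

theorem linear13_isHomogeneous (i j : Fin 8) : (linear13 i j).IsHomogeneous 1 := by
  have h0 : (0 : Poly 14).IsHomogeneous 1 := isHomogeneous_zero _ _ _
  have hX := fun k : Fin 14 => isHomogeneous_X ℂ k
  have hC : ∀ k : Fin 14, (C 2 * X k : Poly 14).IsHomogeneous 1 := fun k => (hX k).C_mul _
  fin_cases i <;> fin_cases j <;> simp only [linear13, Fin.reduceFinMk, Fin.zero_eta, Fin.mk_one,
    Matrix.cons_val] <;> first
      | with_reducible exact h0
      | with_reducible exact hX _
      | with_reducible exact IsHomogeneous.add (hX _) (hX _)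
      | with_reducible exact IsHomogeneous.sub (hX _) (hX _)
      | with_reducible exact IsHomogeneous.add (hX _) (hC _)
      | with_reducible exact IsHomogeneous.sub (hX _) (hC _)

theorem contract_forms13_linear13 (k : Fin 14) :
    contract (listMatrix (forms13 k)) linear13 = X k := by
  rw [contract_forms13]
  have h2 : ∀ x : Poly 14, (1 / 2 : ℂ) • (x + x) = x := fun x => by
    rw [← two_smul ℂ, smul_smul]
    norm_num
  have h3 : ∀ x y : Poly 14, x = y + y → (1 / 2 : ℂ) • x = y := fun x y h => by rw [h, h2]
  fin_cases k <;> simp only [linear13, Fin.reduceFinMk, Fin.zero_eta, Fin.mk_one,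
    Matrix.cons_val] <;>
    exact h3 _ _ (by ring)

/-- The quotient of genus 13. -/
def D13 : QuotientData 7 13 where
  g := diagonalize13
  odd := odd13
  eqs := Set.range fun k => listMatrix (equations13 k)
  eqs_parity := by
    rintro _ ⟨k, rfl⟩
    have hk : (∀ p ∈ equations13 k, ¬odd13 p.2.1 ≠ odd13 p.2.2) ∨
        (∀ p ∈ equations13 k, ¬odd13 p.2.1 = odd13 p.2.2) := by
      fin_cases k <;> simp [equations13, odd13]
    rcases hk with hk | hk
    · exact Or.inl fun i j hij => listMatrix_apply_eq_zero (P := fun i j => odd13 i ≠ odd13 j) hk hij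
    · exact Or.inr fun i j hij => listMatrix_apply_eq_zero (P := fun i j => odd13 i = odd13 j) hk hij
  Z k := listMatrix (forms13 k)
  Z_even k i j hij := by
    have hk : ∀ p ∈ forms13 k, ¬odd13 p.2.1 ≠ odd13 p.2.2 := by
      fin_cases k <;> simp [forms13, odd13]
    exact listMatrix_apply_eq_zero (P := fun i j => odd13 i ≠ odd13 j) hk hij
  L := linear13
  L_hom := linear13_isHomogeneous
  L_spec c hc i j hij := by
    rw [contract_forms13_eq]
    exact eval_linear13 ((forall_equations13_iff c).mp (Set.forall_mem_range.mp hc)) i j hij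
  Z_L := contract_forms13_linear13

theorem mem_cone13 {c : Fin 8 → ℂ} : c ∈ D13.cone ↔ OnCone13 c := by
  rw [← forall_equations13_iff]
  exact Set.forall_mem_range

theorem zmap13 (c : Fin 8 → ℂ) : D13.zmap c = zvec13 c := contract_forms13_eq c

/-- The diagonal coordinates of genus 13 in terms of the original ones. -/
abbrev diag13 {R : Type} [CommRing R] (x : Fin 8 → R) : Fin 8 → R :=
  ![x 6, x 0 + x 2, x 1 + x 4, x 3 + x 5, x 0 - x 2, x 1 - x 4, x 3 - x 5, x 7]

theorem onCone13_diag_iff {R : Type} [CommRing R] [Algebra ℂ R] (x : Fin 8 → R) :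
    OnCone13 (diag13 x) ↔
      ∀ k, x (moves13 k).1 * x (moves13 k).2.1 = x 6 * x (moves13 k).2.2 := by
  constructor
  · rintro ⟨e0, e1, e2, e3, e4, e5, e6, e7, e8⟩ k
    have h4 : ∀ y z : R, 4 * (y - z) = 0 → y = z := fun y z h => by
      have : (4 : ℂ) • (y - z) = 0 := by
        rw [Algebra.smul_def, map_ofNat, h]
      have h2 := congrArg (fun u => (4⁻¹ : ℂ) • u) this
      simp only [smul_smul, smul_zero] at h2
      norm_num at h2
      exact sub_eq_zero.mp h2
    simp only [diag13, Matrix.cons_val] at e0 e1 e2 e3 e4 e5 e6 e7 e8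
    refine h4 _ _ ?_
    fin_cases k <;> simp only [moves13, Fin.reduceFinMk, Fin.zero_eta, Fin.mk_one, Matrix.cons_val] <;> first
      | linear_combination e0
      | linear_combination e1
      | linear_combination e2
      | linear_combination e3 + e6
      | linear_combination e3 - e6
      | linear_combination e4 + e7
      | linear_combination e4 - e7
      | linear_combination e5 + e8
      | linear_combination e5 - e8
  · intro h
    have h0 := h 0
    have h1 := h 1
    have h2 := h 2
    have h3 := h 3
    have h4 := h 4
    have h5 := h 5
    have h6 := h 6
    have h7 := h 7
    have h8 := h 8
    simp only [moves13, Matrix.cons_val] at h0 h1 h2 h3 h4 h5 h6 h7 h8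
    constructor <;> simp only [diag13, Matrix.cons_val]
    · linear_combination 4 * h0
    · linear_combination 4 * h1
    · linear_combination 4 * h2
    · linear_combination 2 * h3 + 2 * h4
    · linear_combination 2 * h5 + 2 * h6
    · linear_combination 2 * h7 + 2 * h8
    · linear_combination 2 * h3 - 2 * h4
    · linear_combination 2 * h5 - 2 * h6
    · linear_combination 2 * h8 - 2 * h7

theorem C_half_mul_two : (C (1 / 2) : Poly 8) * 2 = 1 := by
  rw [show (2 : Poly 8) = C 2 from (map_ofNat C 2).symm, ← C_mul]
  norm_num

/-- The change of coordinates of genus 13, on polynomials. -/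
def diagEquiv13 : Poly 8 ≃ₐ[ℂ] Poly 8 :=
  AlgEquiv.ofAlgHom (aeval (diag13 X))
    (aeval ![C (1 / 2) * (X 1 + X 4), C (1 / 2) * (X 2 + X 5), C (1 / 2) * (X 1 - X 4),
      C (1 / 2) * (X 3 + X 6), C (1 / 2) * (X 2 - X 5), C (1 / 2) * (X 3 - X 6), X 0, X 7])
    (by
      have h2 := C_half_mul_two
      refine MvPolynomial.algHom_ext fun i => ?_
      rw [AlgHom.comp_apply, aeval_X, AlgHom.id_apply]
      fin_cases i <;> simp [-map_div₀, -one_div, MvPolynomial.algebraMap_eq] <;>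
        first
          | (linear_combination (X 0 : Poly 8) * h2)
          | (linear_combination (X 1 : Poly 8) * h2)
          | (linear_combination (X 2 : Poly 8) * h2)
          | (linear_combination (X 3 : Poly 8) * h2)
          | (linear_combination (X 4 : Poly 8) * h2)
          | (linear_combination (X 5 : Poly 8) * h2))
    (by
      have h2 := C_half_mul_two
      refine MvPolynomial.algHom_ext fun i => ?_
      rw [AlgHom.comp_apply, aeval_X, AlgHom.id_apply]
      fin_cases i <;> simp [-map_div₀, -one_div] <;>
        first
          | (linear_combination (X 1 : Poly 8) * h2)
          | (linear_combination (X 2 : Poly 8) * h2)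
          | (linear_combination (X 3 : Poly 8) * h2)
          | (linear_combination (X 4 : Poly 8) * h2)
          | (linear_combination (X 5 : Poly 8) * h2)
          | (linear_combination (X 6 : Poly 8) * h2))

theorem diagEquiv13_X (i : Fin 8) : diagEquiv13 (X i) = diag13 X i := by
  change aeval _ _ = _
  rw [aeval_X]

theorem map_diag13 {R S : Type} [CommRing R] [CommRing S] (f : R →+* S) (x : Fin 8 → R)
    (i : Fin 8) : f (diag13 x i) = diag13 (fun j => f (x j)) i := by
  fin_cases i <;> simp

theorem diag13_symm {R : Type} [CommRing R] (f : Poly 8 →+* R) :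
    (fun i => f (X i)) = diag13 fun i => f (diagEquiv13.symm (X i)) := by
  funext i
  have : (X i : Poly 8) = diag13 (fun j => diagEquiv13.symm (X j)) i := by
    have := map_diag13 (R := Poly 8) (S := Poly 8) diagEquiv13.symm.toAlgHom.toRingHom X i
    rw [← diagEquiv13_X] at this
    exact (diagEquiv13.symm_apply_apply (X i)).symm.trans this
  conv_lhs => rw [this]
  exact map_diag13 f _ i

theorem onCone13_mk : OnCone13 fun i => Ideal.Quotient.mk D13.coneIdeal (X i) := by
  rw [← forall_equations13_iff]
  intro k
  have h1 : quadric (listMatrix (equations13 k)) ∈ D13.coneIdeal := Ideal.subset_span ⟨_, ⟨k, rfl⟩, rfl⟩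
  have h2 := map_contract (Ideal.Quotient.mkₐ ℂ D13.coneIdeal) (listMatrix (equations13 k))
    fun i j => X i * X j
  rw [← (Ideal.Quotient.eq_zero_iff_mem.mpr h1 : Ideal.Quotient.mk D13.coneIdeal _ = 0)]
  exact (h2.trans (by simp)).symm

theorem toricMap_diagEquiv13_contract (β : Matrix (Fin 8) (Fin 8) ℂ) :
    ((toricMap exponents13).comp diagEquiv13.toAlgHom) (contract β fun i j => X i * X j) =
      contract β fun i j => diag13 (fun i => toricMap exponents13 (X i)) i *
        diag13 (fun i => toricMap exponents13 (X i)) j := by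
  have hX : ∀ i, ((toricMap exponents13).comp diagEquiv13.toAlgHom) (X i) =
      diag13 (fun i => toricMap exponents13 (X i)) i := fun i =>
    (congrArg _ (diagEquiv13_X i)).trans (map_diag13 (toricMap exponents13 : Poly 8 →+* Poly 4) X i)
  simp only [map_contract, map_mul, hX]

theorem coneIdeal13 : D13.coneIdeal =
    RingHom.ker ((toricMap exponents13).comp diagEquiv13.toAlgHom) := by
  refine D13.coneIdeal_eq_ker exponents13 diagEquiv13 (by decide) ?_ ?_
  · rintro I rfl s t hs hst
    refine exists_common13 (fun k => ?_) s t hs hst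
    rw [Ideal.mem_comap]
    have h := onCone13_mk
    rw [diag13_symm, onCone13_diag_iff] at h
    have := h k
    rw [← map_mul, ← map_mul, ← map_mul, ← map_mul, Ideal.Quotient.eq, ← map_sub] at this
    exact this
  · rintro _ ⟨k, rfl⟩
    have h : OnCone13 (diag13 fun i => toricMap exponents13 (X i)) := by
      rw [onCone13_diag_iff]
      intro k
      rw [← map_mul, ← map_mul, toricMap_X_mul_X, toricMap_X_mul_X, moves13_spec]
    rw [← forall_equations13_iff] at h
    exact (toricMap_diagEquiv13_contract _).trans (h k)

theorem coneIdeal13_isPrime : D13.coneIdeal.IsPrime := by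
  rw [coneIdeal13]
  exact RingHom.ker_isPrime _

/-- The exponents of the terms of the forms of genus 13. -/
def terms13 : Fin 14 → (Fin 8 × Fin 8) × (Fin 8 × Fin 8) :=
  ![((6, 6), (6, 6)), ((0, 0), (2, 2)), ((1, 1), (4, 4)), ((3, 3), (5, 5)), ((0, 6), (2, 6)),
    ((1, 6), (4, 6)), ((3, 6), (5, 6)), ((0, 1), (2, 4)), ((2, 3), (0, 5)), ((1, 3), (4, 5)),
    ((0, 7), (2, 7)), ((1, 7), (4, 7)), ((3, 7), (5, 7)), ((7, 7), (7, 7))]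

/-- The coefficients of the second terms of the forms of genus 13. -/
def signs13 : Fin 14 → ℂ := ![0, 1, 1, 1, 1, 1, 1, 1, 1, 1, -1, -1, -1, 0]

theorem contract_forms13_diag {R : Type} [CommRing R] [Algebra ℂ R] (x : Fin 8 → R) (k : Fin 14) :
    contract (listMatrix (forms13 k)) (fun i j => diag13 x i * diag13 x j) =
      x (terms13 k).1.1 * x (terms13 k).1.2 +
        signs13 k • (x (terms13 k).2.1 * x (terms13 k).2.2) := by
  have h2 : ∀ x : R, (1 / 2 : ℂ) • (x + x) = x := fun x => by
    rw [← two_smul ℂ, smul_smul]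
    norm_num
  have h3 : ∀ x y : R, x = y + y → (1 / 2 : ℂ) • x = y := fun x y h => by rw [h, h2]
  rw [contract_forms13]
  fin_cases k <;> simp only [diag13, terms13, signs13, Fin.reduceFinMk, Fin.zero_eta, Fin.mk_one,
    Matrix.cons_val, one_smul, zero_smul, neg_smul] <;>
    first | ring1 | exact h3 _ _ (by ring)

theorem z13_eq (k : Fin 14) : z13 k = X (terms13 k).1.1 * X (terms13 k).1.2 +
    signs13 k • (X (terms13 k).2.1 * X (terms13 k).2.2) := by
  fin_cases k <;> simp only [z13, terms13, signs13, Fin.reduceFinMk, Fin.zero_eta, Fin.mk_one,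
    Matrix.cons_val, one_smul, zero_smul, neg_smul] <;>
    ring

theorem linear13_eq_zero {F : Poly 14} (hF : F.IsHomogeneous 1) (h : D13.Vanishes F) : F = 0 := by
  rw [D13.vanishes_iff coneIdeal13_isPrime, coneIdeal13, RingHom.mem_ker] at h
  let e : Fin 14 → Fin 4 → ℕ := fun k =>
    exponents13 (terms13 k).1.1 + exponents13 (terms13 k).1.2
  let f : Fin 14 → Fin 4 → ℕ := fun k =>
    exponents13 (terms13 k).2.1 + exponents13 (terms13 k).2.2
  set Φ := ((toricMap exponents13).comp diagEquiv13.toAlgHom).comp D13.pullback with hΦ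
  have hX : ∀ k, Φ (X k) = monomial (Finsupp.equivFunOnFinite.symm (e k)) 1 +
      signs13 k • monomial (Finsupp.equivFunOnFinite.symm (f k)) 1 := by
    intro k
    rw [hΦ, AlgHom.comp_apply, QuotientData.pullback, aeval_X]
    refine (toricMap_diagEquiv13_contract _).trans ?_
    rw [← toricMap_X_mul_X, ← toricMap_X_mul_X, map_mul, map_mul]
    exact contract_forms13_diag (fun i => toricMap exponents13 (X i)) k
  have h1 : ∀ k l, k ≠ l → e l ≠ e k ∧ f l ≠ e k := by decide
  have h2 : ∀ k, f k = e k → k = 0 ∨ k = 13 := by decide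
  refine linear_eq_zero Φ (fun k => Finsupp.equivFunOnFinite.symm (e k)) (fun k => ?_)
    (fun k l hkl => ?_) hF h
  · rw [hX, coeff_add, coeff_smul, coeff_monomial, if_pos rfl, coeff_monomial]
    split_ifs with hf
    · rcases h2 k (Finsupp.equivFunOnFinite.symm.injective hf) with rfl | rfl <;> simp [signs13]
    · simp
  · rw [hX, coeff_add, coeff_smul, coeff_monomial, if_neg, coeff_monomial, if_neg]
    · simp
    · exact fun hf => (h1 k l hkl).2 (Finsupp.equivFunOnFinite.symm.injective hf)
    · exact fun hf => (h1 k l hkl).1 (Finsupp.equivFunOnFinite.symm.injective hf)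

theorem diagonalize13_apply (v : Fin 8 → ℂ) : diagonalize13 v = diag13 v := rfl

theorem diagonalize13_mem_cone {v : Fin 8 → ℂ} : diagonalize13 v ∈ D13.cone ↔
    ∀ k, v (moves13 k).1 * v (moves13 k).2.1 = v 6 * v (moves13 k).2.2 := by
  rw [mem_cone13, diagonalize13_apply, onCone13_diag_iff]

theorem exists_moves13 (k : Fin 9) : ∃ p q r : Fin 7,
    moves13 k = (p.castSucc, q.castSucc, r.castSucc) := by
  revert k
  decide

theorem diagonalize13_snoc_mem_cone {a : Fin 7 → ℂ} {x : ℂ} :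
    diagonalize13 (Fin.snoc a x) ∈ D13.cone ↔ ∀ k p q r,
      moves13 k = (p.castSucc, q.castSucc, r.castSucc) → a p * a q = a 6 * a r := by
  have hs : ∀ i : Fin 7, (Fin.snoc a x : Fin 8 → ℂ) i.castSucc = a i := fun i => Fin.snoc_castSucc _ _ _
  rw [diagonalize13_mem_cone]
  refine forall_congr' fun k => ⟨fun h p q r hk => ?_, fun h => ?_⟩
  · rw [hk] at h
    simpa only [hs] using h.trans (congrArg (· * _) (hs 6))
  · obtain ⟨p, q, r, hk⟩ := exists_moves13 k
    rw [hk]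
    change _ = (Fin.snoc a x : Fin 8 → ℂ) (Fin.castSucc 6) * _
    simpa only [hs] using h p q r hk

/-- The cubics that parametrize the sextic del Pezzo surface. -/
abbrev cubics13 : Fin 7 → Poly 3 :=
  ![X 1 ^ 2 * X 2, X 1 * X 2 ^ 2, X 0 ^ 2 * X 2, X 0 * X 2 ^ 2, X 0 ^ 2 * X 1, X 0 * X 1 ^ 2,
    X 0 * X 1 * X 2]

theorem eval_cubics13 (w : Fin 4 → ℂ) (k : Fin 7) :
    eval (fun i : Fin 3 => w i.castSucc) (cubics13 k) = ∏ l, w l ^ exponents13 k.castSucc l := by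
  rw [Fin.prod_univ_four]
  fin_cases k <;> simp [exponents13]

theorem mem_delPezzoSix {a : Fin 7 → ℂ} (ha : a ≠ 0) : mk ℂ a ha ∈ delPezzoSix ↔
    ∀ x, diagonalize13 (Fin.snoc a x) ∈ D13.cone := by
  constructor
  · intro h x
    rw [diagonalize13_snoc_mem_cone]
    intro k p q r hk
    have hX : ∀ i j : Fin 7, (X i * X j : Poly 7).IsHomogeneous 2 := fun i j =>
      (isHomogeneous_X ℂ i).mul (isHomogeneous_X ℂ j)
    have hF : (X p * X q - X 6 * X r : Poly 7).IsHomogeneous 2 := (hX _ _).sub (hX _ _)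
    have h1 := h 2 _ hF ?_
    · rw [eval_rep_eq_zero_iff hF] at h1
      simpa [sub_eq_zero] using h1
    · rintro _ ⟨v, hv, hz, -, rfl⟩
      rw [eval_rep_eq_zero_iff hF, map_sub, map_mul, map_mul, eval_X, eval_X, eval_X, eval_X,
        sub_eq_zero]
      have hcub : ∀ k : Fin 7, eval v (cubics13 k) =
          ∏ l, (Fin.snoc v 1 : Fin 4 → ℂ) l ^ exponents13 k.castSucc l := by
        intro k
        rw [← eval_cubics13]
        simp
      change eval v (cubics13 p) * eval v (cubics13 q) = eval v (cubics13 6) * eval v (cubics13 r)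
      rw [hcub, hcub, hcub, hcub]
      refine prod_pow_mul_prod_pow _ ?_
      have := moves13_spec k
      rwa [hk] at this
  · intro h d F hF hvan
    rw [eval_rep_eq_zero_iff hF]
    have hren : toricMap exponents13 (rename Fin.castSucc F) = 0 := by
      refine eq_zero_of_eval_ne_zero (D := X 0 * X 1 * X 2)
        (mul_ne_zero (mul_ne_zero (X_ne_zero _) (X_ne_zero _)) (X_ne_zero _)) fun w hw => ?_
      rw [eval_toricMap, eval_rename]
      have hz : (fun k => eval (fun i : Fin 3 => w i.castSucc) (cubics13 k)) ≠ 0 := by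
        intro h0
        apply hw
        have := congrFun h0 6
        simpa using this
      have h1 := hvan (mk ℂ _ hz) ⟨fun i : Fin 3 => w i.castSucc, fun h0 => ?_, hz, trivial, rfl⟩
      · rw [eval_rep_eq_zero_iff hF] at h1
        rw [← h1]
        congr 2
        funext k
        exact (eval_cubics13 w k).symm
      · apply hw
        have := congrFun h0 0
        simp at this
        simp [this]
    have hmem : diagEquiv13.symm (rename Fin.castSucc F) ∈ D13.coneIdeal := by
      rw [coneIdeal13, RingHom.mem_ker]
      change toricMap exponents13 (diagEquiv13 (diagEquiv13.symm _)) = 0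
      rw [AlgEquiv.apply_symm_apply, hren]
    rw [D13.mem_coneIdeal coneIdeal13_isPrime] at hmem
    have h2 := hmem _ (h 0)
    have h3 : ∀ (G : Poly 8) (v : Fin 8 → ℂ), eval (diagonalize13 v) (diagEquiv13.symm G) =
        eval v G := by
      intro G v
      rw [← AlgEquiv.apply_symm_apply diagEquiv13 G, AlgEquiv.symm_apply_apply]
      generalize diagEquiv13.symm G = H
      have : (aeval v : Poly 8 →ₐ[ℂ] ℂ).comp diagEquiv13.toAlgHom = aeval (diagonalize13 v) := by
        refine MvPolynomial.algHom_ext fun i => ?_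
        rw [aeval_X, diagonalize13_apply]
        refine (congrArg (aeval v) (diagEquiv13_X i)).trans ?_
        refine (map_diag13 (aeval v : Poly 8 →ₐ[ℂ] ℂ).toRingHom X i).trans ?_
        congr 1
        simp
      exact (AlgHom.congr_fun this H).symm
    rw [h3, eval_rename] at h2
    have h4 : (Fin.snoc a 0 : Fin 8 → ℂ) ∘ Fin.castSucc = a := by
      funext k
      exact Fin.snoc_castSucc (α := fun _ => ℂ) _ _ _
    rwa [h4] at h2

theorem mem_V13 {v : Fin 8 → ℂ} (hv : v ≠ 0) : mk ℂ v hv ∈ V13 ↔ diagonalize13 v ∈ D13.cone := by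
  constructor
  · rintro ⟨a, ha, s, x, h, hmem, hQ⟩
    rw [mk_eq_mk_iff_smul] at hQ
    obtain ⟨q, -, rfl⟩ := hQ
    rw [map_smul]
    refine D13.smul_mem_cone ?_ q
    have h1 := (mem_delPezzoSix ha).mp hmem 0
    rw [diagonalize13_snoc_mem_cone] at h1 ⊢
    intro k p q r hk
    simp only [Pi.smul_apply, smul_eq_mul]
    linear_combination s ^ 2 * h1 k p q r hk
  · intro h
    obtain ⟨a, ha, s, hs, hmem⟩ : ∃ (a : Fin 7 → ℂ) (ha : a ≠ 0) (s : ℂ),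
        Fin.init v = s • a ∧ mk ℂ a ha ∈ delPezzoSix := by
      by_cases h0 : Fin.init v = 0
      · refine ⟨1, one_ne_zero, 0, by rw [h0, zero_smul], (mem_delPezzoSix _).mpr fun x => ?_⟩
        exact diagonalize13_snoc_mem_cone.mpr fun _ _ _ _ _ => rfl
      · refine ⟨_, h0, 1, (one_smul _ _).symm, (mem_delPezzoSix _).mpr fun x => ?_⟩
        rw [← Fin.snoc_init_self v, diagonalize13_snoc_mem_cone] at h
        exact diagonalize13_snoc_mem_cone.mpr h
    have hv' : (Fin.snoc (s • a) (v (Fin.last 7)) : Fin 8 → ℂ) = v := by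
      rw [← hs, Fin.snoc_init_self]
    refine ⟨a, ha, s, v (Fin.last 7), hv'.symm ▸ hv, hmem, ?_⟩
    congr 1
    exact hv'.symm

theorem flip13 (v : Fin 8 → ℂ) : D13.flip (diagonalize13 v) = diagonalize13 (t13Lin v) := by
  funext k
  change (if odd13 k then -1 else 1) * diag13 v k = diag13 (t13Lin v) k
  fin_cases k <;> simp [odd13, t13Lin] <;> ring

theorem describes13 : D13.Describes V13 t13 z13 where
  mem v hv := mem_V13 hv
  t_mk v hv := by
    have h1 : D13.g.symm (D13.flip (D13.g v)) = t13Lin v := by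
      change diagonalize13.symm (D13.flip (diagonalize13 v)) = _
      rw [flip13, LinearEquiv.symm_apply_apply]
    refine ⟨?_, ?_⟩
    · rw [h1]
      exact fun h => hv (t13Lin_involutive.injective (h.trans (map_zero _).symm))
    · rw [t13, Projectivization.map_mk]
      congr 1
      exact h1.symm
  z_eval v k := by
    refine Eq.trans ?_ (contract_forms13_diag v k).symm
    rw [z13_eq, map_add, smul_eval, map_mul, map_mul, eval_X, eval_X, eval_X, eval_X, smul_eq_mul]
  z_hom k := by
    rw [z13_eq, smul_eq_C_mul]
    exact ((isHomogeneous_X ℂ _).mul (isHomogeneous_X ℂ _)).add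
      (((isHomogeneous_X ℂ _).mul (isHomogeneous_X ℂ _)).C_mul _)

theorem cone13_nontrivial : ∃ c ∈ D13.cone, c ≠ 0 := by
  refine ⟨diagonalize13 1, diagonalize13_mem_cone.mpr fun k => rfl, fun h => ?_⟩
  have := congrFun h 0
  exact one_ne_zero (α := ℂ) this

theorem idealGeneratedByQuadrics13 : IdealGeneratedByQuadrics W13 :=
  describes13.idealGeneratedByQuadrics cone13_nontrivial (fun _ => linear13_eq_zero)
    fun _ => (D13.mem_coneIdeal coneIdeal13_isPrime).mpr

theorem exists_quotient13 : ∃ π : PSp 7 → PSp 13, IsGivenBy V13 z13 π ∧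
    IsQuotientOnto V13 t13 W13 π :=
  describes13.exists_quotient describes13.isZariskiClosed_image

theorem exists_roots_cubic (a b c : ℂ) :
    ∃ r s t : ℂ, r + s + t = a ∧ r * s + r * t + s * t = b ∧ r * s * t = c := by
  obtain ⟨r, hr⟩ := IsAlgClosed.exists_root (Polynomial.X ^ 3 - (Polynomial.C a * Polynomial.X ^ 2 +
    Polynomial.C (-b) * Polynomial.X + Polynomial.C c) : Polynomial ℂ) (by
      rw [Polynomial.degree_sub_eq_left_of_degree_lt, Polynomial.degree_X_pow]
      · norm_num
      · rw [Polynomial.degree_X_pow]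
        exact Polynomial.degree_quadratic_le.trans_lt (by norm_num))
  simp only [Polynomial.IsRoot, Polynomial.eval_sub, Polynomial.eval_pow, Polynomial.eval_X,
    Polynomial.eval_add, Polynomial.eval_mul, Polynomial.eval_C] at hr
  obtain ⟨s, t, h1, h2⟩ := exists_roots_quadratic (a - r) (b - r * (a - r))
  exact ⟨r, s, t, by linear_combination h1, by linear_combination r * h1 + h2,
    by linear_combination r * h2 + hr⟩

theorem isProjectiveVarietyOfDim13 : IsProjectiveVarietyOfDim W13 3 := by
  let T : Fin 4 → Poly 14 := ![linear13 0 0,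
    linear13 1 1 + linear13 2 2 + linear13 3 3 +
      C 2 * (linear13 1 2 + linear13 1 3 + linear13 2 3),
    linear13 4 4 + linear13 5 5 + linear13 6 6 -
      C 2 * (linear13 4 5 - linear13 4 6 + linear13 5 6), linear13 7 7]
  refine describes13.isProjectiveVarietyOfDim cone13_nontrivial coneIdeal13_isPrime T
    (E := X 0) (X_ne_zero 0) ?_ ?_
  · intro w hw
    rw [eval_X] at hw
    obtain ⟨u, hu⟩ := exists_sq (w 0)
    obtain ⟨y, hy⟩ := exists_sq (w 3)
    obtain ⟨p, hp⟩ := exists_sq (w 1)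
    obtain ⟨q, hq⟩ := exists_sq (w 2)
    obtain ⟨r, s, t, h1, h2, h3⟩ := exists_roots_cubic ((p + q) / 2) (u * ((p - q) / 2)) (u ^ 3)
    have hu0 : u ≠ 0 := by
      rintro rfl
      exact hw (by rw [← hu]; ring)
    have hrst : r * s * t ≠ 0 := by
      rw [h3]
      exact pow_ne_zero 3 hu0
    have ht0 : t ≠ 0 := right_ne_zero_of_mul hrst
    have hr0 : r ≠ 0 := left_ne_zero_of_mul (left_ne_zero_of_mul hrst)
    have hs0 : s ≠ 0 := right_ne_zero_of_mul (left_ne_zero_of_mul hrst)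
    let v : Fin 8 → ℂ := ![r, u ^ 2 / t, u ^ 2 / r, s, t, u ^ 2 / s, u, y]
    have hv : diagonalize13 v ∈ D13.cone := by
      rw [diagonalize13_mem_cone]
      intro k
      fin_cases k <;> simp [moves13, v] <;> field_simp <;> first
        | done
        | linear_combination h3
        | linear_combination -h3
    have hopp : u ^ 2 / t + u ^ 2 / r + u ^ 2 / s = (p - q) / 2 := by
      have : u ^ 2 / t + u ^ 2 / r + u ^ 2 / s = u ^ 2 * (r * s + r * t + s * t) / (r * s * t) := by
        field_simp
        ring
      rw [this, h2, h3]
      field_simp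
    refine ⟨_, hv, ?_⟩
    have hL := fun i j h => D13.eval_L hv (i := i) (j := j) h
    have hL' : ∀ i j, odd13 i = odd13 j → eval (D13.zmap (diagonalize13 v)) (linear13 i j) =
        diag13 v i * diag13 v j := hL
    intro i
    have hP : diag13 v 1 + diag13 v 2 + diag13 v 3 = p := by
      change (r + u ^ 2 / r) + (u ^ 2 / t + t) + (s + u ^ 2 / s) = p
      linear_combination h1 + hopp
    have hQ : diag13 v 4 - diag13 v 5 + diag13 v 6 = q := by
      change (r - u ^ 2 / r) - (u ^ 2 / t - t) + (s - u ^ 2 / s) = q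
      linear_combination h1 - hopp
    match i with
    | 0 =>
      change eval _ (linear13 0 0) = _
      rw [hL' 0 0 rfl, ← hu]
      exact (sq u).symm
    | 1 =>
      change eval _ (linear13 1 1 + linear13 2 2 + linear13 3 3 +
        C 2 * (linear13 1 2 + linear13 1 3 + linear13 2 3)) = _
      simp only [map_add, map_mul, eval_C]
      rw [hL' 1 1 rfl, hL' 2 2 rfl, hL' 3 3 rfl, hL' 1 2 rfl, hL' 1 3 rfl, hL' 2 3 rfl, ← hp, ← hP]
      ring
    | 2 =>
      change eval _ (linear13 4 4 + linear13 5 5 + linear13 6 6 -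
        C 2 * (linear13 4 5 - linear13 4 6 + linear13 5 6)) = _
      simp only [map_add, map_sub, map_mul, eval_C]
      rw [hL' 4 4 rfl, hL' 5 5 rfl, hL' 6 6 rfl, hL' 4 5 rfl, hL' 4 6 rfl, hL' 5 6 rfl, ← hq, ← hQ]
      ring
    | 3 =>
      change eval _ (linear13 7 7) = _
      rw [hL' 7 7 rfl, ← hy]
      exact (sq y).symm
  · intro _ hT hconst
    let y : Fin 8 → Poly 8 ⧸ D13.coneIdeal := fun i => Ideal.Quotient.mk _ (X i)
    let x : Fin 8 → Poly 8 ⧸ D13.coneIdeal := fun i => Ideal.Quotient.mk _ (diagEquiv13.symm (X i))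
    change ∀ i, IsIntegral (Poly 4) (y i)
    have hyx : y = diag13 x := diag13_symm _
    have hx : ∀ k, x (moves13 k).1 * x (moves13 k).2.1 = x 6 * x (moves13 k).2.2 := by
      rw [← onCone13_diag_iff, ← hyx]
      exact onCone13_mk
    have hL : ∀ i j, odd13 i = odd13 j →
        Ideal.Quotient.mk D13.coneIdeal (D13.pullback (linear13 i j)) = y i * y j := by
      intro i j h
      rw [← map_mul]
      exact Ideal.Quotient.eq.mpr (D13.pullback_L coneIdeal13_isPrime h)
    have hC : ∀ a : ℂ, Ideal.Quotient.mk D13.coneIdeal (D13.pullback (C a)) =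
        Ideal.Quotient.mk D13.coneIdeal (C a) := fun a => by
      rw [← MvPolynomial.algebraMap_eq, AlgHom.commutes, MvPolynomial.algebraMap_eq]
    have hC2 : Ideal.Quotient.mk D13.coneIdeal (C 2) = 2 :=
      map_ofNat ((Ideal.Quotient.mk D13.coneIdeal).comp (C : ℂ →+* Poly 8)) 2
    have hy0 : IsIntegral (Poly 4) (y 0) := by
      refine IsIntegral.of_pow two_pos ?_
      rw [sq, ← hL 0 0 rfl]
      exact hT 0
    have hy7 : IsIntegral (Poly 4) (y 7) := by
      refine IsIntegral.of_pow two_pos ?_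
      rw [sq, ← hL 7 7 rfl]
      exact hT 3
    have hP : IsIntegral (Poly 4) (y 1 + y 2 + y 3) := by
      refine IsIntegral.of_pow two_pos ?_
      have := hT 1
      change IsIntegral _ (Ideal.Quotient.mk D13.coneIdeal (D13.pullback
        (linear13 1 1 + linear13 2 2 + linear13 3 3 +
          C 2 * (linear13 1 2 + linear13 1 3 + linear13 2 3)))) at this
      simp only [map_add, map_mul] at this
      rw [hL 1 1 rfl, hL 2 2 rfl, hL 3 3 rfl, hL 1 2 rfl, hL 1 3 rfl, hL 2 3 rfl, hC, hC2] at this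
      convert this using 1
      ring
    have hQ : IsIntegral (Poly 4) (y 4 - y 5 + y 6) := by
      refine IsIntegral.of_pow two_pos ?_
      have := hT 2
      change IsIntegral _ (Ideal.Quotient.mk D13.coneIdeal (D13.pullback
        (linear13 4 4 + linear13 5 5 + linear13 6 6 -
          C 2 * (linear13 4 5 - linear13 4 6 + linear13 5 6)))) at this
      simp only [map_add, map_sub, map_mul] at this
      rw [hL 4 4 rfl, hL 5 5 rfl, hL 6 6 rfl, hL 4 5 rfl, hL 4 6 rfl, hL 5 6 rfl, hC, hC2] at this
      convert this using 1
      ring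
    have hhalf : ∀ z : Poly 8 ⧸ D13.coneIdeal, IsIntegral (Poly 4) (z + z) →
        IsIntegral (Poly 4) z := by
      intro z hz
      have := (hconst (1 / 2)).mul hz
      have h2 : Ideal.Quotient.mk D13.coneIdeal (C (1 / 2)) * 2 = 1 := by
        rw [← hC2, ← map_mul, ← C_mul]
        norm_num
      have h3 : Ideal.Quotient.mk D13.coneIdeal (C (1 / 2)) * (z + z) = z := by
        linear_combination z * h2
      rwa [h3] at this
    rw [hyx] at hy0 hy7 hP hQ ⊢
    have hA : IsIntegral (Poly 4) (x 0 + x 3 + x 4) := hhalf _ (by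
      convert hP.add hQ using 1
      · rfl
      simp only [diag13, Matrix.cons_val]
      ring)
    have hA' : IsIntegral (Poly 4) (x 1 + x 2 + x 5) := hhalf _ (by
      convert hP.sub hQ using 1
      · rfl
      simp only [diag13, Matrix.cons_val]
      ring)
    have hx6 : IsIntegral (Poly 4) (x 6) := hy0
    have m0 := hx 0
    have m1 := hx 1
    have m2 := hx 2
    have m3 := hx 3
    have m4 := hx 4
    have m5 := hx 5
    have m6 := hx 6
    have m7 := hx 7
    have m8 := hx 8
    simp only [moves13, Matrix.cons_val] at m0 m1 m2 m3 m4 m5 m6 m7 m8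
    have hroot : ∀ z, z ^ 3 = (x 0 + x 3 + x 4) * z ^ 2 + -(x 6 * (x 1 + x 2 + x 5)) * z + x 6 ^ 3 →
        IsIntegral (Poly 4) z := fun z h =>
      isIntegral_of_cubic hA (hx6.mul hA').neg (hx6.pow 3) h
    have hroot' : ∀ z, z ^ 3 = (x 1 + x 2 + x 5) * z ^ 2 + -(x 6 * (x 0 + x 3 + x 4)) * z + x 6 ^ 3 →
        IsIntegral (Poly 4) z := fun z h =>
      isIntegral_of_cubic hA' (hx6.mul hA).neg (hx6.pow 3) h
    have h0 := hroot (x 0) (by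
      linear_combination x 6 * m0 - x 0 * m3 - x 0 * m6)
    have h3 := hroot (x 3) (by
      linear_combination x 6 * m2 - x 3 * m3 - x 3 * m7)
    have h4 := hroot (x 4) (by
      linear_combination x 6 * m1 - x 4 * m6 - x 4 * m7)
    have h1 := hroot' (x 1) (by
      linear_combination x 6 * m1 - x 1 * m5 - x 1 * m8)
    have h2 := hroot' (x 2) (by
      linear_combination x 6 * m0 - x 2 * m4 - x 2 * m5)
    have h5 := hroot' (x 5) (by
      linear_combination x 6 * m2 - x 5 * m4 - x 5 * m8)
    intro i
    match i with
    | 0 => exact hx6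
    | 1 => exact h0.add h2
    | 2 => exact h1.add h4
    | 3 => exact h3.add h5
    | 4 => exact h0.sub h2
    | 5 => exact h1.sub h4
    | 6 => exact h3.sub h5
    | 7 => exact hy7

/-! ### Determining tangent cones -/

/-- The vector `v` is the limit at the point `q` of the direction of a curve in `X`. -/
def IsLimitDirection {n : ℕ} (X : Set (PSp n)) (i : Fin (n + 1)) (q : Fin (n + 1) → ℂ)
    (v : Fin n → ℂ) : Prop :=
  ∃ w : ℂ → Fin n → ℂ, ContinuousAt w 0 ∧ w 0 = v ∧
    ∀ᶠ t in 𝓝[≠] (0 : ℂ), q + Fin.insertNth (α := fun _ => ℂ) i 0 (t ^ 2 • w t) ∈ affineCone X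

/-- The vector `v` belongs to a polynomially parametrized family whose general members are limit
directions. -/
def IsGenericLimitDirection {n : ℕ} (X : Set (PSp n)) (i : Fin (n + 1)) (q : Fin (n + 1) → ℂ)
    (v : Fin n → ℂ) : Prop :=
  ∃ (k : ℕ) (κ : Fin n → Poly k) (D : Poly k) (u₀ : Fin k → ℂ), D ≠ 0 ∧
    (v = fun j => eval u₀ (κ j)) ∧
    ∀ u, eval u D ≠ 0 → IsLimitDirection X i q fun j => eval u (κ j)

theorem eval_tangentConeIdeal {n : ℕ} {X : Set (PSp n)} {q : Fin (n + 1) → ℂ} (hq : q ≠ 0)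
    {i : Fin (n + 1)} (hi : q i = 1) (hlt : ∀ j < i, q j = 0) {v : Fin n → ℂ}
    (hv : IsLimitDirection X i q v) {g : Poly n} (hg : g ∈ tangentConeIdeal X (mk ℂ q hq)) :
    eval v g = 0 := by
  obtain ⟨w, hw, rfl, hX⟩ := hv
  refine eval_initialIdeal hw ?_ hg
  filter_upwards [hX] with t ht f hf
  exact eval_localIdeal hq hi hlt ht hf

theorem eval_tangentConeIdeal_of_generic {n : ℕ} {X : Set (PSp n)} {q : Fin (n + 1) → ℂ}
    (hq : q ≠ 0) {i : Fin (n + 1)} (hi : q i = 1) (hlt : ∀ j < i, q j = 0) {v : Fin n → ℂ}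
    (hv : IsGenericLimitDirection X i q v) {g : Poly n}
    (hg : g ∈ tangentConeIdeal X (mk ℂ q hq)) : eval v g = 0 := by
  obtain ⟨k, κ, D, u₀, hD, rfl, h⟩ := hv
  have h0 : aeval κ g = 0 := eq_zero_of_eval_ne_zero hD fun u hu => by
    rw [eval_aeval]
    exact eval_tangentConeIdeal hq hi hlt (h u hu) hg
  rw [← eval_aeval, h0, map_zero]

/-- The polynomials that have a normal form modulo `G`. -/
def reducible {n r : ℕ} (G : Ideal (Poly n)) (m : Fin r → Poly n) (ψ : Fin r → Fin 3 → Poly n) :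
    Submodule ℂ (Poly n) :=
  G.restrictScalars ℂ ⊔ LinearMap.range (normalForm m ψ)

section reducible

variable {n r : ℕ} {G : Ideal (Poly n)} {m : Fin r → Poly n} {ψ : Fin r → Fin 3 → Poly n}

theorem mem_reducible {F : Poly n} :
    F ∈ reducible G m ψ ↔ ∃ h, F - normalForm m ψ h ∈ G := by
  unfold reducible
  rw [Submodule.mem_sup]
  constructor
  · rintro ⟨g, hg, _, ⟨h, rfl⟩, rfl⟩
    exact ⟨h, by simpa using hg⟩
  · rintro ⟨h, hh⟩
    exact ⟨_, hh, _, ⟨h, rfl⟩, by ring⟩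

theorem reducible_of_mem {F : Poly n} (h : F ∈ G) : F ∈ reducible G m ψ :=
  Submodule.mem_sup_left h

theorem reducible_piece (a : Fin r) (h : Poly 3) : m a * aeval (ψ a) h ∈ reducible G m ψ := by
  refine Submodule.mem_sup_right ⟨Pi.single a h, ?_⟩
  change ∑ b, m b * aeval (ψ b) ((Pi.single a h : Fin r → Poly 3) b) = _
  rw [Finset.sum_eq_single a]
  · simp
  · intro b _ hb
    simp [Pi.single_eq_of_ne hb]
  · simp

theorem reducible_of_sub {F F' : Poly n} (h : F - F' ∈ G) (hF' : F' ∈ reducible G m ψ) :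
    F ∈ reducible G m ψ := by
  have := add_mem (reducible_of_mem h) hF'
  rwa [sub_add_cancel] at this

theorem reducible_mul_of_sub {x : Poly n} {a b : Fin r} (hψ : ψ b = ψ a) {ρ : Poly 3}
    (h : m a * x - m b * aeval (ψ b) ρ ∈ G) (f : Poly 3) :
    m a * aeval (ψ a) f * x ∈ reducible G m ψ := by
  refine reducible_of_sub (F' := m b * aeval (ψ b) (f * ρ)) ?_ (reducible_piece b _)
  have := G.mul_mem_left (aeval (ψ a) f) h
  convert this using 1
  rw [map_mul, hψ]
  ring

theorem reducible_eq_top (hone : (1 : Poly n) ∈ reducible G m ψ)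
    (hmul : ∀ (j : Fin n) (a : Fin r) (h : Poly 3), m a * aeval (ψ a) h * X j ∈ reducible G m ψ) (F : Poly n) :
    F ∈ reducible G m ψ := by
  have hX : ∀ j, ∀ F ∈ reducible G m ψ, F * X j ∈ reducible G m ψ := by
    intro j F hF
    obtain ⟨h, hh⟩ := mem_reducible.mp hF
    refine reducible_of_sub (F' := normalForm m ψ h * X j) ?_ ?_
    · rw [← sub_mul]
      exact G.mul_mem_right _ hh
    · change (∑ a, m a * aeval (ψ a) (h a)) * X j ∈ _
      rw [Finset.sum_mul]
      exact sum_mem fun a _ => hmul j a _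
  induction F using MvPolynomial.induction_on with
  | C a =>
    have := (reducible G m ψ).smul_mem a hone
    rwa [smul_eq_C_mul, mul_one] at this
  | add p q hp hq => exact add_mem hp hq
  | mul_X p j hp => exact hX j p hp

end reducible

/-- Multiples of `μ` can be rewritten with the help of rules for the products of `μ` with the
variables. -/
theorem mul_sub_mul_aeval_mem {n k : ℕ} {G : Ideal (Poly n)} {μ : Poly n} {ρ : Fin k → Poly n}
    {x : Fin k → Poly n} (h : ∀ j, μ * x j - μ * ρ j ∈ G) (F : Poly k) :
    μ * aeval x F - μ * aeval ρ F ∈ G := by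
  induction F using MvPolynomial.induction_on with
  | C a => simp
  | add p q hp hq =>
    have := G.add_mem hp hq
    convert this using 1
    simp only [map_add]
    ring
  | mul_X p j hp =>
    have := G.add_mem (G.mul_mem_right (x j) hp) (G.mul_mem_right (aeval ρ p) (h j))
    convert this using 1
    simp only [map_mul, aeval_X]
    ring

/-- The lowest homogeneous part of an element of an ideal belongs to the initial ideal. -/
theorem mem_initialIdeal_of_add {n d : ℕ} {J : Ideal (Poly n)} {f g : Poly n}
    (hf : f.IsHomogeneous d) (hg : g.IsHomogeneous (d + 1)) (h : f + g ∈ J) :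
    f ∈ initialIdeal J := by
  refine Ideal.subset_span ⟨f + g, h, d, fun e he => ?_, ?_⟩
  · rw [map_add, homogeneousComponent_ne hf he.ne, homogeneousComponent_ne hg (by omega), add_zero]
  · rw [map_add, homogeneousComponent_same hf, homogeneousComponent_ne hg (by omega), add_zero]

theorem chartMap_mem_localIdeal {n : ℕ} {X : Set (PSp n)} {q : Fin (n + 1) → ℂ} (hq : q ≠ 0)
    {i : Fin (n + 1)} (hi : q i = 1) (hlt : ∀ j < i, q j = 0) {F : Poly (n + 1)}
    (hF : F ∈ projIdeal X) : chartMap i q F ∈ localIdeal X (mk ℂ q hq) := by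
  rw [← toChart_mk hq hi hlt]
  exact Ideal.mem_map_of_mem _ hF

/-- The tangent cone at `q` is the cone over `Y` if its ideal contains an ideal `G` modulo which
polynomials have a normal form that is unique on `Y`, and if `Y` consists of limit directions. -/
theorem tangentCone_of_normalForm {n r : ℕ} {X : Set (PSp (n + 1))} {q : Fin (n + 2) → ℂ}
    (hq : q ≠ 0) {i : Fin (n + 2)} (hi : q i = 1) (hlt : ∀ j < i, q j = 0) {Y : Set (PSp n)}
    {G : Ideal (Poly (n + 1))} {m : Fin r → Poly (n + 1)} {ψ : Fin r → Fin 3 → Poly (n + 1)}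
    {s : Fin r → ℕ} (hs : ∀ a, s a ≤ 1) (hm : ∀ a, (m a).IsHomogeneous (s a))
    (hψ : ∀ a j, (ψ a j).IsHomogeneous 1)
    (hG : G ≤ tangentConeIdeal X (mk ℂ q hq))
    (hY : ∀ v ∈ affineCone Y, IsGenericLimitDirection X i q v)
    (hone : (1 : Poly (n + 1)) ∈ reducible G m ψ)
    (hmul : ∀ (j : Fin (n + 1)) (a : Fin r) (h : Poly 3),
      m a * aeval (ψ a) h * MvPolynomial.X j ∈ reducible G m ψ)
    (hind : ∀ h, normalForm m ψ h ∈ projIdeal Y → h = 0) :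
    TangentConeIsConeOver X (mk ℂ q hq) Y ∧ HasMultiplicity X (mk ℂ q hq) 3 r := by
  have hle : tangentConeIdeal X (mk ℂ q hq) ≤ projIdeal Y := fun g hg =>
    mem_projIdeal.mpr fun v hv => eval_tangentConeIdeal_of_generic hq hi hlt (hY v hv) hg
  have hge : projIdeal Y ≤ G := by
    intro F hF
    obtain ⟨h, hh⟩ := mem_reducible.mp (reducible_eq_top hone hmul F)
    have h0 : h = 0 := hind h (by
      have := sub_mem hF (hle (hG hh))
      rwa [sub_sub_cancel] at this)
    simpa [h0] using hh
  have heq : tangentConeIdeal X (mk ℂ q hq) = projIdeal Y := le_antisymm hle (hge.trans hG)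
  refine ⟨heq, hasMultiplicity_of_normalForm hs hm hψ ?_ ?_ ?_⟩
  · rw [heq]
    exact hind
  · intro F
    obtain ⟨h, hh⟩ := mem_reducible.mp (reducible_eq_top hone hmul F)
    exact ⟨h, hG hh⟩
  · rw [heq]
    exact fun F hF d => homogeneousComponent_mem_projIdeal hF d

/-! ### Tangent spaces and limit directions -/

theorem insertNth_mem_embeddedTangentSpace {n : ℕ} {X : Set (PSp n)} {q : Fin (n + 1) → ℂ}
    (hq : q ≠ 0) (hX : mk ℂ q hq ∈ X) {i : Fin (n + 1)} {v : Fin n → ℂ}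
    (hv : IsLimitDirection X i q v) :
    Fin.insertNth (α := fun _ => ℂ) i 0 v ∈ embeddedTangentSpace X (mk ℂ q hq) := by
  obtain ⟨w, hw, rfl, hc⟩ := hv
  have hw' : ContinuousAt (fun t => Fin.insertNth (α := fun _ => ℂ) i 0 (w t)) 0 := by
    rw [continuousAt_pi]
    intro j
    rcases Fin.eq_self_or_eq_succAbove i j with rfl | ⟨k, rfl⟩
    · simpa using continuousAt_const
    · simpa using (continuousAt_pi.mp hw) k
  refine mem_embeddedTangentSpace_of_curve hq hX hw' ?_
  filter_upwards [hc] with t ht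
  convert ht using 2
  funext j
  rcases Fin.eq_self_or_eq_succAbove i j with rfl | ⟨k, rfl⟩ <;> simp

theorem insertNth_mem_embeddedTangentSpace_of_generic {n : ℕ} {X : Set (PSp n)}
    {q : Fin (n + 1) → ℂ} (hq : q ≠ 0) (hX : mk ℂ q hq ∈ X) {i : Fin (n + 1)} {v : Fin n → ℂ}
    (hv : IsGenericLimitDirection X i q v) :
    Fin.insertNth (α := fun _ => ℂ) i 0 v ∈ embeddedTangentSpace X (mk ℂ q hq) := by
  obtain ⟨k, κ, D, u₀, hD, rfl, h⟩ := hv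
  rw [mem_embeddedTangentSpace]
  intro F hF
  have hev : ∀ u, dEval (mk ℂ q hq).rep
      (Fin.insertNth (α := fun _ => ℂ) i 0 fun j => eval u (κ j)) F =
      eval u (∑ j, C (eval (mk ℂ q hq).rep (pderiv (i.succAbove j) F)) * κ j) := by
    intro u
    rw [map_sum]
    change ∑ j : Fin (n + 1), _ = _
    rw [Fin.sum_univ_succAbove _ i]
    simp
  have h0 := eq_zero_of_eval_ne_zero hD fun u hu => by
    rw [← hev]
    exact mem_embeddedTangentSpace.mp (insertNth_mem_embeddedTangentSpace hq hX (h u hu)) F hF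
  rw [hev, h0, map_zero]

theorem succ_le_finrank_embeddedTangentSpace {n k : ℕ} {X : Set (PSp n)} {q : Fin (n + 1) → ℂ}
    (hq : q ≠ 0) (hX : mk ℂ q hq ∈ X) {i : Fin (n + 1)} (hi : q i = 1) {v : Fin k → Fin n → ℂ}
    (hv : ∀ a, IsGenericLimitDirection X i q (v a)) (hli : LinearIndependent ℂ v) :
    k + 1 ≤ Module.finrank ℂ (embeddedTangentSpace X (mk ℂ q hq)) := by
  let ι : (Fin n → ℂ) →ₗ[ℂ] (Fin (n + 1) → ℂ) :=
    { toFun := fun v => Fin.insertNth (α := fun _ => ℂ) i 0 v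
      map_add' := fun v w => by
        funext j
        rcases Fin.eq_self_or_eq_succAbove i j with rfl | ⟨k, rfl⟩ <;> simp
      map_smul' := fun a v => by
        funext j
        rcases Fin.eq_self_or_eq_succAbove i j with rfl | ⟨k, rfl⟩ <;> simp }
  have hι : LinearMap.ker ι = ⊥ := by
    rw [LinearMap.ker_eq_bot']
    intro v hv
    funext j
    have : ι v (i.succAbove j) = 0 := by rw [hv]; rfl
    simpa [ι] using this
  refine le_finrank_of_coordinates (Fin.cons q fun a => ι (v a)) (fun a => ?_) ?_
  · refine Fin.cases ?_ (fun a => ?_) a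
    · exact self_mem_embeddedTangentSpace hq hX
    · exact insertNth_mem_embeddedTangentSpace_of_generic hq hX (hv a)
  · rw [linearIndependent_finCons]
    refine ⟨hli.map' ι hι, fun h => ?_⟩
    have hle : Submodule.span ℂ (Set.range fun a => ι (v a)) ≤
        LinearMap.ker (LinearMap.proj i : (Fin (n + 1) → ℂ) →ₗ[ℂ] ℂ) := by
      rw [Submodule.span_le]
      rintro _ ⟨a, rfl⟩
      simp [ι]
    have := hle h
    rw [LinearMap.mem_ker, LinearMap.proj_apply, hi] at this
    exact one_ne_zero this

/-- Constant families of limit directions are generic. -/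
theorem IsLimitDirection.isGeneric {n : ℕ} {X : Set (PSp n)} {q : Fin (n + 1) → ℂ}
    {i : Fin (n + 1)} {v : Fin n → ℂ} (hv : IsLimitDirection X i q v) :
    IsGenericLimitDirection X i q v :=
  ⟨0, fun j => C (v j), 1, 0, one_ne_zero, by simp, fun u _ => by simpa using hv⟩

/-! ### Lines and multiplicities -/

theorem associated_mk_iff {n : ℕ} {X : Set (PSp n)} {p q : Fin (n + 1) → ℂ} (hp : p ≠ 0)
    (hq : q ≠ 0) : Associated X (mk ℂ p hp) (mk ℂ q hq) ↔ mk ℂ p hp ≠ mk ℂ q hq ∧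
      ∀ a b : ℂ, a • p + b • q ≠ 0 → a • p + b • q ∈ affineCone X := by
  unfold Associated
  refine and_congr_right fun _ => ?_
  rw [submodule_mk, submodule_mk, ← Submodule.span_insert]
  constructor
  · intro h a b h0
    refine ⟨h0, h ?_⟩
    change (mk ℂ _ h0).submodule ≤ _
    rw [submodule_mk, Submodule.span_singleton_le_iff_mem]
    exact Submodule.mem_span_pair.mpr ⟨a, b, rfl⟩
  · intro h P hP
    induction P using Projectivization.ind with
    | h v hv =>
      change (mk ℂ v hv).submodule ≤ _ at hP
      rw [submodule_mk, Submodule.span_singleton_le_iff_mem, Submodule.mem_span_pair] at hP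
      obtain ⟨a, b, rfl⟩ := hP
      exact (h a b hv).2

theorem not_hasSimilarSingularPoints {n d e e' : ℕ} {X : Set (PSp n)} {P Q : PSp n}
    (hP : P ∈ singularLocus X) (hQ : Q ∈ singularLocus X) (h : HasMultiplicity X P d e)
    (h' : HasMultiplicity X Q d e') (hne : e ≠ e') : ¬ HasSimilarSingularPoints X d := by
  rintro ⟨⟨a, ha⟩, -⟩
  have h1 := tendsto_nhds_unique h (ha P hP)
  have h2 := tendsto_nhds_unique h' (ha Q hQ)
  exact hne (Nat.cast_injective (R := ℝ) (h1.trans h2.symm))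

theorem mem_singularLocus_iff {n : ℕ} {X : Set (PSp n)} (hX : IsProjectiveVarietyOfDim X 3)
    {P : PSp n} : P ∈ singularLocus X ↔
      P ∈ X ∧ 5 ≤ Module.finrank ℂ (embeddedTangentSpace X P) := by
  change P ∈ X ∧ _ ↔ _
  rw [hX.2.2.2]
  refine and_congr_right fun _ => ?_
  exact_mod_cast Iff.rfl

/-! ### Tangent cones over Veronese surfaces -/

/-- The parametrization of the cone over the Veronese surface. -/
def veronese (u : Fin 3 → ℂ) : Fin 6 → ℂ :=
  ![u 0 ^ 2, u 1 ^ 2, u 2 ^ 2, u 0 * u 1, u 0 * u 2, u 1 * u 2]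

/-- The monomials of degree two in three variables. -/
def veroneseMonomial : Fin 6 → Poly 3 :=
  ![X 0 ^ 2, X 1 ^ 2, X 2 ^ 2, X 0 * X 1, X 0 * X 2, X 1 * X 2]

theorem eval_veroneseMonomial (u : Fin 3 → ℂ) (l : Fin 6) :
    eval u (veroneseMonomial l) = veronese u l := by
  fin_cases l <;> simp [veroneseMonomial, veronese]

theorem veronese_smul (a : ℂ) (u : Fin 3 → ℂ) : veronese (a • u) = a ^ 2 • veronese u := by
  funext l
  fin_cases l <;> simp [veronese] <;> ring

theorem exists_of_mem_affineCone_veronese {n : ℕ} {L : (Fin 6 → ℂ) →ₗ[ℂ] (Fin (n + 1) → ℂ)}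
    (hL : Function.Injective L) {v : Fin (n + 1) → ℂ}
    (hv : v ∈ affineCone (Projectivization.map L hL '' standardVeronese)) :
    ∃ u, v = L (veronese u) := by
  obtain ⟨h0, _, ⟨u, hu, hz, -, rfl⟩, h⟩ := hv
  rw [Projectivization.map_mk, eq_comm, mk_eq_mk_iff_smul] at h
  obtain ⟨a, -, ha⟩ := h
  obtain ⟨b, rfl⟩ := exists_sq a
  refine ⟨b • u, ?_⟩
  rw [veronese_smul, map_smul, ha]
  congr 2
  funext l
  exact eval_veroneseMonomial u l

theorem standardVeronese_eq : standardVeronese = imageUnder veroneseMonomial Set.univ := rfl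

theorem veronese_ne_zero {u : Fin 3 → ℂ} (hu : u ≠ 0) : veronese u ≠ 0 := by
  intro h
  have h0 : u 0 ^ 2 = 0 := congrFun h 0
  have h1 : u 1 ^ 2 = 0 := congrFun h 1
  have h2 : u 2 ^ 2 = 0 := congrFun h 2
  rw [sq_eq_zero_iff] at h0 h1 h2
  refine hu (funext fun j => ?_)
  match j with
  | 0 => exact h0
  | 1 => exact h1
  | 2 => exact h2

theorem mem_affineCone_veronese {n : ℕ} {L : (Fin 6 → ℂ) →ₗ[ℂ] (Fin (n + 1) → ℂ)}
    (hL : Function.Injective L) {u : Fin 3 → ℂ} (hu : u ≠ 0) :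
    L (veronese u) ∈ affineCone (Projectivization.map L hL '' standardVeronese) := by
  have hv := veronese_ne_zero hu
  have hz : (fun l => eval u (veroneseMonomial l)) = veronese u := by
    simp only [eval_veroneseMonomial]
  have hz' : (fun l => eval u (veroneseMonomial l)) ≠ 0 := by rwa [hz]
  have hmem : mk ℂ _ hv ∈ standardVeronese := by
    rw [standardVeronese_eq]
    refine ⟨u, hu, hz', Set.mem_univ _, ?_⟩
    simp only [hz]
  exact ⟨fun h => hv (hL (h.trans (map_zero L).symm)), mk ℂ _ hv, hmem, Projectivization.map_mk ..⟩

theorem eq_zero_of_sign_changes {h : Fin 4 → Poly 3}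
    (hh : ∀ u : Fin 3 → ℂ, u ≠ 0 → eval (fun j => u j ^ 2) (h 0) +
      u 0 * u 1 * eval (fun j => u j ^ 2) (h 1) + u 0 * u 2 * eval (fun j => u j ^ 2) (h 2) +
      u 1 * u 2 * eval (fun j => u j ^ 2) (h 3) = 0) : h = 0 := by
  have key : ∀ v : Fin 3 → ℂ, eval v (X 0 * X 1 * X 2 : Poly 3) ≠ 0 → ∀ a, eval v (h a) = 0 := by
    intro v hv
    have hsq : ∀ j, ∃ b : ℂ, v j = b ^ 2 := fun j =>
      ⟨_, (Complex.cpow_nat_inv_pow (v j) two_ne_zero).symm⟩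
    choose u hu using hsq
    have hvu : (fun j => u j ^ 2) = v := funext fun j => (hu j).symm
    simp only [map_mul, eval_X, hu] at hv
    have n0 : u 0 ≠ 0 := fun h => hv (by rw [h]; ring)
    have n1 : u 1 ≠ 0 := fun h => hv (by rw [h]; ring)
    have n2 : u 2 ≠ 0 := fun h => hv (by rw [h]; ring)
    have e : ∀ a b : ℂ, a ^ 2 = 1 → b ^ 2 = 1 → eval v (h 0) + a * b * (u 0 * u 1 * eval v (h 1)) +
        a * (u 0 * u 2 * eval v (h 2)) + b * (u 1 * u 2 * eval v (h 3)) = 0 := by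
      intro a b ha hb
      have h1 := hh ![a * u 0, b * u 1, u 2] (fun h0 => n2 (congrFun h0 2))
      have h2 : (fun j => (![a * u 0, b * u 1, u 2] : Fin 3 → ℂ) j ^ 2) = v := by
        rw [← hvu]
        funext j
        fin_cases j
        · simp [mul_pow, ha]
        · simp [mul_pow, hb]
        · simp
      rw [h2] at h1
      simp only [Matrix.cons_val] at h1
      linear_combination h1
    have e1 := e 1 1 (by ring) (by ring)
    have e2 := e 1 (-1) (by ring) (by ring)
    have e3 := e (-1) 1 (by ring) (by ring)
    have e4 := e (-1) (-1) (by ring) (by ring)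
    intro a
    fin_cases a
    · change eval v (h 0) = 0
      linear_combination (e1 + e2 + e3 + e4) / 4
    · have : u 0 * u 1 * eval v (h 1) = 0 := by linear_combination (e1 - e2 - e3 + e4) / 4
      exact (mul_eq_zero.mp this).resolve_left (mul_ne_zero n0 n1)
    · have : u 0 * u 2 * eval v (h 2) = 0 := by linear_combination (e1 + e2 - e3 - e4) / 4
      exact (mul_eq_zero.mp this).resolve_left (mul_ne_zero n0 n2)
    · have : u 1 * u 2 * eval v (h 3) = 0 := by linear_combination (e1 - e2 + e3 - e4) / 4
      exact (mul_eq_zero.mp this).resolve_left (mul_ne_zero n1 n2)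
  have hD : (X 0 * X 1 * X 2 : Poly 3) ≠ 0 := mul_ne_zero (mul_ne_zero (X_ne_zero _) (X_ne_zero _))
    (X_ne_zero _)
  funext a
  exact eq_zero_of_eval_ne_zero hD fun v hv => key v hv a

/-- Four points in general position. -/
def signs : Fin 4 → Fin 3 → ℂ := ![![1, 1, 1], ![-1, 1, 1], ![1, -1, 1], ![1, 1, -1]]

theorem signs_ne_zero (a : Fin 4) : signs a 0 * signs a 1 * signs a 2 ≠ 0 := by
  fin_cases a <;> simp [signs]

theorem linearIndependent_veronese_signs :
    LinearIndependent ℂ fun a => veronese (signs a) := by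
  rw [Fintype.linearIndependent_iff]
  intro g hg
  have h0 := congrFun hg 0
  have h3 := congrFun hg 3
  have h4 := congrFun hg 4
  have h5 := congrFun hg 5
  simp [Fin.sum_univ_four, veronese, signs] at h0 h3 h4 h5
  intro a
  match a with
  | 0 => linear_combination (h0 + h3 + h4 + h5) / 4
  | 1 => linear_combination (h0 - h3 - h4 + h5) / 4
  | 2 => linear_combination (h0 - h3 + h4 - h5) / 4
  | 3 => linear_combination (h0 + h3 - h4 - h5) / 4

/-- A tangent cone that satisfies the quadratic relations of the Veronese surface and contains
enough limit directions is the cone over a Veronese surface. -/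
theorem tangentCone_of_veronese {n : ℕ} {W : Set (PSp (n + 1))} {q : Fin (n + 2) → ℂ}
    (hq : q ≠ 0) {i : Fin (n + 2)} (hi : q i = 1) (hlt : ∀ j < i, q j = 0)
    {S : Fin 6 → Poly (n + 1)} (hS : ∀ l, (S l).IsHomogeneous 1)
    (h01 : S 3 * S 3 - S 0 * S 1 ∈ tangentConeIdeal W (mk ℂ q hq))
    (h02 : S 4 * S 4 - S 0 * S 2 ∈ tangentConeIdeal W (mk ℂ q hq))
    (h12 : S 5 * S 5 - S 1 * S 2 ∈ tangentConeIdeal W (mk ℂ q hq))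
    (h0 : S 3 * S 4 - S 0 * S 5 ∈ tangentConeIdeal W (mk ℂ q hq))
    (h1 : S 3 * S 5 - S 1 * S 4 ∈ tangentConeIdeal W (mk ℂ q hq))
    (h2 : S 4 * S 5 - S 2 * S 3 ∈ tangentConeIdeal W (mk ℂ q hq))
    (hgen : ∀ j, ∃ c : Fin 6 → ℂ, X j - ∑ l, C (c l) * S l ∈ tangentConeIdeal W (mk ℂ q hq))
    (L : (Fin 6 → ℂ) →ₗ[ℂ] (Fin (n + 1) → ℂ)) (hL : ∀ v l, eval (L v) (S l) = v l)
    (hcurve : ∀ u : Fin 3 → ℂ, u 0 * u 1 * u 2 ≠ 0 → IsLimitDirection W i q (L (veronese u))) :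
    (mk ℂ q hq ∈ W → 5 ≤ Module.finrank ℂ (embeddedTangentSpace W (mk ℂ q hq))) ∧
      HasMultiplicity W (mk ℂ q hq) 3 4 ∧
      ∃ Y, IsVeroneseSurface Y ∧ TangentConeIsConeOver W (mk ℂ q hq) Y := by
  have hinj : Function.Injective L := by
    intro v w h
    funext l
    rw [← hL v, ← hL w, h]
  refine ⟨fun hW => succ_le_finrank_embeddedTangentSpace hq hW hi
    (v := fun a => L (veronese (signs a))) (fun a => (hcurve _ (signs_ne_zero a)).isGeneric)
    (linearIndependent_veronese_signs.map' L (LinearMap.ker_eq_bot.mpr hinj)), ?_⟩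
  set T := tangentConeIdeal W (mk ℂ q hq) with hT
  set m : Fin 4 → Poly (n + 1) := ![1, S 3, S 4, S 5] with hm
  set ψ : Fin 4 → Fin 3 → Poly (n + 1) := fun _ => ![S 0, S 1, S 2] with hψ
  have hps : ∀ h : Poly 3, ∀ v, eval v (aeval ![S 0, S 1, S 2] h) =
      eval ![eval v (S 0), eval v (S 1), eval v (S 2)] h := by
    intro h v
    rw [eval_aeval]
    congr 2
    ext j
    fin_cases j <;> simp
  suffices h : TangentConeIsConeOver W (mk ℂ q hq) (Projectivization.map L hinj '' standardVeronese)
      ∧ HasMultiplicity W (mk ℂ q hq) 3 4 from ⟨h.2, _, ⟨L, hinj, rfl⟩, h.1⟩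
  have hmS : ∀ (l : Fin 6) (a : Fin 4) (h : Poly 3),
      m a * aeval (ψ a) h * S l ∈ reducible T m ψ := by
    have key : ∀ (l : Fin 6) (a : Fin 4), ∃ b, ∃ ρ : Poly 3,
        m a * S l - m b * aeval (ψ b) ρ ∈ T := by
      have hz : ∀ x : Poly (n + 1), x = 0 → x ∈ T := fun x hx => hx ▸ T.zero_mem
      have hr : ∀ x y : Poly (n + 1), y ∈ T → x = y → x ∈ T := fun x y hy h => h ▸ hy
      intro l a
      fin_cases a
      · fin_cases l
        · exact ⟨0, X 0, hz _ (by simp [m, ψ])⟩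
        · exact ⟨0, X 1, hz _ (by simp [m, ψ])⟩
        · exact ⟨0, X 2, hz _ (by simp [m, ψ])⟩
        · exact ⟨1, 1, hz _ (by simp [m, ψ])⟩
        · exact ⟨2, 1, hz _ (by simp [m, ψ])⟩
        · exact ⟨3, 1, hz _ (by simp [m, ψ])⟩
      · fin_cases l
        · exact ⟨1, X 0, hz _ (by simp [m, ψ])⟩
        · exact ⟨1, X 1, hz _ (by simp [m, ψ])⟩
        · exact ⟨1, X 2, hz _ (by simp [m, ψ])⟩
        · exact ⟨0, X 0 * X 1, hr _ _ h01 (by simp [m, ψ])⟩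
        · exact ⟨3, X 0, hr _ _ h0 (by simp [m, ψ, mul_comm])⟩
        · exact ⟨2, X 1, hr _ _ h1 (by simp [m, ψ, mul_comm])⟩
      · fin_cases l
        · exact ⟨2, X 0, hz _ (by simp [m, ψ])⟩
        · exact ⟨2, X 1, hz _ (by simp [m, ψ])⟩
        · exact ⟨2, X 2, hz _ (by simp [m, ψ])⟩
        · exact ⟨3, X 0, hr _ _ h0 (by simp [m, ψ, mul_comm])⟩
        · exact ⟨0, X 0 * X 2, hr _ _ h02 (by simp [m, ψ])⟩
        · exact ⟨1, X 2, hr _ _ h2 (by simp [m, ψ, mul_comm])⟩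
      · fin_cases l
        · exact ⟨3, X 0, hz _ (by simp [m, ψ])⟩
        · exact ⟨3, X 1, hz _ (by simp [m, ψ])⟩
        · exact ⟨3, X 2, hz _ (by simp [m, ψ])⟩
        · exact ⟨2, X 1, hr _ _ h1 (by simp [m, ψ, mul_comm])⟩
        · exact ⟨1, X 2, hr _ _ h2 (by simp [m, ψ, mul_comm])⟩
        · exact ⟨0, X 1 * X 2, hr _ _ h12 (by simp [m, ψ])⟩
    intro l a h
    obtain ⟨b, ρ, hb⟩ := key l a
    exact reducible_mul_of_sub (G := T) (m := m) (ψ := ψ) (x := S l) (a := a) (b := b) rfl hb h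
  refine tangentCone_of_normalForm hq hi hlt (s := ![0, 1, 1, 1]) (by decide) ?_ ?_ le_rfl ?_ ?_ ?_ ?_
    (m := m) (ψ := ψ)
  · intro a
    fin_cases a
    · exact isHomogeneous_one _ _
    · exact hS 3
    · exact hS 4
    · exact hS 5
  · intro a j
    fin_cases j
    · exact hS 0
    · exact hS 1
    · exact hS 2
  · intro v hv
    obtain ⟨u, rfl⟩ := exists_of_mem_affineCone_veronese hinj hv
    have hκ : ∀ u : Fin 3 → ℂ, L (veronese u) =
        fun j => eval u (∑ l, C (L (Pi.single l 1) j) * veroneseMonomial l) := by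
      intro u
      funext j
      conv_lhs => rw [← Finset.univ_sum_single (veronese u)]
      rw [map_sum, Finset.sum_apply, map_sum]
      refine Finset.sum_congr rfl fun l _ => ?_
      rw [map_mul, eval_C, eval_veroneseMonomial]
      have : (Pi.single l (veronese u l) : Fin 6 → ℂ) = veronese u l • Pi.single l 1 := by
        rw [← Pi.single_smul, smul_eq_mul, mul_one]
      rw [this, map_smul, Pi.smul_apply, smul_eq_mul, mul_comm]
    refine ⟨3, _, X 0 * X 1 * X 2, u, mul_ne_zero (mul_ne_zero (X_ne_zero _) (X_ne_zero _))
      (X_ne_zero _), hκ u, fun u hu => ?_⟩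
    rw [← hκ]
    exact hcurve u (by simpa using hu)
  · have := reducible_piece (G := T) (m := m) (ψ := ψ) 0 1
    simpa [m] using this
  · intro j a h
    obtain ⟨c, hc⟩ := hgen j
    refine reducible_of_sub (F' := ∑ l, c l • (m a * aeval (ψ a) h * S l)) ?_
      (sum_mem fun l _ => (reducible T m ψ).smul_mem _ (hmS l a h))
    have := T.mul_mem_left (m a * aeval (ψ a) h) hc
    rw [mul_sub, Finset.mul_sum] at this
    convert this using 3
    rw [smul_eq_C_mul]
    ring
  · intro h hh
    refine eq_zero_of_sign_changes fun u hu => ?_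
    have := mem_projIdeal.mp hh _ (mem_affineCone_veronese hinj hu)
    change eval _ (∑ a, m a * aeval (ψ a) (h a)) = 0 at this
    have hsq : (![veronese u 0, veronese u 1, veronese u 2] : Fin 3 → ℂ) = fun j => u j ^ 2 := by
      funext j
      fin_cases j <;> rfl
    simp only [Fin.sum_univ_four, map_add, map_mul, hψ, hps, hL, hsq] at this
    simp only [hm, Matrix.cons_val, map_one, hL] at this
    simp only [veronese, Matrix.cons_val] at this
    linear_combination this

/-! ### The tangent cones of genus 17 -/

/-- The coordinate vector with index `i`. -/
abbrev unitVector {n : ℕ} (i : Fin n) : Fin n → ℂ := Pi.single i 1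

theorem unitVector_ne_zero {n : ℕ} (i : Fin n) : unitVector i ≠ 0 := by
  simp [unitVector]

/-- The points with a single nonzero coordinate. -/
abbrev unitPoint {n : ℕ} (i : Fin (n + 1)) : PSp n := mk ℂ (unitVector i) (unitVector_ne_zero i)

theorem unitVector_of_lt {n : ℕ} {i : Fin n} : ∀ j < i, unitVector i j = 0 := fun _ hj =>
  Pi.single_eq_of_ne hj.ne 1

/-- The affine coordinates at the coordinate points of projective space. -/
def localVar {n : ℕ} (i k : Fin (n + 1)) : Poly n := chartMap i (unitVector i) (X k)

theorem localVar_succAbove {n : ℕ} (i : Fin (n + 1)) (j : Fin n) :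
    localVar i (i.succAbove j) = X j := by
  rw [localVar, chartMap_X_succAbove, unitVector, Pi.single_eq_of_ne (i.succAbove_ne j), map_zero,
    add_zero]

theorem localVar_isHomogeneous {n : ℕ} {i k : Fin (n + 1)} (h : k ≠ i) :
    (localVar i k).IsHomogeneous 1 := by
  obtain ⟨j, rfl⟩ := Fin.exists_succAbove_eq h
  rw [localVar_succAbove]
  exact isHomogeneous_X _ _

theorem eval_localVar {n : ℕ} {i k : Fin (n + 1)} (h : k ≠ i) (f : Fin (n + 1) → ℂ) :
    eval (fun j => f (i.succAbove j)) (localVar i k) = f k := by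
  obtain ⟨j, rfl⟩ := Fin.exists_succAbove_eq h
  rw [localVar_succAbove, eval_X]

/-- The exponents of the forms of genus 17. -/
def weight17 (k : Fin 18) : Fin 4 → ℕ := exponents17 (pair17 k).1 + exponents17 (pair17 k).2

theorem binomial_mem17 {a b c d : Fin 18} (h : weight17 a + weight17 b = weight17 c + weight17 d) :
    (X a * X b - X c * X d : Poly 18) ∈ projIdeal W17 := by
  refine describes17.mem_projIdeal_of_vanishes fun v hv => ?_
  have := QuotientData.prod_eq_of_mem_cone coneIdeal17 hv
    [(pair17 a).1, (pair17 a).2, (pair17 b).1, (pair17 b).2]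
    [(pair17 c).1, (pair17 c).2, (pair17 d).1, (pair17 d).2] (by
      simp only [List.map_cons, List.map_nil, List.sum_cons, List.sum_nil, add_zero]
      simpa only [weight17, add_assoc] using h)
  simp only [List.map_cons, List.map_nil, List.prod_cons, List.prod_nil, mul_one] at this
  simp only [map_sub, map_mul, eval_X, zmap17]
  linear_combination this

theorem quadric_mem_tangentCone17 {i a b c d : Fin 18} (ha : a ≠ i) (hb : b ≠ i) (hc : c ≠ i)
    (hd : d ≠ i) (h : weight17 a + weight17 b = weight17 c + weight17 d) :
    localVar i a * localVar i b - localVar i c * localVar i d ∈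
      tangentConeIdeal W17 (unitPoint i) := by
  have := chartMap_mem_localIdeal (unitVector_ne_zero i) (Pi.single_eq_same i 1) unitVector_of_lt
    (binomial_mem17 h)
  rw [map_sub, map_mul, map_mul] at this
  refine mem_initialIdeal_of_add (d := 2) (g := 0) (IsHomogeneous.sub ?_ ?_)
    (isHomogeneous_zero _ _ _) (by rwa [add_zero])
  · exact (localVar_isHomogeneous ha).mul (localVar_isHomogeneous hb)
  · exact (localVar_isHomogeneous hc).mul (localVar_isHomogeneous hd)

theorem linear_mem_tangentCone17 {i b c d : Fin 18} (hb : b ≠ i) (hc : c ≠ i) (hd : d ≠ i)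
    (h : weight17 i + weight17 b = weight17 c + weight17 d) :
    localVar i b ∈ tangentConeIdeal W17 (unitPoint i) := by
  have := chartMap_mem_localIdeal (unitVector_ne_zero i) (Pi.single_eq_same i 1) unitVector_of_lt
    (binomial_mem17 h)
  rw [map_sub, map_mul, map_mul, chartMap_X_self, one_mul, sub_eq_add_neg] at this
  exact mem_initialIdeal_of_add (d := 1) (localVar_isHomogeneous hb)
    (((localVar_isHomogeneous hc).mul (localVar_isHomogeneous hd)).neg) this

/-- The exponents of the forms of genus 17 in the homogeneous parametrization. -/
def biweight17 (k : Fin 18) : Fin 6 → ℕ :=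
  bihomogeneous17 (pair17 k).1 + bihomogeneous17 (pair17 k).2

theorem isLimitDirection_of_monomials {n : ℕ} {W : Set (PSp n)} {i : Fin (n + 1)}
    {N : Fin (n + 1) → ℕ} {c : Fin (n + 1) → ℂ} (h0 : N i = 0) (hi : c i = 1)
    (h2 : ∀ k, k ≠ i → 2 ≤ N k) (hW : ∀ t : ℂ, (fun k => t ^ N k * c k) ∈ affineCone W) :
    IsLimitDirection W i (unitVector i) fun j =>
      0 ^ (N (i.succAbove j) - 2) * c (i.succAbove j) := by
  refine ⟨fun t j => t ^ (N (i.succAbove j) - 2) * c (i.succAbove j), ?_, rfl,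
    .of_forall fun t => ?_⟩
  · exact Continuous.continuousAt (by fun_prop)
  · convert hW t using 1
    funext k
    rcases Fin.eq_self_or_eq_succAbove i k with rfl | ⟨j, rfl⟩
    · simp [hi, h0]
    · rw [Pi.add_apply, Fin.insertNth_apply_succAbove, unitVector,
        Pi.single_eq_of_ne (i.succAbove_ne j), zero_add, Pi.smul_apply, smul_eq_mul, ← mul_assoc,
        ← pow_add, Nat.add_sub_cancel' (h2 _ (i.succAbove_ne j))]

theorem isLimitDirection17 {i : Fin 18} {w : Fin 6 → ℂ} {μ : Fin 6 → ℕ}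
    (hi : ∏ l, w l ^ biweight17 i l = 1) (h0 : ∑ l, μ l * biweight17 i l = 0)
    (h2 : ∀ k, k ≠ i → 2 ≤ ∑ l, μ l * biweight17 k l) :
    IsLimitDirection W17 i (unitVector i) fun j =>
      0 ^ (∑ l, μ l * biweight17 (i.succAbove j) l - 2) *
        ∏ l, w l ^ biweight17 (i.succAbove j) l := by
  refine isLimitDirection_of_monomials (N := fun k => ∑ l, μ l * biweight17 k l)
    (c := fun k => ∏ l, w l ^ biweight17 k l) h0 hi h2 fun t => ?_
  have hc := param_mem_cone17 fun l => w l * t ^ μ l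
  have hz : D17.zmap (fun k => ∏ l, (w l * t ^ μ l) ^ bihomogeneous17 k l) =
      fun k => t ^ (∑ l, μ l * biweight17 k l) * ∏ l, w l ^ biweight17 k l := by
    funext k
    rw [zmap17, ← Finset.prod_mul_distrib, ← Finset.prod_pow_eq_pow_sum, ← Finset.prod_mul_distrib]
    refine Finset.prod_congr rfl fun l _ => ?_
    rw [← pow_add, mul_pow, ← pow_mul, mul_comm]
    rfl
  rw [← hz]
  refine describes17.zmap_mem_affineCone hc fun h0' => ?_
  have := congrFun hz i
  simp only [h0', hi, h0, zmap17, Pi.zero_apply, zero_mul, pow_zero, mul_one] at this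
  exact zero_ne_one this

/-- The indices of the coordinate points that are the singular points of genus 17. -/
def singular17 : Fin 5 → Fin 18 := ![1, 2, 3, 4, 5]

/-- The coordinates that do not vanish on the tangent cone at a corner. -/
def survivor17 : Fin 4 → Fin 6 → Fin 18 :=
  ![![6, 7, 5, 14, 10, 11], ![6, 8, 5, 15, 10, 12], ![9, 7, 5, 16, 13, 11],
    ![9, 8, 5, 17, 13, 12]]

/-- Multiplicities of the parameters along curves through a corner. -/
def order17 : Fin 4 → Fin 6 → ℕ :=
  ![![1, 0, 1, 0, 0, 1], ![1, 0, 0, 1, 0, 1], ![0, 1, 1, 0, 0, 1], ![0, 1, 0, 1, 0, 1]]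

/-- Parameters of curves through a corner. -/
def parameter17 (u : Fin 3 → ℂ) : Fin 4 → Fin 6 → ℂ :=
  ![![u 1, 1, u 0, 1, 1, u 2], ![u 1, 1, 1, u 0, 1, u 2], ![1, u 1, u 0, 1, 1, u 2],
    ![1, u 1, 1, u 0, 1, u 2]]

/-- The corner with the given number. -/
abbrev corner17 (κ : Fin 4) : Fin 18 := singular17 κ.castSucc

theorem survivor17_ne (κ : Fin 4) (l : Fin 6) : survivor17 κ l ≠ corner17 κ := by
  revert κ l
  decide

theorem survivor17_injective (κ : Fin 4) : Function.Injective (survivor17 κ) := by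
  revert κ
  decide

theorem survivor17_relation (κ : Fin 4) :
    weight17 (survivor17 κ 3) + weight17 (survivor17 κ 3) =
      weight17 (survivor17 κ 0) + weight17 (survivor17 κ 1) ∧
    weight17 (survivor17 κ 4) + weight17 (survivor17 κ 4) =
      weight17 (survivor17 κ 0) + weight17 (survivor17 κ 2) ∧
    weight17 (survivor17 κ 5) + weight17 (survivor17 κ 5) =
      weight17 (survivor17 κ 1) + weight17 (survivor17 κ 2) ∧
    weight17 (survivor17 κ 3) + weight17 (survivor17 κ 4) =
      weight17 (survivor17 κ 0) + weight17 (survivor17 κ 5) ∧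
    weight17 (survivor17 κ 3) + weight17 (survivor17 κ 5) =
      weight17 (survivor17 κ 1) + weight17 (survivor17 κ 4) ∧
    weight17 (survivor17 κ 4) + weight17 (survivor17 κ 5) =
      weight17 (survivor17 κ 2) + weight17 (survivor17 κ 3) := by
  revert κ
  decide

theorem exists_relation17 (κ : Fin 4) (b : Fin 18) (hb : b ≠ corner17 κ)
    (hs : ∀ l, survivor17 κ l ≠ b) : ∃ c d, c ≠ corner17 κ ∧ d ≠ corner17 κ ∧
      weight17 (corner17 κ) + weight17 b = weight17 c + weight17 d := by
  revert κ b
  decide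

theorem order17_spec (κ : Fin 4) : ∑ l, order17 κ l * biweight17 (corner17 κ) l = 0 ∧
    (∀ k, k ≠ corner17 κ → 2 ≤ ∑ l, order17 κ l * biweight17 k l) ∧
    (∀ l, ∑ l', order17 κ l' * biweight17 (survivor17 κ l) l' = 2) ∧
    ∀ k, k ≠ corner17 κ → (∀ l, survivor17 κ l ≠ k) → 2 < ∑ l, order17 κ l * biweight17 k l := by
  revert κ
  decide

theorem parameter17_spec (u : Fin 3 → ℂ) (κ : Fin 4) :
    ∏ l, parameter17 u κ l ^ biweight17 (corner17 κ) l = 1 := by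
  rw [Fin.prod_univ_six]
  fin_cases κ <;> simp [parameter17, biweight17, bihomogeneous17, pair17, corner17, singular17]

theorem parameter17_survivor (u : Fin 3 → ℂ) (κ : Fin 4) (l : Fin 6) :
    ∏ l', parameter17 u κ l' ^ biweight17 (survivor17 κ l) l' = veronese u l := by
  rw [Fin.prod_univ_six]
  fin_cases κ <;> fin_cases l <;>
    simp [parameter17, biweight17, bihomogeneous17, pair17, survivor17, veronese] <;> ring

theorem tangentCone17_corner (κ : Fin 4) :
    (unitPoint (corner17 κ) ∈ W17 → 5 ≤ Module.finrank ℂ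
      (embeddedTangentSpace W17 (unitPoint (corner17 κ)))) ∧
    HasMultiplicity W17 (unitPoint (corner17 κ)) 3 4 ∧
      ∃ Y, IsVeroneseSurface Y ∧
        TangentConeIsConeOver W17 (unitPoint (corner17 κ)) Y := by
  obtain ⟨r1, r2, r3, r4, r5, r6⟩ := survivor17_relation κ
  obtain ⟨o1, o2, o3, o4⟩ := order17_spec κ
  have hne := survivor17_ne κ
  let ext : (Fin 6 → ℂ) →ₗ[ℂ] (Fin 18 → ℂ) :=
    ∑ l, LinearMap.single ℂ (fun _ => ℂ) (survivor17 κ l) ∘ₗ LinearMap.proj l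
  have hext : ∀ v k, ext v k = ∑ l, if k = survivor17 κ l then v l else 0 := by
    intro v k
    simp [ext, Pi.single_apply]
  have hext1 : ∀ v l, ext v (survivor17 κ l) = v l := by
    intro v l
    rw [hext, Finset.sum_eq_single l]
    · simp
    · intro l' _ hl'
      rw [if_neg]
      exact fun h => hl' (survivor17_injective κ h).symm
    · simp
  have hext2 : ∀ v k, (∀ l, survivor17 κ l ≠ k) → ext v k = 0 := by
    intro v k hk
    rw [hext]
    exact Finset.sum_eq_zero fun l _ => if_neg fun h => hk l h.symm
  refine tangentCone_of_veronese (unitVector_ne_zero _) (Pi.single_eq_same _ 1) unitVector_of_lt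
    (S := fun l => localVar (corner17 κ) (survivor17 κ l))
    (fun l => localVar_isHomogeneous (hne l))
    (quadric_mem_tangentCone17 (hne _) (hne _) (hne _) (hne _) r1)
    (quadric_mem_tangentCone17 (hne _) (hne _) (hne _) (hne _) r2)
    (quadric_mem_tangentCone17 (hne _) (hne _) (hne _) (hne _) r3)
    (quadric_mem_tangentCone17 (hne _) (hne _) (hne _) (hne _) r4)
    (quadric_mem_tangentCone17 (hne _) (hne _) (hne _) (hne _) r5)
    (quadric_mem_tangentCone17 (hne _) (hne _) (hne _) (hne _) r6) (fun j => ?_)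
    (LinearMap.funLeft ℂ ℂ (corner17 κ).succAbove ∘ₗ ext) (fun v l => ?_) (fun u _ => ?_)
  · by_cases h : ∃ l, survivor17 κ l = (corner17 κ).succAbove j
    · obtain ⟨l, hl⟩ := h
      refine ⟨Pi.single l 1, ?_⟩
      rw [Finset.sum_eq_single l]
      · rw [hl, localVar_succAbove, Pi.single_eq_same, map_one, one_mul, sub_self]
        exact Ideal.zero_mem _
      · intro b _ hb
        rw [Pi.single_eq_of_ne hb, map_zero, zero_mul]
      · simp
    · push Not at h
      obtain ⟨c, d, hc, hd, hcd⟩ := exists_relation17 κ _ ((corner17 κ).succAbove_ne j) h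
      refine ⟨0, ?_⟩
      have := linear_mem_tangentCone17 ((corner17 κ).succAbove_ne j) hc hd hcd
      rw [localVar_succAbove] at this
      simpa using this
  · exact (eval_localVar (hne l) (ext v)).trans (hext1 v l)
  · have h := isLimitDirection17 (parameter17_spec u κ) o1 o2
    convert h using 1
    funext j
    change ext _ ((corner17 κ).succAbove j) = _
    by_cases h : ∃ l, survivor17 κ l = (corner17 κ).succAbove j
    · obtain ⟨l, hl⟩ := h
      rw [← hl, hext1, o3, parameter17_survivor, Nat.sub_self, pow_zero, one_mul]
    · push Not at h
      have := o4 _ ((corner17 κ).succAbove_ne j) h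
      rw [hext2 _ _ h, zero_pow (by omega), zero_mul]

theorem reducible_mul_piece {n r : ℕ} {G : Ideal (Poly n)} {m : Fin r → Poly n}
    {ψ : Fin r → Fin 3 → Poly n} {b : Fin r}
    (h : ∀ j, ∃ σ : Poly 3, m b * X j - m b * aeval (ψ b) σ ∈ G) (F : Poly n) :
    m b * F ∈ reducible G m ψ := by
  choose σ hσ using h
  have h1 := mul_sub_mul_aeval_mem (x := X) (ρ := fun j => aeval (ψ b) (σ j)) hσ F
  have h2 : aeval (fun j => aeval (ψ b) (σ j)) F = aeval (ψ b) (aeval σ F) := by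
    rw [← AlgHom.comp_apply]
    congr 1
    ext j
    simp
  rw [h2, aeval_X_left_apply] at h1
  exact reducible_of_sub h1 (reducible_piece b _)

/-! ### Unions of linear subspaces and quadrics -/

theorem eq_of_affineCone_eq {n : ℕ} {A B : Set (PSp n)} (h : affineCone A = affineCone B) :
    A = B := by
  ext P
  have h1 : ∀ S : Set (PSp n), P ∈ S ↔ P.rep ∈ affineCone S := fun S =>
    ⟨fun hP => ⟨P.rep_nonzero, by rwa [mk_rep]⟩, fun ⟨_, hP⟩ => by rwa [mk_rep] at hP⟩
  rw [h1 A, h1 B, h]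

theorem mem_affineCone_projSubspace {n : ℕ} {E : Submodule ℂ (Fin (n + 1) → ℂ)}
    {v : Fin (n + 1) → ℂ} : v ∈ affineCone (projSubspace E) ↔ v ≠ 0 ∧ v ∈ E := by
  constructor
  · rintro ⟨h0, h⟩
    refine ⟨h0, ?_⟩
    change (mk ℂ v h0).submodule ≤ E at h
    rwa [submodule_mk, Submodule.span_singleton_le_iff_mem] at h
  · rintro ⟨h0, h⟩
    refine ⟨h0, ?_⟩
    change (mk ℂ v h0).submodule ≤ E
    rwa [submodule_mk, Submodule.span_singleton_le_iff_mem]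

theorem mem_affineCone_union {n : ℕ} {A B : Set (PSp n)} {v : Fin (n + 1) → ℂ} :
    v ∈ affineCone (A ∪ B) ↔ v ∈ affineCone A ∨ v ∈ affineCone B :=
  exists_or

theorem mem_affineCone_inter {n : ℕ} {A B : Set (PSp n)} {v : Fin (n + 1) → ℂ} :
    v ∈ affineCone (A ∩ B) ↔ v ∈ affineCone A ∧ v ∈ affineCone B :=
  ⟨fun ⟨h0, h1, h2⟩ => ⟨⟨h0, h1⟩, ⟨h0, h2⟩⟩, fun ⟨⟨h0, h1⟩, ⟨_, h2⟩⟩ => ⟨h0, h1, h2⟩⟩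

theorem mem_affineCone_iUnion {n : ℕ} {ι : Type} {A : ι → Set (PSp n)} {v : Fin (n + 1) → ℂ} :
    v ∈ affineCone (⋃ i, A i) ↔ ∃ i, v ∈ affineCone (A i) := by
  constructor
  · rintro ⟨h0, h⟩
    obtain ⟨i, hi⟩ := Set.mem_iUnion.mp h
    exact ⟨i, h0, hi⟩
  · rintro ⟨i, h0, hi⟩
    exact ⟨h0, Set.mem_iUnion.mpr ⟨i, hi⟩⟩

theorem mem_affineCone_quadric {n : ℕ} {L : (Fin 4 → ℂ) →ₗ[ℂ] (Fin (n + 1) → ℂ)}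
    (hL : Function.Injective L) {v : Fin (n + 1) → ℂ} :
    v ∈ affineCone (Projectivization.map L hL ''
      {P : PSp 3 | P.rep 0 * P.rep 3 = P.rep 1 * P.rep 2}) ↔
      v ≠ 0 ∧ ∃ w, v = L w ∧ w 0 * w 3 = w 1 * w 2 := by
  have hQ : (X 0 * X 3 - X 1 * X 2 : Poly 4).IsHomogeneous 2 :=
    ((isHomogeneous_X _ _).mul (isHomogeneous_X _ _)).sub
      ((isHomogeneous_X _ _).mul (isHomogeneous_X _ _))
  have hmem : ∀ (w : Fin 4 → ℂ) (hw : w ≠ 0), mk ℂ w hw ∈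
      {P : PSp 3 | P.rep 0 * P.rep 3 = P.rep 1 * P.rep 2} ↔ w 0 * w 3 = w 1 * w 2 := by
    intro w hw
    have := eval_rep_eq_zero_iff hQ w hw
    simp only [map_sub, map_mul, eval_X, sub_eq_zero] at this
    exact this
  constructor
  · rintro ⟨h0, P, hP, h⟩
    refine ⟨h0, ?_⟩
    induction P using Projectivization.ind with
    | h w hw =>
      rw [hmem] at hP
      rw [Projectivization.map_mk, eq_comm, mk_eq_mk_iff_smul] at h
      obtain ⟨a, -, ha⟩ := h
      refine ⟨a • w, by rw [map_smul, ha], ?_⟩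
      simp only [Pi.smul_apply, smul_eq_mul]
      linear_combination a ^ 2 * hP
  · rintro ⟨h0, w, rfl, hw⟩
    have hw0 : w ≠ 0 := fun h => h0 (by rw [h, map_zero])
    exact ⟨h0, mk ℂ w hw0, (hmem w hw0).mpr hw, Projectivization.map_mk ..⟩

/-- A square matrix of size two with determinant zero has rank at most one. -/
theorem exists_factorization {w : Fin 4 → ℂ} (h : w 0 * w 3 = w 1 * w 2) :
    ∃ a b c d, w 0 = a * c ∧ w 1 = a * d ∧ w 2 = b * c ∧ w 3 = b * d := by
  by_cases h0 : w 0 = 0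
  · by_cases h1 : w 1 = 0
    · exact ⟨0, 1, w 2, w 3, by simp [h0], by simp [h1], by simp, by simp⟩
    · have h2 : w 2 = 0 := by
        rw [h0, zero_mul, eq_comm, mul_eq_zero] at h
        exact h.resolve_left h1
      exact ⟨w 1, w 3, 0, 1, by simp [h0], by simp, by simp [h2], by simp⟩
  · refine ⟨w 0, w 2, 1, w 1 / w 0, by simp, by field_simp, by simp, ?_⟩
    field_simp
    linear_combination h

/-- The vectors whose coordinates outside `S` vanish. -/
def coordSubspace {n : ℕ} (S : Finset (Fin n)) : Submodule ℂ (Fin n → ℂ) where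
  carrier := {v | ∀ j, j ∉ S → v j = 0}
  add_mem' ha hb j hj := by
    rw [Pi.add_apply, ha j hj, hb j hj, add_zero]
  zero_mem' _ _ := rfl
  smul_mem' a v hv j hj := by
    rw [Pi.smul_apply, hv j hj, smul_zero]

theorem mem_coordSubspace {n : ℕ} {S : Finset (Fin n)} {v : Fin n → ℂ} :
    v ∈ coordSubspace S ↔ ∀ j, j ∉ S → v j = 0 := Iff.rfl

theorem coordSubspace_mono {n : ℕ} {S S' : Finset (Fin n)} (h : S ⊆ S') :
    coordSubspace S ≤ coordSubspace S' := fun _ hv j hj => hv j fun hjS => hj (h hjS)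

theorem coordSubspace_inf {n : ℕ} (S S' : Finset (Fin n)) :
    coordSubspace S ⊓ coordSubspace S' = coordSubspace (S ∩ S') := by
  ext v
  simp only [Submodule.mem_inf, mem_coordSubspace, Finset.mem_inter, not_and_or]
  exact ⟨fun h j hj => hj.elim (h.1 j) (h.2 j), fun h => ⟨fun j hj => h j (.inl hj),
    fun j hj => h j (.inr hj)⟩⟩

theorem coordSubspace_empty {n : ℕ} : coordSubspace (∅ : Finset (Fin n)) = ⊥ := by
  ext v
  simp [mem_coordSubspace, funext_iff]

theorem finrank_coordSubspace {n : ℕ} (S : Finset (Fin n)) :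
    Module.finrank ℂ (coordSubspace S) = S.card := by
  have e : coordSubspace S ≃ₗ[ℂ] (S → ℂ) :=
    { toFun := fun v j => v.1 j
      map_add' := fun _ _ => rfl
      map_smul' := fun _ _ => rfl
      invFun := fun f => ⟨fun j => if h : j ∈ S then f ⟨j, h⟩ else 0, fun j hj => dif_neg hj⟩
      left_inv := fun v => by
        ext j
        by_cases h : j ∈ S
        · simp [h]
        · simp [h, v.2 j h]
      right_inv := fun f => by
        ext j
        simp }
  rw [e.finrank_eq, Module.finrank_fintype_fun_eq_card, Fintype.card_coe]

/-! ### The vertex of genus 17 -/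

/-- The index of the squared corner coordinates. -/
def cornerIndex : Fin 4 → Fin 17 := ![1, 2, 3, 4]

/-- The indices of the coordinates that belong to the edges at a corner. -/
def edgeIndex : Fin 4 → Fin 2 → Fin 17 := ![![9, 10], ![9, 11], ![12, 10], ![12, 11]]

/-- The indices of the plane that belongs to a corner. -/
def planeIndices (κ : Fin 4) : Finset (Fin 17) := {cornerIndex κ, edgeIndex κ 0, edgeIndex κ 1}

theorem planeIndices_card (κ : Fin 4) : (planeIndices κ).card = 3 := by
  revert κ
  decide

/-- The tangent cone at the vertex. -/
abbrev vertexIdeal17 : Ideal (Poly 17) :=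
  tangentConeIdeal W17 (unitPoint 5)

theorem X_mem_vertexIdeal17 {j : Fin 17} (h : j ∉ ({1, 2, 3, 4, 9, 10, 11, 12} : Finset (Fin 17))) :
    X j ∈ vertexIdeal17 := by
  have key : ∀ j : Fin 17, j ∉ ({1, 2, 3, 4, 9, 10, 11, 12} : Finset (Fin 17)) →
      ∃ c d : Fin 18, c ≠ 5 ∧ d ≠ 5 ∧
        weight17 5 + weight17 ((5 : Fin 18).succAbove j) = weight17 c + weight17 d := by decide
  obtain ⟨c, d, hc, hd, hcd⟩ := key j h
  have := linear_mem_tangentCone17 ((5 : Fin 18).succAbove_ne j) hc hd hcd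
  rwa [localVar_succAbove] at this

theorem binomial_mem_vertexIdeal17 {a b c d : Fin 17}
    (h : weight17 ((5 : Fin 18).succAbove a) + weight17 ((5 : Fin 18).succAbove b) =
      weight17 ((5 : Fin 18).succAbove c) + weight17 ((5 : Fin 18).succAbove d)) :
    (X a * X b - X c * X d : Poly 17) ∈ vertexIdeal17 := by
  have hne := (5 : Fin 18).succAbove_ne
  have := quadric_mem_tangentCone17 (hne a) (hne b) (hne c) (hne d) h
  rwa [localVar_succAbove, localVar_succAbove, localVar_succAbove, localVar_succAbove] at this

theorem corner_mul_mem_vertexIdeal17 {κ : Fin 4} {j : Fin 17} (h : j ∉ planeIndices κ) :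
    (X (cornerIndex κ) * X j : Poly 17) ∈ vertexIdeal17 := by
  by_cases hj : j ∈ ({1, 2, 3, 4, 9, 10, 11, 12} : Finset (Fin 17))
  · have key : ∀ κ : Fin 4, ∀ j ∈ ({1, 2, 3, 4, 9, 10, 11, 12} : Finset (Fin 17)),
        j ∉ planeIndices κ → ∃ c ∈ ({0, 13, 14, 15, 16, 5, 6, 7, 8} : Finset (Fin 17)), ∃ d,
        weight17 ((5 : Fin 18).succAbove (cornerIndex κ)) + weight17 ((5 : Fin 18).succAbove j) =
          weight17 ((5 : Fin 18).succAbove c) + weight17 ((5 : Fin 18).succAbove d) := by decide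
    obtain ⟨c, hc, d, hcd⟩ := key κ j hj h
    have hk : ∀ c ∈ ({0, 13, 14, 15, 16, 5, 6, 7, 8} : Finset (Fin 17)),
        c ∉ ({1, 2, 3, 4, 9, 10, 11, 12} : Finset (Fin 17)) := by decide
    have := vertexIdeal17.add_mem (binomial_mem_vertexIdeal17 hcd)
      (vertexIdeal17.mul_mem_right (X d) (X_mem_vertexIdeal17 (hk c hc)))
    rwa [sub_add_cancel] at this
  · exact vertexIdeal17.mul_mem_left _ (X_mem_vertexIdeal17 hj)

theorem edges_mem_vertexIdeal17 : (X 9 * X 12 - X 10 * X 11 : Poly 17) ∈ vertexIdeal17 :=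
  binomial_mem_vertexIdeal17 (by decide)

/-- The multipliers of the normal form at the vertex. -/
def vertexMultiplier17 : Fin 6 → Poly 17 := ![1, X 11, X 1, X 2, X 3, X 4]

/-- The variables of the normal form at the vertex. -/
def vertexVariable17 : Fin 6 → Fin 3 → Fin 17 :=
  ![![9, 12, 10], ![9, 12, 11], ![1, 9, 10], ![2, 9, 11], ![3, 12, 10], ![4, 12, 11]]

theorem exists_decomposition (h : Poly 3) :
    ∃ h₀ g : Poly 3, h = aeval ![X 0, X 1, 0] h₀ + X 2 * g := by
  refine ⟨h, ?_⟩
  suffices h - aeval ![X 0, X 1, 0] h ∈ Ideal.span {(X 2 : Poly 3)} by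
    obtain ⟨g, hg⟩ := Ideal.mem_span_singleton.mp this
    exact ⟨g, by rw [← hg]; ring⟩
  have := mul_sub_mul_aeval_mem (G := Ideal.span {(X 2 : Poly 3)}) (μ := 1) (x := X)
    (ρ := ![X 0, X 1, 0]) (fun j => ?_) h
  · simpa using this
  · fin_cases j
    · simp
    · simp
    · simp

theorem aeval_decomposition {n : ℕ} (x : Fin 3 → Poly n) (h : Poly 3) :
    aeval x (aeval ![X 0, X 1, 0] h : Poly 3) = aeval ![x 0, x 1, 0] h := by
  rw [← AlgHom.comp_apply]
  congr 1
  ext j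
  fin_cases j <;> simp

theorem reducible_vertex17 (j : Fin 17) (a : Fin 6) (h : Poly 3) :
    vertexMultiplier17 a * aeval (fun l => (X (vertexVariable17 a l) : Poly 17)) h * X j ∈
      reducible vertexIdeal17 vertexMultiplier17 fun a l => X (vertexVariable17 a l) := by
  set T := vertexIdeal17
  set m := vertexMultiplier17 with hm
  set ψ : Fin 6 → Fin 3 → Poly 17 := fun a l => X (vertexVariable17 a l) with hψ
  have hcorner : ∀ (κ : Fin 4) (F : Poly 17), X (cornerIndex κ) * F ∈ reducible T m ψ := by
    intro κ
    have key : ∀ j : Fin 17, j ∈ planeIndices κ → ∃ l, j = vertexVariable17 κ.succ.succ l := by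
      revert κ
      decide
    have hb : m κ.succ.succ = X (cornerIndex κ) := by fin_cases κ <;> rfl
    rw [← hb]
    refine reducible_mul_piece fun j => ?_
    by_cases hj : j ∈ planeIndices κ
    · obtain ⟨l, rfl⟩ := key j hj
      refine ⟨X l, ?_⟩
      rw [aeval_X, sub_self]
      exact T.zero_mem
    · refine ⟨0, ?_⟩
      rw [map_zero, mul_zero, sub_zero, hb]
      exact corner_mul_mem_vertexIdeal17 hj
  by_cases hj : j ∈ ({1, 2, 3, 4, 9, 10, 11, 12} : Finset (Fin 17))
  swap
  · exact reducible_of_mem (T.mul_mem_left _ (X_mem_vertexIdeal17 hj))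
  by_cases ha : ∃ κ : Fin 4, a = κ.succ.succ
  · obtain ⟨κ, rfl⟩ := ha
    have hb : m κ.succ.succ = X (cornerIndex κ) := by fin_cases κ <;> rfl
    rw [hb, mul_assoc]
    exact hcorner κ _
  by_cases hjc : ∃ κ, j = cornerIndex κ
  · obtain ⟨κ, rfl⟩ := hjc
    rw [mul_comm]
    exact hcorner κ _
  have ha' : a = 0 ∨ a = 1 := by
    revert a
    decide
  have hj' : j = 9 ∨ j = 10 ∨ j = 11 ∨ j = 12 := by
    revert j
    decide
  have hvar : ∀ (a : Fin 6) (l : Fin 3) (h : Poly 3),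
      m a * aeval (ψ a) h * X (vertexVariable17 a l) ∈ reducible T m ψ := by
    intro a l h
    refine reducible_mul_of_sub (b := a) (ρ := X l) rfl ?_ h
    rw [aeval_X, sub_self]
    exact T.zero_mem
  have hm0 : m 0 = 1 := rfl
  have hm1 : m 1 = X 11 := rfl
  have hψ0 : ψ 0 = ![X 9, X 12, X 10] := by
    funext l
    fin_cases l <;> rfl
  have hψ1 : ψ 1 = ![X 9, X 12, X 11] := by
    funext l
    fin_cases l <;> rfl
  obtain ⟨h₀, g, rfl⟩ := exists_decomposition h
  have hdec0 : aeval (ψ 0) (aeval ![X 0, X 1, 0] h₀ : Poly 3) = aeval ![X 9, X 12, 0] h₀ := by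
    rw [aeval_decomposition, hψ0]
    rfl
  have hdec1 : aeval (ψ 1) (aeval ![X 0, X 1, 0] h₀ : Poly 3) = aeval ![X 9, X 12, 0] h₀ := by
    rw [aeval_decomposition, hψ1]
    rfl
  have hx02 : aeval (ψ 0) (X 2 : Poly 3) = (X 10 : Poly 17) := aeval_X _ _
  have hx12 : aeval (ψ 1) (X 2 : Poly 3) = (X 11 : Poly 17) := aeval_X _ _
  have hx : ∀ a : Fin 6, a = 0 ∨ a = 1 → aeval (ψ a) (X 0 * X 1 : Poly 3) = (X 9 * X 12 : Poly 17) := by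
    rintro a (rfl | rfl)
    · rw [map_mul, aeval_X, aeval_X]
      rfl
    · rw [map_mul, aeval_X, aeval_X]
      rfl
  rcases ha' with rfl | rfl
  · rcases hj' with rfl | rfl | rfl | rfl
    · exact hvar 0 0 _
    · exact hvar 0 2 _
    · refine reducible_of_sub (F' := m 1 * aeval (ψ 1) (aeval ![X 0, X 1, 0] h₀ : Poly 3) +
        m 0 * aeval (ψ 0) (X 0 * X 1 * g : Poly 3)) ?_ (add_mem (reducible_piece _ _) (reducible_piece _ _))
      have := T.mul_mem_left (-aeval (ψ 0) g) edges_mem_vertexIdeal17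
      convert this using 1
      rw [map_add, map_mul (aeval (ψ 0)), map_mul (aeval (ψ 0)) (X 0 * X 1 : Poly 3) g, hx 0 (.inl rfl),
        hdec0, hdec1, hx02, hm0, hm1]
      ring
    · exact hvar 0 1 _
  · rcases hj' with rfl | rfl | rfl | rfl
    · exact hvar 1 0 _
    · refine reducible_of_sub (F' := m 0 * aeval (ψ 0) (X 0 * X 1 * aeval ![X 0, X 1, 0] h₀ : Poly 3)
        + m 1 * aeval (ψ 1) (X 0 * X 1 * g : Poly 3)) ?_
        (add_mem (reducible_piece _ _) (reducible_piece _ _))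
      have := T.mul_mem_left (-aeval (ψ 1) (aeval ![X 0, X 1, 0] h₀ + X 2 * g : Poly 3))
        edges_mem_vertexIdeal17
      convert this using 1
      rw [map_add, map_mul (aeval (ψ 1)), map_mul (aeval (ψ 1)) (X 0 * X 1) g,
        map_mul (aeval (ψ 0)) (X 0 * X 1 : Poly 3), hx 0 (.inl rfl), hx 1 (.inr rfl),
        hdec0, hdec1, hx12, hm0, hm1]
      ring
    · exact hvar 1 2 _
    · exact hvar 1 1 _

theorem injective_of_coordinates {n m : ℕ} {L : (Fin n → ℂ) →ₗ[ℂ] (Fin m → ℂ)} (σ : Fin n → Fin m)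
    (h : ∀ w l, L w (σ l) = w l) : Function.Injective L := fun v w e =>
  funext fun l => by rw [← h v l, e, h]

/-- The inclusion of the space of the quadric surface in the tangent cone at the vertex. -/
def quadricSpace17 : (Fin 4 → ℂ) →ₗ[ℂ] (Fin 17 → ℂ) where
  toFun w := ![0, 0, 0, 0, 0, 0, 0, 0, 0, w 0, w 1, w 2, w 3, 0, 0, 0, 0]
  map_add' v w := by
    ext j
    fin_cases j <;> simp
  map_smul' c w := by
    ext j
    fin_cases j <;> simp

theorem quadricSpace17_injective : Function.Injective quadricSpace17 :=
  injective_of_coordinates ![9, 10, 11, 12] fun w l => by fin_cases l <;> rfl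

theorem eq_quadricSpace17 {v : Fin 17 → ℂ}
    (hv : v ∈ coordSubspace ({9, 10, 11, 12} : Finset (Fin 17))) :
    v = quadricSpace17 ![v 9, v 10, v 11, v 12] := by
  rw [mem_coordSubspace] at hv
  funext j
  by_cases h : j ∈ ({9, 10, 11, 12} : Finset (Fin 17))
  · simp only [Finset.mem_insert, Finset.mem_singleton] at h
    rcases h with rfl | rfl | rfl | rfl <;> rfl
  · rw [hv j h]
    fin_cases j <;> first | rfl | exact absurd (by decide) h

theorem quadricSpace17_mem (w : Fin 4 → ℂ) :
    quadricSpace17 w ∈ coordSubspace ({9, 10, 11, 12} : Finset (Fin 17)) := by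
  rw [mem_coordSubspace]
  intro j h
  fin_cases j <;> first | rfl | exact absurd (by decide) h

/-- The quadric surface in the tangent cone at the vertex. -/
def quadric17 : Set (PSp 16) :=
  Projectivization.map quadricSpace17 quadricSpace17_injective ''
    {P : PSp 3 | P.rep 0 * P.rep 3 = P.rep 1 * P.rep 2}

/-- The base of the tangent cone at the vertex. -/
def vertexCone17 : Set (PSp 16) :=
  (⋃ i : Fin 2, projSubspace (coordSubspace (planeIndices (![0, 1] i)))) ∪
    (⋃ i : Fin 2, projSubspace (coordSubspace (planeIndices (![3, 2] i)))) ∪ quadric17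

theorem mem_vertexCone17 {v : Fin 17 → ℂ} : v ∈ affineCone vertexCone17 ↔ v ≠ 0 ∧
    ((∃ κ, v ∈ coordSubspace (planeIndices κ)) ∨
      ∃ w, v = quadricSpace17 w ∧ w 0 * w 3 = w 1 * w 2) := by
  unfold vertexCone17 quadric17
  rw [mem_affineCone_union, mem_affineCone_union, mem_affineCone_iUnion, mem_affineCone_iUnion,
    mem_affineCone_quadric, Fin.exists_fin_two, Fin.exists_fin_two]
  simp only [mem_affineCone_projSubspace, Matrix.cons_val_zero, Matrix.cons_val_one]
  constructor
  · rintro (((h | h) | (h | h)) | h)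
    · exact ⟨h.1, .inl ⟨0, h.2⟩⟩
    · exact ⟨h.1, .inl ⟨1, h.2⟩⟩
    · exact ⟨h.1, .inl ⟨3, h.2⟩⟩
    · exact ⟨h.1, .inl ⟨2, h.2⟩⟩
    · exact ⟨h.1, .inr h.2⟩
  · rintro ⟨h0, ⟨κ, h⟩ | h⟩
    · match κ with
      | 0 => exact .inl (.inl (.inl ⟨h0, h⟩))
      | 1 => exact .inl (.inl (.inr ⟨h0, h⟩))
      | 2 => exact .inl (.inr (.inr ⟨h0, h⟩))
      | 3 => exact .inl (.inr (.inl ⟨h0, h⟩))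
    · exact .inr ⟨h0, h⟩

/-- The indices of the line in which a plane meets the quadric surface. -/
def edgeIndices (κ : Fin 4) : Finset (Fin 17) := {edgeIndex κ 0, edgeIndex κ 1}

theorem plane_inter_quadric17 (κ : Fin 4) :
    projSubspace (coordSubspace (planeIndices κ)) ∩ quadric17 =
      projSubspace (coordSubspace (edgeIndices κ)) := by
  refine eq_of_affineCone_eq (Set.ext fun v => ?_)
  unfold quadric17
  rw [mem_affineCone_inter, mem_affineCone_projSubspace, mem_affineCone_projSubspace,
    mem_affineCone_quadric]
  have h1 : planeIndices κ ∩ {9, 10, 11, 12} ⊆ edgeIndices κ := by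
    revert κ
    decide
  have h2 : edgeIndices κ ⊆ planeIndices κ ∧ edgeIndices κ ⊆ {9, 10, 11, 12} ∧
      (9 ∉ edgeIndices κ ∨ 12 ∉ edgeIndices κ) ∧ (10 ∉ edgeIndices κ ∨ 11 ∉ edgeIndices κ) := by
    revert κ
    decide
  constructor
  · rintro ⟨⟨h0, h⟩, -, w, rfl, -⟩
    refine ⟨h0, coordSubspace_mono h1 ?_⟩
    rw [← coordSubspace_inf]
    exact ⟨h, quadricSpace17_mem w⟩
  · rintro ⟨h0, h⟩
    refine ⟨⟨h0, coordSubspace_mono h2.1 h⟩, h0, _,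
      eq_quadricSpace17 (coordSubspace_mono h2.2.1 h), ?_⟩
    rw [mem_coordSubspace] at h
    have e1 : v 9 * v 12 = 0 := by
      rcases h2.2.2.1 with h3 | h3 <;> simp [h _ h3]
    have e2 : v 10 * v 11 = 0 := by
      rcases h2.2.2.2 with h3 | h3 <;> simp [h _ h3]
    exact e1.trans e2.symm

theorem isUnionOfFourPlanesAndQuadric17 : IsUnionOfFourPlanesAndQuadric vertexCone17 := by
  refine ⟨coordSubspace {1, 2, 3, 4, 9, 10, 11, 12}, coordSubspace {9, 10, 11, 12}, quadric17,
    fun i => coordSubspace (planeIndices (![0, 1] i)),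
    fun i => coordSubspace (planeIndices (![3, 2] i)),
    fun i => coordSubspace (edgeIndices (![0, 1] i)),
    fun i => coordSubspace (edgeIndices (![3, 2] i)),
    finrank_coordSubspace _, coordSubspace_mono (by decide),
    ⟨quadricSpace17, quadricSpace17_injective, ?_, rfl⟩, fun i => ⟨coordSubspace_mono ?_, ?_⟩,
    fun i => ⟨coordSubspace_mono ?_, ?_⟩, rfl, fun i => ⟨?_, plane_inter_quadric17 _⟩,
    fun i => ⟨?_, plane_inter_quadric17 _⟩, fun i => ?_, ?_, ?_, ?_, ?_⟩
  · refine le_antisymm ?_ fun v hv => ⟨_, (eq_quadricSpace17 hv).symm⟩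
    rintro _ ⟨w, rfl⟩
    exact quadricSpace17_mem w
  · revert i
    decide
  · rw [finrank_coordSubspace, planeIndices_card]
  · revert i
    decide
  · rw [finrank_coordSubspace, planeIndices_card]
  · rw [finrank_coordSubspace]
    revert i
    decide
  · rw [finrank_coordSubspace]
    revert i
    decide
  · rw [coordSubspace_inf, ← coordSubspace_empty]
    congr 1
    revert i
    decide
  all_goals
    rw [coordSubspace_inf, finrank_coordSubspace]
    decide

/-! ### Limit directions at the vertex of genus 17 -/

/-- Multiplicities of the parameters along curves that touch the planes. -/
def planeOrder17 : Fin 4 → Fin 6 → ℕ :=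
  ![![1, 0, 1, 0, 1, 0], ![1, 0, 0, 1, 1, 0], ![0, 1, 1, 0, 1, 0], ![0, 1, 0, 1, 1, 0]]

/-- Parameters of curves that touch the planes. -/
def planeParameter17 (a b c : ℂ) : Fin 4 → Fin 6 → ℂ :=
  ![![c, 1, b, 1, a, 1], ![c, 1, 1, b, a, 1], ![1, c, b, 1, a, 1], ![1, c, 1, b, a, 1]]

theorem planeOrder17_spec (κ : Fin 4) : ∑ l, planeOrder17 κ l * biweight17 5 l = 0 ∧
    (∀ k, k ≠ 5 → 2 ≤ ∑ l, planeOrder17 κ l * biweight17 k l) ∧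
    (∀ j ∈ planeIndices κ, ∑ l, planeOrder17 κ l * biweight17 ((5 : Fin 18).succAbove j) l = 2) ∧
    ∀ j, j ∉ planeIndices κ →
      2 < ∑ l, planeOrder17 κ l * biweight17 ((5 : Fin 18).succAbove j) l := by
  revert κ
  decide

theorem planeParameter17_spec (a b c : ℂ) (κ : Fin 4) :
    ∏ l, planeParameter17 a b c κ l ^ biweight17 5 l = 1 ∧
    ∏ l, planeParameter17 a b c κ l ^ biweight17 ((5 : Fin 18).succAbove (cornerIndex κ)) l
      = a ^ 2 ∧
    ∏ l, planeParameter17 a b c κ l ^ biweight17 ((5 : Fin 18).succAbove (edgeIndex κ 0)) l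
      = b * a ∧
    ∏ l, planeParameter17 a b c κ l ^ biweight17 ((5 : Fin 18).succAbove (edgeIndex κ 1)) l
      = c * a := by
  have e : ∀ κ, biweight17 5 = ![0, 0, 0, 0, 0, 2] ∧
      biweight17 ((5 : Fin 18).succAbove (cornerIndex κ)) =
        ![![0, 4, 0, 4, 2, 0], ![0, 4, 4, 0, 2, 0], ![4, 0, 0, 4, 2, 0], ![4, 0, 4, 0, 2, 0]] κ ∧
      biweight17 ((5 : Fin 18).succAbove (edgeIndex κ 0)) =
        ![![0, 2, 1, 1, 1, 1], ![0, 2, 1, 1, 1, 1], ![2, 0, 1, 1, 1, 1], ![2, 0, 1, 1, 1, 1]] κ ∧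
      biweight17 ((5 : Fin 18).succAbove (edgeIndex κ 1)) =
        ![![1, 1, 0, 2, 1, 1], ![1, 1, 2, 0, 1, 1], ![1, 1, 0, 2, 1, 1], ![1, 1, 2, 0, 1, 1]] κ := by
    decide
  obtain ⟨e1, e2, e3, e4⟩ := e κ
  rw [e1, e2, e3, e4]
  simp only [Fin.prod_univ_six]
  fin_cases κ <;> simp [planeParameter17]

theorem isGenericLimitDirection17_plane {κ : Fin 4} {v : Fin 17 → ℂ}
    (hv : v ∈ coordSubspace (planeIndices κ)) :
    IsGenericLimitDirection W17 5 (unitVector 5) v := by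
  let f : {A : Type} → [CommRing A] → (Fin 3 → A) → Fin 17 → A := fun u j =>
    if j = cornerIndex κ then u 0 else if j = edgeIndex κ 0 then u 1 else
      if j = edgeIndex κ 1 then u 2 else 0
  have hf : ∀ u : Fin 3 → ℂ, (fun j => eval u (f (X : Fin 3 → Poly 3) j)) = f u := by
    intro u
    funext j
    simp only [f, apply_ite (eval u), eval_X, map_zero]
  refine ⟨3, f X, X 0, ![v (cornerIndex κ), v (edgeIndex κ 0), v (edgeIndex κ 1)], X_ne_zero _, ?_,
    fun u hu => ?_⟩
  · rw [hf]
    funext j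
    simp only [f]
    split_ifs with h1 h2 h3
    · rw [h1]
      rfl
    · rw [h2]
      rfl
    · rw [h3]
      rfl
    · refine mem_coordSubspace.mp hv j ?_
      simp [planeIndices, h1, h2, h3]
  · rw [hf]
    rw [eval_X] at hu
    obtain ⟨a, ha⟩ := exists_sq (u 0)
    have ha0 : a ≠ 0 := by
      rintro rfl
      exact hu (by rw [← ha]; ring)
    obtain ⟨o1, o2, o3, o4⟩ := planeOrder17_spec κ
    obtain ⟨p1, p2, p3, p4⟩ := planeParameter17_spec a (u 1 / a) (u 2 / a) κ
    have h := isLimitDirection17 p1 o1 o2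
    convert h using 1
    funext j
    simp only [f]
    split_ifs with h1 h2 h3
    · rw [h1, o3 _ (by simp [planeIndices]), p2, ← ha, Nat.sub_self, pow_zero, one_mul]
    · rw [h2, o3 _ (by simp [planeIndices]), p3, Nat.sub_self, pow_zero, one_mul,
        div_mul_cancel₀ _ ha0]
    · rw [h3, o3 _ (by simp [planeIndices]), p4, Nat.sub_self, pow_zero, one_mul,
        div_mul_cancel₀ _ ha0]
    · have := o4 j (by simp [planeIndices, h1, h2, h3])
      rw [zero_pow (by omega), zero_mul]

theorem isGenericLimitDirection17_quadric {w : Fin 4 → ℂ} (hw : w 0 * w 3 = w 1 * w 2) :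
    IsGenericLimitDirection W17 5 (unitVector 5) (quadricSpace17 w) := by
  obtain ⟨a, b, c, d, h0, h1, h2, h3⟩ := exists_factorization hw
  let f : {A : Type} → [CommRing A] → (Fin 4 → A) → Fin 17 → A := fun u =>
    ![0, 0, 0, 0, 0, 0, 0, 0, 0, u 0 * u 2, u 0 * u 3, u 1 * u 2, u 1 * u 3, 0, 0, 0, 0]
  have hf : ∀ u : Fin 4 → ℂ, (fun j => eval u (f (X : Fin 4 → Poly 4) j)) = f u := by
    intro u
    funext j
    fin_cases j <;> simp [f]
  refine ⟨4, f X, X 0 * X 1 * X 2 * X 3, ![a, b, c, d], ?_, ?_, fun u hu => ?_⟩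
  · exact mul_ne_zero (mul_ne_zero (mul_ne_zero (X_ne_zero _) (X_ne_zero _)) (X_ne_zero _))
      (X_ne_zero _)
  · rw [hf]
    simp only [f, quadricSpace17, LinearMap.coe_mk, AddHom.coe_mk, h0, h1, h2, h3,
      Matrix.cons_val]
  · rw [hf]
    simp only [map_mul, eval_X, mul_ne_zero_iff] at hu
    obtain ⟨⟨⟨n0, n1⟩, n2⟩, n3⟩ := hu
    obtain ⟨r, hr⟩ := exists_sq (u 1 * u 2 / (u 0 * u 3))
    have hr0 : r ≠ 0 := by
      rintro rfl
      have : u 1 * u 2 / (u 0 * u 3) ≠ 0 := by positivity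
      exact this (by rw [← hr]; ring)
    have hr' : u 1 * u 2 = r ^ 2 * (u 0 * u 3) := by
      rw [hr]
      field_simp
    have h := isLimitDirection17 (i := 5) (w := ![u 3 * r / u 2, 1, r, 1, u 0 * u 2 / r, 1])
      (μ := ![0, 0, 0, 0, 2, 0]) (by
        simp [Fin.prod_univ_six, biweight17, bihomogeneous17, pair17]) (by decide) (by decide)
    convert h using 1
    have ho : ∀ j : Fin 17, j ∉ ({9, 10, 11, 12} : Finset (Fin 17)) → 2 <
        ∑ l, (![0, 0, 0, 0, 2, 0] : Fin 6 → ℕ) l * biweight17 ((5 : Fin 18).succAbove j) l := by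
      decide
    have ho' : ∀ j ∈ ({9, 10, 11, 12} : Finset (Fin 17)),
        ∑ l, (![0, 0, 0, 0, 2, 0] : Fin 6 → ℕ) l * biweight17 ((5 : Fin 18).succAbove j) l = 2 := by
      decide
    have e9 : biweight17 ((5 : Fin 18).succAbove 9) = ![0, 2, 1, 1, 1, 1] := by decide
    have e10 : biweight17 ((5 : Fin 18).succAbove 10) = ![1, 1, 0, 2, 1, 1] := by decide
    have e11 : biweight17 ((5 : Fin 18).succAbove 11) = ![1, 1, 2, 0, 1, 1] := by decide
    have e12 : biweight17 ((5 : Fin 18).succAbove 12) = ![2, 0, 1, 1, 1, 1] := by decide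
    funext j
    by_cases hj : j ∈ ({9, 10, 11, 12} : Finset (Fin 17))
    · rw [ho' j hj, Nat.sub_self, pow_zero, one_mul]
      simp only [Finset.mem_insert, Finset.mem_singleton] at hj
      rcases hj with rfl | rfl | rfl | rfl <;>
        simp only [e9, e10, e11, e12, Fin.prod_univ_six, f, Matrix.cons_val] <;> field_simp
      all_goals linear_combination hr'
    · rw [zero_pow (Nat.sub_pos_of_lt (ho j hj)).ne', zero_mul]
      fin_cases j <;> first | rfl | exact absurd (by decide) hj

/-! ### Uniqueness of the normal form at the vertex of genus 17 -/

/-- Substituting values for the first two variables. -/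
theorem eval_polynomial_aeval (h : Poly 3) (x y z : ℂ) :
    Polynomial.eval z (aeval ![Polynomial.C x, Polynomial.C y, Polynomial.X] h) =
      eval ![x, y, z] h := by
  rw [← Polynomial.coe_evalRingHom, ← MvPolynomial.aeval_eq_eval]
  induction h using MvPolynomial.induction_on with
  | C a => simp
  | add p q hp hq => rw [map_add, map_add, map_add, hp, hq]
  | mul_X p j hp =>
    rw [map_mul, map_mul, map_mul, hp]
    congr 1
    fin_cases j <;> simp

theorem eq_zero_of_reciprocal {P Q : Polynomial ℂ} {a : ℂ} (ha : a ≠ 0)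
    (h : ∀ z, z ≠ 0 → P.eval z + a / z * Q.eval (a / z) = 0) : P = 0 ∧ Q = 0 := by
  have hlim : Tendsto (fun n : ℕ => P.eval (n : ℂ)) atTop (𝓝 0) := by
    have h1 : Tendsto (fun n : ℕ => a / (n : ℂ)) atTop (𝓝 0) :=
      tendsto_const_div_atTop_nhds_zero_nat a
    have h2 : Tendsto (fun n : ℕ => -(a / (n : ℂ) * Q.eval (a / (n : ℂ)))) atTop
        (𝓝 (-(0 * Q.eval 0))) :=
      (h1.mul ((Q.continuous.tendsto 0).comp h1)).neg
    rw [zero_mul, neg_zero] at h2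
    refine h2.congr' ?_
    filter_upwards [eventually_gt_atTop 0] with n hn
    linear_combination -h n (Nat.cast_ne_zero.mpr hn.ne')
  have hP : P = 0 := by
    by_cases hd : 0 < P.degree
    · have h1 : Tendsto (fun n : ℕ => ‖P.eval (n : ℂ)‖) atTop atTop :=
        P.tendsto_norm_atTop hd (by
          simp only [Complex.norm_natCast]
          exact tendsto_natCast_atTop_atTop)
      exact absurd hlim.norm (not_tendsto_nhds_of_tendsto_atTop h1 _)
    · rw [Polynomial.eq_C_of_degree_le_zero (not_lt.mp hd)] at hlim ⊢
      simp only [Polynomial.eval_C] at hlim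
      rw [tendsto_nhds_unique tendsto_const_nhds hlim, Polynomial.C_0]
  refine ⟨hP, ?_⟩
  have : Q * Polynomial.X = 0 := by
    refine Polynomial.funext fun z => ?_
    by_cases hz : z = 0
    · simp [hz]
    · have := h (a / z) (div_ne_zero ha hz)
      rw [hP, Polynomial.eval_zero, zero_add, div_div_cancel₀ ha] at this
      rw [Polynomial.eval_mul, Polynomial.eval_X, Polynomial.eval_zero, mul_comm]
      exact this
  simpa using this

theorem normalForm_apply {n r : ℕ} (m : Fin r → Poly n) (ψ : Fin r → Fin 3 → Poly n)
    (h : Fin r → Poly 3) : normalForm m ψ h = ∑ a, m a * aeval (ψ a) (h a) := rfl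

theorem normalForm_vertex17 {h : Fin 6 → Poly 3}
    (hh : normalForm vertexMultiplier17 (fun a l => X (vertexVariable17 a l)) h ∈
      projIdeal vertexCone17) : h = 0 := by
  have hev : ∀ v ∈ affineCone vertexCone17, ∑ a, eval v (vertexMultiplier17 a) *
      eval (fun l => v (vertexVariable17 a l)) (h a) = 0 := by
    intro v hv
    have := mem_projIdeal.mp hh v hv
    rw [normalForm_apply, map_sum] at this
    rw [← this]
    refine Finset.sum_congr rfl fun a _ => ?_
    rw [map_mul, eval_aeval]
    simp
  have hcorner : ∀ κ : Fin 4, h κ.succ.succ = 0 := by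
    intro κ
    have hidx : ∀ κ : Fin 4, cornerIndex κ ≠ edgeIndex κ 0 ∧ cornerIndex κ ≠ edgeIndex κ 1 ∧
        edgeIndex κ 0 ≠ edgeIndex κ 1 := by decide
    have hmul : ∀ (κ : Fin 4) (v : Fin 17 → ℂ),
        eval v (vertexMultiplier17 κ.succ.succ) = v (cornerIndex κ) := by
      intro κ v
      fin_cases κ <;> exact eval_X _
    have hvar : ∀ κ l, vertexVariable17 κ.succ.succ l =
        ![cornerIndex κ, edgeIndex κ 0, edgeIndex κ 1] l := by decide
    have hoff : ∀ κ κ' : Fin 4, κ' ≠ κ → cornerIndex κ' ∉ planeIndices κ := by decide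
    have hcv : ∀ κ : Fin 4, ∀ a ∈ ({0, 1} : Finset (Fin 6)), ∀ l,
        cornerIndex κ ≠ vertexVariable17 a l := by decide
    have hc11 : ∀ κ, cornerIndex κ ≠ 11 := by decide
    refine eq_zero_of_eval_ne_zero (D := X 0 * X 1) (mul_ne_zero (X_ne_zero _) (X_ne_zero _))
      fun u hu => ?_
    simp only [map_mul, eval_X, mul_ne_zero_iff] at hu
    have hmem : ∀ (v : Fin 17 → ℂ), v (edgeIndex κ 0) ≠ 0 → v ∈ coordSubspace (planeIndices κ) →
        v ∈ affineCone vertexCone17 := fun v h0 hv =>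
      mem_vertexCone17.mpr ⟨fun h => h0 (by rw [h]; rfl), .inl ⟨κ, hv⟩⟩
    have hred : ∀ v ∈ coordSubspace (planeIndices κ), v (edgeIndex κ 0) ≠ 0 →
        eval (fun l => v (vertexVariable17 0 l)) (h 0) +
        v 11 * eval (fun l => v (vertexVariable17 1 l)) (h 1) +
        v (cornerIndex κ) * eval (fun l => v (vertexVariable17 κ.succ.succ l))
          (h κ.succ.succ) = 0 := by
      intro v hv h0
      have h1 := hev v (hmem v h0 hv)
      rw [Fin.sum_univ_succ, Fin.sum_univ_succ, Finset.sum_eq_single κ] at h1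
      · rw [hmul] at h1
        have e0 : eval v (vertexMultiplier17 0) = 1 := map_one _
        have e1 : eval v (vertexMultiplier17 (Fin.succ 0)) = v 11 := eval_X _
        rw [e0, e1, one_mul, ← add_assoc] at h1
        exact h1
      · intro κ' _ hκ'
        rw [hmul, mem_coordSubspace.mp hv _ (hoff κ κ' hκ'), zero_mul]
      · simp
    let p : ℂ → Fin 17 → ℂ := fun x j => if j = cornerIndex κ then x else
      if j = edgeIndex κ 0 then u 1 else if j = edgeIndex κ 1 then u 2 else 0
    have hp : ∀ x, p x ∈ coordSubspace (planeIndices κ) := by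
      intro x j hj
      simp only [planeIndices, Finset.mem_insert, Finset.mem_singleton, not_or] at hj
      simp [p, hj]
    have hpc : ∀ x, p x (cornerIndex κ) = x := fun x => if_pos rfl
    have hp0 : ∀ x, p x (edgeIndex κ 0) = u 1 := fun x =>
      (if_neg (hidx κ).1.symm).trans (if_pos rfl)
    have hp1 : ∀ x, p x (edgeIndex κ 1) = u 2 := fun x =>
      (if_neg (hidx κ).2.1.symm).trans ((if_neg (hidx κ).2.2.symm).trans (if_pos rfl))
    have hpx : ∀ x j, j ≠ cornerIndex κ → p x j = p 0 j := fun x j hj => by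
      simp only [p, if_neg hj]
    have h1 := hred _ (hp (u 0)) (by rw [hp0]; exact hu.2)
    have h2 := hred _ (hp 0) (by rw [hp0]; exact hu.2)
    have hq : ∀ a ∈ ({0, 1} : Finset (Fin 6)), (fun l => p (u 0) (vertexVariable17 a l)) =
        fun l => p 0 (vertexVariable17 a l) := fun a ha =>
      funext fun l => hpx _ _ (hcv κ a ha l).symm
    rw [hq 0 (by decide), hq 1 (by decide), hpx _ _ (hc11 κ).symm, hpc] at h1
    rw [hpc, zero_mul, add_zero] at h2
    rw [h2, zero_add] at h1
    have h3 := (mul_eq_zero.mp h1).resolve_left hu.1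
    have h4 : (fun l => p (u 0) (vertexVariable17 κ.succ.succ l)) = u := by
      funext l
      rw [hvar]
      fin_cases l
      · exact hpc _
      · exact hp0 _
      · exact hp1 _
    rwa [h4] at h3
  have hquad : ∀ x y z : ℂ, x ≠ 0 → z ≠ 0 →
      eval ![x, y, z] (h 0) + x * y / z * eval ![x, y, x * y / z] (h 1) = 0 := by
    intro x y z hx hz
    have h1 := hev (quadricSpace17 ![x, z, x * y / z, y]) (mem_vertexCone17.mpr
      ⟨fun h0 => hx (congrFun h0 9), .inr ⟨_, rfl, by simp; field_simp⟩⟩)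
    rw [Fin.sum_univ_succ, Fin.sum_univ_succ, Finset.sum_eq_zero (fun κ _ => by
      have := hcorner κ
      simp only [this, map_zero, mul_zero])] at h1
    have e0 : ∀ v, eval v (vertexMultiplier17 0) = 1 := fun v => map_one _
    have e1 : ∀ v, eval v (vertexMultiplier17 (Fin.succ 0)) = v 11 := fun v => eval_X _
    rw [e0, e1, one_mul, add_zero] at h1
    have f0 : (fun l => quadricSpace17 ![x, z, x * y / z, y] (vertexVariable17 0 l)) =
        ![x, y, z] := by
      funext l
      fin_cases l <;> rfl
    have f1 : (fun l => quadricSpace17 ![x, z, x * y / z, y] (vertexVariable17 (Fin.succ 0) l)) =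
        ![x, y, x * y / z] := by
      funext l
      fin_cases l <;> rfl
    rw [f0, f1] at h1
    exact h1
  have h01 : ∀ x y : ℂ, x ≠ 0 → y ≠ 0 → ∀ z, eval ![x, y, z] (h 0) = 0 ∧ eval ![x, y, z] (h 1) = 0 := by
    intro x y hx hy z
    have := eq_zero_of_reciprocal (P := aeval ![Polynomial.C x, Polynomial.C y, Polynomial.X] (h 0))
      (Q := aeval ![Polynomial.C x, Polynomial.C y, Polynomial.X] (h 1)) (mul_ne_zero hx hy)
      (fun z hz => by
        rw [eval_polynomial_aeval, eval_polynomial_aeval]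
        exact hquad x y z hx hz)
    rw [← eval_polynomial_aeval, ← eval_polynomial_aeval, this.1, this.2]
    simp
  have hfin : ∀ a, (∀ x y : ℂ, x ≠ 0 → y ≠ 0 → ∀ z, eval ![x, y, z] (h a) = 0) → h a = 0 := by
    intro a ha
    refine eq_zero_of_eval_ne_zero (D := X 0 * X 1) (mul_ne_zero (X_ne_zero _) (X_ne_zero _))
      fun u hu => ?_
    simp only [map_mul, eval_X, mul_ne_zero_iff] at hu
    have : u = ![u 0, u 1, u 2] := by
      funext l
      fin_cases l <;> rfl
    rw [this]
    exact ha _ _ hu.1 hu.2 _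
  funext a
  match a with
  | 0 => exact hfin 0 fun x y hx hy z => (h01 x y hx hy z).1
  | 1 => exact hfin 1 fun x y hx hy z => (h01 x y hx hy z).2
  | 2 => exact hcorner 0
  | 3 => exact hcorner 1
  | 4 => exact hcorner 2
  | 5 => exact hcorner 3

theorem tangentCone17_vertex :
    TangentConeIsConeOver W17 (unitPoint 5) vertexCone17 ∧
      HasMultiplicity W17 (unitPoint 5) 3 6 := by
  refine tangentCone_of_normalForm (unitVector_ne_zero 5) (Pi.single_eq_same 5 1) unitVector_of_lt
    (m := vertexMultiplier17) (ψ := fun a l => X (vertexVariable17 a l)) (s := ![0, 1, 1, 1, 1, 1])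
    (by decide) (fun a => ?_) (fun a j => isHomogeneous_X _ _) le_rfl (fun v hv => ?_) ?_
    reducible_vertex17 fun h hh => normalForm_vertex17 hh
  · fin_cases a
    · exact isHomogeneous_one _ _
    all_goals exact isHomogeneous_X _ _
  · obtain ⟨-, ⟨κ, h⟩ | ⟨w, rfl, hw⟩⟩ := mem_vertexCone17.mp hv
    · exact isGenericLimitDirection17_plane h
    · exact isGenericLimitDirection17_quadric hw
  · have := reducible_piece (G := vertexIdeal17) (m := vertexMultiplier17)
      (ψ := fun a l => X (vertexVariable17 a l)) 0 1
    rwa [map_one, mul_one] at this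

/-! ### The singular points of genus 17 -/

/-- The coordinate points of the cone that lie over the singular points. -/
def fixed17 : Fin 5 → Fin 10 := ![0, 2, 6, 8, 9]

theorem zmap_unitVector17 (i : Fin 5) (a : ℂ) :
    D17.zmap (a • unitVector (fixed17 i)) = a ^ 2 • unitVector (singular17 i) := by
  have key : ∀ i k, (pair17 k).1 = fixed17 i ∧ (pair17 k).2 = fixed17 i ↔ k = singular17 i := by
    decide
  funext k
  rw [zmap17]
  simp only [Pi.smul_apply, Pi.single_apply, smul_eq_mul, mul_ite, mul_one, mul_zero, ite_mul,
    zero_mul]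
  rw [← ite_and]
  exact if_congr (and_comm.trans (key i k)) (sq a).symm rfl

theorem segment_mem_cone17 (κ : Fin 4) (a b : ℂ) :
    a • unitVector (fixed17 κ.castSucc) + b • unitVector 9 ∈ D17.cone := by
  rw [mem_cone17]
  have key : ∀ κ : Fin 4, ∀ i ∈ ({fixed17 κ.castSucc, 9} : Finset (Fin 10)),
      ∀ j ∈ ({fixed17 κ.castSucc, 9} : Finset (Fin 10)), ∀ k l,
      exponents17 i + exponents17 j = exponents17 k + exponents17 l →
        (k = i ∧ l = j) ∨ (k = j ∧ l = i) := by decide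
  set c := a • unitVector (fixed17 κ.castSucc) + b • unitVector 9 with hc
  have hz : ∀ i, i ∉ ({fixed17 κ.castSucc, 9} : Finset (Fin 10)) → c i = 0 := by
    intro i hi
    simp only [Finset.mem_insert, Finset.mem_singleton, not_or] at hi
    simp [hc, Pi.single_eq_of_ne hi.1, Pi.single_eq_of_ne hi.2]
  have main : ∀ i j k l, exponents17 i + exponents17 j = exponents17 k + exponents17 l →
      i ∈ ({fixed17 κ.castSucc, 9} : Finset (Fin 10)) →
      j ∈ ({fixed17 κ.castSucc, 9} : Finset (Fin 10)) → c i * c j = c k * c l := by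
    intro i j k l h hi hj
    rcases key κ i hi j hj k l h with ⟨rfl, rfl⟩ | ⟨rfl, rfl⟩
    · rfl
    · exact mul_comm _ _
  intro i j k l h
  by_cases hij : i ∈ ({fixed17 κ.castSucc, 9} : Finset (Fin 10)) ∧
      j ∈ ({fixed17 κ.castSucc, 9} : Finset (Fin 10))
  · exact main i j k l h hij.1 hij.2
  by_cases hkl : k ∈ ({fixed17 κ.castSucc, 9} : Finset (Fin 10)) ∧
      l ∈ ({fixed17 κ.castSucc, 9} : Finset (Fin 10))
  · exact (main k l i j h.symm hkl.1 hkl.2).symm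
  have h0 : ∀ i j, ¬ (i ∈ ({fixed17 κ.castSucc, 9} : Finset (Fin 10)) ∧
      j ∈ ({fixed17 κ.castSucc, 9} : Finset (Fin 10))) → c i * c j = 0 := by
    intro i j h
    rcases not_and_or.mp h with h | h
    · rw [hz i h, zero_mul]
    · rw [hz j h, mul_zero]
  rw [h0 i j hij, h0 k l hkl]

theorem zmap_segment17 (κ : Fin 4) (a b : ℂ) :
    D17.zmap (a • unitVector (fixed17 κ.castSucc) + b • unitVector 9) =
      a ^ 2 • unitVector (singular17 κ.castSucc) + b ^ 2 • unitVector 5 := by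
  have key : ∀ (κ : Fin 4) k,
      (¬ ((pair17 k).1 = fixed17 κ.castSucc ∧ (pair17 k).2 = 9)) ∧
      (¬ ((pair17 k).1 = 9 ∧ (pair17 k).2 = fixed17 κ.castSucc)) := by decide
  have h1 := zmap_unitVector17 κ.castSucc a
  have h2 := zmap_unitVector17 4 b
  funext k
  have e1 := congrFun h1 k
  have e2 := congrFun h2 k
  rw [zmap17] at e1 e2 ⊢
  obtain ⟨k1, k2⟩ := key κ k
  have e3 : (a • unitVector (fixed17 κ.castSucc)) (pair17 k).1 *
      (b • unitVector (9 : Fin 10)) (pair17 k).2 = 0 := by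
    rcases not_and_or.mp k1 with h | h <;> simp [Pi.single_eq_of_ne h]
  have e4 : (b • unitVector (9 : Fin 10)) (pair17 k).1 *
      (a • unitVector (fixed17 κ.castSucc)) (pair17 k).2 = 0 := by
    rcases not_and_or.mp k2 with h | h <;> simp [Pi.single_eq_of_ne h]
  have e2' : (b • unitVector (9 : Fin 10)) (pair17 k).1 *
      (b • unitVector (9 : Fin 10)) (pair17 k).2 = (b ^ 2 • unitVector (5 : Fin 18)) k := e2
  simp only [Pi.add_apply] at e1 ⊢
  linear_combination e1 + e2' + e3 + e4

theorem finrank_tangent_le17 {c : Fin 10 → ℂ} (hc : c ∈ D17.cone) {k l : Fin 10}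
    (hk : odd17 k = false) (hl : odd17 l = true) (hck : c k ≠ 0) (hcl : c l ≠ 0)
    (hq : D17.zmap c ≠ 0) :
    Module.finrank ℂ (embeddedTangentSpace W17 (mk ℂ (D17.zmap c) hq)) ≤ 4 := by
  have hmul := mem_cone17.mp hc
  have hcorner : ∃ κ : Fin 4, c (fixed17 κ.castSucc) ≠ 0 := by
    have hk' : (∃ κ : Fin 4, fixed17 κ.castSucc = k) ∨ k = 4 := by
      clear hck
      revert k
      decide
    rcases hk' with ⟨κ, rfl⟩ | rfl
    · exact ⟨κ, hck⟩
    · refine ⟨0, fun h0 => hck ?_⟩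
      have := hmul 4 4 0 8 (by decide)
      change c 0 = 0 at h0
      rw [h0, zero_mul] at this
      exact mul_self_eq_zero.mp this
  obtain ⟨κ, hκ⟩ := hcorner
  have htab : ∀ κ : Fin 4, ∃ x y : Fin 10, ∀ b,
      b ∈ ({fixed17 κ.castSucc, x, y, 9} : Finset (Fin 10)) ∨
      (∃ p ∈ ({fixed17 κ.castSucc, x, y, 9} : Finset (Fin 10)),
        ∃ q ∈ ({fixed17 κ.castSucc, x, y, 9} : Finset (Fin 10)),
          exponents17 (fixed17 κ.castSucc) + exponents17 b = exponents17 p + exponents17 q) ∨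
      ∃ p, (∃ p1 ∈ ({fixed17 κ.castSucc, x, y, 9} : Finset (Fin 10)),
          ∃ p2 ∈ ({fixed17 κ.castSucc, x, y, 9} : Finset (Fin 10)),
          exponents17 (fixed17 κ.castSucc) + exponents17 p = exponents17 p1 + exponents17 p2) ∧
        ∃ q, (∃ q1 ∈ ({fixed17 κ.castSucc, x, y, 9} : Finset (Fin 10)),
          ∃ q2 ∈ ({fixed17 κ.castSucc, x, y, 9} : Finset (Fin 10)),
          exponents17 (fixed17 κ.castSucc) + exponents17 q = exponents17 q1 + exponents17 q2) ∧
          exponents17 (fixed17 κ.castSucc) + exponents17 b = exponents17 p + exponents17 q := by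
    intro κ
    fin_cases κ
    · exact ⟨1, 3, by decide⟩
    · exact ⟨1, 5, by decide⟩
    · exact ⟨7, 3, by decide⟩
    · exact ⟨7, 5, by decide⟩
  obtain ⟨x, y, hxy⟩ := htab κ
  set S : Finset (Fin 10) := {fixed17 κ.castSucc, x, y, 9} with hS
  refine describes17.finrank_tangent_le hc hk hl hck hcl
    (LinearMap.funLeft ℂ ℂ ![fixed17 κ.castSucc, x, y, 9]) (fun e he hφ => ?_) hq
  have hstep : ∀ b p q, exponents17 (fixed17 κ.castSucc) + exponents17 b =
      exponents17 p + exponents17 q → e (fixed17 κ.castSucc) = 0 → e p = 0 → e q = 0 → e b = 0 := by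
    intro b p q h h0 hp hq
    have := he _ ⟨_, _, _, _, h, rfl⟩
    rw [contract_binomial, h0, hp, hq] at this
    simpa [hκ] using this
  have hS0 : ∀ b ∈ S, e b = 0 := by
    intro b hb
    simp only [hS, Finset.mem_insert, Finset.mem_singleton] at hb
    rcases hb with rfl | rfl | rfl | rfl
    · exact congrFun hφ 0
    · exact congrFun hφ 1
    · exact congrFun hφ 2
    · exact congrFun hφ 3
  have h0 : e (fixed17 κ.castSucc) = 0 := hS0 _ (by simp [hS])
  have hS1 : ∀ b, (∃ p ∈ S, ∃ q ∈ S, exponents17 (fixed17 κ.castSucc) + exponents17 b =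
      exponents17 p + exponents17 q) → e b = 0 := fun b ⟨p, hp, q, hq, h⟩ =>
    hstep b p q h h0 (hS0 p hp) (hS0 q hq)
  funext b
  rcases hxy b with h | h | ⟨p, hp, q, hq, h⟩
  · exact hS0 b h
  · exact hS1 b h
  · exact hstep b p q h h0 (hS1 p hp) (hS1 q hq)

theorem eq_unitVector17 {c : Fin 10 → ℂ} (hc : c ∈ D17.cone)
    (h : (∀ k, odd17 k = false → c k = 0) ∨ ∀ k, odd17 k = true → c k = 0) :
    ∃ i, c = c (fixed17 i) • unitVector (fixed17 i) := by
  have hmul := mem_cone17.mp hc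
  have hsq : ∀ k p q, exponents17 k + exponents17 k = exponents17 p + exponents17 q →
      c p = 0 → c k = 0 := by
    intro k p q h h0
    have := hmul k k p q h
    rw [h0, zero_mul] at this
    exact mul_self_eq_zero.mp this
  have hone : ∀ i : Fin 5, (∀ k, k ≠ fixed17 i → c k = 0) →
      ∃ i, c = c (fixed17 i) • unitVector (fixed17 i) := by
    intro i hi
    refine ⟨i, funext fun k => ?_⟩
    by_cases hk : k = fixed17 i
    · rw [hk]
      simp
    · rw [hi k hk]
      simp [Pi.single_eq_of_ne hk]
  rcases h with h | h
  · refine hone 4 fun k hk => ?_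
    have key : ∀ k : Fin 10, k ≠ fixed17 4 → odd17 k = false ∨ ∃ p q, odd17 p = false ∧
        exponents17 k + exponents17 k = exponents17 p + exponents17 q := by decide
    rcases key k hk with h1 | ⟨p, q, h1, h2⟩
    · exact h k h1
    · exact hsq k p q h2 (h p h1)
  · have h4 : c 4 = 0 := hsq 4 1 7 (by decide) (h 1 rfl)
    by_cases hex : ∃ κ : Fin 4, c (fixed17 κ.castSucc) ≠ 0
    · obtain ⟨κ, hκ⟩ := hex
      refine hone κ.castSucc fun k hk => ?_
      have key : ∀ (κ : Fin 4) (k : Fin 10), k ≠ fixed17 κ.castSucc → odd17 k = true ∨ k = 4 ∨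
          ∃ p q, (odd17 p = true ∨ p = 4) ∧
            exponents17 (fixed17 κ.castSucc) + exponents17 k = exponents17 p + exponents17 q := by
        decide
      rcases key κ k hk with h1 | rfl | ⟨p, q, h1, h2⟩
      · exact h k h1
      · exact h4
      · have hp : c p = 0 := by
          rcases h1 with h1 | rfl
          · exact h p h1
          · exact h4
        have := hmul _ _ _ _ h2
        rw [hp, zero_mul] at this
        exact (mul_eq_zero.mp this).resolve_left hκ
    · push Not at hex
      refine hone 0 fun k _ => ?_
      have key : ∀ k : Fin 10, odd17 k = true ∨ k = 4 ∨ ∃ κ : Fin 4, fixed17 κ.castSucc = k := by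
        decide
      rcases key k with h1 | rfl | ⟨κ, rfl⟩
      · exact h k h1
      · exact h4
      · exact hex κ

/-- The singular points of genus 17. -/
def point17 (i : Fin 5) : PSp 17 := unitPoint (singular17 i)

theorem unitVector_mem_cone17 (i : Fin 5) (a : ℂ) : a • unitVector (fixed17 i) ∈ D17.cone := by
  refine Fin.lastCases ?_ (fun κ => ?_) i
  · have := segment_mem_cone17 0 0 a
    rw [zero_smul, zero_add] at this
    exact this
  · have := segment_mem_cone17 κ a 0
    rwa [zero_smul, add_zero] at this

theorem point17_mem (i : Fin 5) : point17 i ∈ W17 := by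
  refine (describes17.mk_mem_image _).mpr ⟨_, unitVector_mem_cone17 i 1, ?_⟩
  rw [zmap_unitVector17, one_pow, one_smul]

theorem five_le_finrank_vertex17 :
    5 ≤ Module.finrank ℂ (embeddedTangentSpace W17 (unitPoint 5)) := by
  have hinj : Function.Injective cornerIndex := by decide
  refine succ_le_finrank_embeddedTangentSpace (unitVector_ne_zero 5) (point17_mem 4)
    (Pi.single_eq_same 5 1) (v := fun κ => unitVector (cornerIndex κ)) (fun κ => ?_) ?_
  · refine isGenericLimitDirection17_plane (κ := κ) fun j hj => Pi.single_eq_of_ne ?_ 1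
    rintro rfl
    exact hj (by simp [planeIndices])
  · exact (Pi.linearIndependent_single_one (Fin 17) ℂ).comp _ hinj

theorem singularLocus17 : singularLocus W17 = Set.range point17 := by
  ext P
  rw [mem_singularLocus_iff isProjectiveVarietyOfDim17]
  constructor
  · rintro ⟨hP, hT⟩
    induction P using Projectivization.ind with
    | h q hq =>
      obtain ⟨c, hc, rfl⟩ := (describes17.mk_mem_image hq).mp hP
      have h : (∀ k, odd17 k = false → c k = 0) ∨ ∀ k, odd17 k = true → c k = 0 := by
        by_contra hcon
        push Not at hcon
        obtain ⟨⟨k, hk, hck⟩, l, hl, hcl⟩ := hcon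
        have := finrank_tangent_le17 hc hk hl hck hcl hq
        omega
      obtain ⟨i, hi⟩ := eq_unitVector17 hc h
      refine ⟨i, ?_⟩
      unfold point17
      rw [eq_comm, mk_eq_mk_iff_smul]
      have hz : D17.zmap c = c (fixed17 i) ^ 2 • unitVector (singular17 i) := by
        rw [← zmap_unitVector17, ← hi]
      refine ⟨_, fun h0 => hq ?_, hz⟩
      rw [hz, h0, zero_smul]
  · rintro ⟨i, rfl⟩
    refine ⟨point17_mem i, ?_⟩
    refine Fin.lastCases ?_ (fun κ => ?_) i
    · exact five_le_finrank_vertex17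
    · exact (tangentCone17_corner κ).1 (point17_mem _)

theorem point17_injective : Function.Injective point17 := by
  have hinj : Function.Injective singular17 := by decide
  intro i j h
  unfold point17 at h
  rw [mk_eq_mk_iff_smul] at h
  obtain ⟨a, -, h⟩ := h
  by_contra hij
  have := congrFun h (singular17 i)
  simp [Pi.single_eq_of_ne fun h => hij (hinj h)] at this

theorem associated17 (κ : Fin 4) : Associated W17 (point17 κ.castSucc) (point17 4) := by
  refine (associated_mk_iff _ _).mpr ⟨fun h => ?_, fun a b h0 => ?_⟩
  · exact absurd (point17_injective h) (Fin.castSucc_lt_last κ).ne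
  · obtain ⟨r, rfl⟩ := exists_sq a
    obtain ⟨s, rfl⟩ := exists_sq b
    exact describes17.mem_affineCone_image.mpr ⟨h0, _, segment_mem_cone17 κ r s,
      zmap_segment17 κ r s⟩

theorem not_associated17 (κ ν : Fin 4) :
    ¬ Associated W17 (point17 κ.castSucc) (point17 ν.castSucc) := by
  intro h
  obtain ⟨hne, h⟩ := (associated_mk_iff _ _).mp h
  have hκν : κ ≠ ν := by
    rintro rfl
    exact hne rfl
  have key : ∀ κ ν : Fin 4, κ ≠ ν → singular17 κ.castSucc ≠ singular17 ν.castSucc ∧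
      ∃ k, k ≠ singular17 κ.castSucc ∧ k ≠ singular17 ν.castSucc ∧
      weight17 (singular17 κ.castSucc) + weight17 (singular17 ν.castSucc) =
        weight17 k + weight17 k := by decide
  obtain ⟨h1, k, h2, h3, h4⟩ := key κ ν hκν
  set v := (1 : ℂ) • unitVector (singular17 κ.castSucc) +
    (1 : ℂ) • unitVector (singular17 ν.castSucc) with hv
  have e1 : v (singular17 κ.castSucc) = 1 := by simp [hv, Pi.single_eq_of_ne h1]
  have e2 : v (singular17 ν.castSucc) = 1 := by simp [hv, Pi.single_eq_of_ne h1.symm]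
  have e3 : v k = 0 := by simp [hv, Pi.single_eq_of_ne h2, Pi.single_eq_of_ne h3]
  have h5 := mem_projIdeal.mp (binomial_mem17 h4) v
    (h 1 1 fun h0 => one_ne_zero (e1.symm.trans (congrFun h0 _)))
  simp only [map_sub, map_mul, eval_X, e1, e2, e3] at h5
  norm_num at h5

theorem exists_castSucc_of_ne {i : Fin 5} (h : i ≠ 4) : ∃ κ : Fin 4, κ.castSucc = i :=
  Fin.exists_castSucc_eq.mpr h

/-! ### The tangent cones of genus 13 at the four similar points -/

/-- A polynomial that vanishes on the variety contributes its lowest homogeneous part in the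
chart to the ideal of the tangent cone. -/
theorem mem_tangentConeIdeal_of_eval {n d : ℕ} {W : Set (PSp n)} {q : Fin (n + 1) → ℂ} (hq : q ≠ 0)
    {i : Fin (n + 1)} (hi : q i = 1) (hlt : ∀ j < i, q j = 0) {F : Poly (n + 1)}
    (hF : F ∈ projIdeal W) {f g : Poly n} (hf : f.IsHomogeneous d) (hg : g.IsHomogeneous (d + 1))
    (h : ∀ w, eval (q + Fin.insertNth (α := fun _ => ℂ) i 0 w) F = eval w f + eval w g) :
    f ∈ tangentConeIdeal W (mk ℂ q hq) := by
  refine mem_initialIdeal_of_add hf hg ?_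
  have : f + g = chartMap i q F := MvPolynomial.funext fun w => by
    rw [eval_chartMap hi, h, map_add]
  rw [this]
  exact chartMap_mem_localIdeal hq hi hlt hF

theorem mem_projIdeal13 {F : Poly 14} (h : ∀ c, OnCone13 c → eval (zvec13 c) F = 0) :
    F ∈ projIdeal W13 :=
  describes13.mem_projIdeal_of_vanishes fun c hc => by
    rw [zmap13]
    exact h c (mem_cone13.mp hc)

/-- The coordinates of the singular points of genus 13 other than the vertex. -/
def cornerVector13 (ε δ : ℂ) : Fin 14 → ℂ :=
  ![1, 2, 2, 2, 2 * ε, 2 * δ, 2 * (ε * δ), 2 * (ε * δ), 2 * δ, 2 * ε, 0, 0, 0, 0]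

theorem cornerVector13_ne_zero (ε δ : ℂ) : cornerVector13 ε δ ≠ 0 := fun h =>
  one_ne_zero (α := ℂ) (congrFun h 0)

/-- The singular points of genus 13 other than the vertex. -/
abbrev corner13 (ε δ : ℂ) : PSp 13 := mk ℂ (cornerVector13 ε δ) (cornerVector13_ne_zero ε δ)

theorem cornerVector13_add (ε δ : ℂ) (w : Fin 13 → ℂ) :
    cornerVector13 ε δ + Fin.insertNth (α := fun _ => ℂ) 0 0 w =
      ![1, 2 + w 0, 2 + w 1, 2 + w 2, 2 * ε + w 3, 2 * δ + w 4, 2 * (ε * δ) + w 5,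
        2 * (ε * δ) + w 6, 2 * δ + w 7, 2 * ε + w 8, w 9, w 10, w 11, w 12] := by
  funext k
  refine Fin.cases ?_ (fun j => ?_) k
  · simp [cornerVector13]
  · rw [Pi.add_apply, Fin.insertNth_zero, Fin.cons_succ]
    fin_cases j <;> simp [cornerVector13]

/-- The quadrics that are used at the corners. -/
def cornerQuadrics13 : Fin 13 → Poly 14 :=
  ![X 4 * X 4 - X 0 * (X 1 + C 2 * X 0), X 5 * X 5 - X 0 * (X 2 + C 2 * X 0),
    X 6 * X 6 - X 0 * (X 3 + C 2 * X 0), C 2 * X 0 * X 12 - X 4 * X 11 + X 5 * X 10,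
    C 2 * X 0 * (X 5 - X 8) - X 4 * (X 7 - X 6) + X 5 * (X 1 - C 2 * X 0),
    C 2 * X 0 * (X 9 - X 4) - X 4 * (X 2 - C 2 * X 0) + X 5 * (X 7 - X 6),
    C 2 * X 0 * (X 3 - C 2 * X 0) - X 4 * (X 9 - X 4) + X 5 * (X 5 - X 8),
    (X 7 - X 6) * (X 7 - X 6) - (X 1 - C 2 * X 0) * (X 2 - C 2 * X 0),
    X 10 * X 10 - (X 1 - C 2 * X 0) * X 13, X 11 * X 11 - (X 2 - C 2 * X 0) * X 13,
    (X 7 - X 6) * X 10 - (X 1 - C 2 * X 0) * X 11,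
    (X 7 - X 6) * X 11 - (X 2 - C 2 * X 0) * X 10, X 10 * X 11 - X 13 * (X 7 - X 6)]

/-- Linear forms in the squared and mixed products on the cone. -/
theorem OnCone13.products {c : Fin 8 → ℂ} (hc : OnCone13 c) :
    (c 1 * c 1 + c 4 * c 4) / 2 = c 4 * c 4 + 2 * (c 0 * c 0) ∧
    (c 2 * c 2 + c 5 * c 5) / 2 = c 5 * c 5 + 2 * (c 0 * c 0) ∧
    (c 3 * c 3 + c 6 * c 6) / 2 = c 6 * c 6 + 2 * (c 0 * c 0) ∧
    (c 1 * c 2 + c 4 * c 5) / 2 = c 4 * c 5 + c 0 * c 3 ∧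
    (c 1 * c 3 - c 4 * c 6) / 2 = c 0 * c 2 - c 4 * c 6 ∧
    (c 2 * c 3 + c 5 * c 6) / 2 = c 5 * c 6 + c 0 * c 1 := by
  obtain ⟨e0, e1, e2, e3, e4, e5, -, -, -⟩ := hc
  refine ⟨?_, ?_, ?_, ?_, ?_, ?_⟩
  · linear_combination e0 / 2
  · linear_combination e1 / 2
  · linear_combination e2 / 2
  · linear_combination e4 / 2
  · linear_combination e3 / 2
  · linear_combination e5 / 2

theorem cornerQuadrics13_mem (k : Fin 13) : cornerQuadrics13 k ∈ projIdeal W13 := by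
  refine mem_projIdeal13 fun c hc => ?_
  obtain ⟨p1, p2, p3, p7, p8, p9⟩ := hc.products
  obtain ⟨e0, e1, e2, e3, e4, e5, e6, e7, e8⟩ := hc
  fin_cases k <;> simp only [cornerQuadrics13, Fin.reduceFinMk, Fin.zero_eta, Fin.mk_one,
    Matrix.cons_val, map_sub, map_add, map_mul, eval_X,
    eval_C, p1, p2, p3, p7, p8, p9] <;> first
    | ring1
    | linear_combination c 0 * c 0 * e0
    | linear_combination c 0 * c 0 * e1
    | linear_combination c 0 * c 0 * e2
    | linear_combination -c 0 * c 7 * e7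
    | linear_combination -c 0 * c 4 * e7
    | linear_combination -c 0 * c 5 * e7
    | linear_combination -c 0 * c 6 * e7

/-- The linear forms of the tangent cone at a corner. -/
def cornerLinear13 (ε δ : ℂ) : Fin 7 → Poly 13 :=
  ![C (4 * ε) * X 3 - X 0, C (4 * δ) * X 4 - X 1, C (4 * (ε * δ)) * X 5 - X 2,
    C 2 * X 11 - C (2 * ε) * X 10 + C (2 * δ) * X 9,
    C 2 * (X 4 - X 7) - C (2 * ε) * (X 6 - X 5) + C (2 * δ) * X 0,
    C 2 * (X 8 - X 3) - C (2 * ε) * X 1 + C (2 * δ) * (X 6 - X 5),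
    C 2 * X 2 - C (2 * ε) * (X 8 - X 3) + C (2 * δ) * (X 4 - X 7)]

/-- The higher terms of the equations with the linear parts `cornerLinear13`. -/
def cornerHigher13 : Fin 7 → Poly 13 :=
  ![X 3 * X 3, X 4 * X 4, X 5 * X 5, X 4 * X 9 - X 3 * X 10, X 4 * X 0 - X 3 * (X 6 - X 5),
    X 4 * (X 6 - X 5) - X 3 * X 1, X 4 * (X 4 - X 7) - X 3 * (X 8 - X 3)]

theorem cornerLinear13_isHomogeneous (ε δ : ℂ) (k : Fin 7) :
    (cornerLinear13 ε δ k).IsHomogeneous 1 := by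
  fin_cases k <;> repeat' first
    | exact isHomogeneous_X _ _
    | apply IsHomogeneous.sub
    | apply IsHomogeneous.add
    | apply IsHomogeneous.C_mul

theorem cornerHigher13_isHomogeneous (k : Fin 7) : (cornerHigher13 k).IsHomogeneous 2 := by
  have hX := fun k : Fin 13 => isHomogeneous_X ℂ k
  have hD := fun k l : Fin 13 => (hX k).sub (hX l)
  fin_cases k
  · exact (hX 3).mul (hX 3)
  · exact (hX 4).mul (hX 4)
  · exact (hX 5).mul (hX 5)
  · exact ((hX 4).mul (hX 9)).sub ((hX 3).mul (hX 10))
  · exact ((hX 4).mul (hX 0)).sub ((hX 3).mul (hD 6 5))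
  · exact ((hX 4).mul (hD 6 5)).sub ((hX 3).mul (hX 1))
  · exact ((hX 4).mul (hD 4 7)).sub ((hX 3).mul (hD 8 3))

/-- Signs are the square roots of one. -/
abbrev IsSign (ε : ℂ) : Prop := ε * ε = 1

variable {ε δ : ℂ}

theorem cornerLinear13_mem (hε : IsSign ε) (hδ : IsSign δ) (k : Fin 7) :
    cornerLinear13 ε δ k ∈
      tangentConeIdeal W13 (corner13 ε δ) := by
  refine mem_tangentConeIdeal_of_eval (i := 0) (cornerVector13_ne_zero ε δ) rfl (by simp)
    (cornerQuadrics13_mem (Fin.castLE (by norm_num) k)) (cornerLinear13_isHomogeneous ε δ k)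
    (cornerHigher13_isHomogeneous k) fun w => ?_
  rw [cornerVector13_add]
  fin_cases k <;> simp only [Fin.castLE, cornerQuadrics13, cornerLinear13, cornerHigher13,
    Fin.reduceFinMk, Fin.zero_eta, Fin.mk_one, Matrix.cons_val, map_sub, map_add, map_mul, eval_X, eval_C] <;> first
    | ring1
    | linear_combination 4 * hε
    | linear_combination 4 * hδ
    | linear_combination 4 * ε * ε * hδ + 4 * hε

/-- The linear forms on the tangent cone at a corner that parametrize it as a Veronese cone. -/
def cornerForms13 (ε δ : ℂ) : Fin 6 → Poly 13 :=
  ![X 0, X 1, X 12, C (ε * δ) * (X 6 - X 5), C ε * X 9, C δ * X 10]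

theorem cornerForms13_isHomogeneous (ε δ : ℂ) (k : Fin 6) :
    (cornerForms13 ε δ k).IsHomogeneous 1 := by
  fin_cases k <;> repeat' first
    | exact isHomogeneous_X _ _
    | apply IsHomogeneous.sub
    | apply IsHomogeneous.add
    | apply IsHomogeneous.C_mul

theorem cornerRelation13 {a : ℂ} (k : Fin 6) {f : Poly 13} (hf : f.IsHomogeneous 2)
    (h : ∀ w, eval (![1, 2 + w 0, 2 + w 1, 2 + w 2, 2 * ε + w 3, 2 * δ + w 4, 2 * (ε * δ) + w 5,
        2 * (ε * δ) + w 6, 2 * δ + w 7, 2 * ε + w 8, w 9, w 10, w 11, w 12] : Fin 14 → ℂ)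
        (C a * cornerQuadrics13 (Fin.natAdd 7 k)) = eval w f) :
    f ∈ tangentConeIdeal W13 (corner13 ε δ) := by
  refine mem_tangentConeIdeal_of_eval (i := 0) (g := 0) (cornerVector13_ne_zero ε δ) rfl (by simp)
    (Ideal.mul_mem_left _ (C a) (cornerQuadrics13_mem (Fin.natAdd 7 k))) hf
    (isHomogeneous_zero _ _ _) fun w => ?_
  rw [cornerVector13_add, h, map_zero, add_zero]

/-- The parametrization of the tangent cone at a corner. -/
def cornerSpace13 (ε δ : ℂ) : (Fin 6 → ℂ) →ₗ[ℂ] (Fin 13 → ℂ) where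
  toFun v := ![v 0, v 1, v 0 + v 1 - 2 * v 3, ε * (v 0 / 4), δ * (v 1 / 4),
    ε * δ * ((v 0 + v 1 - 2 * v 3) / 4), ε * δ * ((v 0 + v 1 - 2 * v 3) / 4 + v 3),
    δ * (v 1 / 4 - v 3 + v 0), ε * (v 0 / 4 + v 1 - v 3), ε * v 4, δ * v 5,
    ε * δ * (v 5 - v 4), v 2]
  map_add' v w := by
    ext j
    fin_cases j <;> simp <;> ring
  map_smul' a v := by
    ext j
    fin_cases j <;> simp <;> ring

theorem OnCone13.twist (hε : IsSign ε) (hδ : IsSign δ) {a0 a1 a3 b0 b1 b3 y : ℂ}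
    (h : OnCone13 ![1, a0, a1, a3, b0, b1, b3, y]) :
    OnCone13 ![1, ε * a0, δ * a1, ε * δ * a3, ε * b0, δ * b1, ε * δ * b3, y] := by
  obtain ⟨e0, e1, e2, e3, e4, e5, e6, e7, e8⟩ := h
  simp only [Matrix.cons_val] at e0 e1 e2 e3 e4 e5 e6 e7 e8
  unfold IsSign at hε hδ
  constructor <;> simp only [Matrix.cons_val]
  · linear_combination e0 + (a0 * a0 - b0 * b0) * hε
  · linear_combination e1 + (a1 * a1 - b1 * b1) * hδ
  · linear_combination e2 + (a3 * a3 - b3 * b3) * (δ * δ * hε + hδ)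
  · linear_combination δ * e3 + δ * (a0 * a3 + b0 * b3) * hε
  · linear_combination ε * δ * e4
  · linear_combination ε * e5 + ε * (a1 * a3 - b1 * b3) * hδ
  · linear_combination δ * e6 + δ * (a0 * b3 + b0 * a3) * hε
  · linear_combination ε * δ * e7
  · linear_combination ε * e8 + ε * (b1 * a3 - a1 * b3) * hδ

/-- A curve in the cone whose odd coordinates vanish to first order, and whose even coordinates
are constant up to second order, gives a limit direction. -/
theorem isLimitDirection_corner13 (hε : IsSign ε) (hδ : IsSign δ) {A0 A1 A3 B0 B1 B3 : ℂ → ℂ} (y : ℂ)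
    (hA0 : ContinuousAt A0 0) (hA1 : ContinuousAt A1 0) (hA3 : ContinuousAt A3 0)
    (hB0 : ContinuousAt B0 0) (hB1 : ContinuousAt B1 0) (hB3 : ContinuousAt B3 0)
    (hc : ∀ᶠ t in 𝓝[≠] (0 : ℂ), OnCone13 ![1, 2 + t ^ 2 * A0 t, 2 + t ^ 2 * A1 t,
      2 + t ^ 2 * A3 t, t * B0 t, t * B1 t, t * B3 t, t * y]) :
    IsLimitDirection W13 0 (cornerVector13 ε δ)
      ![B0 0 ^ 2, B1 0 ^ 2, B3 0 ^ 2, ε * A0 0, δ * A1 0, ε * δ * A3 0,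
        ε * δ * (A3 0 + B0 0 * B1 0), δ * (A1 0 - B0 0 * B3 0), ε * (A0 0 + B1 0 * B3 0),
        ε * (B0 0 * y), δ * (B1 0 * y), ε * δ * (B3 0 * y), y ^ 2] := by
  refine ⟨fun t => ![B0 t ^ 2, B1 t ^ 2, B3 t ^ 2, ε * A0 t, δ * A1 t, ε * δ * A3 t,
        ε * δ * (A3 t + B0 t * B1 t), δ * (A1 t - B0 t * B3 t), ε * (A0 t + B1 t * B3 t),
        ε * (B0 t * y), δ * (B1 t * y), ε * δ * (B3 t * y), y ^ 2], ?_, rfl, ?_⟩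
  · rw [continuousAt_pi]
    intro j
    fin_cases j <;> simp only [Fin.reduceFinMk, Fin.zero_eta, Fin.mk_one, Matrix.cons_val] <;> fun_prop
  · filter_upwards [hc] with t ht
    have ht' := ht.twist hε hδ
    have hz : _ ∈ affineCone W13 := describes13.zmap_mem_affineCone (mem_cone13.mpr ht') fun h =>
      one_ne_zero (α := ℂ) (congrFun h 0)
    rw [zmap13] at hz
    refine Eq.subst (motive := fun v => v ∈ affineCone W13) ?_ hz
    obtain ⟨p1, p2, p3, p7, p8, p9⟩ := ht'.products
    rw [cornerVector13_add]
    unfold zvec13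
    rw [p1, p2, p3, p7, p8, p9]
    unfold IsSign at hε hδ
    funext k
    fin_cases k <;> simp only [Pi.smul_apply, smul_eq_mul, Fin.reduceFinMk, Fin.zero_eta,
      Fin.mk_one, Matrix.cons_val] <;> first
      | ring1
      | linear_combination (t ^ 2 * B0 t ^ 2) * hε
      | linear_combination (t ^ 2 * B1 t ^ 2) * hδ
      | linear_combination (t ^ 2 * B3 t ^ 2) * (δ * δ * hε + hδ)
      | linear_combination -(δ * t ^ 2 * B0 t * B3 t) * hε
      | linear_combination (ε * t ^ 2 * B1 t * B3 t) * hδ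

/-- The cone of genus 13 contains a curve through the fixed point in every odd direction. -/
theorem onCone13_curve {α β t : ℂ} (y : ℂ) (h0 : 1 - t ^ 2 * α ^ 2 ≠ 0) (h1 : 1 - t ^ 2 * β ^ 2 ≠ 0) :
    OnCone13 ![1, 2 + t ^ 2 * (4 * α ^ 2 / (1 - t ^ 2 * α ^ 2)),
      2 + t ^ 2 * (4 * β ^ 2 / (1 - t ^ 2 * β ^ 2)),
      2 + t ^ 2 * (4 * (α - β) ^ 2 / ((1 - t ^ 2 * α ^ 2) * (1 - t ^ 2 * β ^ 2))),
      t * (4 * α / (1 - t ^ 2 * α ^ 2)), t * (4 * β / (1 - t ^ 2 * β ^ 2)),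
      t * (4 * (β - α) * (1 - t ^ 2 * (α * β)) / ((1 - t ^ 2 * α ^ 2) * (1 - t ^ 2 * β ^ 2))),
      t * y] := by
  constructor <;> simp only [Matrix.cons_val] <;>
    field_simp <;> ring

/-- The coordinates on the tangent cone at a corner in terms of those of the Veronese cone. -/
def cornerCoefficients13 (ε δ : ℂ) : Fin 13 → Fin 6 → ℂ :=
  ![![1, 0, 0, 0, 0, 0], ![0, 1, 0, 0, 0, 0], ![1, 1, 0, -2, 0, 0], ![ε / 4, 0, 0, 0, 0, 0],
    ![0, δ / 4, 0, 0, 0, 0], ![ε * δ / 4, ε * δ / 4, 0, -(ε * δ) / 2, 0, 0],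
    ![ε * δ / 4, ε * δ / 4, 0, ε * δ / 2, 0, 0], ![δ, δ / 4, 0, -δ, 0, 0],
    ![ε / 4, ε, 0, -ε, 0, 0], ![0, 0, 0, 0, ε, 0], ![0, 0, 0, 0, 0, δ],
    ![0, 0, 0, 0, -(ε * δ), ε * δ], ![0, 0, 1, 0, 0, 0]]

/-- The combinations of the linear forms in the tangent cone that express the coordinates. -/
def cornerCombination13 (ε δ : ℂ) : Fin 13 → Fin 7 → ℂ :=
  ![0, 0, ![0, 0, 0, 0, -δ / 2, ε / 2, 1 / 2], ![ε / 4, 0, 0, 0, 0, 0, 0],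
    ![0, δ / 4, 0, 0, 0, 0, 0],
    ![0, 0, ε * δ / 4, 0, -ε / 8, δ / 8, ε * δ / 8],
    ![0, 0, ε * δ / 4, 0, -ε / 8, δ / 8, ε * δ / 8],
    ![0, δ / 4, 0, 0, -1 / 2, 0, 0], ![ε / 4, 0, 0, 0, 0, 1 / 2, 0], 0, 0,
    ![0, 0, 0, 1 / 2, 0, 0, 0], 0]

theorem cornerCombination13_spec (hε : IsSign ε) (hδ : IsSign δ) (j : Fin 13) :
    X j - ∑ l, C (cornerCoefficients13 ε δ j l) * cornerForms13 ε δ l =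
      ∑ l, C (cornerCombination13 ε δ j l) * cornerLinear13 ε δ l := by
  refine MvPolynomial.funext fun w => ?_
  simp only [Fin.sum_univ_six, Fin.sum_univ_seven, cornerForms13, cornerLinear13]
  have hε' : ε = 1 ∨ ε = -1 := mul_self_eq_one_iff.mp hε
  have hδ' : δ = 1 ∨ δ = -1 := mul_self_eq_one_iff.mp hδ
  fin_cases j <;> simp only [cornerCoefficients13, cornerCombination13, Fin.reduceFinMk,
    Fin.zero_eta, Fin.mk_one, Matrix.cons_val, map_sub,
    map_add, map_mul, eval_X, eval_C, Pi.zero_apply] <;>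
    rcases hε' with rfl | rfl <;> rcases hδ' with rfl | rfl <;> ring

theorem tangentCone13_corner (hε : IsSign ε) (hδ : IsSign δ) :
    (corner13 ε δ ∈ W13 → 5 ≤ Module.finrank ℂ
      (embeddedTangentSpace W13 (corner13 ε δ))) ∧
    HasMultiplicity W13 (corner13 ε δ) 3 4 ∧
      ∃ Y, IsVeroneseSurface Y ∧ TangentConeIsConeOver W13
        (corner13 ε δ) Y := by
  have hS := cornerForms13_isHomogeneous ε δ
  have hSS := fun i j k l => ((hS i).mul (hS j)).sub ((hS k).mul (hS l))
  have hε' : ε = 1 ∨ ε = -1 := mul_self_eq_one_iff.mp hε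
  have hδ' : δ = 1 ∨ δ = -1 := mul_self_eq_one_iff.mp hδ
  refine tangentCone_of_veronese (i := 0) (cornerVector13_ne_zero ε δ) rfl (by simp) hS
    (cornerRelation13 (a := 1) 0 (hSS _ _ _ _) fun w => ?_)
    (cornerRelation13 (a := 1) 1 (hSS _ _ _ _) fun w => ?_)
    (cornerRelation13 (a := 1) 2 (hSS _ _ _ _) fun w => ?_)
    (cornerRelation13 (a := δ) 3 (hSS _ _ _ _) fun w => ?_)
    (cornerRelation13 (a := ε) 4 (hSS _ _ _ _) fun w => ?_)
    (cornerRelation13 (a := ε * δ) 5 (hSS _ _ _ _) fun w => ?_) (fun j => ?_)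
    (cornerSpace13 ε δ) (fun v l => ?_) (fun u _ => ?_)
  iterate 6
    · simp [cornerQuadrics13, cornerForms13, Fin.natAdd]
      rcases hε' with rfl | rfl <;> rcases hδ' with rfl | rfl <;> ring
  · refine ⟨cornerCoefficients13 ε δ j, ?_⟩
    rw [cornerCombination13_spec hε hδ]
    exact Ideal.sum_mem _ fun l _ => Ideal.mul_mem_left _ _ (cornerLinear13_mem hε hδ l)
  · fin_cases l <;> simp [cornerForms13, cornerSpace13] <;>
      rcases hε' with rfl | rfl <;> rcases hδ' with rfl | rfl <;> ring
  · have h0 : ∀ γ : ℂ, (1 : ℂ) - 0 ^ 2 * γ ^ 2 ≠ 0 := fun γ => by simp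
    have hne : ∀ γ : ℂ, ∀ᶠ t in 𝓝[≠] (0 : ℂ), 1 - t ^ 2 * γ ^ 2 ≠ 0 := fun γ =>
      nhdsWithin_le_nhds (ContinuousAt.eventually_ne (by fun_prop) (h0 γ))
    have h := isLimitDirection_corner13 hε hδ (u 2)
      (A0 := fun t => 4 * (u 0 / 4) ^ 2 / (1 - t ^ 2 * (u 0 / 4) ^ 2))
      (A1 := fun t => 4 * (u 1 / 4) ^ 2 / (1 - t ^ 2 * (u 1 / 4) ^ 2))
      (A3 := fun t => 4 * (u 0 / 4 - u 1 / 4) ^ 2 /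
        ((1 - t ^ 2 * (u 0 / 4) ^ 2) * (1 - t ^ 2 * (u 1 / 4) ^ 2)))
      (B0 := fun t => 4 * (u 0 / 4) / (1 - t ^ 2 * (u 0 / 4) ^ 2))
      (B1 := fun t => 4 * (u 1 / 4) / (1 - t ^ 2 * (u 1 / 4) ^ 2))
      (B3 := fun t => 4 * (u 1 / 4 - u 0 / 4) * (1 - t ^ 2 * (u 0 / 4 * (u 1 / 4))) /
        ((1 - t ^ 2 * (u 0 / 4) ^ 2) * (1 - t ^ 2 * (u 1 / 4) ^ 2)))
      (ContinuousAt.div (by fun_prop) (by fun_prop) (h0 _))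
      (ContinuousAt.div (by fun_prop) (by fun_prop) (h0 _))
      (ContinuousAt.div (by fun_prop) (by fun_prop) (mul_ne_zero (h0 _) (h0 _)))
      (ContinuousAt.div (by fun_prop) (by fun_prop) (h0 _))
      (ContinuousAt.div (by fun_prop) (by fun_prop) (h0 _))
      (ContinuousAt.div (by fun_prop) (by fun_prop) (mul_ne_zero (h0 _) (h0 _)))
      (by
        filter_upwards [hne (u 0 / 4), hne (u 1 / 4)] with t t0 t1
        exact onCone13_curve (u 2) t0 t1)
    convert h using 1
    funext j
    fin_cases j <;> simp only [cornerSpace13, veronese, LinearMap.coe_mk, AddHom.coe_mk,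
      Fin.reduceFinMk, Fin.zero_eta, Fin.mk_one, Matrix.cons_val] <;> ring1

/-! ### The ideal of the tangent cone at the vertex of genus 13 -/

theorem unitVector13_add (w : Fin 13 → ℂ) :
    (unitVector 13 : Fin 14 → ℂ) + Fin.insertNth (α := fun _ => ℂ) 13 0 w =
      ![w 0, w 1, w 2, w 3, w 4, w 5, w 6, w 7, w 8, w 9, w 10, w 11, w 12, 1] := by
  have h13 : (13 : Fin 14) = Fin.last 13 := rfl
  funext k
  rw [h13]
  refine Fin.lastCases ?_ (fun j => ?_) k
  · rw [Pi.add_apply, Fin.insertNth_apply_same]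
    simp [unitVector]
  · rw [Pi.add_apply, ← Fin.succAbove_last_apply, Fin.insertNth_apply_succAbove, unitVector,
      Pi.single_eq_of_ne (Fin.succAbove_ne _ _), zero_add, Fin.succAbove_last_apply]
    fin_cases j <;> rfl

/-- The tangent cone at the vertex. -/
abbrev vertexIdeal13 : Ideal (Poly 13) :=
  tangentConeIdeal W13 (unitPoint 13)

theorem mem_vertexIdeal13 {d : ℕ} {F : Poly 14} {f g : Poly 13}
    (hf : f.IsHomogeneous d) (hg : g.IsHomogeneous (d + 1))
    (hF : ∀ c, OnCone13 c → eval (zvec13 c) F = 0)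
    (h : ∀ w : Fin 13 → ℂ, eval (![w 0, w 1, w 2, w 3, w 4, w 5, w 6, w 7, w 8, w 9, w 10, w 11,
      w 12, 1] : Fin 14 → ℂ) F = eval w f + eval w g) : f ∈ vertexIdeal13 := by
  refine mem_tangentConeIdeal_of_eval (i := 13) (unitVector_ne_zero 13) (Pi.single_eq_same 13 1)
    unitVector_of_lt (mem_projIdeal13 hF) hf hg fun w => ?_
  rw [unitVector13_add, h]

/-- The equations of the cone that have a linear part at the vertex. -/
def vertexQuadrics13 : Fin 6 → Poly 14 :=
  ![(X 1 - C 2 * X 0) * X 13 - X 10 * X 10, (X 2 - C 2 * X 0) * X 13 - X 11 * X 11,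
    (X 3 - C 2 * X 0) * X 13 - X 12 * X 12, (X 7 - X 6) * X 13 - X 10 * X 11,
    (X 5 - X 8) * X 13 - X 10 * X 12, (X 9 - X 4) * X 13 - X 11 * X 12]

/-- The linear forms of the tangent cone at the vertex. -/
def vertexLinear13 : Fin 6 → Poly 13 :=
  ![X 1 - C 2 * X 0, X 2 - C 2 * X 0, X 3 - C 2 * X 0, X 7 - X 6, X 5 - X 8, X 9 - X 4]

/-- The higher terms of the equations with the linear parts `vertexLinear13`. -/
def vertexHigher13 : Fin 6 → Poly 13 :=
  ![-(X 10 * X 10), -(X 11 * X 11), -(X 12 * X 12), -(X 10 * X 11), -(X 10 * X 12), -(X 11 * X 12)]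

theorem vertexLinear13_mem (k : Fin 6) : vertexLinear13 k ∈ vertexIdeal13 := by
  refine mem_vertexIdeal13 (d := 1) (F := vertexQuadrics13 k) (g := vertexHigher13 k) ?_ ?_
    (fun c hc => ?_) fun w => ?_
  · fin_cases k <;> repeat' first
      | exact isHomogeneous_X _ _
      | apply IsHomogeneous.sub
      | apply IsHomogeneous.C_mul
  · fin_cases k <;> exact ((isHomogeneous_X ℂ _).mul (isHomogeneous_X ℂ _)).neg
  · obtain ⟨p1, p2, p3, p7, p8, p9⟩ := hc.products
    fin_cases k <;> simp only [vertexQuadrics13, Fin.reduceFinMk, Fin.zero_eta, Fin.mk_one,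
      Matrix.cons_val, map_sub, map_mul, eval_X,
      eval_C, p1, p2, p3, p7, p8, p9] <;> ring1
  · fin_cases k <;> simp only [vertexQuadrics13, vertexLinear13, vertexHigher13, Fin.reduceFinMk,
      Fin.zero_eta, Fin.mk_one, Matrix.cons_val,
      map_sub, map_neg, map_mul, eval_X, eval_C] <;> ring1

/-- The quadrics that contain the threefold and are singular at the vertex. -/
def vertexCones13 : Fin 10 → {n : ℕ} → (Fin 13 → Poly n) → Poly n := fun k _ x =>
  ![x 4 * x 4 - x 0 * (x 1 + C 2 * x 0), x 5 * x 5 - x 0 * (x 2 + C 2 * x 0),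
    x 6 * x 6 - x 0 * (x 3 + C 2 * x 0), x 4 * x 5 - x 0 * (x 7 + x 6),
    x 4 * x 6 - x 0 * (x 8 + x 5), x 5 * x 6 - x 0 * (x 9 + x 4),
    x 4 * x 11 - x 5 * x 10 - C 2 * (x 0 * x 12), x 6 * x 11 - x 5 * x 12 - C 2 * (x 0 * x 10),
    x 4 * x 12 + x 6 * x 10 - C 2 * (x 0 * x 11), x 4 * x 10 - x 5 * x 11 + x 7 * x 12] k

theorem vertexCones13_mem (k : Fin 10) : vertexCones13 k X ∈ vertexIdeal13 := by
  have hX := fun k : Fin 13 => isHomogeneous_X ℂ k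
  have hXX := fun i j : Fin 13 => (hX i).mul (hX j)
  refine mem_vertexIdeal13 (d := 2) (F := vertexCones13 k fun j => X j.castSucc) (g := 0) ?_
    (isHomogeneous_zero _ _ _) (fun c hc => ?_) fun w => ?_
  · fin_cases k
    · exact (hXX 4 4).sub ((hX 0).mul ((hX 1).add ((hX 0).C_mul 2)))
    · exact (hXX 5 5).sub ((hX 0).mul ((hX 2).add ((hX 0).C_mul 2)))
    · exact (hXX 6 6).sub ((hX 0).mul ((hX 3).add ((hX 0).C_mul 2)))
    · exact (hXX 4 5).sub ((hX 0).mul ((hX 7).add (hX 6)))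
    · exact (hXX 4 6).sub ((hX 0).mul ((hX 8).add (hX 5)))
    · exact (hXX 5 6).sub ((hX 0).mul ((hX 9).add (hX 4)))
    · exact ((hXX 4 11).sub (hXX 5 10)).sub ((hXX 0 12).C_mul 2)
    · exact ((hXX 6 11).sub (hXX 5 12)).sub ((hXX 0 10).C_mul 2)
    · exact ((hXX 4 12).add (hXX 6 10)).sub ((hXX 0 11).C_mul 2)
    · exact ((hXX 4 10).sub (hXX 5 11)).add (hXX 7 12)
  · obtain ⟨p1, p2, p3, p7, p8, p9⟩ := hc.products
    obtain ⟨e0, e1, e2, e3, e4, e5, e6, e7, e8⟩ := hc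
    fin_cases k <;> simp only [vertexCones13, Fin.reduceFinMk, Fin.zero_eta, Fin.mk_one,
      Matrix.cons_val, map_sub, map_add, map_mul, eval_X,
      eval_C, p1, p2, p3, p7, p8, p9, Fin.reduceCastSucc, Fin.castSucc_zero, Fin.castSucc_one]
    · linear_combination c 0 * c 0 * e0
    · linear_combination c 0 * c 0 * e1
    · linear_combination c 0 * c 0 * e2
    · linear_combination c 0 * c 0 * e4
    · linear_combination c 0 * c 0 * e3
    · linear_combination c 0 * c 0 * e5
    · linear_combination c 0 * c 7 * e7
    · linear_combination c 0 * c 7 * e8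
    · linear_combination c 0 * c 7 * e6
    · linear_combination
        c 7 * (c 2 / 2 * e6 - c 1 / 2 * e8 + c 3 / 2 * e7 - c 6 * e4)
  · fin_cases k <;> simp only [vertexCones13, Fin.reduceFinMk, Fin.zero_eta, Fin.mk_one,
      Matrix.cons_val, map_sub, map_add, map_mul, eval_X,
      eval_C, Fin.reduceCastSucc, Fin.castSucc_zero, Fin.castSucc_one, map_zero, add_zero]

/-! ### The planes in the tangent cone at the vertex of genus 13 -/

/-- The values of the first of two independent signs. -/
def firstSign : Fin 4 → ℂ := ![1, 1, -1, -1]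

/-- The values of the second sign. -/
def secondSign : Fin 4 → ℂ := ![1, -1, 1, -1]

theorem isSign_firstSign (κ : Fin 4) : IsSign (firstSign κ) := by
  unfold IsSign
  fin_cases κ <;> simp [firstSign]

theorem isSign_secondSign (κ : Fin 4) : IsSign (secondSign κ) := by
  unfold IsSign
  fin_cases κ <;> simp [secondSign]

/-- The parametrization of the plane in the tangent cone that belongs to a corner. -/
def planeForms13 (ε δ : ℂ) : Fin 13 → Poly 3 :=
  ![X 0, C 2 * X 0, C 2 * X 0, C 2 * X 0, C (2 * ε) * X 0, C (2 * δ) * X 0, C (2 * (ε * δ)) * X 0,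
    C (2 * (ε * δ)) * X 0, C (2 * δ) * X 0, C (2 * ε) * X 0, X 1, X 2, C ε * X 2 - C δ * X 1]

/-- The linear form that vanishes on all planes in the tangent cone but one. -/
def signForm13 (ε δ : ℂ) : Poly 13 :=
  C 2 * X 0 + C ε * X 4 + C δ * X 5 + C (ε * δ) * X 6

theorem signForm13_isHomogeneous (ε δ : ℂ) : (signForm13 ε δ).IsHomogeneous 1 :=
  (((((isHomogeneous_X _ _).C_mul _).add ((isHomogeneous_X _ _).C_mul _)).add
    ((isHomogeneous_X _ _).C_mul _)).add ((isHomogeneous_X _ _).C_mul _))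

theorem signForm13_relations {A : Type} [CommRing A] {s a b c x y z e d : A} (he : e * e = 1)
    (hd : d * d = 1) (q0 : a * a = 4 * (s * s)) (q1 : b * b = 4 * (s * s))
    (q2 : c * c = 4 * (s * s)) (q3 : a * b = 2 * (s * c)) (q4 : a * c = 2 * (s * b))
    (q5 : b * c = 2 * (s * a)) (q6 : a * y - b * x - 2 * (s * z) = 0)
    (q7 : c * y - b * z - 2 * (s * x) = 0) (q8 : a * z + c * x - 2 * (s * y) = 0)
    (q9 : a * x - b * y + c * z = 0) :
    (2 * s + e * a + d * b + e * d * c) * a = (2 * s + e * a + d * b + e * d * c) * (2 * e * s) ∧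
    (2 * s + e * a + d * b + e * d * c) * b = (2 * s + e * a + d * b + e * d * c) * (2 * d * s) ∧
    (2 * s + e * a + d * b + e * d * c) * c =
      (2 * s + e * a + d * b + e * d * c) * (2 * (e * d) * s) ∧
    (2 * s + e * a + d * b + e * d * c) * z =
      (2 * s + e * a + d * b + e * d * c) * (e * y - d * x) := by
  refine ⟨?_, ?_, ?_, ?_⟩
  · linear_combination e * q0 + d * q3 + e * d * q4 - (2 * s * a + 2 * d * (s * c)) * he
  · linear_combination e * q3 + d * q1 + e * d * q5 - (2 * s * b + 2 * e * (s * c)) * hd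
  · linear_combination e * q4 + d * q5 + e * d * q2 - 2 * s * d * a * he - 2 * s * e * b * hd -
      2 * s * c * (d * d * he + hd)
  · linear_combination -q6 - d * q7 + e * q8 + e * d * q9 - (a * y + d * c * y) * he +
      (b * x + e * c * x) * hd

theorem map_signForm13_mul {A : Type} [CommRing A] (φ : Poly 13 →+* A) {ε δ : ℂ}
    (hε : IsSign ε) (hδ : IsSign δ) (hl : ∀ k, φ (vertexLinear13 k) = 0)
    (hq : ∀ k, φ (vertexCones13 k X) = 0) (j : Fin 13) :
    φ (signForm13 ε δ * X j - signForm13 ε δ *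
      aeval ![(X 0 : Poly 13), X 10, X 11] (planeForms13 ε δ j)) = 0 := by
  have hε' := congrArg (fun a => φ (C a)) hε
  have hδ' := congrArg (fun a => φ (C a)) hδ
  have h2 : φ (C 2) = 2 := by rw [show (C 2 : Poly 13) = 2 from map_ofNat C 2, map_ofNat]
  have h := And.intro (And.intro (hl 0) (And.intro (hl 1) (hl 2)))
    (And.intro (hl 3) (And.intro (hl 4) (hl 5)))
  have h' := And.intro (And.intro (And.intro (hq 0) (And.intro (hq 1) (hq 2)))
    (And.intro (hq 3) (And.intro (hq 4) (hq 5)))) (And.intro (And.intro (hq 6) (hq 7))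
      (And.intro (hq 8) (hq 9)))
  simp only [vertexLinear13, vertexCones13, Matrix.cons_val, map_sub, map_add, map_mul, map_one, h2] at h h' hε' hδ'
  obtain ⟨⟨l0, l1, l2⟩, l3, l4, l5⟩ := h
  obtain ⟨⟨⟨q0, q1, q2⟩, q3, q4, q5⟩, ⟨q6, q7⟩, q8, q9⟩ := h'
  obtain ⟨m0, m1, m3, m6⟩ := signForm13_relations hε' hδ'
    (by linear_combination q0 + φ (X 0) * l0) (by linear_combination q1 + φ (X 0) * l1)
    (by linear_combination q2 + φ (X 0) * l2) (by linear_combination q3 + φ (X 0) * l3)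
    (by linear_combination q4 - φ (X 0) * l4) (by linear_combination q5 + φ (X 0) * l5) q6 q7 q8
    (by linear_combination q9 - φ (X 12) * l3)
  have hσ : φ (signForm13 ε δ) =
      2 * φ (X 0) + φ (C ε) * φ (X 4) + φ (C δ) * φ (X 5) + φ (C ε) * φ (C δ) * φ (X 6) := by
    simp only [signForm13, map_add, map_mul, h2]
  rw [← hσ] at m0 m1 m3 m6
  rw [map_sub, map_mul, map_mul]
  fin_cases j <;> simp only [planeForms13, Fin.reduceFinMk, Fin.zero_eta, Fin.mk_one,
    Matrix.cons_val, map_sub, map_mul, aeval_X,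
    algHom_C, algebraMap_eq, h2]
  · ring1
  · linear_combination φ (signForm13 ε δ) * l0
  · linear_combination φ (signForm13 ε δ) * l1
  · linear_combination φ (signForm13 ε δ) * l2
  · linear_combination m0
  · linear_combination m1
  · linear_combination m3
  · linear_combination m3 + φ (signForm13 ε δ) * l3
  · linear_combination m1 - φ (signForm13 ε δ) * l4
  · linear_combination m0 + φ (signForm13 ε δ) * l5
  · ring1
  · ring1
  · linear_combination m6

theorem signForm13_mul_mem {ε δ : ℂ} (hε : IsSign ε) (hδ : IsSign δ) (j : Fin 13) :
    signForm13 ε δ * X j - signForm13 ε δ *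
      aeval ![(X 0 : Poly 13), X 10, X 11] (planeForms13 ε δ j) ∈ vertexIdeal13 :=
  Ideal.Quotient.eq_zero_iff_mem.mp (map_signForm13_mul (Ideal.Quotient.mk vertexIdeal13) hε hδ
    (fun k => Ideal.Quotient.eq_zero_iff_mem.mpr (vertexLinear13_mem k))
    (fun k => Ideal.Quotient.eq_zero_iff_mem.mpr (vertexCones13_mem k)) j)

/-! ### The normal form at the vertex of genus 13 -/

/-- The multipliers of the normal form at the vertex. -/
def vertexMultiplier13 : Fin 5 → Poly 13 :=
  Fin.cons 1 fun κ => signForm13 (firstSign κ) (secondSign κ)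

/-- The variables of the normal form at the vertex. -/
def vertexVariable13 : Fin 5 → Fin 3 → Fin 13 := Fin.cons ![10, 11, 12] fun _ => ![0, 10, 11]

/-- The coefficients of the coordinates with respect to the forms `signForm13`. -/
def vertexCoefficients13 (ε δ : ℂ) : Fin 13 → ℂ :=
  ![1 / 8, 1 / 4, 1 / 4, 1 / 4, ε / 4, δ / 4, ε * δ / 4, ε * δ / 4, δ / 4, ε / 4, 0, 0, 0]

theorem sub_sum_signForm13_mem {j : Fin 13} (hj : ∀ l, j ≠ vertexVariable13 0 l) :
    X j - ∑ κ, C (vertexCoefficients13 (firstSign κ) (secondSign κ) j) *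
      signForm13 (firstSign κ) (secondSign κ) ∈ vertexIdeal13 := by
  have h : ∀ a : Fin 6 → ℂ, ∑ k, C (a k) * vertexLinear13 k ∈ vertexIdeal13 := fun a =>
    Ideal.sum_mem _ fun k _ => Ideal.mul_mem_left _ _ (vertexLinear13_mem k)
  suffices ∃ a : Fin 6 → ℂ, X j - ∑ κ, C (vertexCoefficients13 (firstSign κ) (secondSign κ) j) *
      signForm13 (firstSign κ) (secondSign κ) = ∑ k, C (a k) * vertexLinear13 k by
    obtain ⟨a, ha⟩ := this
    rw [ha]
    exact h a
  refine ⟨(![0, Pi.single 0 1, Pi.single 1 1, Pi.single 2 1, 0, 0, 0, Pi.single 3 1,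
    Pi.single 4 (-1), Pi.single 5 1, 0, 0, 0] : Fin 13 → Fin 6 → ℂ) j, MvPolynomial.funext fun w => ?_⟩
  simp only [Fin.sum_univ_four, Fin.sum_univ_six]
  fin_cases j <;> first
    | exact absurd rfl (hj 0)
    | exact absurd rfl (hj 1)
    | exact absurd rfl (hj 2)
    | (simp [vertexCoefficients13, signForm13, vertexLinear13, firstSign, secondSign]; try ring1)

theorem reducible_vertex13 (j : Fin 13) (a : Fin 5) (h : Poly 3) :
    vertexMultiplier13 a * aeval (fun l => (X (vertexVariable13 a l) : Poly 13)) h * X j ∈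
      reducible vertexIdeal13 vertexMultiplier13 fun a l => X (vertexVariable13 a l) := by
  have hσ : ∀ (κ : Fin 4) (F : Poly 13), signForm13 (firstSign κ) (secondSign κ) * F ∈
      reducible vertexIdeal13 vertexMultiplier13 fun a l => X (vertexVariable13 a l) := by
    intro κ
    refine reducible_mul_piece (b := κ.succ) fun j =>
      ⟨planeForms13 (firstSign κ) (secondSign κ) j, ?_⟩
    have := signForm13_mul_mem (isSign_firstSign κ) (isSign_secondSign κ) j
    have hv : (fun l => X (vertexVariable13 κ.succ l)) = ![(X 0 : Poly 13), X 10, X 11] := by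
      funext l
      fin_cases l <;> rfl
    rwa [hv]
  refine Fin.cases ?_ (fun κ => ?_) a
  · by_cases hj : ∃ l, j = vertexVariable13 0 l
    · obtain ⟨l, rfl⟩ := hj
      refine reducible_mul_of_sub (b := 0) (ρ := X l) rfl ?_ h
      rw [aeval_X, sub_self]
      exact Ideal.zero_mem _
    · push Not at hj
      refine reducible_of_sub (F' := vertexMultiplier13 0 *
        aeval (fun l => (X (vertexVariable13 0 l) : Poly 13)) h *
        ∑ κ, C (vertexCoefficients13 (firstSign κ) (secondSign κ) j) *
          signForm13 (firstSign κ) (secondSign κ)) ?_ ?_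
      · rw [← mul_sub]
        exact Ideal.mul_mem_left _ _ (sub_sum_signForm13_mem hj)
      · rw [Finset.mul_sum]
        refine sum_mem fun κ _ => ?_
        rw [mul_comm, mul_comm (C _), mul_assoc]
        exact hσ κ _
  · rw [mul_assoc]
    exact hσ κ _

/-! ### The surface at the vertex of genus 13 -/

theorem eval_planeForms13 (ε δ : ℂ) (u : Fin 3 → ℂ) : (fun j => eval u (planeForms13 ε δ j)) =
    ![u 0, 2 * u 0, 2 * u 0, 2 * u 0, 2 * ε * u 0, 2 * δ * u 0, 2 * (ε * δ) * u 0,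
      2 * (ε * δ) * u 0, 2 * δ * u 0, 2 * ε * u 0, u 1, u 2, ε * u 2 - δ * u 1] := by
  funext j
  fin_cases j <;> simp only [planeForms13, Fin.reduceFinMk, Fin.zero_eta, Fin.mk_one,
    Matrix.cons_val, map_sub, map_mul, eval_X, eval_C]

/-- The parametrization of the plane in the tangent cone that belongs to a corner. -/
def planeMap13 (ε δ : ℂ) : (Fin 3 → ℂ) →ₗ[ℂ] (Fin 13 → ℂ) where
  toFun u := ![u 0, 2 * u 0, 2 * u 0, 2 * u 0, 2 * ε * u 0, 2 * δ * u 0, 2 * (ε * δ) * u 0,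
      2 * (ε * δ) * u 0, 2 * δ * u 0, 2 * ε * u 0, u 1, u 2, ε * u 2 - δ * u 1]
  map_add' v w := by
    ext j
    fin_cases j <;> simp <;> ring
  map_smul' a v := by
    ext j
    fin_cases j <;> simp <;> ring

theorem planeMap13_injective (ε δ : ℂ) : Function.Injective (planeMap13 ε δ) :=
  injective_of_coordinates ![0, 10, 11] fun w l => by fin_cases l <;> rfl

/-- The parametrization of an edge of the quadrilateral. -/
def edgeMap13 : (Fin 2 → ℂ) →ₗ[ℂ] (Fin 3 → ℂ) where
  toFun u := ![0, u 0, u 1]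
  map_add' v w := by
    ext j
    fin_cases j <;> simp
  map_smul' a v := by
    ext j
    fin_cases j <;> simp

theorem edgeMap13_injective : Function.Injective edgeMap13 :=
  injective_of_coordinates ![1, 2] fun w l => by fin_cases l <;> rfl

/-- The space spanned by the surface. -/
def hullMap13 : (Fin 7 → ℂ) →ₗ[ℂ] (Fin 13 → ℂ) where
  toFun u := ![u 0, 2 * u 0, 2 * u 0, 2 * u 0, u 1, u 2, u 3, u 3, u 2, u 1, u 4, u 5, u 6]
  map_add' v w := by
    ext j
    fin_cases j <;> simp <;> ring
  map_smul' a v := by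
    ext j
    fin_cases j <;> simp <;> ring

theorem hullMap13_injective : Function.Injective hullMap13 :=
  injective_of_coordinates ![0, 4, 5, 6, 10, 11, 12] fun w l => by fin_cases l <;> rfl

/-- The planes of the surface. -/
def plane13 : Fin 5 → Submodule ℂ (Fin 13 → ℂ) :=
  Fin.cons (coordSubspace {10, 11, 12}) fun κ =>
    LinearMap.range (planeMap13 (firstSign κ) (secondSign κ))

/-- The base of the tangent cone at the vertex. -/
def vertexCone13 : Set (PSp 12) := ⋃ i, projSubspace (plane13 i)

theorem mem_vertexCone13 {v : Fin 13 → ℂ} :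
    v ∈ affineCone vertexCone13 ↔ v ≠ 0 ∧ ∃ i, v ∈ plane13 i := by
  unfold vertexCone13
  simp only [mem_affineCone_iUnion, mem_affineCone_projSubspace, exists_and_left]

theorem mem_plane13_zero {v : Fin 13 → ℂ} : v ∈ plane13 0 ↔
    v = ![0, 0, 0, 0, 0, 0, 0, 0, 0, 0, v 10, v 11, v 12] := by
  change v ∈ coordSubspace _ ↔ _
  rw [mem_coordSubspace]
  constructor
  · intro h
    funext j
    by_cases hj : j ∈ ({10, 11, 12} : Finset (Fin 13))
    · simp only [Finset.mem_insert, Finset.mem_singleton] at hj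
      rcases hj with rfl | rfl | rfl <;> rfl
    · rw [h j hj]
      fin_cases j <;> first | rfl | exact absurd (by decide) hj
  · intro h j hj
    rw [h]
    fin_cases j <;> first | rfl | exact absurd (by decide) hj

theorem planeMap13_zero (ε δ p q : ℂ) : planeMap13 ε δ ![0, p, q] =
    ![0, 0, 0, 0, 0, 0, 0, 0, 0, 0, p, q, ε * q - δ * p] := by
  funext j
  fin_cases j <;> simp [planeMap13]

theorem plane13_inter (κ : Fin 4) : plane13 0 ⊓ plane13 κ.succ =
    LinearMap.range (planeMap13 (firstSign κ) (secondSign κ) ∘ₗ edgeMap13) := by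
  ext v
  rw [Submodule.mem_inf, mem_plane13_zero]
  constructor
  · rintro ⟨h, u, rfl⟩
    have h0 : u 0 = 0 := congrFun h 0
    refine ⟨![u 1, u 2], ?_⟩
    rw [LinearMap.comp_apply]
    congr 1
    funext l
    match l with
    | 0 => exact h0.symm
    | 1 => rfl
    | 2 => rfl
  · rintro ⟨u, rfl⟩
    refine ⟨?_, edgeMap13 u, rfl⟩
    exact planeMap13_zero _ _ _ _

theorem isUnionOfFivePlanes13 : IsUnionOfFivePlanes vertexCone13 := by
  refine ⟨LinearMap.range hullMap13, plane13, ?_, fun i => ?_, fun i => ?_, rfl, fun i hi => ?_,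
    fun i j k hi hj hk hij hik hjk => ?_⟩
  · rw [LinearMap.finrank_range_of_inj hullMap13_injective, Module.finrank_fin_fun]
  · refine Fin.cases ?_ (fun κ => ?_) i
    · intro v hv
      rw [mem_plane13_zero] at hv
      rw [hv]
      refine ⟨![0, 0, 0, 0, v 10, v 11, v 12], ?_⟩
      funext j
      fin_cases j <;> simp [hullMap13]
    · rintro _ ⟨u, rfl⟩
      refine ⟨![u 0, 2 * firstSign κ * u 0, 2 * secondSign κ * u 0,
        2 * (firstSign κ * secondSign κ) * u 0, u 1, u 2,
        firstSign κ * u 2 - secondSign κ * u 1], ?_⟩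
      rfl
  · refine Fin.cases ?_ (fun κ => ?_) i
    · exact finrank_coordSubspace _
    · exact (LinearMap.finrank_range_of_inj (planeMap13_injective _ _)).trans
        (Module.finrank_fin_fun ℂ)
  · obtain ⟨κ, rfl⟩ := Fin.exists_succ_eq.mpr hi
    rw [plane13_inter, LinearMap.finrank_range_of_inj, Module.finrank_fin_fun]
    exact (planeMap13_injective _ _).comp edgeMap13_injective
  · obtain ⟨κ, rfl⟩ := Fin.exists_succ_eq.mpr hi
    obtain ⟨μ, rfl⟩ := Fin.exists_succ_eq.mpr hj
    obtain ⟨ν, rfl⟩ := Fin.exists_succ_eq.mpr hk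
    rw [eq_bot_iff]
    rintro v ⟨⟨⟨h0, u1, h1⟩, u2, h2⟩, u3, h3⟩
    have key : ∀ (κ : Fin 4) (u : Fin 3 → ℂ),
        planeMap13 (firstSign κ) (secondSign κ) u = v →
        v 12 = firstSign κ * v 11 - secondSign κ * v 10 := by
      rintro κ u rfl
      rfl
    have e1 := key κ u1 h1
    have e2 := key μ u2 h2
    have e3 := key ν u3 h3
    have h : v 10 = 0 ∧ v 11 = 0 ∧ v 12 = 0 := by
      clear h1 h2 h3 key
      fin_cases κ <;> fin_cases μ <;> first
        | exact absurd rfl hij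
        | (fin_cases ν <;> first
            | exact absurd rfl hik
            | exact absurd rfl hjk
            | (simp [firstSign, secondSign] at e1 e2 e3; grind))
    rw [Submodule.mem_bot, mem_plane13_zero.mp h0, h.1, h.2.1, h.2.2]
    funext j
    fin_cases j <;> rfl

/-! ### Uniqueness of the normal form at the vertex of genus 13 -/

theorem eval_signForm13 (κ ν : Fin 4) (u : Fin 3 → ℂ) :
    eval (planeMap13 (firstSign κ) (secondSign κ) u) (signForm13 (firstSign ν) (secondSign ν)) =
      if ν = κ then 8 * u 0 else 0 := by
  fin_cases κ <;> fin_cases ν <;>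
    simp [planeMap13, signForm13, firstSign, secondSign] <;> ring

theorem normalForm_vertex13 {h : Fin 5 → Poly 3}
    (hh : normalForm vertexMultiplier13 (fun a l => X (vertexVariable13 a l)) h ∈
      projIdeal vertexCone13) : h = 0 := by
  have hev : ∀ i, ∀ v ∈ plane13 i, v ≠ 0 →
      eval (fun l => v (vertexVariable13 0 l)) (h 0) +
      ∑ κ : Fin 4, eval v (signForm13 (firstSign κ) (secondSign κ)) *
      eval (fun l => v (vertexVariable13 κ.succ l)) (h κ.succ) = 0 := by
    intro i v hv h0
    have := mem_projIdeal.mp hh v (mem_vertexCone13.mpr ⟨h0, i, hv⟩)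
    rw [normalForm_apply, Fin.sum_univ_succ, map_add, map_sum] at this
    have hcomp : ∀ a, eval v (aeval (fun l => (X (vertexVariable13 a l) : Poly 13)) (h a)) =
        eval (fun l => v (vertexVariable13 a l)) (h a) := fun a => by
      rw [eval_aeval]
      simp
    rw [← this, map_mul, hcomp]
    have e0 : eval v (vertexMultiplier13 0) = 1 := map_one _
    rw [e0, one_mul]
    congr 1
    refine Finset.sum_congr rfl fun κ _ => ?_
    rw [map_mul, hcomp]
    rfl
  have h0 : h 0 = 0 := by
    refine eq_zero_of_eval_ne_zero (D := X 0) (X_ne_zero _) fun u hu => ?_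
    rw [eval_X] at hu
    have := hev 0 ![0, 0, 0, 0, 0, 0, 0, 0, 0, 0, u 0, u 1, u 2] (mem_plane13_zero.mpr rfl)
      fun h => hu (congrFun h 10)
    rw [Finset.sum_eq_zero, add_zero] at this
    · rw [← this]
      congr 1
      congr 1
      funext l
      fin_cases l <;> rfl
    · intro κ _
      simp [signForm13]
  funext a
  refine Fin.cases h0 (fun κ => ?_) a
  refine eq_zero_of_eval_ne_zero (D := X 0) (X_ne_zero _) fun u hu => ?_
  rw [eval_X] at hu
  have := hev κ.succ (planeMap13 (firstSign κ) (secondSign κ) u) ⟨u, rfl⟩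
    fun h => hu (congrFun h 0)
  simp only [h0, map_zero, zero_add, eval_signForm13, ite_mul, zero_mul, Finset.sum_ite_eq',
    Finset.mem_univ, if_true] at this
  have h8 := (mul_eq_zero.mp this).resolve_left (mul_ne_zero (by norm_num) hu)
  rw [← h8]
  congr 1
  congr 1
  funext l
  fin_cases l <;> rfl

/-! ### Limit directions at the vertex of genus 13 -/

/-- The last coordinate is free on the cone, and the others can be scaled. -/
theorem OnCone13.scale {a0 a1 a2 a3 a4 a5 a6 y : ℂ} (h : OnCone13 ![a0, a1, a2, a3, a4, a5, a6, y])
    (r z : ℂ) : OnCone13 ![r * a0, r * a1, r * a2, r * a3, r * a4, r * a5, r * a6, z] := by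
  obtain ⟨e0, e1, e2, e3, e4, e5, e6, e7, e8⟩ := h
  simp only [Matrix.cons_val] at e0 e1 e2 e3 e4 e5 e6 e7 e8
  constructor <;> simp only [Matrix.cons_val]
  · linear_combination r * r * e0
  · linear_combination r * r * e1
  · linear_combination r * r * e2
  · linear_combination r * r * e3
  · linear_combination r * r * e4
  · linear_combination r * r * e5
  · linear_combination r * r * e6
  · linear_combination r * r * e7
  · linear_combination r * r * e8

/-- Curves in the cone through the vertex, whose even coordinates vanish to first and whose odd
coordinates vanish to second order, give limit directions. -/
theorem isLimitDirection_vertex13 {R A0 A1 A3 B0 B1 B3 : ℂ → ℂ} (hR : ContinuousAt R 0)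
    (hA0 : ContinuousAt A0 0) (hA1 : ContinuousAt A1 0) (hA3 : ContinuousAt A3 0)
    (hB0 : ContinuousAt B0 0) (hB1 : ContinuousAt B1 0) (hB3 : ContinuousAt B3 0)
    (hc : ∀ᶠ t in 𝓝[≠] (0 : ℂ), OnCone13 ![t * R t, t * A0 t, t * A1 t, t * A3 t,
      t * (t * B0 t), t * (t * B1 t), t * (t * B3 t), 1]) :
    IsLimitDirection W13 13 (unitVector 13)
      ![R 0 * R 0, A0 0 * A0 0 / 2, A1 0 * A1 0 / 2, A3 0 * A3 0 / 2, R 0 * A0 0, R 0 * A1 0,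
        R 0 * A3 0, A0 0 * A1 0 / 2, A0 0 * A3 0 / 2, A1 0 * A3 0 / 2, B0 0, B1 0, B3 0] := by
  refine ⟨fun t => ![R t * R t, (A0 t * A0 t + t ^ 2 * (B0 t * B0 t)) / 2,
    (A1 t * A1 t + t ^ 2 * (B1 t * B1 t)) / 2, (A3 t * A3 t + t ^ 2 * (B3 t * B3 t)) / 2,
    R t * A0 t, R t * A1 t, R t * A3 t, (A0 t * A1 t + t ^ 2 * (B0 t * B1 t)) / 2,
    (A0 t * A3 t - t ^ 2 * (B0 t * B3 t)) / 2, (A1 t * A3 t + t ^ 2 * (B1 t * B3 t)) / 2,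
    B0 t, B1 t, B3 t], ?_, ?_, ?_⟩
  · rw [continuousAt_pi]
    intro j
    fin_cases j <;> simp only [Fin.reduceFinMk, Fin.zero_eta, Fin.mk_one, Matrix.cons_val] <;> fun_prop
  · funext j
    fin_cases j <;> simp only [Fin.reduceFinMk, Fin.zero_eta, Fin.mk_one, Matrix.cons_val] <;> ring1
  · filter_upwards [hc] with t ht
    have hz : _ ∈ affineCone W13 := describes13.zmap_mem_affineCone (mem_cone13.mpr ht) fun h =>
      one_ne_zero (α := ℂ) (congrFun h 7)
    rw [zmap13] at hz
    refine Eq.subst (motive := fun v => v ∈ affineCone W13) ?_ hz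
    rw [unitVector13_add]
    funext k
    fin_cases k <;> simp only [zvec13, Pi.smul_apply, smul_eq_mul, Fin.reduceFinMk, Fin.zero_eta,
      Fin.mk_one, Matrix.cons_val] <;> ring1

theorem isGenericLimitDirection13_plane {ε δ : ℂ} (hε : IsSign ε) (hδ : IsSign δ) (u : Fin 3 → ℂ) :
    IsGenericLimitDirection W13 13 (unitVector 13) (planeMap13 ε δ u) := by
  refine ⟨3, planeForms13 ε δ, X 0, u, X_ne_zero _, ?_, fun u hu => ?_⟩
  · rw [eval_planeForms13]
    rfl
  rw [eval_X] at hu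
  obtain ⟨r, hr⟩ := exists_sq (u 0)
  have hr0 : r ≠ 0 := by
    rintro rfl
    exact hu (by rw [← hr]; ring)
  rw [eval_planeForms13]
  obtain ⟨α, hα⟩ : ∃ α, 4 * r * α = ε * u 1 := ⟨ε * u 1 / (4 * r), by field_simp⟩
  obtain ⟨β, hβ⟩ : ∃ β, 4 * r * β = δ * u 2 := ⟨δ * u 2 / (4 * r), by field_simp⟩
  have h0 : ∀ γ : ℂ, (1 : ℂ) - 0 ^ 2 * γ ^ 2 ≠ 0 := fun γ => by simp
  have hne : ∀ γ : ℂ, ∀ᶠ t in 𝓝[≠] (0 : ℂ), 1 - t ^ 2 * γ ^ 2 ≠ 0 := fun γ =>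
    nhdsWithin_le_nhds (ContinuousAt.eventually_ne (by fun_prop) (h0 γ))
  have hα' : ContinuousAt (fun t : ℂ => (1 - t ^ 2 * α ^ 2)⁻¹) 0 :=
    ContinuousAt.inv₀ (by fun_prop) (h0 α)
  have hβ' : ContinuousAt (fun t : ℂ => (1 - t ^ 2 * β ^ 2)⁻¹) 0 :=
    ContinuousAt.inv₀ (by fun_prop) (h0 β)
  have h := isLimitDirection_vertex13 (R := fun _ => r)
    (A0 := fun t => r * (ε * (2 + t ^ 2 * (4 * α ^ 2 * (1 - t ^ 2 * α ^ 2)⁻¹))))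
    (A1 := fun t => r * (δ * (2 + t ^ 2 * (4 * β ^ 2 * (1 - t ^ 2 * β ^ 2)⁻¹))))
    (A3 := fun t => r * (ε * δ * (2 + t ^ 2 * (4 * (α - β) ^ 2 *
      ((1 - t ^ 2 * α ^ 2)⁻¹ * (1 - t ^ 2 * β ^ 2)⁻¹)))))
    (B0 := fun t => r * (ε * (4 * α * (1 - t ^ 2 * α ^ 2)⁻¹)))
    (B1 := fun t => r * (δ * (4 * β * (1 - t ^ 2 * β ^ 2)⁻¹)))
    (B3 := fun t => r * (ε * δ * (4 * (β - α) * (1 - t ^ 2 * (α * β)) *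
      ((1 - t ^ 2 * α ^ 2)⁻¹ * (1 - t ^ 2 * β ^ 2)⁻¹))))
    (by fun_prop) (by fun_prop) (by fun_prop) (by fun_prop) (by fun_prop) (by fun_prop)
    (by fun_prop) (by
      filter_upwards [hne α, hne β] with t t0 t1
      have := ((onCone13_curve 0 t0 t1).twist hε hδ).scale (t * r) 1
      refine Eq.subst (motive := OnCone13) ?_ this
      funext k
      fin_cases k <;> simp only [Fin.reduceFinMk, Fin.zero_eta, Fin.mk_one, Matrix.cons_val, div_eq_mul_inv, mul_inv_rev] <;> ring1)
  refine Eq.subst (motive := IsLimitDirection W13 13 (unitVector 13)) ?_ h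
  unfold IsSign at hε hδ
  have i1 : (1 - 0 ^ 2 * α ^ 2 : ℂ)⁻¹ = 1 := by norm_num
  have i2 : (1 - 0 ^ 2 * β ^ 2 : ℂ)⁻¹ = 1 := by norm_num
  funext j
  fin_cases j <;> simp only [Fin.reduceFinMk, Fin.zero_eta, Fin.mk_one, Matrix.cons_val, i1, i2, ← hr]
  · ring1
  · linear_combination 2 * r ^ 2 * hε
  · linear_combination 2 * r ^ 2 * hδ
  · linear_combination 2 * r ^ 2 * (δ * δ * hε + hδ)
  · ring1
  · ring1
  · ring1
  · ring1
  · linear_combination 2 * r ^ 2 * δ * hε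
  · linear_combination 2 * r ^ 2 * ε * hδ
  · linear_combination ε * hα + u 1 * hε
  · linear_combination δ * hβ + u 2 * hδ
  · linear_combination ε * δ * hβ - ε * δ * hα + ε * u 2 * hδ - δ * u 1 * hε

theorem isGenericLimitDirection13_center {v : Fin 13 → ℂ} (hv : v ∈ plane13 0) :
    IsGenericLimitDirection W13 13 (unitVector 13) v := by
  have he : ∀ u : Fin 3 → ℂ, (fun j => eval u
      ((![0, 0, 0, 0, 0, 0, 0, 0, 0, 0, X 0, X 1, X 2] : Fin 13 → Poly 3) j)) =
      ![0, 0, 0, 0, 0, 0, 0, 0, 0, 0, u 0, u 1, u 2] := by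
    intro u
    funext j
    fin_cases j <;> simp
  refine ⟨3, ![0, 0, 0, 0, 0, 0, 0, 0, 0, 0, X 0, X 1, X 2],
    (X 1 ^ 2 + X 2 ^ 2 - X 0 ^ 2) ^ 2 - C 4 * X 1 ^ 2 * X 2 ^ 2, ![v 10, v 11, v 12], fun h => ?_,
    ?_, fun u hu => ?_⟩
  · have := congrArg (eval ![1, 0, 0]) h
    simp at this
  · rw [he]
    exact mem_plane13_zero.mp hv
  · rw [he]
    simp only [map_sub, map_add, map_mul, map_pow, eval_X, eval_C] at hu
    obtain ⟨d, hd⟩ := exists_sq ((u 1 ^ 2 + u 2 ^ 2 - u 0 ^ 2) ^ 2 - 4 * u 1 ^ 2 * u 2 ^ 2)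
    have hd0 : d ≠ 0 := by
      rintro rfl
      exact hu (by rw [← hd]; ring)
    have h := isLimitDirection_vertex13 (R := fun t => t * (u 0 * u 1 * u 2 / d))
      (A0 := fun t => t * (u 0 * (u 1 ^ 2 + u 2 ^ 2 - u 0 ^ 2) / d))
      (A1 := fun t => t * (u 1 * (u 1 ^ 2 - u 0 ^ 2 - u 2 ^ 2) / d))
      (A3 := fun t => t * (u 2 * (u 0 ^ 2 + u 1 ^ 2 - u 2 ^ 2) / d))
      (B0 := fun _ => u 0) (B1 := fun _ => u 1) (B3 := fun _ => u 2)
      (by fun_prop) (by fun_prop) (by fun_prop) (by fun_prop) (by fun_prop) (by fun_prop)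
      (by fun_prop) (Eventually.of_forall fun t => by
        have : OnCone13 ![u 0 * u 1 * u 2 / d, u 0 * (u 1 ^ 2 + u 2 ^ 2 - u 0 ^ 2) / d,
            u 1 * (u 1 ^ 2 - u 0 ^ 2 - u 2 ^ 2) / d, u 2 * (u 0 ^ 2 + u 1 ^ 2 - u 2 ^ 2) / d,
            u 0, u 1, u 2, 0] := by
          constructor <;> simp only [Matrix.cons_val] <;>
            field_simp
          · linear_combination -u 0 ^ 2 * hd
          · linear_combination -u 1 ^ 2 * hd
          · linear_combination -u 2 ^ 2 * hd
          · linear_combination u 0 * u 2 * hd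
          · linear_combination -u 0 * u 1 * hd
          · linear_combination -u 1 * u 2 * hd
          all_goals ring1
        have := this.scale (t * t) 1
        refine Eq.subst (motive := OnCone13) ?_ this
        funext k
        fin_cases k <;> simp only [Fin.reduceFinMk, Fin.zero_eta, Fin.mk_one, Matrix.cons_val] <;> ring1)
    refine Eq.subst (motive := IsLimitDirection W13 13 (unitVector 13)) ?_ h
    funext j
    fin_cases j <;> simp only [Fin.reduceFinMk, Fin.zero_eta, Fin.mk_one, Matrix.cons_val] <;> ring1

theorem tangentCone13_vertex :
    TangentConeIsConeOver W13 (unitPoint 13) vertexCone13 ∧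
      HasMultiplicity W13 (unitPoint 13) 3 5 := by
  refine tangentCone_of_normalForm (unitVector_ne_zero 13) (Pi.single_eq_same 13 1) unitVector_of_lt
    (m := vertexMultiplier13) (ψ := fun a l => X (vertexVariable13 a l)) (s := ![0, 1, 1, 1, 1])
    (by decide) (fun a => ?_) (fun a j => isHomogeneous_X _ _) le_rfl (fun v hv => ?_) ?_
    reducible_vertex13 fun h hh => normalForm_vertex13 hh
  · refine Fin.cases (isHomogeneous_one _ _) (fun κ => ?_) a
    have hs : ∀ κ : Fin 4, (![0, 1, 1, 1, 1] : Fin 5 → ℕ) κ.succ = 1 := by decide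
    rw [hs]
    exact signForm13_isHomogeneous _ _
  · obtain ⟨-, i, hi⟩ := mem_vertexCone13.mp hv
    revert hi
    refine Fin.cases (fun hi => ?_) (fun κ hi => ?_) i
    · exact isGenericLimitDirection13_center hi
    · obtain ⟨u, rfl⟩ := hi
      exact isGenericLimitDirection13_plane (isSign_firstSign κ) (isSign_secondSign κ) u
  · have := reducible_piece (G := vertexIdeal13) (m := vertexMultiplier13)
      (ψ := fun a l => X (vertexVariable13 a l)) 0 1
    rwa [map_one, mul_one] at this

/-! ### The singular points of genus 13 -/

theorem onCone13_segment {ε δ : ℂ} (hε : IsSign ε) (hδ : IsSign δ) (a b : ℂ) :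
    OnCone13 ![a, 2 * ε * a, 2 * δ * a, 2 * (ε * δ) * a, 0, 0, 0, b] := by
  unfold IsSign at hε hδ
  constructor <;> simp only [Matrix.cons_val] <;> first
    | ring1
    | linear_combination 4 * a * a * hε
    | linear_combination 4 * a * a * hδ
    | linear_combination 4 * a * a * (δ * δ * hε + hδ)
    | linear_combination 4 * a * a * δ * hε
    | linear_combination 4 * a * a * ε * hδ

theorem zvec13_segment {ε δ : ℂ} (hε : IsSign ε) (hδ : IsSign δ) (a b : ℂ) :
    zvec13 ![a, 2 * ε * a, 2 * δ * a, 2 * (ε * δ) * a, 0, 0, 0, b] =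
      a ^ 2 • cornerVector13 ε δ + b ^ 2 • unitVector 13 := by
  unfold IsSign at hε hδ
  funext k
  fin_cases k <;> simp [cornerVector13, unitVector] <;> first
    | ring1
    | linear_combination 2 * a * a * hε
    | linear_combination 2 * a * a * hδ
    | linear_combination 2 * a * a * (δ * δ * hε + hδ)
    | linear_combination 2 * a * a * δ * hε
    | linear_combination 2 * a * a * ε * hδ

/-- The vectors of the singular points. -/
def singularVector13 : Fin 5 → Fin 14 → ℂ :=
  Fin.snoc (α := fun _ => Fin 14 → ℂ) (fun κ => cornerVector13 (firstSign κ) (secondSign κ))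
    (unitVector 13)

theorem singularVector13_castSucc (κ : Fin 4) :
    singularVector13 κ.castSucc = cornerVector13 (firstSign κ) (secondSign κ) :=
  Fin.snoc_castSucc ..

theorem singularVector13_last : singularVector13 4 = unitVector 13 :=
  Fin.snoc_last (α := fun _ => Fin 14 → ℂ) (n := 4) _ _

theorem singularVector13_ne_zero (i : Fin 5) : singularVector13 i ≠ 0 := by
  refine Fin.lastCases ?_ (fun κ => ?_) i
  · exact singularVector13_last.trans_ne (unitVector_ne_zero 13)
  · rw [singularVector13_castSucc]
    exact cornerVector13_ne_zero _ _

/-- The singular points of genus 13. -/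
def point13 (i : Fin 5) : PSp 13 := mk ℂ (singularVector13 i) (singularVector13_ne_zero i)

theorem point13_castSucc (κ : Fin 4) : point13 κ.castSucc =
    corner13 (firstSign κ) (secondSign κ) := by
  unfold point13
  congr 1
  exact singularVector13_castSucc κ

theorem point13_last : point13 4 = unitPoint 13 := by
  unfold point13
  congr 1

theorem segment_mem_affineCone13 (κ : Fin 4) {a b : ℂ}
    (h : a • cornerVector13 (firstSign κ) (secondSign κ) + b • unitVector 13 ≠ 0) :
    a • cornerVector13 (firstSign κ) (secondSign κ) + b • unitVector 13 ∈ affineCone W13 := by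
  obtain ⟨r, rfl⟩ := exists_sq a
  obtain ⟨s, rfl⟩ := exists_sq b
  refine describes13.mem_affineCone_image.mpr ⟨h, _,
    mem_cone13.mpr (onCone13_segment (isSign_firstSign κ) (isSign_secondSign κ) r s), ?_⟩
  rw [zmap13, zvec13_segment (isSign_firstSign κ) (isSign_secondSign κ)]

theorem point13_mem (i : Fin 5) : point13 i ∈ W13 := by
  suffices singularVector13 i ∈ affineCone W13 from this.2
  refine Fin.lastCases ?_ (fun κ => ?_) i
  · have := segment_mem_affineCone13 0 (a := 0) (b := 1) (by
      rw [zero_smul, one_smul, zero_add]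
      exact unitVector_ne_zero 13)
    rw [zero_smul, one_smul, zero_add] at this
    exact singularVector13_last.symm ▸ this
  · have := segment_mem_affineCone13 κ (a := 1) (b := 0) (by
      rw [zero_smul, one_smul, add_zero]
      exact cornerVector13_ne_zero _ _)
    rw [zero_smul, one_smul, add_zero] at this
    rwa [singularVector13_castSucc]

theorem eq_of_signs {κ ν : Fin 4} (h1 : firstSign κ = firstSign ν)
    (h2 : secondSign κ = secondSign ν) : κ = ν := by
  fin_cases κ <;> fin_cases ν <;> first
    | rfl
    | (exfalso; revert h1 h2; norm_num [firstSign, secondSign])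

theorem exists_signs {ε δ : ℂ} (hε : IsSign ε) (hδ : IsSign δ) :
    ∃ κ, firstSign κ = ε ∧ secondSign κ = δ := by
  rcases mul_self_eq_one_iff.mp hε with rfl | rfl <;>
    rcases mul_self_eq_one_iff.mp hδ with rfl | rfl
  · exact ⟨0, rfl, rfl⟩
  · exact ⟨1, rfl, rfl⟩
  · exact ⟨2, rfl, rfl⟩
  · exact ⟨3, rfl, rfl⟩

theorem point13_castSucc_ne (κ : Fin 4) : point13 κ.castSucc ≠ point13 4 := by
  intro h
  rw [point13_castSucc, point13_last, mk_eq_mk_iff_smul] at h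
  obtain ⟨a, -, h⟩ := h
  have h0 : a = 0 := by
    have := congrFun h 13
    simp [cornerVector13] at this
    exact this.symm
  rw [h0, zero_smul] at h
  exact cornerVector13_ne_zero _ _ h

theorem point13_injective : Function.Injective point13 := by
  intro i j
  refine Fin.lastCases ?_ (fun κ => ?_) i <;> refine Fin.lastCases ?_ (fun ν => ?_) j
  · exact fun _ => rfl
  · exact fun h => absurd h.symm (point13_castSucc_ne ν)
  · exact fun h => absurd h (point13_castSucc_ne κ)
  · intro h
    rw [point13_castSucc, point13_castSucc, mk_eq_mk_iff_smul] at h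
    obtain ⟨a, -, h⟩ := h
    have h0 : 1 = a * 1 := congrFun h 0
    rw [mul_one, eq_comm] at h0
    rw [h0, one_smul] at h
    have h4 : 2 * firstSign κ = 2 * firstSign ν := congrFun h 4
    have h5 : 2 * secondSign κ = 2 * secondSign ν := congrFun h 5
    rw [eq_of_signs (mul_left_cancel₀ two_ne_zero h4) (mul_left_cancel₀ two_ne_zero h5)]

theorem associated13 (κ : Fin 4) : Associated W13 (point13 κ.castSucc) (point13 4) := by
  have h := point13_castSucc_ne κ
  rw [point13_castSucc, point13_last] at h ⊢
  exact (associated_mk_iff _ _).mpr ⟨h, fun a b h0 => segment_mem_affineCone13 κ h0⟩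

theorem not_associated13 (κ ν : Fin 4) :
    ¬ Associated W13 (point13 κ.castSucc) (point13 ν.castSucc) := by
  intro h
  have hne := h.1
  rw [point13_castSucc, point13_castSucc] at h
  have h1 := ((associated_mk_iff _ _).mp h).2 1 1 fun h0 => by
    have := congrFun h0 0
    simp [cornerVector13] at this
  have hsign : ∀ {ε ε' : ℂ}, IsSign ε → IsSign ε' → (2 * ε + 2 * ε') * (2 * ε + 2 * ε') = 16 →
      ε = ε' := by
    intro ε ε' h h' hs
    have : (ε - ε') * (ε - ε') = 0 := by
      unfold IsSign at h h'
      linear_combination 2 * h + 2 * h' - hs / 4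
    exact sub_eq_zero.mp (mul_self_eq_zero.mp this)
  have e0 := mem_projIdeal.mp (cornerQuadrics13_mem 0) _ h1
  have e1 := mem_projIdeal.mp (cornerQuadrics13_mem 1) _ h1
  simp only [cornerQuadrics13, cornerVector13, one_smul, Pi.add_apply, Matrix.cons_val, map_sub, map_add, map_mul, eval_X, eval_C] at e0 e1
  refine hne ?_
  rw [eq_of_signs (hsign (isSign_firstSign κ) (isSign_firstSign ν) (by linear_combination e0))
    (hsign (isSign_secondSign κ) (isSign_secondSign ν) (by linear_combination e1))]

/-! ### Tangent spaces of genus 13 -/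

/-- The equations of the tangent spaces of the cone, in the original coordinates. -/
theorem tangent_moves13 {x x' : Fin 8 → ℂ} (hc : OnCone13 (diag13 x))
    (h : ∀ β ∈ D13.eqs, contract β
      (fun i j => diag13 x' i * diag13 x j + diag13 x i * diag13 x' j) = 0) (k : Fin 9) :
    x (moves13 k).1 * x (moves13 k).2.1 = x 6 * x (moves13 k).2.2 ∧
    x (moves13 k).1 * x' (moves13 k).2.1 + x' (moves13 k).1 * x (moves13 k).2.1 =
      x 6 * x' (moves13 k).2.2 + x' 6 * x (moves13 k).2.2 := by
  let y : Fin 8 → DualNumber ℂ := fun j => TrivSqZeroExt.inl (x j) + TrivSqZeroExt.inr (x' j)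
  have hy : ∀ i, diag13 y i =
      TrivSqZeroExt.inl (diag13 x i) + TrivSqZeroExt.inr (diag13 x' i) := by
    intro i
    fin_cases i <;> ext <;> simp [y]
  have hD : OnCone13 (diag13 y) := by
    rw [← forall_equations13_iff]
    intro k
    have h0 := (forall_equations13_iff _).mpr hc k
    have h1 := h _ ⟨k, rfl⟩
    simp only [contract] at h0 h1 ⊢
    ext
    · simp only [TrivSqZeroExt.fst_sum, TrivSqZeroExt.fst_smul, hy, TrivSqZeroExt.fst_mul,
        TrivSqZeroExt.fst_add, TrivSqZeroExt.fst_inl, TrivSqZeroExt.fst_inr, add_zero]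
      exact h0
    · simp only [TrivSqZeroExt.snd_sum, TrivSqZeroExt.snd_smul, hy, TrivSqZeroExt.snd_mul,
        TrivSqZeroExt.snd_add, TrivSqZeroExt.snd_inl, TrivSqZeroExt.snd_inr, zero_add,
        TrivSqZeroExt.fst_add, TrivSqZeroExt.fst_inl, TrivSqZeroExt.fst_inr, add_zero]
      simp only [smul_eq_mul, MulOpposite.smul_eq_mul_unop, MulOpposite.unop_op] at h1 ⊢
      refine Eq.trans (Finset.sum_congr rfl fun i _ => Finset.sum_congr rfl fun j _ => ?_) h1
      ring
  have := (onCone13_diag_iff y).mp hD k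
  have h1 := congrArg TrivSqZeroExt.fst this
  have h2 := congrArg TrivSqZeroExt.snd this
  simp [y] at h1 h2
  exact ⟨h1, by linear_combination h2⟩

/-- The hexagon of the monomials of the sextic del Pezzo surface, in cyclic order. -/
def hexagon13 : Fin 6 → Fin 6 → Fin 8 :=
  ![![0, 1, 3, 2, 4, 5], ![1, 3, 2, 4, 5, 0], ![2, 4, 5, 0, 1, 3], ![3, 2, 4, 5, 0, 1],
    ![4, 5, 0, 1, 3, 2], ![5, 0, 1, 3, 2, 4]]

theorem hexagon13_moves (κ : Fin 6) :
    (∃ k, moves13 k = (hexagon13 κ 1, hexagon13 κ 5, hexagon13 κ 0) ∨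
      moves13 k = (hexagon13 κ 5, hexagon13 κ 1, hexagon13 κ 0)) ∧
    (∃ k, moves13 k = (hexagon13 κ 0, hexagon13 κ 2, hexagon13 κ 1) ∨
      moves13 k = (hexagon13 κ 2, hexagon13 κ 0, hexagon13 κ 1)) ∧
    (∃ k, moves13 k = (hexagon13 κ 0, hexagon13 κ 4, hexagon13 κ 5) ∨
      moves13 k = (hexagon13 κ 4, hexagon13 κ 0, hexagon13 κ 5)) ∧
    (∃ k, moves13 k = (hexagon13 κ 0, hexagon13 κ 3, 6) ∨
      moves13 k = (hexagon13 κ 3, hexagon13 κ 0, 6)) := by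
  revert κ
  decide

theorem eq_zero_of_hexagon13 {x x' : Fin 8 → ℂ}
    (h : ∀ k, x (moves13 k).1 * x' (moves13 k).2.1 + x' (moves13 k).1 * x (moves13 k).2.1 =
      x 6 * x' (moves13 k).2.2 + x' 6 * x (moves13 k).2.2) {κ : Fin 6} (hx : x (hexagon13 κ 0) ≠ 0)
    (h0 : x' (hexagon13 κ 0) = 0) (h1 : x' (hexagon13 κ 1) = 0) (h5 : x' (hexagon13 κ 5) = 0)
    (h7 : x' 7 = 0) : x' = 0 := by
  have hm : ∀ a b c, (∃ k, moves13 k = (a, b, c) ∨ moves13 k = (b, a, c)) →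
      x a * x' b + x' a * x b = x 6 * x' c + x' 6 * x c := by
    rintro a b c ⟨k, hk | hk⟩
    · simpa only [hk] using h k
    · have := h k
      rw [hk] at this
      linear_combination this
  obtain ⟨m1, m2, m3, m4⟩ := hexagon13_moves κ
  have h6 : x' 6 = 0 := by
    simpa [h0, h1, h5, hx] using hm _ _ _ m1
  have h2 : x' (hexagon13 κ 2) = 0 := by
    simpa [h0, h1, h6, hx] using hm _ _ _ m2
  have h4 : x' (hexagon13 κ 4) = 0 := by
    simpa [h0, h5, h6, hx] using hm _ _ _ m3
  have h3 : x' (hexagon13 κ 3) = 0 := by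
    simpa [h0, h6, hx] using hm _ _ _ m4
  have key : ∀ (κ : Fin 6) (j : Fin 8), (∃ l, j = hexagon13 κ l) ∨ j = 6 ∨ j = 7 := by decide
  funext j
  rcases key κ j with ⟨l, rfl⟩ | rfl | rfl
  · match l with
    | 0 => exact h0
    | 1 => exact h1
    | 2 => exact h2
    | 3 => exact h3
    | 4 => exact h4
    | 5 => exact h5
  · exact h6
  · exact h7

theorem diag13_diagonalize_symm (c : Fin 8 → ℂ) : diag13 (diagonalize13.symm c) = c :=
  diagonalize13.apply_symm_apply c

theorem finrank_tangent_le13 {c : Fin 8 → ℂ} (hc : OnCone13 c) {k l : Fin 8}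
    (hk : odd13 k = false) (hl : odd13 l = true) (hck : c k ≠ 0) (hcl : c l ≠ 0)
    (hq : D13.zmap c ≠ 0) :
    Module.finrank ℂ (embeddedTangentSpace W13 (mk ℂ (D13.zmap c) hq)) ≤ 4 := by
  set x := diagonalize13.symm c with hx
  have hcx : c = diag13 x := (diag13_diagonalize_symm c).symm
  have hcorner : ∃ κ, x (hexagon13 κ 0) ≠ 0 := by
    by_contra! h
    have hz : ∀ j : Fin 8, j ≠ 6 → j ≠ 7 → x j = 0 := by
      intro j h6 h7
      have key : ∀ j : Fin 8, j ≠ 6 → j ≠ 7 → ∃ κ, hexagon13 κ 0 = j := by decide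
      obtain ⟨κ, rfl⟩ := key j h6 h7
      exact h κ
    have h6 : x 6 = 0 := by
      have : x 0 * x 2 = x 6 * x 6 := (onCone13_diag_iff x).mp (hcx ▸ hc) 0
      rw [hz 0 (by decide) (by decide), zero_mul, eq_comm] at this
      exact mul_self_eq_zero.mp this
    refine hck ?_
    rw [hcx]
    fin_cases k <;> first
      | (exfalso; revert hk; decide)
      | simp [diag13, hz, h6]
  obtain ⟨κ, hκ⟩ := hcorner
  refine describes13.finrank_tangent_le (mem_cone13.mpr hc) hk hl hck hcl
    (LinearMap.funLeft ℂ ℂ ![hexagon13 κ 0, hexagon13 κ 1, hexagon13 κ 5, 7] ∘ₗ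
      diagonalize13.symm.toLinearMap) (fun e he hφ => ?_) hq
  have hex : e = diag13 (diagonalize13.symm e) := (diag13_diagonalize_symm e).symm
  have hzero := eq_zero_of_hexagon13 (x' := diagonalize13.symm e) (fun k => (tangent_moves13
    (hcx ▸ hc) (fun β hβ => by
      have := he β hβ
      rwa [hcx, hex] at this) k).2) hκ (congrFun hφ 0) (congrFun hφ 1) (congrFun hφ 2)
    (congrFun hφ 3)
  exact (LinearEquiv.map_eq_zero_iff _).mp hzero

/-- Points over which the quotient map is ramified. -/
theorem eq_segment13 {c : Fin 8 → ℂ} (hc : OnCone13 c)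
    (h : (∀ k, odd13 k = false → c k = 0) ∨ ∀ k, odd13 k = true → c k = 0) :
    ∃ κ : Fin 4, ∃ a b : ℂ, a * b = 0 ∧
      c = ![a, 2 * firstSign κ * a, 2 * secondSign κ * a,
        2 * (firstSign κ * secondSign κ) * a, 0, 0, 0, b] := by
  obtain ⟨e0, e1, e2, e3, e4, -, -, -, -⟩ := hc
  have hc' : c = ![c 0, c 1, c 2, c 3, c 4, c 5, c 6, c 7] := by
    funext j
    fin_cases j <;> rfl
  rcases h with h | h
  · have h0 := h 0 rfl
    have h1 := h 1 rfl
    have h2 := h 2 rfl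
    have h3 := h 3 rfl
    rw [h0, h1] at e0
    rw [h0, h2] at e1
    rw [h0, h3] at e2
    have h4 : c 4 = 0 := mul_self_eq_zero.mp (by linear_combination -e0)
    have h5 : c 5 = 0 := mul_self_eq_zero.mp (by linear_combination -e1)
    have h6 : c 6 = 0 := mul_self_eq_zero.mp (by linear_combination -e2)
    refine ⟨0, 0, c 7, zero_mul _, ?_⟩
    rw [hc', h0, h1, h2, h3, h4, h5, h6]
    simp only [mul_zero, Matrix.cons_val]
  · have h4 := h 4 rfl
    have h5 := h 5 rfl
    have h6 := h 6 rfl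
    have h7 := h 7 rfl
    rw [h4] at e0 e4
    rw [h5] at e1
    rw [h6] at e2
    have hsign : ∀ {z : ℂ}, z * z - 0 * 0 - 4 * (c 0 * c 0) = 0 → ∃ ε, IsSign ε ∧ z = 2 * ε * c 0 := by
      intro z hz
      have : (z - 2 * c 0) * (z + 2 * c 0) = 0 := by linear_combination hz
      rcases mul_eq_zero.mp this with h | h
      · exact ⟨1, one_mul 1, by linear_combination h⟩
      · exact ⟨-1, by unfold IsSign; norm_num, by linear_combination h⟩
    obtain ⟨ε, hε, h1⟩ := hsign e0
    obtain ⟨δ, hδ, h2⟩ := hsign e1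
    obtain ⟨κ, rfl, rfl⟩ := exists_signs hε hδ
    refine ⟨κ, c 0, 0, mul_zero _, ?_⟩
    have h3 : c 3 = 2 * (firstSign κ * secondSign κ) * c 0 := by
      by_cases h0 : c 0 = 0
      · rw [h0, mul_zero]
        rw [h0] at e2
        exact mul_self_eq_zero.mp (by linear_combination e2)
      · rw [h1, h2] at e4
        refine mul_left_cancel₀ (mul_ne_zero two_ne_zero h0) ?_
        linear_combination -e4
    conv_lhs => rw [hc', h1, h2, h3, h4, h5, h6, h7]

theorem five_le_finrank_vertex13 : 5 ≤ Module.finrank ℂ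
    (embeddedTangentSpace W13 (unitPoint 13)) := by
  refine succ_le_finrank_embeddedTangentSpace (unitVector_ne_zero 13)
    (by simpa only [point13_last] using point13_mem 4) (Pi.single_eq_same 13 1)
    (v := fun κ : Fin 4 => planeMap13 (firstSign κ) (secondSign κ) ![1, 0, 0])
    (fun κ => isGenericLimitDirection13_plane (isSign_firstSign κ) (isSign_secondSign κ) _) ?_
  rw [Fintype.linearIndependent_iff]
  intro a ha
  have h0 := congrFun ha 0
  have h4 := congrFun ha 4
  have h5 := congrFun ha 5
  have h6 := congrFun ha 6
  simp only [Fin.sum_univ_four, planeMap13, LinearMap.coe_mk, AddHom.coe_mk, firstSign, secondSign,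
    Pi.add_apply, Pi.smul_apply, Pi.zero_apply, smul_eq_mul, Matrix.cons_val] at h0 h4 h5 h6
  have r0 : a 0 = 0 := by linear_combination h0 / 4 + h4 / 8 + h5 / 8 + h6 / 8
  have r1 : a 1 = 0 := by linear_combination h0 / 4 + h4 / 8 - h5 / 8 - h6 / 8
  have r2 : a 2 = 0 := by linear_combination h0 / 4 - h4 / 8 + h5 / 8 - h6 / 8
  have r3 : a 3 = 0 := by linear_combination h0 / 4 - h4 / 8 - h5 / 8 + h6 / 8
  intro κ
  fin_cases κ
  exacts [r0, r1, r2, r3]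

theorem singularLocus13 : singularLocus W13 = Set.range point13 := by
  ext P
  rw [mem_singularLocus_iff isProjectiveVarietyOfDim13]
  constructor
  · rintro ⟨hP, hT⟩
    induction P using Projectivization.ind with
    | h q hq =>
      obtain ⟨c, hc, rfl⟩ := (describes13.mk_mem_image hq).mp hP
      rw [mem_cone13] at hc
      have h : (∀ k, odd13 k = false → c k = 0) ∨ ∀ k, odd13 k = true → c k = 0 := by
        by_contra hcon
        push Not at hcon
        obtain ⟨⟨k, hk, hck⟩, l, hl, hcl⟩ := hcon
        have := finrank_tangent_le13 hc hk hl hck hcl hq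
        omega
      obtain ⟨κ, a, b, hab, hcab⟩ := eq_segment13 hc h
      have hz : D13.zmap c =
          a ^ 2 • cornerVector13 (firstSign κ) (secondSign κ) + b ^ 2 • unitVector 13 := by
        rw [zmap13, hcab, zvec13_segment (isSign_firstSign κ) (isSign_secondSign κ)]
      rcases mul_eq_zero.mp hab with rfl | rfl
      · refine ⟨4, ?_⟩
        rw [zero_pow two_ne_zero, zero_smul, zero_add] at hz
        rw [point13_last, eq_comm, mk_eq_mk_iff_smul]
        exact ⟨_, fun h0 => hq (by rw [hz, h0, zero_smul]), hz⟩
      · refine ⟨κ.castSucc, ?_⟩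
        rw [zero_pow two_ne_zero, zero_smul, add_zero] at hz
        rw [point13_castSucc, eq_comm, mk_eq_mk_iff_smul]
        exact ⟨_, fun h0 => hq (by rw [hz, h0, zero_smul]), hz⟩
  · rintro ⟨i, rfl⟩
    refine ⟨point13_mem i, ?_⟩
    refine Fin.lastCases ?_ (fun κ => ?_) i
    · exact point13_last ▸ five_le_finrank_vertex13
    · have := (tangentCone13_corner (isSign_firstSign κ) (isSign_secondSign κ)).1
      rw [← point13_castSucc] at this
      exact this (point13_mem _)

end EnriquesFano

end

theorem mainTheorem6 :
    -- genus 13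
    ((∃ π : EnriquesFano.PSp 7 → EnriquesFano.PSp 13,
        EnriquesFano.IsGivenBy EnriquesFano.V13 EnriquesFano.z13 π ∧
        EnriquesFano.IsQuotientOnto EnriquesFano.V13 EnriquesFano.t13 EnriquesFano.W13 π) ∧
      EnriquesFano.IsProjectiveVarietyOfDim EnriquesFano.W13 3 ∧
      EnriquesFano.IdealGeneratedByQuadrics EnriquesFano.W13 ∧
      ¬ EnriquesFano.HasSimilarSingularPoints EnriquesFano.W13 3 ∧
      ∃ P : Fin 5 → EnriquesFano.PSp 13, Function.Injective P ∧
        EnriquesFano.singularLocus EnriquesFano.W13 = Set.range P ∧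
        (∀ i, i ≠ 4 → EnriquesFano.Associated EnriquesFano.W13 (P i) (P 4)) ∧
        (∀ i j, i ≠ 4 → j ≠ 4 → ¬ EnriquesFano.Associated EnriquesFano.W13 (P i) (P j)) ∧
        (∀ i, i ≠ 4 → EnriquesFano.HasMultiplicity EnriquesFano.W13 (P i) 3 4 ∧
          ∃ Y : Set (EnriquesFano.PSp 12), EnriquesFano.IsVeroneseSurface Y ∧
            EnriquesFano.TangentConeIsConeOver EnriquesFano.W13 (P i) Y) ∧
        EnriquesFano.HasMultiplicity EnriquesFano.W13 (P 4) 3 5 ∧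
        ∃ M : Set (EnriquesFano.PSp 12), EnriquesFano.IsUnionOfFivePlanes M ∧
          EnriquesFano.TangentConeIsConeOver EnriquesFano.W13 (P 4) M) ∧
    -- genus 17
    ((∃ π : EnriquesFano.PSp 9 → EnriquesFano.PSp 17,
        EnriquesFano.IsGivenBy EnriquesFano.V17 EnriquesFano.z17 π ∧
        EnriquesFano.IsQuotientOnto EnriquesFano.V17 EnriquesFano.t17 EnriquesFano.W17 π) ∧
      EnriquesFano.IsProjectiveVarietyOfDim EnriquesFano.W17 3 ∧
      EnriquesFano.IdealGeneratedByQuadrics EnriquesFano.W17 ∧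
      ¬ EnriquesFano.HasSimilarSingularPoints EnriquesFano.W17 3 ∧
      ∃ P : Fin 5 → EnriquesFano.PSp 17, Function.Injective P ∧
        EnriquesFano.singularLocus EnriquesFano.W17 = Set.range P ∧
        (∀ i, i ≠ 4 → EnriquesFano.Associated EnriquesFano.W17 (P i) (P 4)) ∧
        (∀ i j, i ≠ 4 → j ≠ 4 → ¬ EnriquesFano.Associated EnriquesFano.W17 (P i) (P j)) ∧
        (∀ i, i ≠ 4 → EnriquesFano.HasMultiplicity EnriquesFano.W17 (P i) 3 4 ∧
          ∃ Y : Set (EnriquesFano.PSp 16), EnriquesFano.IsVeroneseSurface Y ∧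
            EnriquesFano.TangentConeIsConeOver EnriquesFano.W17 (P i) Y) ∧
        EnriquesFano.HasMultiplicity EnriquesFano.W17 (P 4) 3 6 ∧
        ∃ M : Set (EnriquesFano.PSp 16), EnriquesFano.IsUnionOfFourPlanesAndQuadric M ∧
          EnriquesFano.TangentConeIsConeOver EnriquesFano.W17 (P 4) M) := by
  open EnriquesFano in
  have corner13 : ∀ i, i ≠ 4 → HasMultiplicity W13 (point13 i) 3 4 ∧
      ∃ Y, IsVeroneseSurface Y ∧ TangentConeIsConeOver W13 (point13 i) Y := by
    intro i hi
    obtain ⟨κ, rfl⟩ := exists_castSucc_of_ne hi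
    rw [point13_castSucc]
    exact (tangentCone13_corner (isSign_firstSign κ) (isSign_secondSign κ)).2
  open EnriquesFano in
  have vertex13 : TangentConeIsConeOver W13 (point13 4) vertexCone13 ∧
      HasMultiplicity W13 (point13 4) 3 5 := by
    rw [point13_last]
    exact tangentCone13_vertex
  open EnriquesFano in
  have corner17 : ∀ i, i ≠ 4 → HasMultiplicity W17 (point17 i) 3 4 ∧
      ∃ Y, IsVeroneseSurface Y ∧ TangentConeIsConeOver W17 (point17 i) Y := by
    intro i hi
    obtain ⟨κ, rfl⟩ := exists_castSucc_of_ne hi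
    exact (tangentCone17_corner κ).2
  open EnriquesFano in
  refine ⟨⟨exists_quotient13, isProjectiveVarietyOfDim13, idealGeneratedByQuadrics13, ?_, point13,
    point13_injective, singularLocus13, fun i hi => ?_, fun i j hi hj => ?_, corner13, vertex13.2,
    vertexCone13, isUnionOfFivePlanes13, vertex13.1⟩,
    exists_quotient17, isProjectiveVarietyOfDim17, idealGeneratedByQuadrics17, ?_, point17,
    point17_injective, singularLocus17, fun i hi => ?_, fun i j hi hj => ?_, corner17,
    tangentCone17_vertex.2, vertexCone17, isUnionOfFourPlanesAndQuadric17, tangentCone17_vertex.1⟩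
  · exact EnriquesFano.not_hasSimilarSingularPoints
      (EnriquesFano.singularLocus13 ▸ Set.mem_range_self 0)
      (EnriquesFano.singularLocus13 ▸ Set.mem_range_self 4) (corner13 0 (by decide)).1
      vertex13.2 (by norm_num)
  · obtain ⟨κ, rfl⟩ := EnriquesFano.exists_castSucc_of_ne hi
    exact EnriquesFano.associated13 κ
  · obtain ⟨κ, rfl⟩ := EnriquesFano.exists_castSucc_of_ne hi
    obtain ⟨ν, rfl⟩ := EnriquesFano.exists_castSucc_of_ne hj
    exact EnriquesFano.not_associated13 κ ν
  · exact EnriquesFano.not_hasSimilarSingularPoints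
      (EnriquesFano.singularLocus17 ▸ Set.mem_range_self 0)
      (EnriquesFano.singularLocus17 ▸ Set.mem_range_self 4) (corner17 0 (by decide)).1
      EnriquesFano.tangentCone17_vertex.2 (by norm_num)
  · obtain ⟨κ, rfl⟩ := EnriquesFano.exists_castSucc_of_ne hi
    exact EnriquesFano.associated17 κ
  · obtain ⟨κ, rfl⟩ := EnriquesFano.exists_castSucc_of_ne hi
    obtain ⟨ν, rfl⟩ := EnriquesFano.exists_castSucc_of_ne hj
    exact EnriquesFano.not_associated17 κ ν
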